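/- Let $\Bbbk$ be a field of characteristic $0$. All diagrams are read from bottom to top, and strings are numbered from right to left. **The categories.** Let $\mathcal{AH}$ be the degenerate affine Hecke category: the strict $\Bbbk$-linear monoidal category with one generating object $\uparrow$ and generating morphisms the dot $x:\uparrow\to\uparrow$ and the crossing $s:\uparrow\otimes\uparrow\to\uparrow\otimes\uparrow$, subject to $$s\circ s=1,\qquad (s\otimes 1)(1\otimes s)(s\otimes 1)=(1\otimes s)(s\otimes 1)(1\otimes s),$$ $$s\circ(x\otimes 1)=(1\otimes x)\circ s+1,\qquad (x\otimes 1)\circ s=s\circ(1\otimes x)+1.$$ Let $b$ and $r$ denote the object $\uparrow$ in a blue and in a red copy of $\mathcal{AH}$, and write $x_b,s_b,x_r,s_r$ for the coloured dots and crossings. The symmetric product $\mathcal{AH}\odot\mathcal{AH}$ is the free product (as strict $\Bbbk$-linear monoidal categories) of the blue and the red copy with adjoined isomorphisms $\sigma_{X,Y}:X\otimes Y\to Y\otimes X$ for all blue objects $X$ and red objects $Y$, natural in $X$ and $Y$ and such that $\sigma_{X_1\otimes X_2,Y}=(\sigma_{X_1,Y}\otimes 1)(1\otimes\sigma_{X_2,Y})$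 and $\sigma_{X,Y_1\otimes Y_2}=(1\otimes\sigma_{X,Y_2})(\sigma_{X,Y_1}\otimes 1)$. The category $\mathcal{AH}\,\overline\odot\,\mathcal{AH}$ is obtained from it by adjoining a two-sided inverse $D$ of the morphism $1_b\otimes x_r-x_b\otimes 1_r:b\otimes r\to b\otimes r$. Put $\sigma=\sigma_{b,r}$ and $D'=\sigma\circ D\circ\sigma^{-1}$, an endomorphism of $r\otimes b$. Write $\mathrm{Add}$ for the additive envelope and $\mathrm{Kar}$ for the additive Karoubi envelope of a $\Bbbk$-linear category (the idempotent completion of the additive envelope), and $K_0$ for the split Grothendieck group. The two canonical functors from $\mathcal{AH}$ to $\mathcal{AH}\,\overline\odot\,\mathcal{AH}$ are written $X\mapsto X^{b}$ and $X\mapsto X^{r}$, also on Karoubi envelopes. **The objects.** Let $\imath_n:\Bbbk\mathfrak S_n\to\mathrm{End}_{\mathcal{AH}}(\uparrow^{\otimes n})$ be the algebra homomorphism that sends the $i$th basic transposition to the crossing of the $i$th and $(i+1)$th strings. In $\mathrm{Kar}(\mathcal{AH})$ put $H_n=(\uparrow^{\otimes n},\imath_n(e_{(n)}))$ and $E_n=(\uparrow^{\otimes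 n},\imath_n(e_{(1^n)}))$, where $e_{(n)}=\frac1{n!}\sum_{\pi\in\mathfrak S_n}\pi$ and $e_{(1^n)}=\frac1{n!}\sum_{\pi\in\mathfrak S_n}\mathrm{sgn}(\pi)\pi$. **Theorem.** There is a $\Bbbk$-linear monoidal functor $\Delta:\mathcal{AH}\to\mathrm{Add}(\mathcal{AH}\,\overline\odot\,\mathcal{AH})$ with $\Delta(\uparrow)=b\oplus r$, with $\Delta(x)=x_b+x_r$, and such that $\Delta(s)$ is the endomorphism $$s_b+s_r+\sigma+\sigma^{-1}-\sigma\circ D+\sigma^{-1}\circ D'-D+D'$$ of $(b\oplus r)\otimes(b\oplus r)=(b\otimes b)\oplus(b\otimes r)\oplus(r\otimes b)\oplus(r\otimes r)$. For any such functor, extended to Karoubi envelopes, the following hold. 1. For all $n\ge 0$ there are isomorphisms in $\mathrm{Kar}(\mathcal{AH}\,\overline\odot\,\mathcal{AH})$ $$\Delta(H_n)\cong\bigoplus_{j=0}^n H_{n-j}^{b}\otimes H_j^{r},\qquad \Delta(E_n)\cong\bigoplus_{j=0}^n E_{n-j}^{b}\otimes E_j^{r}.$$ 2. $\Delta$ categorifies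 the comultiplication of the ring of symmetric functions. That is, let $\mathrm{Sym}_{\mathbb Z}=\mathbb Z[h_1,h_2,\dots]$ be this ring, with complete symmetric functions $h_n$ ($h_0=1$), elementary symmetric functions $e_n$ and comultiplication $\delta(h_n)=\sum_{j=0}^n h_{n-j}\otimes h_j$. Then there is a (unique) ring homomorphism $\gamma:\mathrm{Sym}_{\mathbb Z}\to K_0(\mathrm{Kar}(\mathcal{AH}))$ with $\gamma(h_n)=[H_n]$ and $\gamma(e_n)=[E_n]$ for all $n\ge 0$, and $$[\Delta]\circ\gamma=\epsilon\circ(\gamma\otimes\gamma)\circ\delta,$$ where $\epsilon:K_0(\mathrm{Kar}(\mathcal{AH}))\otimes_{\mathbb Z}K_0(\mathrm{Kar}(\mathcal{AH}))\to K_0(\mathrm{Kar}(\mathcal{AH}\,\overline\odot\,\mathcal{AH}))$ is the map $[X]\otimes[Y]\mapsto[X^{b}\otimes Y^{r}]$. -/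

import Mathlib

open CategoryTheory MonoidalCategory Limits
open scoped TensorProduct

universe u

noncomputable section

namespace StrictLin

section Presentations

/-- Formal expressions for morphisms in a strict `k`-linear monoidal category whose objects are the
words in `C` and which has generating morphisms `G`.  `ident h` is the identity morphism of a word,
written with two propositionally equal source and target words. -/
inductive MorExpr (k : Type u) {C : Type} (G : List C → List C → Type) : List C → List C → Type u
  | ident {X Y : List C} (h : X = Y) : MorExpr k G X Y
  | gen {X Y : List C} (g : G X Y) : MorExpr k G X Y
  | comp {X Y Z : List C} (f : MorExpr k G X Y) (g : MorExpr k G Y Z) : MorExpr k G X Z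
  | tensor {X Y X' Y' : List C} (f : MorExpr k G X Y) (g : MorExpr k G X' Y') :
      MorExpr k G (X ++ X') (Y ++ Y')
  | zero {X Y : List C} : MorExpr k G X Y
  | add {X Y : List C} (f g : MorExpr k G X Y) : MorExpr k G X Y
  | smul {X Y : List C} (a : k) (f : MorExpr k G X Y) : MorExpr k G X Y

namespace MorExpr

variable {k : Type u} {C C' : Type} {G : List C → List C → Type} {G' G'' : List C → List C → Type}
  {H : List C' → List C' → Type}

/-- Rename the generating morphisms, keeping the generating objects. -/
def mapGen (F : ∀ {X Y : List C}, G X Y → G' X Y) : ∀ {X Y : List C}, MorExpr k G X Y → MorExpr k G' X Y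
  | _, _, ident h => ident h
  | _, _, gen g => gen (F g)
  | _, _, comp f g => comp (mapGen F f) (mapGen F g)
  | _, _, tensor f g => tensor (mapGen F f) (mapGen F g)
  | _, _, zero => zero
  | _, _, add f g => add (mapGen F f) (mapGen F g)
  | _, _, smul a f => smul a (mapGen F f)

/-- Rename the generating objects along `φ` and the generating morphisms along `F`. -/
def map (φ : C → C') (F : ∀ {X Y : List C}, G X Y → H (X.map φ) (Y.map φ)) :
    ∀ {X Y : List C}, MorExpr k G X Y → MorExpr k H (X.map φ) (Y.map φ)
  | _, _, ident h => ident (congrArg (List.map φ) h)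
  | _, _, gen g => gen (F g)
  | _, _, comp f g => comp (map φ F f) (map φ F g)
  | _, _, tensor f g =>
      comp (ident List.map_append) (comp (tensor (map φ F f) (map φ F g))
        (ident List.map_append.symm))
  | _, _, zero => zero
  | _, _, add f g => add (map φ F f) (map φ F g)
  | _, _, smul a f => smul a (map φ F f)

end MorExpr

/-- Generators and relations for a strict `k`-linear monoidal category. -/
structure Presentation (k : Type u) where
  /-- generating objects -/
  C : Type
  /-- generating morphisms -/
  Gen : List C → List C → Type
  /-- defining relations -/
  Rel : ∀ {X Y : List C}, MorExpr k Gen X Y → MorExpr k Gen X Y → Prop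

variable {k : Type u} [Field k]

open StrictLin.MorExpr in
/-- The smallest congruence on expressions which contains the defining relations and
the axioms of a strict `k`-linear monoidal category. -/
inductive Presentation.Eqv (P : Presentation k) :
    ∀ {X Y : List P.C}, MorExpr k P.Gen X Y → MorExpr k P.Gen X Y → Prop
  | rel {X Y : List P.C} {f g : MorExpr k P.Gen X Y} (h : P.Rel f g) : P.Eqv f g
  -- equivalence relation
  | refl {X Y : List P.C} (f : MorExpr k P.Gen X Y) : P.Eqv f f
  | symm {X Y : List P.C} {f g : MorExpr k P.Gen X Y} (h : P.Eqv f g) : P.Eqv g f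
  | trans {X Y : List P.C} {f g h : MorExpr k P.Gen X Y} (h₁ : P.Eqv f g) (h₂ : P.Eqv g h) : P.Eqv f h
  -- compatibility with the operations
  | comp_congr {X Y Z : List P.C} {f f' : MorExpr k P.Gen X Y} {g g' : MorExpr k P.Gen Y Z}
      (h₁ : P.Eqv f f') (h₂ : P.Eqv g g') : P.Eqv (comp f g) (comp f' g')
  | tensor_congr {X Y X' Y' : List P.C} {f f' : MorExpr k P.Gen X Y} {g g' : MorExpr k P.Gen X' Y'}
      (h₁ : P.Eqv f f') (h₂ : P.Eqv g g') : P.Eqv (tensor f g) (tensor f' g')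
  | add_congr {X Y : List P.C} {f f' g g' : MorExpr k P.Gen X Y}
      (h₁ : P.Eqv f f') (h₂ : P.Eqv g g') : P.Eqv (add f g) (add f' g')
  | smul_congr {X Y : List P.C} (a : k) {f f' : MorExpr k P.Gen X Y}
      (h : P.Eqv f f') : P.Eqv (smul a f) (smul a f')
  -- category
  | id_comp {X Y : List P.C} (f : MorExpr k P.Gen X Y) : P.Eqv (comp (ident rfl) f) f
  | comp_id {X Y : List P.C} (f : MorExpr k P.Gen X Y) : P.Eqv (comp f (ident rfl)) f
  | assoc {W X Y Z : List P.C} (f : MorExpr k P.Gen W X) (g : MorExpr k P.Gen X Y)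
      (h : MorExpr k P.Gen Y Z) : P.Eqv (comp (comp f g) h) (comp f (comp g h))
  -- strict monoidal structure
  | tensor_id (X Y : List P.C) :
      P.Eqv (tensor (ident (rfl : X = X)) (ident (rfl : Y = Y))) (ident rfl)
  | interchange {X Y Z X' Y' Z' : List P.C} (f : MorExpr k P.Gen X Y) (g : MorExpr k P.Gen Y Z)
      (f' : MorExpr k P.Gen X' Y') (g' : MorExpr k P.Gen Y' Z') :
      P.Eqv (comp (tensor f f') (tensor g g')) (tensor (comp f g) (comp f' g'))
  | tensor_assoc {X Y X' Y' X'' Y'' : List P.C} (f : MorExpr k P.Gen X Y) (f' : MorExpr k P.Gen X' Y')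
      (f'' : MorExpr k P.Gen X'' Y'') :
      P.Eqv (comp (tensor (tensor f f') f'') (ident (List.append_assoc _ _ _)))
        (comp (ident (List.append_assoc _ _ _)) (tensor f (tensor f' f'')))
  | unit_tensor {X Y : List P.C} (f : MorExpr k P.Gen X Y) :
      P.Eqv (tensor (ident (rfl : [] = ([] : List P.C))) f) f
  | tensor_unit {X Y : List P.C} (f : MorExpr k P.Gen X Y) :
      P.Eqv (comp (tensor f (ident (rfl : [] = ([] : List P.C)))) (ident (List.append_nil _)))
        (comp (ident (List.append_nil _)) f)
  -- morphism spaces are `k`-modules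
  | add_assoc {X Y : List P.C} (f g h : MorExpr k P.Gen X Y) :
      P.Eqv (add (add f g) h) (add f (add g h))
  | add_comm {X Y : List P.C} (f g : MorExpr k P.Gen X Y) : P.Eqv (add f g) (add g f)
  | zero_add {X Y : List P.C} (f : MorExpr k P.Gen X Y) : P.Eqv (add zero f) f
  | one_smul {X Y : List P.C} (f : MorExpr k P.Gen X Y) : P.Eqv (smul 1 f) f
  | mul_smul {X Y : List P.C} (a b : k) (f : MorExpr k P.Gen X Y) :
      P.Eqv (smul (a * b) f) (smul a (smul b f))
  | zero_smul {X Y : List P.C} (f : MorExpr k P.Gen X Y) : P.Eqv (smul 0 f) zero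
  | smul_add {X Y : List P.C} (a : k) (f g : MorExpr k P.Gen X Y) :
      P.Eqv (smul a (add f g)) (add (smul a f) (smul a g))
  | add_smul {X Y : List P.C} (a b : k) (f : MorExpr k P.Gen X Y) :
      P.Eqv (smul (a + b) f) (add (smul a f) (smul b f))
  -- both compositions are bilinear
  | add_comp {X Y Z : List P.C} (f g : MorExpr k P.Gen X Y) (h : MorExpr k P.Gen Y Z) :
      P.Eqv (comp (add f g) h) (add (comp f h) (comp g h))
  | comp_add {X Y Z : List P.C} (f : MorExpr k P.Gen X Y) (g h : MorExpr k P.Gen Y Z) :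
      P.Eqv (comp f (add g h)) (add (comp f g) (comp f h))
  | smul_comp {X Y Z : List P.C} (a : k) (f : MorExpr k P.Gen X Y) (g : MorExpr k P.Gen Y Z) :
      P.Eqv (comp (smul a f) g) (smul a (comp f g))
  | comp_smul {X Y Z : List P.C} (a : k) (f : MorExpr k P.Gen X Y) (g : MorExpr k P.Gen Y Z) :
      P.Eqv (comp f (smul a g)) (smul a (comp f g))
  | add_tensor {X Y X' Y' : List P.C} (f g : MorExpr k P.Gen X Y) (h : MorExpr k P.Gen X' Y') :
      P.Eqv (tensor (add f g) h) (add (tensor f h) (tensor g h))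
  | tensor_add {X Y X' Y' : List P.C} (f : MorExpr k P.Gen X Y) (g h : MorExpr k P.Gen X' Y') :
      P.Eqv (tensor f (add g h)) (add (tensor f g) (tensor f h))
  | smul_tensor {X Y X' Y' : List P.C} (a : k) (f : MorExpr k P.Gen X Y) (g : MorExpr k P.Gen X' Y') :
      P.Eqv (tensor (smul a f) g) (smul a (tensor f g))
  | tensor_smul {X Y X' Y' : List P.C} (a : k) (f : MorExpr k P.Gen X Y) (g : MorExpr k P.Gen X' Y') :
      P.Eqv (tensor f (smul a g)) (smul a (tensor f g))

/-- The objects of the strict `k`-linear monoidal category presented by `P`: words in the generating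
objects.  (They are put into `Type 1` because additive envelopes live there.) -/
@[ext]
structure Presentation.Cat (P : Presentation k) : Type 1 where
  /-- the underlying word -/
  word : List P.C

namespace Presentation

variable (P : Presentation k)

/-- Morphisms: expressions modulo the congruence. -/
instance exprSetoid (X Y : List P.C) : Setoid (MorExpr k P.Gen X Y) where
  r := P.Eqv
  iseqv := ⟨Eqv.refl, Eqv.symm, Eqv.trans⟩

variable {P}

instance : Category P.Cat where
  Hom X Y := Quotient (P.exprSetoid X.word Y.word)
  id X := ⟦.ident rfl⟧
  comp := Quotient.map₂ .comp fun _ _ h _ _ h' => .comp_congr h h'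
  id_comp := by rintro _ _ ⟨f⟩; exact Quotient.sound (Eqv.id_comp f)
  comp_id := by rintro _ _ ⟨f⟩; exact Quotient.sound (Eqv.comp_id f)
  assoc := by rintro _ _ _ _ ⟨f⟩ ⟨g⟩ ⟨h⟩; exact Quotient.sound (Eqv.assoc f g h)

/-- The morphism represented by an expression. -/
def homMk {X Y : List P.C} (f : MorExpr k P.Gen X Y) : (⟨X⟩ : P.Cat) ⟶ ⟨Y⟩ := Quotient.mk _ f

lemma homMk_surj {X Y : P.Cat} (f : X ⟶ Y) : ∃ f' : MorExpr k P.Gen X.word Y.word, f = homMk f' := by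
  obtain ⟨f'⟩ := f; exact ⟨f', rfl⟩

lemma homMk_eq {X Y : List P.C} {f g : MorExpr k P.Gen X Y} (h : P.Eqv f g) : homMk f = homMk g :=
  Quotient.sound h

lemma homMk_comp {X Y Z : List P.C} (f : MorExpr k P.Gen X Y) (g : MorExpr k P.Gen Y Z) :
    homMk (f.comp g) = homMk f ≫ homMk g := rfl

lemma homMk_ident {X Y : List P.C} (h : X = Y) :
    homMk (.ident h : MorExpr k P.Gen X Y) = eqToHom (congrArg Cat.mk h) := by
  subst h; rfl

instance (X Y : P.Cat) : Zero (X ⟶ Y) := ⟨homMk .zero⟩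
instance (X Y : P.Cat) : Add (X ⟶ Y) :=
  ⟨Quotient.map₂ .add fun _ _ h _ _ h' => .add_congr h h'⟩
instance (X Y : P.Cat) : SMul k (X ⟶ Y) := ⟨fun a => Quotient.map (.smul a) fun _ _ h => .smul_congr a h⟩
instance (X Y : P.Cat) : Neg (X ⟶ Y) := ⟨fun f => (-1 : k) • f⟩

instance (X Y : P.Cat) : AddCommGroup (X ⟶ Y) where
  add_assoc := by rintro ⟨f⟩ ⟨g⟩ ⟨h⟩; exact homMk_eq (.add_assoc f g h)
  zero_add := by rintro ⟨f⟩; exact homMk_eq (.zero_add f)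
  add_zero := by rintro ⟨f⟩; exact Quotient.sound ((Eqv.add_comm _ _).trans (.zero_add f))
  add_comm := by rintro ⟨f⟩ ⟨g⟩; exact homMk_eq (.add_comm f g)
  nsmul := nsmulRec
  zsmul := zsmulRec
  neg_add_cancel := by
    rintro ⟨f⟩
    refine homMk_eq (.trans (.add_congr (.refl _) (.symm (.one_smul f))) ?_)
    refine .trans (.symm (.add_smul _ _ _)) ?_
    rw [neg_add_cancel]
    exact .zero_smul f

instance (X Y : P.Cat) : Module k (X ⟶ Y) where
  one_smul := by rintro ⟨f⟩; exact homMk_eq (.one_smul f)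
  mul_smul := by rintro a b ⟨f⟩; exact homMk_eq (.mul_smul a b f)
  smul_zero a := by
    refine homMk_eq (.trans (.smul_congr a (.symm (.zero_smul .zero))) ?_)
    refine .trans (.symm (.mul_smul _ _ _)) ?_
    rw [mul_zero]
    exact .zero_smul _
  smul_add := by rintro a ⟨f⟩ ⟨g⟩; exact homMk_eq (.smul_add a f g)
  add_smul := by rintro a b ⟨f⟩; exact homMk_eq (.add_smul a b f)
  zero_smul := by rintro ⟨f⟩; exact homMk_eq (.zero_smul f)

instance : Preadditive P.Cat where
  add_comp := by rintro _ _ _ ⟨f⟩ ⟨g⟩ ⟨h⟩; exact homMk_eq (.add_comp f g h)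
  comp_add := by rintro _ _ _ ⟨f⟩ ⟨g⟩ ⟨h⟩; exact homMk_eq (.comp_add f g h)

instance : Linear k P.Cat where
  smul_comp := by rintro _ _ _ a ⟨f⟩ ⟨g⟩; exact homMk_eq (.smul_comp a f g)
  comp_smul := by rintro _ _ _ ⟨f⟩ a ⟨g⟩; exact homMk_eq (.comp_smul a f g)

/-- The tensor product of morphisms. -/
def tens {X Y X' Y' : P.Cat} : (X ⟶ Y) → (X' ⟶ Y') →
    ((⟨X.word ++ X'.word⟩ : P.Cat) ⟶ ⟨Y.word ++ Y'.word⟩) :=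
  Quotient.map₂ .tensor fun _ _ h _ _ h' => .tensor_congr h h'

/-- The tensor product is concatenation of words; the associators and unitors are identities. -/
instance : MonoidalCategoryStruct P.Cat where
  tensorObj X Y := ⟨X.word ++ Y.word⟩
  tensorUnit := ⟨[]⟩
  tensorHom f g := tens f g
  whiskerLeft X _ _ f := tens (𝟙 X) f
  whiskerRight f X := tens f (𝟙 X)
  associator _ _ _ := eqToIso (congrArg Cat.mk (List.append_assoc _ _ _))
  leftUnitor _ := eqToIso rfl
  rightUnitor _ := eqToIso (congrArg Cat.mk (List.append_nil _))

lemma homMk_tensor {X Y X' Y' : List P.C} (f : MorExpr k P.Gen X Y) (g : MorExpr k P.Gen X' Y') :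
    homMk (f.tensor g) = (homMk f ⊗ₘ homMk g) := rfl

lemma tens_eqToHom {X Y X' Y' : P.Cat} (h : X = Y) (h' : X' = Y') :
    tens (eqToHom h) (eqToHom h') = eqToHom (by rw [h, h']) := by
  subst h h'; exact homMk_eq (.tensor_id _ _)

lemma assoc_eq (X Y Z : P.Cat) : (X ⊗ Y) ⊗ Z = X ⊗ (Y ⊗ Z) :=
  congrArg Cat.mk (List.append_assoc _ _ _)

lemma unit_eq (X : P.Cat) : X ⊗ 𝟙_ P.Cat = X := congrArg Cat.mk (List.append_nil _)

instance : MonoidalCategory P.Cat := .ofTensorHom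
  (id_tensorHom_id := fun X Y => homMk_eq (.tensor_id _ _))
  (id_tensorHom := fun _ _ _ _ => rfl)
  (tensorHom_id := fun _ _ => rfl)
  (tensorHom_comp_tensorHom := by
    rintro _ _ _ _ _ _ ⟨f⟩ ⟨f'⟩ ⟨g⟩ ⟨g'⟩; exact homMk_eq (.interchange f g f' g'))
  (associator_naturality := by
    rintro _ _ _ _ _ _ ⟨f⟩ ⟨g⟩ ⟨h⟩
    have := homMk_eq (.tensor_assoc f g h)
    rw [homMk_comp, homMk_comp, homMk_ident, homMk_ident] at this
    exact this)
  (leftUnitor_naturality := by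
    rintro _ _ ⟨f⟩
    refine (Category.comp_id _).trans (Eq.trans ?_ (Category.id_comp _).symm)
    exact homMk_eq (.unit_tensor f))
  (rightUnitor_naturality := by
    rintro _ _ ⟨f⟩
    have := homMk_eq (.tensor_unit f)
    rw [homMk_comp, homMk_comp, homMk_ident, homMk_ident] at this
    exact this)
  (pentagon := fun W X Y Z => by
    change tens (eqToHom (assoc_eq W X Y)) (eqToHom (rfl : Z = Z)) ≫
      eqToHom (assoc_eq W (X ⊗ Y) Z) ≫ tens (eqToHom (rfl : W = W)) (eqToHom (assoc_eq X Y Z)) =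
      eqToHom (assoc_eq (W ⊗ X) Y Z) ≫ eqToHom (assoc_eq W X (Y ⊗ Z))
    simp only [tens_eqToHom]
    exact (congrArg _ (eqToHom_trans _ _)).trans ((eqToHom_trans _ _).trans (eqToHom_trans _ _).symm))
  (triangle := fun X Y => by
    change eqToHom (assoc_eq X (𝟙_ P.Cat) Y) ≫ tens (eqToHom (rfl : X = X)) (eqToHom (rfl : Y = Y)) =
      tens (eqToHom (unit_eq X)) (eqToHom (rfl : Y = Y))
    simp only [tens_eqToHom]
    exact eqToHom_trans _ _)

instance : MonoidalPreadditive P.Cat where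
  whiskerLeft_add := by rintro _ _ _ ⟨f⟩ ⟨g⟩; exact homMk_eq (.tensor_add _ f g)
  add_whiskerRight := by rintro _ _ _ ⟨f⟩ ⟨g⟩; exact homMk_eq (.add_tensor f g _)
  whiskerLeft_zero := by
    intro X Y Z
    refine homMk_eq (.trans (.tensor_congr (.refl _) (.symm (.zero_smul .zero))) ?_)
    exact .trans (.tensor_smul _ _ _) (.zero_smul _)
  zero_whiskerRight := by
    intro X Y Z
    refine homMk_eq (.trans (.tensor_congr (.symm (.zero_smul .zero)) (.refl _)) ?_)
    exact .trans (.smul_tensor _ _ _) (.zero_smul _)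

instance : MonoidalLinear k P.Cat where
  whiskerLeft_smul := by rintro _ _ _ a ⟨f⟩; exact homMk_eq (.tensor_smul a _ f)
  smul_whiskerRight := by rintro a _ _ ⟨f⟩ _; exact homMk_eq (.smul_tensor a f _)

end Presentation

namespace Presentation

variable {P Q : Presentation k}

lemma associator_eq (X Y Z : P.Cat) : (α_ X Y Z).hom = eqToHom (assoc_eq X Y Z) := rfl

lemma eqToHom_tensor {X Y X' Y' : P.Cat} (h : X = Y) (h' : X' = Y') :
    (eqToHom h ⊗ₘ eqToHom h') = eqToHom (by rw [h, h']) := tens_eqToHom h h'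

section relabel

variable (φ : P.C → Q.C) (F : ∀ {X Y : List P.C}, P.Gen X Y → Q.Gen (X.map φ) (Y.map φ))

lemma homMk_map_tensor {X Y X' Y' : List P.C} (f : MorExpr k P.Gen X Y)
    (g : MorExpr k P.Gen X' Y') :
    homMk ((f.tensor g).map φ F) = eqToHom (congrArg Cat.mk List.map_append) ≫
      (homMk (f.map φ F) ⊗ₘ homMk (g.map φ F)) ≫
        eqToHom (congrArg Cat.mk List.map_append.symm) := by
  simp only [MorExpr.map, homMk_comp, homMk_ident, homMk_tensor]

lemma map_sound
    (hF : ∀ {X Y : List P.C} {f g : MorExpr k P.Gen X Y}, P.Rel f g →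
      homMk (P := Q) (f.map φ F) = homMk (g.map φ F))
    {X Y : List P.C} {f g : MorExpr k P.Gen X Y} (h : P.Eqv f g) :
    homMk (P := Q) (f.map φ F) = homMk (g.map φ F) := by
  induction h with
  | rel h => exact hF h
  | refl f => rfl
  | symm _ ih => exact ih.symm
  | trans _ _ ih₁ ih₂ => exact ih₁.trans ih₂
  | comp_congr _ _ ih₁ ih₂ => simp only [MorExpr.map, homMk_comp, ih₁, ih₂]
  | tensor_congr _ _ ih₁ ih₂ => simp only [homMk_map_tensor, ih₁, ih₂]
  | add_congr _ _ ih₁ ih₂ => exact congrArg₂ (· + ·) ih₁ ih₂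
  | smul_congr a _ ih => exact congrArg (a • ·) ih
  | id_comp f => exact homMk_eq (.id_comp _)
  | comp_id f => exact homMk_eq (.comp_id _)
  | assoc f g h => exact homMk_eq (.assoc _ _ _)
  | tensor_id X Y =>
    rw [homMk_map_tensor]
    simp only [MorExpr.map, homMk_ident, eqToHom_tensor, eqToHom_trans]
  | interchange f g f' g' =>
    rw [homMk_map_tensor, MorExpr.map, homMk_comp, homMk_map_tensor, homMk_map_tensor]
    simp only [MorExpr.map, homMk_comp, Category.assoc, eqToHom_trans_assoc,
      eqToHom_refl, Category.id_comp, ← tensorHom_comp_tensorHom]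
  | @tensor_assoc X Y X' Y' X'' Y'' f f' f'' =>
    have e₁ : ∀ {A B A' B' D E : Q.Cat} (h : A = B) (h' : A' = B') (f : B ⟶ A') (g : D ⟶ E),
        (eqToHom h ≫ f ≫ eqToHom h') ⊗ₘ g =
          eqToHom (by rw [h]) ≫ (f ⊗ₘ g) ≫ eqToHom (by rw [h']) := by
      rintro A _ A' _ D E rfl rfl f g; simp
    have e₂ : ∀ {A B A' B' D E : Q.Cat} (h : A = B) (h' : A' = B') (f : B ⟶ A') (g : D ⟶ E),
        g ⊗ₘ (eqToHom h ≫ f ≫ eqToHom h') =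
          eqToHom (by rw [h]) ≫ (g ⊗ₘ f) ≫ eqToHom (by rw [h']) := by
      rintro A _ A' _ D E rfl rfl f g; simp
    have n := associator_naturality (homMk (P := Q) (f.map φ F)) (homMk (P := Q) (f'.map φ F))
      (homMk (P := Q) (f''.map φ F))
    rw [associator_eq, associator_eq, ← cancel_epi (eqToHom (assoc_eq _ _ _).symm),
      eqToHom_trans_assoc, eqToHom_refl, Category.id_comp] at n
    simp only [MorExpr.map, homMk_comp, homMk_ident, homMk_tensor, e₁, e₂, ← n,
      Category.assoc, eqToHom_trans, eqToHom_trans_assoc]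
  | unit_tensor f =>
    exact homMk_eq ((Eqv.id_comp _).trans ((Eqv.comp_id _).trans (.unit_tensor _)))
  | tensor_unit f =>
    have n := homMk_eq (.tensor_unit (f.map φ F))
    rw [homMk_comp, homMk_comp, homMk_ident, homMk_ident, ← cancel_mono (eqToHom (unit_eq _).symm),
      Category.assoc] at n
    erw [eqToHom_trans] at n
    rw [eqToHom_refl, Category.comp_id] at n
    simp only [MorExpr.map, homMk_comp, homMk_ident]
    erw [n]
    simp
  | add_assoc f g h => exact homMk_eq (.add_assoc _ _ _)
  | add_comm f g => exact homMk_eq (.add_comm _ _)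
  | zero_add f => exact homMk_eq (.zero_add _)
  | one_smul f => exact homMk_eq (.one_smul _)
  | mul_smul a b f => exact homMk_eq (.mul_smul _ _ _)
  | zero_smul f => exact homMk_eq (.zero_smul _)
  | smul_add a f g => exact homMk_eq (.smul_add _ _ _)
  | add_smul a b f => exact homMk_eq (.add_smul _ _ _)
  | add_comp f g h => exact homMk_eq (.add_comp _ _ _)
  | comp_add f g h => exact homMk_eq (.comp_add _ _ _)
  | smul_comp a f g => exact homMk_eq (.smul_comp _ _ _)
  | comp_smul a f g => exact homMk_eq (.comp_smul _ _ _)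
  | add_tensor f g h =>
    refine homMk_eq ((Eqv.comp_congr (.refl _) ((Eqv.comp_congr (.add_tensor _ _ _) (.refl _)).trans
      (.add_comp _ _ _))).trans (.comp_add _ _ _))
  | tensor_add f g h =>
    refine homMk_eq ((Eqv.comp_congr (.refl _) ((Eqv.comp_congr (.tensor_add _ _ _) (.refl _)).trans
      (.add_comp _ _ _))).trans (.comp_add _ _ _))
  | smul_tensor a f g =>
    refine homMk_eq ((Eqv.comp_congr (.refl _) ((Eqv.comp_congr (.smul_tensor _ _ _) (.refl _)).trans
      (.smul_comp _ _ _))).trans (.comp_smul _ _ _))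
  | tensor_smul a f g =>
    refine homMk_eq ((Eqv.comp_congr (.refl _) ((Eqv.comp_congr (.tensor_smul _ _ _) (.refl _)).trans
      (.smul_comp _ _ _))).trans (.comp_smul _ _ _))

/-- The functor induced by a relabelling of generators that respects the defining relations. -/
def relabel
    (hF : ∀ {X Y : List P.C} {f g : MorExpr k P.Gen X Y}, P.Rel f g →
      homMk (P := Q) (f.map φ F) = homMk (g.map φ F)) : P.Cat ⥤ Q.Cat where
  obj X := ⟨X.word.map φ⟩
  map {X Y} := Quotient.lift (fun f => homMk (f.map φ F)) fun _ _ h => map_sound φ F hF h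
  map_id _ := rfl
  map_comp := by rintro _ _ _ ⟨f⟩ ⟨g⟩; rfl

instance relabel_additive
    (hF : ∀ {X Y : List P.C} {f g : MorExpr k P.Gen X Y}, P.Rel f g →
      homMk (P := Q) (f.map φ F) = homMk (g.map φ F)) : (relabel φ F hF).Additive where
  map_add := by rintro _ _ ⟨f⟩ ⟨g⟩; rfl

end relabel
end Presentation

open Presentation

/-- Generating morphisms of the symmetric product. -/
inductive SymProdGen (P Q : Presentation k) : List (P.C ⊕ Q.C) → List (P.C ⊕ Q.C) → Type
  | left {X Y : List P.C} (g : P.Gen X Y) : SymProdGen P Q (X.map Sum.inl) (Y.map Sum.inl)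
  | right {X Y : List Q.C} (g : Q.Gen X Y) : SymProdGen P Q (X.map Sum.inr) (Y.map Sum.inr)
  | braid (X : List P.C) (Y : List Q.C) :
      SymProdGen P Q (X.map Sum.inl ++ Y.map Sum.inr) (Y.map Sum.inr ++ X.map Sum.inl)
  | braidInv (X : List P.C) (Y : List Q.C) :
      SymProdGen P Q (Y.map Sum.inr ++ X.map Sum.inl) (X.map Sum.inl ++ Y.map Sum.inr)

/-- Defining relations of the symmetric product. -/
inductive SymProdRel (P Q : Presentation k) : ∀ {X Y : List (P.C ⊕ Q.C)},
    MorExpr k (SymProdGen P Q) X Y → MorExpr k (SymProdGen P Q) X Y → Prop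
  -- the free product of the two categories
  | left {X Y : List P.C} {f g : MorExpr k P.Gen X Y} (h : P.Rel f g) :
      SymProdRel P Q (f.map Sum.inl SymProdGen.left) (g.map Sum.inl SymProdGen.left)
  | right {X Y : List Q.C} {f g : MorExpr k Q.Gen X Y} (h : Q.Rel f g) :
      SymProdRel P Q (f.map Sum.inr SymProdGen.right) (g.map Sum.inr SymProdGen.right)
  -- the adjoined morphisms are isomorphisms
  | braid_braidInv (X : List P.C) (Y : List Q.C) :
      SymProdRel P Q (.comp (.gen (.braid X Y)) (.gen (.braidInv X Y))) (.ident rfl)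
  | braidInv_braid (X : List P.C) (Y : List Q.C) :
      SymProdRel P Q (.comp (.gen (.braidInv X Y)) (.gen (.braid X Y))) (.ident rfl)
  -- compatibility with tensor products
  | braid_tensor_left (X₁ X₂ : List P.C) (Y : List Q.C) :
      SymProdRel P Q (.gen (.braid (X₁ ++ X₂) Y))
        (.comp (.ident (by simp)) (.comp (.tensor (.ident (rfl : X₁.map Sum.inl = _)) (.gen (.braid X₂ Y)))
          (.comp (.ident (by simp)) (.comp (.tensor (.gen (.braid X₁ Y)) (.ident (rfl : X₂.map Sum.inl = _)))
            (.ident (by simp))))))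
  | braid_tensor_right (X : List P.C) (Y₁ Y₂ : List Q.C) :
      SymProdRel P Q (.gen (.braid X (Y₁ ++ Y₂)))
        (.comp (.ident (by simp)) (.comp (.tensor (.gen (.braid X Y₁)) (.ident (rfl : Y₂.map Sum.inr = _)))
          (.comp (.ident (by simp)) (.comp (.tensor (.ident (rfl : Y₁.map Sum.inr = _)) (.gen (.braid X Y₂)))
            (.ident (by simp))))))
  -- naturality
  | braid_natural_left {X₁ X₂ : List P.C} (f : MorExpr k P.Gen X₁ X₂) (Y : List Q.C) :
      SymProdRel P Q
        (.comp (.tensor (f.map Sum.inl SymProdGen.left) (.ident (rfl : Y.map Sum.inr = _))) (.gen (.braid X₂ Y)))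
        (.comp (.gen (.braid X₁ Y)) (.tensor (.ident (rfl : Y.map Sum.inr = _)) (f.map Sum.inl SymProdGen.left)))
  | braid_natural_right (X : List P.C) {Y₁ Y₂ : List Q.C} (g : MorExpr k Q.Gen Y₁ Y₂) :
      SymProdRel P Q
        (.comp (.tensor (.ident (rfl : X.map Sum.inl = _)) (g.map Sum.inr SymProdGen.right)) (.gen (.braid X Y₂)))
        (.comp (.gen (.braid X Y₁)) (.tensor (g.map Sum.inr SymProdGen.right) (.ident (rfl : X.map Sum.inl = _))))

/-- The symmetric product of two (presented) strict `k`-linear monoidal categories: the free product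
with adjoined isomorphisms `X ⊗ Y ≅ Y ⊗ X`, natural and compatible with tensor products, for all
`X` in the first and `Y` in the second category. -/
def symProd (P Q : Presentation k) : Presentation k where
  C := P.C ⊕ Q.C
  Gen := SymProdGen P Q
  Rel := SymProdRel P Q

/-- Generating morphisms of the localization at a morphism `X ⟶ Y`. -/
inductive LocalizeGen (P : Presentation k) (X Y : List P.C) : List P.C → List P.C → Type
  | old {U V : List P.C} (g : P.Gen U V) : LocalizeGen P X Y U V
  | inv : LocalizeGen P X Y Y X

/-- Defining relations of the localization at a morphism. -/
inductive LocalizeRel (P : Presentation k) {X Y : List P.C} (f : MorExpr k P.Gen X Y) :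
    ∀ {U V : List P.C}, MorExpr k (LocalizeGen P X Y) U V → MorExpr k (LocalizeGen P X Y) U V → Prop
  | old {U V : List P.C} {g h : MorExpr k P.Gen U V} (r : P.Rel g h) :
      LocalizeRel P f (g.mapGen .old) (h.mapGen .old)
  | comp_inv : LocalizeRel P f (.comp (f.mapGen .old) (.gen .inv)) (.ident rfl)
  | inv_comp : LocalizeRel P f (.comp (.gen .inv) (f.mapGen .old)) (.ident rfl)

/-- The localization of a (presented) strict `k`-linear monoidal category at a morphism, obtained by
adjoining a two-sided inverse. -/
def localize (P : Presentation k) {X Y : List P.C} (f : MorExpr k P.Gen X Y) : Presentation k where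
  C := P.C
  Gen := LocalizeGen P X Y
  Rel := LocalizeRel P f

/-- Generating morphisms of the degenerate affine Hecke category. -/
inductive AHGen : List Unit → List Unit → Type
  | dot : AHGen [()] [()]
  | cross : AHGen [(), ()] [(), ()]

variable (k) in
/-- A vertical strand (the identity). -/
def strandE : MorExpr k AHGen [()] [()] := .ident rfl

variable (k) in
/-- A dot on a vertical strand. -/
def dotE : MorExpr k AHGen [()] [()] := .gen .dot

variable (k) in
/-- A crossing of two strands. -/
def crossE : MorExpr k AHGen [(), ()] [(), ()] := .gen .cross

variable (k) in
/-- The crossing of the two strands on the left among three strands. -/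
def crossLeftE : MorExpr k AHGen [(), (), ()] [(), (), ()] := .tensor (crossE k) (strandE k)

variable (k) in
/-- The crossing of the two strands on the right among three strands. -/
def crossRightE : MorExpr k AHGen [(), (), ()] [(), (), ()] := .tensor (strandE k) (crossE k)

variable (k) in
/-- The dot on the left one of two strands. -/
def dotLeftE : MorExpr k AHGen [(), ()] [(), ()] := .tensor (dotE k) (strandE k)

variable (k) in
/-- The dot on the right one of two strands. -/
def dotRightE : MorExpr k AHGen [(), ()] [(), ()] := .tensor (strandE k) (dotE k)

/-- Defining relations of the degenerate affine Hecke category.  Here `comp f g` is the diagram with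
`g` drawn above `f`, and `tensor f g` is the diagram with `f` drawn to the left of `g`. -/
inductive AHRel : ∀ {X Y : List Unit}, MorExpr k AHGen X Y → MorExpr k AHGen X Y → Prop
  | quadratic : AHRel (.comp (crossE k) (crossE k)) (.ident rfl)
  | braid : AHRel (.comp (crossLeftE k) (.comp (crossRightE k) (crossLeftE k)))
      (.comp (crossRightE k) (.comp (crossLeftE k) (crossRightE k)))
  | dot_cross : AHRel (.comp (dotLeftE k) (crossE k))
      (.add (.comp (crossE k) (dotRightE k)) (.ident rfl))
  | cross_dot : AHRel (.comp (crossE k) (dotLeftE k))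
      (.add (.comp (dotRightE k) (crossE k)) (.ident rfl))

variable (k) in
/-- The presentation of the degenerate affine Hecke category. -/
def ahPres : Presentation k where
  C := Unit
  Gen := AHGen
  Rel := AHRel

/-- The blue copy of a generating morphism. -/
def blueGen {X Y : List Unit} (g : AHGen X Y) :
    SymProdGen (ahPres k) (ahPres k) (X.map Sum.inl) (Y.map Sum.inl) :=
  .left (P := ahPres k) g

/-- The red copy of a generating morphism. -/
def redGen {X Y : List Unit} (g : AHGen X Y) :
    SymProdGen (ahPres k) (ahPres k) (X.map Sum.inr) (Y.map Sum.inr) :=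
  .right (Q := ahPres k) g

/-- The difference (dot on the red strand) - (dot on the blue strand) on the object
`blue ⊗ red`. -/
def dotted : MorExpr k (SymProdGen (ahPres k) (ahPres k))
    [Sum.inl (), Sum.inr ()] [Sum.inl (), Sum.inr ()] :=
  .add (.tensor (.ident (rfl : [Sum.inl ()] = [Sum.inl ()])) (.gen (redGen .dot)))
    (.smul (-1) (.tensor (.gen (blueGen .dot)) (.ident (rfl : [Sum.inr ()] = [Sum.inr ()]))))

variable (k) in
/-- The presentation of the localized symmetric product of two copies of the degenerate affine Hecke
category (the first copy is blue, the second one is red). -/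
def ahBarPres : Presentation k := localize (symProd (ahPres k) (ahPres k)) dotted

variable (k) in
/-- The degenerate affine Hecke category. -/
abbrev AH := (ahPres k).Cat

variable (k) in
/-- The localized symmetric product of two copies of the degenerate affine Hecke category. -/
abbrev AHBar := (ahBarPres k).Cat

end Presentations

section AdditiveEnvelope

universe v₁ u₁

variable {C : Type u₁} [Category.{v₁} C] [Preadditive C]

open scoped Classical in
/-- The matrix with entries `f i` in the positions `(i, e i)` and zero elsewhere. -/
def matOfMap {M N : Mat_ C} (e : M.ι → N.ι) (f : ∀ i, M.X i ⟶ N.X (e i)) : M ⟶ N :=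
  fun i j => if h : e i = j then f i ≫ eqToHom (congrArg N.X h) else 0

lemma matOfMap_apply {M N : Mat_ C} (e : M.ι → N.ι) (f : ∀ i, M.X i ⟶ N.X (e i)) (i : M.ι) :
    matOfMap e f i (e i) = f i := by
  simp [matOfMap]

lemma matOfMap_apply_of_ne {M N : Mat_ C} (e : M.ι → N.ι) (f : ∀ i, M.X i ⟶ N.X (e i)) {i : M.ι}
    {j : N.ι} (h : e i ≠ j) : matOfMap e f i j = 0 := by
  simp [matOfMap, h]

lemma matOfMap_comp_apply {M N K : Mat_ C} (e : M.ι → N.ι) (f : ∀ i, M.X i ⟶ N.X (e i))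
    (g : N ⟶ K) (i : M.ι) (j : K.ι) : (matOfMap e f ≫ g) i j = f i ≫ g (e i) j := by
  classical
  rw [Mat_.comp_apply, Finset.sum_eq_single (e i)]
  · rw [matOfMap_apply]
  · intro b _ hb
    simp [matOfMap, Ne.symm hb]
  · simp

lemma comp_matOfMap_apply {M N K : Mat_ C} (e : M.ι → N.ι) (he : e.Injective)
    (f : ∀ i, M.X i ⟶ N.X (e i)) (g : K ⟶ M) (i : K.ι) (j : M.ι) :
    (g ≫ matOfMap e f) i (e j) = g i j ≫ f j := by
  classical
  rw [Mat_.comp_apply, Finset.sum_eq_single j]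
  · rw [matOfMap_apply]
  · intro b _ hb
    simp [matOfMap, he.ne hb]
  · simp

lemma matOfMap_comp {M N K : Mat_ C} (e : M.ι → N.ι) (f : ∀ i, M.X i ⟶ N.X (e i))
    (e' : N.ι → K.ι) (f' : ∀ i, N.X i ⟶ K.X (e' i)) :
    matOfMap e f ≫ matOfMap e' f' =
      matOfMap (fun i => e' (e i)) (fun i => f i ≫ f' (e i)) := by
  ext i j
  rw [matOfMap_comp_apply]
  by_cases h : e' (e i) = j
  · subst h; simp [matOfMap]
  · simp [matOfMap, h]

lemma matOfMap_id (M : Mat_ C) : matOfMap (fun i => i) (fun i => 𝟙 (M.X i)) = 𝟙 M := by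
  ext i j
  simp [matOfMap, Mat_.id_apply]

open scoped Classical in
/-- The isomorphism given by a bijection of the index sets and isomorphisms of the summands. -/
def matIso {M N : Mat_ C} (e : M.ι ≃ N.ι) (f : ∀ i, M.X i ≅ N.X (e i)) : M ≅ N where
  hom := matOfMap e fun i => (f i).hom
  inv := fun j i => if h : e i = j then eqToHom (congrArg N.X h.symm) ≫ (f i).inv else 0
  hom_inv_id := by
    ext i i'
    refine (matOfMap_comp_apply _ _ _ _ _).trans ?_
    by_cases h : i' = i
    · subst h
      simp
    · simp [h, Mat_.id_apply_of_ne _ _ _ (Ne.symm h)]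
  inv_hom_id := by
    ext j j'
    obtain ⟨i, rfl⟩ := e.surjective j'
    refine (comp_matOfMap_apply e e.injective _ _ _ _).trans ?_
    by_cases h : e i = j
    · subst h
      simp
    · simp [h, Mat_.id_apply_of_ne _ _ _ (Ne.symm h)]

section Linear

variable {R : Type*} [Semiring R] [Linear R C]

instance (M N : Mat_ C) : Module R (M ⟶ N) :=
  inferInstanceAs <| Module R (∀ (i : M.ι) (j : N.ι), M.X i ⟶ N.X j)

lemma mat_smul_apply {M N : Mat_ C} (r : R) (f : M ⟶ N) (i : M.ι) (j : N.ι) :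
    (r • f) i j = r • f i j := rfl

instance : Linear R (Mat_ C) where
  smul_comp _ _ _ r f g := by ext; simp [mat_smul_apply, Finset.smul_sum]
  comp_smul _ _ _ f r g := by ext; simp [mat_smul_apply, Finset.smul_sum]

end Linear

variable [MonoidalCategory C]

/-- The tensor product of two direct sums, expanded by distributivity. -/
instance : MonoidalCategoryStruct (Mat_ C) where
  tensorObj M N := ⟨M.ι × N.ι, fun p => M.X p.1 ⊗ N.X p.2⟩
  tensorUnit := ⟨PUnit, fun _ => 𝟙_ C⟩
  tensorHom f g := fun p q => f p.1 q.1 ⊗ₘ g p.2 q.2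
  whiskerLeft M _ _ g := fun p q => (𝟙 M : M ⟶ M) p.1 q.1 ⊗ₘ g p.2 q.2
  whiskerRight f N := fun p q => f p.1 q.1 ⊗ₘ (𝟙 N : N ⟶ N) p.2 q.2
  associator M N K := matIso (Equiv.prodAssoc M.ι N.ι K.ι) fun p => α_ (M.X p.1.1) (N.X p.1.2) (K.X p.2)
  leftUnitor M := matIso (Equiv.punitProd M.ι) fun p => λ_ (M.X p.2)
  rightUnitor M := matIso (Equiv.prodPUnit M.ι) fun p => ρ_ (M.X p.1)

lemma mat_tensorHom_apply {M N M' N' : Mat_ C} (f : M ⟶ N) (g : M' ⟶ N') (p : (M ⊗ M').ι)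
    (q : (N ⊗ N').ι) : (f ⊗ₘ g) p q = (f p.1 q.1 ⊗ₘ g p.2 q.2) := rfl

variable [MonoidalPreadditive C]

lemma mat_tensorHom_matOfMap {M N M' N' : Mat_ C} (e : M.ι → N.ι) (f : ∀ i, M.X i ⟶ N.X (e i))
    (e' : M'.ι → N'.ι) (f' : ∀ i, M'.X i ⟶ N'.X (e' i)) :
    (matOfMap e f ⊗ₘ matOfMap e' f') =
      matOfMap (M := M ⊗ M') (N := N ⊗ N') (fun p => (e p.1, e' p.2)) (fun p => f p.1 ⊗ₘ f' p.2) := by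
  ext ⟨i, i'⟩ ⟨j, j'⟩
  refine (mat_tensorHom_apply _ _ _ _).trans ?_
  by_cases h : e i = j
  · subst h
    by_cases h' : e' i' = j'
    · subst h'
      exact (congrArg₂ (· ⊗ₘ ·) (matOfMap_apply _ _ _) (matOfMap_apply _ _ _)).trans
        (matOfMap_apply (M := M ⊗ M') (N := N ⊗ N') (fun p => (e p.1, e' p.2))
          (fun p => f p.1 ⊗ₘ f' p.2) (i, i')).symm
    · have hne : (e i, e' i') ≠ (e i, j') := fun hh => h' (congrArg Prod.snd hh)
      exact ((congrArg _ (matOfMap_apply_of_ne _ _ h')).trans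
        (MonoidalPreadditive.tensor_zero _)).trans
          (matOfMap_apply_of_ne (M := M ⊗ M') (N := N ⊗ N') (fun p => (e p.1, e' p.2))
            (fun p => f p.1 ⊗ₘ f' p.2)
            (i := (i, i')) (j := (e i, j')) hne).symm
  · have hne : (e i, e' i') ≠ (j, j') := fun hh => h (congrArg Prod.fst hh)
    exact ((congrArg (· ⊗ₘ _) (matOfMap_apply_of_ne _ _ h)).trans
        (MonoidalPreadditive.zero_tensor _)).trans
          (matOfMap_apply_of_ne (M := M ⊗ M') (N := N ⊗ N') (fun p => (e p.1, e' p.2))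
            (fun p => f p.1 ⊗ₘ f' p.2)
            (i := (i, i')) (j := (j, j')) hne).symm

instance : MonoidalCategory (Mat_ C) := .ofTensorHom
  (id_tensorHom_id := fun M N => by
    rw [← matOfMap_id, ← matOfMap_id, mat_tensorHom_matOfMap, ← matOfMap_id]
    congr 1; ext p; exact id_tensorHom_id _ _)
  (id_tensorHom := fun _ _ _ _ => rfl)
  (tensorHom_id := fun _ _ => rfl)
  (tensorHom_comp_tensorHom := fun {X₁ Y₁ Z₁ X₂ Y₂ Z₂} f g f' g' => by
    ext p q
    have h : ∀ (i : X₁.ι) (j : Z₁.ι), (f ≫ f') i j = ∑ l, f i l ≫ f' l j := fun _ _ => rfl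
    have h' : ∀ (i : X₂.ι) (j : Z₂.ι), (g ≫ g') i j = ∑ l, g i l ≫ g' l j := fun _ _ => rfl
    rw [mat_tensorHom_apply, h, h', sum_tensor]
    simp_rw [tensor_sum, ← tensorHom_comp_tensorHom]
    exact Fintype.sum_prod_type _)
  (associator_naturality := fun f g h => by
    ext ⟨⟨i, j⟩, l⟩ q
    obtain ⟨⟨⟨i', j'⟩, l'⟩, rfl⟩ := (Equiv.prodAssoc _ _ _).surjective q
    refine (comp_matOfMap_apply _ (Equiv.injective _) _ _ _ _).trans
      (Eq.trans ?_ (matOfMap_comp_apply _ _ _ _ _).symm)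
    exact associator_naturality _ _ _)
  (leftUnitor_naturality := fun {M N} f => by
    ext ⟨i, j⟩ (q : N.ι)
    refine (comp_matOfMap_apply (M := 𝟙_ (Mat_ C) ⊗ N) (Equiv.punitProd N.ι)
      (Equiv.injective _) _ _ _ (PUnit.unit, q)).trans
      (Eq.trans ?_ (matOfMap_comp_apply _ _ _ _ _).symm)
    refine (congrArg (fun t => (t ⊗ₘ f j q) ≫ (λ_ (N.X q)).hom) (Mat_.id_apply_self _ _)).trans ?_
    exact (congrArg (· ≫ _) (id_tensorHom _ _)).trans (leftUnitor_naturality (f j q)))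
  (rightUnitor_naturality := fun {M N} f => by
    ext ⟨i, j⟩ (q : N.ι)
    refine (comp_matOfMap_apply (M := N ⊗ 𝟙_ (Mat_ C)) (Equiv.prodPUnit N.ι)
      (Equiv.injective _) _ _ _ (q, PUnit.unit)).trans
      (Eq.trans ?_ (matOfMap_comp_apply _ _ _ _ _).symm)
    refine (congrArg (fun t => (f i q ⊗ₘ t) ≫ (ρ_ (N.X q)).hom) (Mat_.id_apply_self _ _)).trans ?_
    exact (congrArg (· ≫ _) (tensorHom_id _ _)).trans (rightUnitor_naturality (f i q)))
  (pentagon := fun W X Y Z => by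
    change ((matOfMap _ _ ⊗ₘ 𝟙 Z) ≫ matOfMap _ _ ≫ (𝟙 W ⊗ₘ matOfMap _ _)) =
      matOfMap _ _ ≫ matOfMap _ _
    rw [← matOfMap_id, ← matOfMap_id, mat_tensorHom_matOfMap, mat_tensorHom_matOfMap, matOfMap_comp,
      matOfMap_comp, matOfMap_comp]
    congr 1
    ext p
    have := pentagon (W.X p.1.1.1) (X.X p.1.1.2) (Y.X p.1.2) (Z.X p.2)
    simp only [← id_tensorHom, ← tensorHom_id] at this
    exact this)
  (triangle := fun X Y => by
    change (matOfMap _ _ ≫ (𝟙 X ⊗ₘ matOfMap _ _)) = (matOfMap _ _ ⊗ₘ 𝟙 Y)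
    rw [← matOfMap_id, ← matOfMap_id, mat_tensorHom_matOfMap, mat_tensorHom_matOfMap, matOfMap_comp]
    congr 1
    ext p
    have := triangle (X.X p.1.1) (Y.X p.2)
    simp only [← id_tensorHom, ← tensorHom_id] at this
    exact this)

instance : MonoidalPreadditive (Mat_ C) where
  whiskerLeft_add f g := by ext p q; exact MonoidalPreadditive.tensor_add _ _ _
  add_whiskerRight f g := by ext p q; exact MonoidalPreadditive.add_tensor _ _ _
  whiskerLeft_zero := by intros; ext p q; exact MonoidalPreadditive.tensor_zero _
  zero_whiskerRight := by intros; ext p q; exact MonoidalPreadditive.zero_tensor _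

end AdditiveEnvelope

section KaroubiEnvelope

open Idempotents

universe v₁ u₁

variable {C : Type u₁} [Category.{v₁} C] [MonoidalCategory C]

/-- The tensor product of two idempotents `(X, p)` and `(Y, q)` is `(X ⊗ Y, p ⊗ q)`. -/
instance : MonoidalCategoryStruct (Karoubi C) where
  tensorObj P Q := ⟨P.X ⊗ Q.X, P.p ⊗ₘ Q.p, by simp⟩
  tensorUnit := ⟨𝟙_ C, 𝟙 _, by simp⟩
  tensorHom f g := ⟨f.f ⊗ₘ g.f, by simp⟩
  whiskerLeft P _ _ g := ⟨P.p ⊗ₘ g.f, by simp⟩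
  whiskerRight f Q := ⟨f.f ⊗ₘ Q.p, by simp⟩
  associator P Q R :=
    { hom := ⟨((P.p ⊗ₘ Q.p) ⊗ₘ R.p) ≫ (α_ P.X Q.X R.X).hom, by simp⟩
      inv := ⟨(P.p ⊗ₘ (Q.p ⊗ₘ R.p)) ≫ (α_ P.X Q.X R.X).inv, by simp⟩
      hom_inv_id := by ext; simp
      inv_hom_id := by ext; simp }
  leftUnitor P :=
    { hom := ⟨(𝟙 _ ⊗ₘ P.p) ≫ (λ_ P.X).hom, by simp⟩
      inv := ⟨P.p ≫ (λ_ P.X).inv, by simp⟩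
      hom_inv_id := by ext; simp
      inv_hom_id := by ext; simp }
  rightUnitor P :=
    { hom := ⟨(P.p ⊗ₘ 𝟙 _) ≫ (ρ_ P.X).hom, by simp⟩
      inv := ⟨P.p ≫ (ρ_ P.X).inv, by simp⟩
      hom_inv_id := by ext; simp
      inv_hom_id := by ext; simp }

instance : MonoidalCategory (Karoubi C) := .ofTensorHom
  (id_tensorHom_id := fun _ _ => rfl)
  (id_tensorHom := fun _ _ _ _ => rfl)
  (tensorHom_id := fun _ _ => rfl)
  (tensorHom_comp_tensorHom := fun f g f' g' => by
    ext; exact tensorHom_comp_tensorHom f.f g.f f'.f g'.f)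
  (associator_naturality := fun {X₁ X₂ X₃ Y₁ Y₂ Y₃} f g h => by
    ext
    change ((f.f ⊗ₘ g.f) ⊗ₘ h.f) ≫ ((Y₁.p ⊗ₘ Y₂.p) ⊗ₘ Y₃.p) ≫ (α_ _ _ _).hom =
      (((X₁.p ⊗ₘ X₂.p) ⊗ₘ X₃.p) ≫ (α_ _ _ _).hom) ≫ (f.f ⊗ₘ (g.f ⊗ₘ h.f))
    simp)
  (leftUnitor_naturality := fun {X Y} f => by
    ext
    change (𝟙 _ ⊗ₘ f.f) ≫ (𝟙 _ ⊗ₘ Y.p) ≫ (λ_ Y.X).hom = ((𝟙 _ ⊗ₘ X.p) ≫ (λ_ X.X).hom) ≫ f.f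
    simp)
  (rightUnitor_naturality := fun {X Y} f => by
    ext
    change (f.f ⊗ₘ 𝟙 _) ≫ (Y.p ⊗ₘ 𝟙 _) ≫ (ρ_ Y.X).hom = ((X.p ⊗ₘ 𝟙 _) ≫ (ρ_ X.X).hom) ≫ f.f
    simp)
  (pentagon := fun W X Y Z => by
    ext
    change ((((W.p ⊗ₘ X.p) ⊗ₘ Y.p) ≫ (α_ _ _ _).hom) ⊗ₘ Z.p) ≫
      (((W.p ⊗ₘ (X.p ⊗ₘ Y.p)) ⊗ₘ Z.p) ≫ (α_ _ _ _).hom) ≫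
        (W.p ⊗ₘ (((X.p ⊗ₘ Y.p) ⊗ₘ Z.p) ≫ (α_ _ _ _).hom)) =
      ((((W.p ⊗ₘ X.p) ⊗ₘ Y.p) ⊗ₘ Z.p) ≫ (α_ _ _ _).hom) ≫
        ((W.p ⊗ₘ X.p) ⊗ₘ (Y.p ⊗ₘ Z.p)) ≫ (α_ _ _ _).hom
    have h₁ : ((((W.p ⊗ₘ X.p) ⊗ₘ Y.p) ≫ (α_ _ _ _).hom) ⊗ₘ Z.p) =
        ((((W.p ⊗ₘ X.p) ⊗ₘ Y.p)) ⊗ₘ Z.p) ≫ ((α_ _ _ _).hom ⊗ₘ 𝟙 _) := by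
      rw [tensorHom_comp_tensorHom, Category.comp_id]
    have h₂ : (W.p ⊗ₘ (((X.p ⊗ₘ Y.p) ⊗ₘ Z.p) ≫ (α_ _ _ _).hom)) =
        (𝟙 _ ⊗ₘ (α_ _ _ _).hom) ≫ (W.p ⊗ₘ (X.p ⊗ₘ (Y.p ⊗ₘ Z.p))) := by
      rw [tensorHom_comp_tensorHom, Category.id_comp, associator_naturality]
    have h₃ : ((W.p ⊗ₘ (X.p ⊗ₘ Y.p)) ⊗ₘ Z.p) ≫ (α_ _ _ _).hom =
        (α_ _ _ _).hom ≫ (W.p ⊗ₘ ((X.p ⊗ₘ Y.p) ⊗ₘ Z.p)) := associator_naturality _ _ _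
    have h₄ : (W.p ⊗ₘ ((X.p ⊗ₘ Y.p) ⊗ₘ Z.p)) ≫ (𝟙 _ ⊗ₘ (α_ _ _ _).hom) =
        (𝟙 _ ⊗ₘ (α_ _ _ _).hom) ≫ (W.p ⊗ₘ (X.p ⊗ₘ (Y.p ⊗ₘ Z.p))) := by
      rw [tensorHom_comp_tensorHom, tensorHom_comp_tensorHom, Category.id_comp, Category.comp_id,
        associator_naturality]
    have h₅ : ((W.p ⊗ₘ X.p) ⊗ₘ (Y.p ⊗ₘ Z.p)) ≫ (α_ _ _ _).hom =
        (α_ _ _ _).hom ≫ (W.p ⊗ₘ (X.p ⊗ₘ (Y.p ⊗ₘ Z.p))) := associator_naturality _ _ _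
    have hp := MonoidalCategory.pentagon W.X X.X Y.X Z.X
    rw [← id_tensorHom, ← tensorHom_id] at hp
    rw [h₁, h₂, h₃, h₅]
    simp only [Category.assoc]
    have h₆ : (W.p ⊗ₘ (X.p ⊗ₘ (Y.p ⊗ₘ Z.p))) ≫ (W.p ⊗ₘ (X.p ⊗ₘ (Y.p ⊗ₘ Z.p))) =
        (W.p ⊗ₘ (X.p ⊗ₘ (Y.p ⊗ₘ Z.p))) := by
      simp only [tensorHom_comp_tensorHom, Karoubi.idem]
    rw [reassoc_of% h₄, h₆, reassoc_of% hp])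
  (triangle := fun X Y => by
    ext
    change (((X.p ⊗ₘ 𝟙 _) ⊗ₘ Y.p) ≫ (α_ _ _ _).hom) ≫ (X.p ⊗ₘ ((𝟙 _ ⊗ₘ Y.p) ≫ (λ_ Y.X).hom)) =
      ((X.p ⊗ₘ 𝟙 _) ≫ (ρ_ X.X).hom) ⊗ₘ Y.p
    have h₁ : (((X.p ⊗ₘ 𝟙 _) ≫ (ρ_ X.X).hom) ⊗ₘ Y.p) =
        ((X.p ⊗ₘ 𝟙 _) ⊗ₘ Y.p) ≫ ((ρ_ X.X).hom ⊗ₘ 𝟙 _) := by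
      rw [tensorHom_comp_tensorHom, Category.comp_id]
    have h₂ : (X.p ⊗ₘ ((𝟙 _ ⊗ₘ Y.p) ≫ (λ_ Y.X).hom)) =
        (X.p ⊗ₘ (𝟙 _ ⊗ₘ Y.p)) ≫ (𝟙 _ ⊗ₘ (λ_ Y.X).hom) := by
      rw [tensorHom_comp_tensorHom, Category.comp_id]
    have ht := MonoidalCategory.triangle X.X Y.X
    rw [← id_tensorHom, ← tensorHom_id] at ht
    have h₃ : (X.p ⊗ₘ (𝟙 (𝟙_ C) ⊗ₘ Y.p)) ≫ (X.p ⊗ₘ (𝟙 (𝟙_ C) ⊗ₘ Y.p)) =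
        (X.p ⊗ₘ (𝟙 (𝟙_ C) ⊗ₘ Y.p)) := by
      simp only [tensorHom_comp_tensorHom, Karoubi.idem, Category.comp_id]
    rw [h₁, h₂, associator_naturality, Category.assoc, reassoc_of% h₃,
      ← associator_naturality_assoc, ht])

instance [Preadditive C] [MonoidalPreadditive C] : MonoidalPreadditive (Karoubi C) where
  whiskerLeft_add f g := by ext; exact MonoidalPreadditive.tensor_add _ _ _
  add_whiskerRight f g := by ext; exact MonoidalPreadditive.add_tensor _ _ _
  whiskerLeft_zero := by intros; ext; exact MonoidalPreadditive.tensor_zero _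
  zero_whiskerRight := by intros; ext; exact MonoidalPreadditive.zero_tensor _

end KaroubiEnvelope

section GrothendieckRing

open Algebra

section Semiring

variable {S : Type*} [Semiring S]

lemma grothendieck_lift_of {A : Type*} [AddCommGroup A] (f : S →+ A) (s : S) :
    GrothendieckAddGroup.lift f (GrothendieckAddGroup.of s) = f s :=
  DFunLike.congr_fun (GrothendieckAddGroup.lift.symm_apply_apply f) s

lemma grothendieck_hom_ext {A : Type*} [AddCommGroup A] {f g : GrothendieckAddGroup S →+ A}
    (h : ∀ s, f (GrothendieckAddGroup.of s) = g (GrothendieckAddGroup.of s)) : f = g := by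
  apply GrothendieckAddGroup.lift.symm.injective
  ext t
  exact h t

/-- The biadditive extension of the multiplication of `S` to its Grothendieck group. -/
def grothendieckMul :
    GrothendieckAddGroup S →+ GrothendieckAddGroup S →+ GrothendieckAddGroup S :=
  GrothendieckAddGroup.lift
    { toFun := fun s => GrothendieckAddGroup.lift
        (GrothendieckAddGroup.of.comp (AddMonoidHom.mulLeft s))
      map_zero' := grothendieck_hom_ext fun t => by
        rw [grothendieck_lift_of]
        simp
      map_add' := fun s s' => grothendieck_hom_ext fun t => by
        rw [AddMonoidHom.add_apply]
        simp only [grothendieck_lift_of]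
        simp [add_mul] }

lemma grothendieckMul_of (s t : S) :
    grothendieckMul (GrothendieckAddGroup.of s) (GrothendieckAddGroup.of t) =
      GrothendieckAddGroup.of (s * t) := by
  rw [grothendieckMul, grothendieck_lift_of]
  exact grothendieck_lift_of _ _

lemma grothendieckMul_assoc (a b c : GrothendieckAddGroup S) :
    grothendieckMul (grothendieckMul a b) c = grothendieckMul a (grothendieckMul b c) := by
  have h₁ : ∀ s t : S, ∀ c, grothendieckMul
      (grothendieckMul (GrothendieckAddGroup.of s) (GrothendieckAddGroup.of t)) c =
      grothendieckMul (GrothendieckAddGroup.of s) (grothendieckMul (GrothendieckAddGroup.of t) c) :=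
    fun s t => DFunLike.congr_fun (grothendieck_hom_ext
      (g := (grothendieckMul (GrothendieckAddGroup.of s)).comp
        (grothendieckMul (GrothendieckAddGroup.of t))) fun r => by
      rw [AddMonoidHom.comp_apply, grothendieckMul_of, grothendieckMul_of, grothendieckMul_of,
        grothendieckMul_of, mul_assoc])
  have h₂ : ∀ s : S, ∀ b c, grothendieckMul (grothendieckMul (GrothendieckAddGroup.of s) b) c =
      grothendieckMul (GrothendieckAddGroup.of s) (grothendieckMul b c) :=
    fun s b c => DFunLike.congr_fun (grothendieck_hom_ext
      (f := (grothendieckMul.flip c).comp (grothendieckMul (GrothendieckAddGroup.of s)))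
      (g := (grothendieckMul (GrothendieckAddGroup.of s)).comp (grothendieckMul.flip c))
      fun t => h₁ s t c) b
  exact DFunLike.congr_fun (grothendieck_hom_ext
    (f := (grothendieckMul.flip c).comp (grothendieckMul.flip b))
    (g := grothendieckMul.flip (grothendieckMul b c)) fun s => h₂ s b c) a

lemma grothendieckMul_one_left (a : GrothendieckAddGroup S) :
    grothendieckMul (GrothendieckAddGroup.of 1) a = a :=
  DFunLike.congr_fun (grothendieck_hom_ext (f := grothendieckMul (GrothendieckAddGroup.of 1))
    (g := AddMonoidHom.id _) fun s => by
      rw [grothendieckMul_of, one_mul, AddMonoidHom.id_apply]) a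

lemma grothendieckMul_one_right (a : GrothendieckAddGroup S) :
    grothendieckMul a (GrothendieckAddGroup.of 1) = a :=
  DFunLike.congr_fun (grothendieck_hom_ext
    (f := grothendieckMul.flip (GrothendieckAddGroup.of 1))
    (g := AddMonoidHom.id _) fun s => by
      rw [AddMonoidHom.flip_apply, grothendieckMul_of, mul_one, AddMonoidHom.id_apply]) a

lemma grothendieckMul_zero_left (a : GrothendieckAddGroup S) : grothendieckMul 0 a = 0 := by
  rw [map_zero, AddMonoidHom.zero_apply]

lemma grothendieckMul_add_left (a b c : GrothendieckAddGroup S) :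
    grothendieckMul (a + b) c = grothendieckMul a c + grothendieckMul b c := by
  rw [map_add, AddMonoidHom.add_apply]

instance : Mul (GrothendieckAddGroup S) := ⟨fun a b => grothendieckMul a b⟩

instance : One (GrothendieckAddGroup S) := ⟨GrothendieckAddGroup.of 1⟩

/-- The Grothendieck group of a semiring is a ring. -/
instance grothendieckRing : Ring (GrothendieckAddGroup S) :=
  { (inferInstance : AddCommGroup (GrothendieckAddGroup S)) with
    left_distrib := fun a b c => map_add (grothendieckMul a) b c
    right_distrib := grothendieckMul_add_left
    zero_mul := grothendieckMul_zero_left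
    mul_zero := fun a => map_zero (grothendieckMul a)
    one_mul := grothendieckMul_one_left
    mul_one := grothendieckMul_one_right
    mul_assoc := grothendieckMul_assoc }

end Semiring

section IsoClass

universe v₁ u₁

/-- Isomorphism classes of objects. -/
def IsoClass (C : Type u₁) [Category.{v₁} C] : Type u₁ := Quotient (isIsomorphicSetoid C)

variable {C : Type u₁} [Category.{v₁} C]

/-- The isomorphism class of an object. -/
def isoClass (X : C) : IsoClass C := Quotient.mk (isIsomorphicSetoid C) X

lemma isoClass_eq {X Y : C} (e : X ≅ Y) : isoClass X = isoClass Y :=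
  Quotient.sound (s := isIsomorphicSetoid C) ⟨e⟩

lemma isoClass_eq_iff {X Y : C} : isoClass X = isoClass Y ↔ Nonempty (X ≅ Y) :=
  Quotient.eq (r := isIsomorphicSetoid C)

variable [Preadditive C] [HasFiniteBiproducts C]

instance : HasBinaryBiproducts C := hasBinaryBiproducts_of_finite_biproducts C

/-- The sum of two isomorphism classes is the class of the direct sum. -/
instance : Add (IsoClass C) :=
  ⟨Quotient.map₂ (fun X Y => X ⊞ Y) fun _ _ ⟨e⟩ _ _ ⟨e'⟩ => ⟨biprod.mapIso e e'⟩⟩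

open ZeroObject in
/-- Zero is the class of the zero object. -/
instance : Zero (IsoClass C) := ⟨isoClass (0 : C)⟩

instance : AddCommMonoid (IsoClass C) where
  add_assoc := by
    rintro ⟨X⟩ ⟨Y⟩ ⟨Z⟩
    exact isoClass_eq (biprod.associator X Y Z)
  zero_add := by
    rintro ⟨X⟩
    exact isoClass_eq (isoZeroBiprod (isZero_zero C)).symm
  add_zero := by
    rintro ⟨X⟩
    exact isoClass_eq (isoBiprodZero (isZero_zero C)).symm
  add_comm := by
    rintro ⟨X⟩ ⟨Y⟩
    exact isoClass_eq (biprod.braiding X Y)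
  nsmul := nsmulRec

variable [MonoidalCategory C] [MonoidalPreadditive C]

/-- The product of two isomorphism classes is the class of the tensor product. -/
instance : Mul (IsoClass C) :=
  ⟨Quotient.map₂ (fun X Y => X ⊗ Y) fun _ _ ⟨e⟩ _ _ ⟨e'⟩ => ⟨e ⊗ᵢ e'⟩⟩

/-- One is the class of the unit object. -/
instance : One (IsoClass C) := ⟨isoClass (𝟙_ C)⟩

instance : Semiring (IsoClass C) where
  mul_assoc := by
    rintro ⟨X⟩ ⟨Y⟩ ⟨Z⟩
    exact isoClass_eq (α_ X Y Z)
  one_mul := by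
    rintro ⟨X⟩
    exact isoClass_eq (λ_ X)
  mul_one := by
    rintro ⟨X⟩
    exact isoClass_eq (ρ_ X)
  zero_mul := by
    rintro ⟨X⟩
    exact isoClass_eq (IsZero.iso (Functor.map_isZero (tensorRight X) (isZero_zero C))
      (isZero_zero C))
  mul_zero := by
    rintro ⟨X⟩
    exact isoClass_eq (IsZero.iso (Functor.map_isZero (tensorLeft X) (isZero_zero C))
      (isZero_zero C))
  left_distrib := by
    rintro ⟨X⟩ ⟨Y⟩ ⟨Z⟩
    have := preservesBinaryBiproducts_of_preservesBiproducts (tensorLeft X)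
    exact isoClass_eq ((tensorLeft X).mapBiprod Y Z)
  right_distrib := by
    rintro ⟨X⟩ ⟨Y⟩ ⟨Z⟩
    have := preservesBinaryBiproducts_of_preservesBiproducts (tensorRight Z)
    exact isoClass_eq ((tensorRight Z).mapBiprod X Y)

end IsoClass

universe v₁ u₁ v₂ u₂

/-- The split Grothendieck group of an additive category: the group completion of the monoid of
isomorphism classes of objects under direct sum.  If the category is monoidal, it is a ring. -/
abbrev K0 (C : Type u₁) [Category.{v₁} C] [Preadditive C] [HasFiniteBiproducts C] : Type u₁ :=
  GrothendieckAddGroup (IsoClass C)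

/-- The class of an object in the Grothendieck group. -/
def K0.cls {C : Type u₁} [Category.{v₁} C] [Preadditive C] [HasFiniteBiproducts C] (X : C) : K0 C :=
  GrothendieckAddGroup.of (isoClass X)

/-- The homomorphism of Grothendieck groups induced by an additive functor. -/
def K0.map {C : Type u₁} [Category.{v₁} C] [Preadditive C] [HasFiniteBiproducts C]
    {D : Type u₂} [Category.{v₂} D] [Preadditive D] [HasFiniteBiproducts D]
    (F : C ⥤ D) [F.Additive] : K0 C →+ K0 D :=
  GrothendieckAddGroup.lift (GrothendieckAddGroup.of.comp
    { toFun := Quotient.map F.obj fun _ _ ⟨e⟩ => ⟨F.mapIso e⟩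
      map_zero' := isoClass_eq (IsZero.iso (F.map_isZero (isZero_zero C)) (isZero_zero D))
      map_add' := by
        rintro ⟨X⟩ ⟨Y⟩
        have := preservesBinaryBiproducts_of_preservesBiproducts F
        exact isoClass_eq (F.mapBiprod X Y) })

lemma K0.map_cls {C : Type u₁} [Category.{v₁} C] [Preadditive C] [HasFiniteBiproducts C]
    {D : Type u₂} [Category.{v₂} D] [Preadditive D] [HasFiniteBiproducts D]
    (F : C ⥤ D) [F.Additive] (X : C) : K0.map F (K0.cls X) = K0.cls (F.obj X) :=
  DFunLike.congr_fun (GrothendieckAddGroup.lift.symm_apply_apply _) (isoClass X)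

end GrothendieckRing

section Coxeter

/-- The Coxeter relations of the symmetric group on `n` letters. -/
structure CoxeterRel {M : Type*} [Monoid M] (n : ℕ) (s : ℕ → M) : Prop where
  quad : ∀ i, i + 1 < n → s i * s i = 1
  braid : ∀ i, i + 2 < n → s i * s (i + 1) * s i = s (i + 1) * s i * s (i + 1)
  comm : ∀ i j, i + 1 < j → j + 1 < n → s i * s j = s j * s i

variable {M : Type*} [Monoid M]

lemma CoxeterRel.shift {n : ℕ} {s : ℕ → M} (h : CoxeterRel (n + 1) s) :
    CoxeterRel n fun i => s (i + 1) where
  quad i hi := h.quad (i + 1) (by omega)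
  braid i hi := h.braid (i + 1) (by omega)
  comm i j hij hj := h.comm (i + 1) (j + 1) (by omega) (by omega)

/-- The product `s (p - 1) * ... * s 1 * s 0`. -/
def coxProd (s : ℕ → M) : ℕ → M
  | 0 => 1
  | p + 1 => s p * coxProd s p

lemma coxProd_comm {n : ℕ} {s : ℕ → M} (h : CoxeterRel n s) (i : ℕ) (hi : i + 1 < n) :
    ∀ p < i, s i * coxProd s p = coxProd s p * s i
  | 0, _ => by simp [coxProd]
  | p + 1, hp => by
    rw [coxProd, ← mul_assoc, ← h.comm p i (by omega) hi, mul_assoc,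
      coxProd_comm h i hi p (by omega), mul_assoc]

lemma coxProd_comm' {n : ℕ} {s : ℕ → M} (h : CoxeterRel n s) (i : ℕ) :
    ∀ p, i + 1 < p → p < n → s i * coxProd s p = coxProd s p * s (i + 1)
  | 0, hp, _ => by omega
  | 1, hp, _ => by omega
  | p + 2, hp, hn => by
    rcases Nat.lt_or_ge i p with hi | hi
    · have := coxProd_comm' h i (p + 1) (by omega) (by omega)
      rw [coxProd, ← mul_assoc, h.comm i (p + 1) (by omega) (by omega), mul_assoc, this, mul_assoc]
    · obtain rfl : i = p := by omega
      have := coxProd_comm h (i + 1) (by omega) i (by omega)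
      rw [coxProd, coxProd, ← mul_assoc, ← mul_assoc, h.braid i (by omega), mul_assoc, this]
      simp only [mul_assoc]

/-- Left multiplication by a generator, in terms of the normal form. -/
def coxStep (i p : ℕ) : ℕ × Option ℕ :=
  if i = p then (p + 1, none) else if i + 1 = p then (i, none)
  else if p < i then (p, some (i - 1)) else (p, some i)

lemma coxStep_lt (n i p : ℕ) (hi : i < n) (hp : p < n + 1) : (coxStep i p).1 < n + 1 := by
  unfold coxStep
  split_ifs <;> simp <;> omega

lemma coxStep_some (n i p j : ℕ) (hi : i < n) (hp : p < n + 1) (h : (coxStep i p).2 = some j) :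
    j + 1 < n := by
  unfold coxStep at h
  split_ifs at h <;> simp at h <;> omega

lemma coxStep_spec {n : ℕ} {s : ℕ → M} (h : CoxeterRel (n + 1) s) (i p : ℕ) (hi : i < n)
    (hp : p < n + 1) : s i * coxProd s p =
      coxProd s (coxStep i p).1 * ((coxStep i p).2.map fun j => s (j + 1)).getD 1 := by
  unfold coxStep
  split_ifs with h₁ h₂ h₃
  · subst h₁; simp [coxProd]
  · subst h₂; simp [coxProd, ← mul_assoc, h.quad i (by omega)]
  · obtain ⟨i, rfl⟩ : ∃ j, i = j + 1 := ⟨i - 1, by omega⟩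
    simpa using coxProd_comm h (i + 1) (by omega) p h₃
  · simpa using coxProd_comm' h i p (by omega) hp

open Equiv Equiv.Perm

/-- The transposition of `i` and `i + 1`. -/
def adjSwap (n i : ℕ) : Perm (Fin n) :=
  if h : i + 1 < n then swap ⟨i, by omega⟩ ⟨i + 1, h⟩ else 1

lemma adjSwap_val (n i : ℕ) (h : i + 1 < n) (x : Fin n) :
    (adjSwap n i x : ℕ) = if (x : ℕ) = i then i + 1 else if (x : ℕ) = i + 1 then i else x := by
  rw [adjSwap, dif_pos h, swap_apply_def]
  simp only [Fin.ext_iff]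
  split_ifs <;> rfl

lemma adjSwap_rel (n : ℕ) : CoxeterRel n (adjSwap n) where
  quad i hi := by simp [adjSwap, hi]
  braid i hi := by
    have h₁ : i + 1 < n := by omega
    ext x
    simp only [Perm.mul_apply, adjSwap_val n i h₁, adjSwap_val n (i + 1) hi]
    grind
  comm i j hij hj := by
    have h₁ : i + 1 < n := by omega
    ext x
    simp only [Perm.mul_apply, adjSwap_val n i h₁, adjSwap_val n j hj]
    grind

lemma adjSwap_closure (n : ℕ) :
    Submonoid.closure {g | ∃ i, i + 1 < n ∧ adjSwap n i = g} = ⊤ := by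
  cases n with
  | zero => exact Subsingleton.elim _ _
  | succ n =>
    rw [eq_top_iff, ← Equiv.Perm.mclosure_swap_castSucc_succ n]
    apply Submonoid.closure_mono
    rintro _ ⟨i, rfl⟩
    refine ⟨i, by omega, ?_⟩
    rw [adjSwap, dif_pos (by omega)]
    rfl

/-- The embedding of symmetric groups fixing `0`. -/
def permShift (n : ℕ) : Perm (Fin n) →* Perm (Fin (n + 1)) where
  toFun e := decomposeFin.symm (0, e)
  map_one' := by
    ext x; refine Fin.cases ?_ (fun x => ?_) x <;> simp
  map_mul' e f := by
    ext x; refine Fin.cases ?_ (fun x => ?_) x <;> simp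

lemma permShift_adjSwap (n i : ℕ) (hi : i + 1 < n) :
    permShift n (adjSwap n i) = adjSwap (n + 1) (i + 1) := by
  ext x
  have h₂ : i + 1 + 1 < n + 1 := by omega
  rw [adjSwap, adjSwap, dif_pos hi, dif_pos h₂]
  refine Fin.cases ?_ (fun x => ?_) x
  · simp [permShift, swap_apply_def, Fin.ext_iff]
  · simp only [permShift, MonoidHom.coe_mk, OneHom.coe_mk, decomposeFin_symm_apply_succ,
      swap_self, coe_refl, id_eq, swap_apply_def, Fin.ext_iff, Fin.val_succ]
    split_ifs <;> simp_all

lemma coxProd_zero_apply (n p : ℕ) (hp : p < n + 1) :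
    coxProd (adjSwap (n + 1)) p 0 = ⟨p, hp⟩ := by
  induction p with
  | zero => rfl
  | succ p ih =>
    rw [coxProd, Perm.mul_apply, ih (by omega), adjSwap, dif_pos hp, swap_apply_left]

/-- The normal form of a permutation. -/
lemma perm_bijective (n : ℕ) : Function.Bijective fun x : Fin (n + 1) × Perm (Fin n) =>
    coxProd (adjSwap (n + 1)) x.1 * permShift n x.2 := by
  constructor
  · rintro ⟨p, e⟩ ⟨q, f⟩ h
    have h₀ := DFunLike.congr_fun h 0
    simp only [Perm.mul_apply] at h₀
    have hs : ∀ e, permShift n e 0 = 0 := fun e => by simp [permShift]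
    rw [hs, hs, coxProd_zero_apply n p p.2, coxProd_zero_apply n q q.2] at h₀
    obtain rfl : p = q := h₀
    have h' := mul_left_cancel h
    have := decomposeFin.symm.injective h'
    exact Prod.ext rfl (Prod.mk.inj this).2
  · intro g
    let c := coxProd (adjSwap (n + 1)) (g 0)
    have hc : (c⁻¹ * g) 0 = 0 := by
      rw [Perm.mul_apply, Perm.inv_eq_iff_eq]
      exact (coxProd_zero_apply n _ (g 0).2).symm
    refine ⟨(g 0, (decomposeFin (c⁻¹ * g)).2), ?_⟩
    have : permShift n (decomposeFin (c⁻¹ * g)).2 = c⁻¹ * g := by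
      change decomposeFin.symm _ = _
      rw [Equiv.symm_apply_eq]
      refine Prod.ext ?_ rfl
      have h2 := decomposeFin_symm_apply_zero (decomposeFin (c⁻¹ * g)).1 (decomposeFin (c⁻¹ * g)).2
      rw [Prod.mk.eta, Equiv.symm_apply_apply, hc] at h2
      exact h2
    change c * permShift n _ = g
    rw [this, mul_inv_cancel_left]

lemma exists_permHom (n : ℕ) (s : ℕ → M) (h : CoxeterRel n s) :
    ∃ f : Perm (Fin n) →* M, ∀ i, i + 1 < n → f (adjSwap n i) = s i := by
  induction n generalizing s with
  | zero => exact ⟨1, fun i hi => by omega⟩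
  | succ n ih =>
    obtain ⟨f, hf⟩ := ih _ h.shift
    let b := Equiv.ofBijective _ (perm_bijective n)
    let F : Perm (Fin (n + 1)) → M := fun g => coxProd s (b.symm g).1 * f (b.symm g).2
    have hF : ∀ p e, F (coxProd (adjSwap (n + 1)) (p : Fin (n + 1)) * permShift n e) =
        coxProd s p * f e := fun p e => by
      have : b.symm (coxProd (adjSwap (n + 1)) (p : Fin (n + 1)) * permShift n e) = (p, e) :=
        b.symm_apply_apply (p, e)
      simp only [F, this]
    have hone : F 1 = 1 := by simpa [coxProd] using hF 0 1
    have hstep : ∀ i, i + 1 < n + 1 → ∀ g, F (adjSwap (n + 1) i * g) = s i * F g := by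
      intro i hi g
      obtain ⟨⟨p, e⟩, rfl⟩ := (perm_bijective n).2 g
      have h₁ := coxStep_spec (adjSwap_rel (n + 1)) i p (by omega) p.2
      have h₂ := coxStep_spec h i p (by omega) p.2
      have h₃ := coxStep_lt n i p (by omega) p.2
      have h₄ := coxStep_some n i p
      simp only
      rw [← mul_assoc, h₁, hF, ← mul_assoc, h₂]
      rcases hj : (coxStep i p).2 with _ | j
      · simpa [hj] using hF ⟨_, h₃⟩ e
      · have h₅ := h₄ j (by omega) p.2 hj
        have := hF ⟨_, h₃⟩ (adjSwap n j * e)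
        rw [map_mul, map_mul, permShift_adjSwap n j h₅, hf j h₅] at this
        simpa [hj, mul_assoc] using this
    have hmul : ∀ g g', F (g * g') = F g * F g' := by
      intro g
      have hg : g ∈ Submonoid.closure {g | ∃ i, i + 1 < n + 1 ∧ adjSwap (n + 1) i = g} := by
        rw [adjSwap_closure]; trivial
      induction hg using Submonoid.closure_induction with
      | mem g hg =>
        obtain ⟨i, hi, rfl⟩ := hg
        intro g'
        have := hstep i hi 1
        rw [mul_one, hone, mul_one] at this
        rw [hstep i hi, this]
      | one => intro g'; rw [one_mul, hone, one_mul]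
      | mul a b _ _ ha hb => intro g'; rw [mul_assoc a b g', ha, hb, ha b]; exact (mul_assoc _ _ _).symm
    refine ⟨⟨⟨F, hone⟩, hmul⟩, fun i hi => ?_⟩
    have := hstep i hi 1
    rwa [mul_one, hone, mul_one] at this

/-- The homomorphism from the symmetric group which sends the transposition of `i` and `i + 1` to
`s i`, for elements `s i` satisfying the Coxeter relations. -/
def permHom {n : ℕ} {s : ℕ → M} (h : CoxeterRel n s) : Perm (Fin n) →* M :=
  (exists_permHom n s h).choose

lemma permHom_adjSwap {n : ℕ} {s : ℕ → M} (h : CoxeterRel n s) (i : ℕ) (hi : i + 1 < n) :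
    permHom h (adjSwap n i) = s i :=
  (exists_permHom n s h).choose_spec i hi

end Coxeter

section Idempotents

variable (k : Type u) [Field k]

/-- The symmetrizing idempotent of the group algebra of the symmetric group. -/
def symIdem (n : ℕ) : MonoidAlgebra k (Equiv.Perm (Fin n)) :=
  (n.factorial : k)⁻¹ • ∑ g, MonoidAlgebra.of k _ g

/-- The antisymmetrizing idempotent of the group algebra of the symmetric group. -/
def altIdem (n : ℕ) : MonoidAlgebra k (Equiv.Perm (Fin n)) :=
  (n.factorial : k)⁻¹ • ∑ g, ((Equiv.Perm.sign g : ℤ) : k) • MonoidAlgebra.of k _ g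

variable [CharZero k]

lemma symIdem_idem (n : ℕ) : symIdem k n * symIdem k n = symIdem k n := by
  have h : (n.factorial : k) ≠ 0 := by exact_mod_cast n.factorial_ne_zero
  have key : ∀ g : Equiv.Perm (Fin n), MonoidAlgebra.of k _ g *
      (∑ x : Equiv.Perm (Fin n), MonoidAlgebra.of k _ x) = ∑ x, MonoidAlgebra.of k _ x := by
    intro g
    rw [Finset.mul_sum, ← Equiv.sum_comp (Equiv.mulLeft g) (MonoidAlgebra.of k _)]
    simp
  rw [symIdem, smul_mul_smul_comm, Finset.sum_mul]
  simp only [key]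
  rw [Finset.sum_const, Finset.card_univ, Fintype.card_perm, Fintype.card_fin,
    ← Nat.cast_smul_eq_nsmul k, smul_smul]
  congr 1
  field_simp

lemma altIdem_idem (n : ℕ) : altIdem k n * altIdem k n = altIdem k n := by
  have h : (n.factorial : k) ≠ 0 := by exact_mod_cast n.factorial_ne_zero
  have hs : ∀ g : Equiv.Perm (Fin n), ((Equiv.Perm.sign g : ℤ) : k) *
      ((Equiv.Perm.sign g : ℤ) : k) = 1 := by
    intro g
    rw [← Int.cast_mul, ← Units.val_mul, Int.units_mul_self, Units.val_one, Int.cast_one]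
  have key : ∀ g : Equiv.Perm (Fin n), (((Equiv.Perm.sign g : ℤ) : k) • MonoidAlgebra.of k _ g) *
      (∑ x : Equiv.Perm (Fin n), ((Equiv.Perm.sign x : ℤ) : k) • MonoidAlgebra.of k _ x) =
        ∑ x : Equiv.Perm (Fin n), ((Equiv.Perm.sign x : ℤ) : k) • MonoidAlgebra.of k _ x := by
    intro g
    rw [Finset.mul_sum, ← Equiv.sum_comp (Equiv.mulLeft g)
      (fun x => ((Equiv.Perm.sign x : ℤ) : k) • MonoidAlgebra.of k _ x)]
    refine Finset.sum_congr rfl fun x _ => ?_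
    rw [smul_mul_smul_comm, Equiv.coe_mulLeft, map_mul, map_mul, Units.val_mul, Int.cast_mul]
  rw [altIdem, smul_mul_smul_comm, Finset.sum_mul]
  simp only [key]
  rw [Finset.sum_const, Finset.card_univ, Fintype.card_perm, Fintype.card_fin,
    ← Nat.cast_smul_eq_nsmul k, smul_smul]
  congr 1
  field_simp

end Idempotents

open Idempotents

section Functors

lemma mapGen_map {k : Type u} {P Q : Presentation k} {G : List Q.C → List Q.C → Type}
    (φ : P.C → Q.C) (F : ∀ {X Y : List P.C}, P.Gen X Y → Q.Gen (X.map φ) (Y.map φ))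
    (F' : ∀ {X Y : List Q.C}, Q.Gen X Y → G X Y) {X Y : List P.C} (f : MorExpr k P.Gen X Y) :
    (f.map φ F).mapGen F' = f.map φ fun g => F' (F g) := by
  induction f with
  | ident h => rfl
  | gen g => rfl
  | comp f g hf hg => simp only [MorExpr.map, MorExpr.mapGen, hf, hg]
  | tensor f g hf hg => simp only [MorExpr.map, MorExpr.mapGen, hf, hg]
  | zero => rfl
  | add f g hf hg => simp only [MorExpr.map, MorExpr.mapGen, hf, hg]
  | smul a f hf => simp only [MorExpr.map, MorExpr.mapGen, hf]

variable {k : Type u} [Field k]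

/-- The canonical functor from the first factor to a localized symmetric product. -/
def fromLeft (P Q : Presentation k) {U V : List (symProd P Q).C}
    (d : MorExpr k (symProd P Q).Gen U V) : P.Cat ⥤ (localize (symProd P Q) d).Cat :=
  Presentation.relabel (Q := localize (symProd P Q) d) Sum.inl (fun g => .old (.left g))
    fun {X Y f g} h => by
      have e : ∀ f : MorExpr k P.Gen X Y, _ :=
        mapGen_map (Q := symProd P Q) (G := LocalizeGen (symProd P Q) U V) Sum.inl SymProdGen.left
          LocalizeGen.old
      have r := LocalizeRel.old (P := symProd P Q) (f := d) (SymProdRel.left (Q := Q) h)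
      exact (congrArg _ (e f)).symm.trans
        ((Presentation.homMk_eq (P := localize (symProd P Q) d) (.rel r)).trans (congrArg _ (e g)))

/-- The canonical functor from the second factor to a localized symmetric product. -/
def fromRight (P Q : Presentation k) {U V : List (symProd P Q).C}
    (d : MorExpr k (symProd P Q).Gen U V) : Q.Cat ⥤ (localize (symProd P Q) d).Cat :=
  Presentation.relabel (Q := localize (symProd P Q) d) Sum.inr (fun g => .old (.right g))
    fun {X Y f g} h => by
      have e : ∀ f : MorExpr k Q.Gen X Y, _ :=
        mapGen_map (Q := symProd P Q) (G := LocalizeGen (symProd P Q) U V) Sum.inr SymProdGen.right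
          LocalizeGen.old
      have r := LocalizeRel.old (P := symProd P Q) (f := d) (SymProdRel.right (P := P) h)
      exact (congrArg _ (e f)).symm.trans
        ((Presentation.homMk_eq (P := localize (symProd P Q) d) (.rel r)).trans (congrArg _ (e g)))

variable (k) in
/-- The canonical functor from the blue copy of the degenerate affine Hecke category. -/
def blue : AH k ⥤ AHBar k := fromLeft (ahPres k) (ahPres k) dotted

variable (k) in
/-- The canonical functor from the red copy of the degenerate affine Hecke category. -/
def red : AH k ⥤ AHBar k := fromRight (ahPres k) (ahPres k) dotted

instance : (blue k).Additive where
  map_add := by rintro _ _ ⟨f⟩ ⟨g⟩; rfl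

instance : (red k).Additive where
  map_add := by rintro _ _ ⟨f⟩ ⟨g⟩; rfl

end Functors

section Envelopes

universe v₁ u₁

/-- The additive Karoubi envelope. -/
abbrev Kar (C : Type u₁) [Category.{v₁} C] [Preadditive C] := Karoubi (Mat_ C)

variable {C D : Type u₁} [Category.{v₁} C] [Preadditive C] [Category.{v₁} D] [Preadditive D]

/-- The functor of Karoubi envelopes induced by a functor of additive envelopes. -/
def karMap (F : Mat_ C ⥤ Mat_ D) : Kar C ⥤ Kar D := (functorExtension₂ _ _).obj F

instance karMap_additive (F : Mat_ C ⥤ Mat_ D) [F.Additive] : (karMap F).Additive where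
  map_add {X Y f g} := by
    ext1
    exact F.map_add

instance (F : C ⥤ D) [F.Additive] : F.mapMat_.Additive where
  map_add {X Y f g} := by
    ext i j
    exact F.map_add

end Envelopes

section Objects

variable (k : Type u) [Field k]

/-- The generating object `↑` of the degenerate affine Hecke category. -/
def up : AH k := ⟨[()]⟩

/-- The dot. -/
def dot : up k ⟶ up k := Presentation.homMk (dotE k)

/-- The crossing. -/
def cross : up k ⊗ up k ⟶ up k ⊗ up k := Presentation.homMk (crossE k)

/-- The tensor power `↑ ⊗ ... ⊗ ↑` with `n` factors. -/
def upPow (n : ℕ) : AH k := ⟨List.replicate n ()⟩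

/-- The crossing of the strands in the positions `i` and `i + 1` of `n` strands, which are numbered
`0, 1, ...` from left to right. -/
def crossAt : (n i : ℕ) → End (upPow k n)
  | 0, _ => 1
  | 1, _ => 1
  | n + 2, 0 => (cross k ▷ upPow k n : up k ⊗ up k ⊗ upPow k n ⟶ up k ⊗ up k ⊗ upPow k n)
  | n + 2, i + 1 => (up k ◁ crossAt (n + 1) i : up k ⊗ upPow k (n + 1) ⟶ up k ⊗ upPow k (n + 1))

lemma crossAt_succ (n i : ℕ) (hi : i + 1 < n) : crossAt k (n + 1) (i + 1) =
    (up k ◁ crossAt k n i : up k ⊗ upPow k n ⟶ up k ⊗ upPow k n) := by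
  obtain ⟨n, rfl⟩ : ∃ m, n = m + 2 := ⟨n - 2, by omega⟩
  rfl

lemma cross_cross : cross k ≫ cross k = 𝟙 _ := Presentation.homMk_eq (.rel AHRel.quadratic)

lemma cross_braid : (cross k ▷ up k) ≫
    (up k ◁ cross k : up k ⊗ up k ⊗ up k ⟶ up k ⊗ up k ⊗ up k) ≫ (cross k ▷ up k) =
    (up k ◁ cross k : up k ⊗ up k ⊗ up k ⟶ up k ⊗ up k ⊗ up k) ≫ (cross k ▷ up k) ≫
      (up k ◁ cross k : up k ⊗ up k ⊗ up k ⟶ up k ⊗ up k ⊗ up k) :=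
  Presentation.homMk_eq (.rel AHRel.braid)

lemma crossAt_rel (n : ℕ) : CoxeterRel n (crossAt k n) := by
  induction n with
  | zero => exact ⟨by omega, by omega, by omega⟩
  | succ n ih =>
    refine ⟨fun i hi => ?_, fun i hi => ?_, fun i j hij hj => ?_⟩
    · rcases i with _ | i
      · obtain ⟨m, rfl⟩ : ∃ m, n = m + 1 := ⟨n - 1, by omega⟩
        refine (comp_whiskerRight (cross k) (cross k) (upPow k m)).symm.trans ?_
        rw [cross_cross, id_whiskerRight]
        rfl
      · rw [crossAt_succ k n i (by omega)]
        refine (whiskerLeft_comp (up k) _ _).symm.trans ?_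
        have := ih.quad i (by omega)
        rw [End.mul_def] at this
        rw [this]
        exact whiskerLeft_id _ _
    · rcases i with _ | i
      · obtain ⟨m, rfl⟩ : ∃ m, n = m + 2 := ⟨n - 2, by omega⟩
        have h := congrArg (fun f => f ▷ upPow k m) (cross_braid k)
        have h₁ : crossAt k (m + 3) 0 = cross k ▷ up k ▷ upPow k m :=
          (whiskerRight_tensor (cross k) (up k) (upPow k m)).trans
            ((Category.id_comp _).trans (Category.comp_id _))
        have h₂ : crossAt k (m + 3) 1 = (up k ◁ cross k) ▷ upPow k m :=
          ((whisker_assoc (up k) (cross k) (upPow k m)).trans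
            ((Category.id_comp _).trans (Category.comp_id _))).symm
        rw [h₁, h₂]
        have e : ∀ a b c : up k ⊗ up k ⊗ up k ⟶ up k ⊗ up k ⊗ up k,
            (a ≫ b ≫ c) ▷ upPow k m = a ▷ upPow k m ≫ b ▷ upPow k m ≫ c ▷ upPow k m := by simp
        exact (e _ _ _).symm.trans (h.trans (e _ _ _))
      · rw [crossAt_succ k n i (by omega), crossAt_succ k n (i + 1) (by omega)]
        have h := congrArg (fun f => up k ◁ f) (ih.braid i (by omega))
        refine Eq.trans ?_ (h.trans ?_)
        · exact (congrArg _ (whiskerLeft_comp _ _ _).symm).trans (whiskerLeft_comp _ _ _).symm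
        · exact (whiskerLeft_comp _ _ _).trans (congrArg _ (whiskerLeft_comp _ _ _))
    · obtain ⟨j, rfl⟩ : ∃ l, j = l + 1 := ⟨j - 1, by omega⟩
      rw [crossAt_succ k n j (by omega)]
      rcases i with _ | i
      · obtain ⟨m, rfl⟩ : ∃ m, n = m + 1 := ⟨n - 1, by omega⟩
        obtain ⟨j, rfl⟩ : ∃ l, j = l + 1 := ⟨j - 1, by omega⟩
        rw [crossAt_succ k m j (by omega)]
        have h₁ : (up k ◁ (up k ◁ crossAt k m j) : (up k ⊗ up k ⊗ upPow k m ⟶ _)) =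
            (up k ⊗ up k) ◁ crossAt k m j :=
          ((tensor_whiskerLeft (up k) (up k) (crossAt k m j)).trans
            ((Category.id_comp _).trans (Category.comp_id _))).symm
        refine (congrArg (fun f => f ≫ crossAt k (m + 2) 0) h₁).trans (Eq.trans ?_
          (congrArg (fun f => crossAt k (m + 2) 0 ≫ f) h₁).symm)
        exact whisker_exchange (cross k) (crossAt k m j)
      · rw [crossAt_succ k n i (by omega)]
        have h := congrArg (fun f => up k ◁ f) (ih.comm i j (by omega) (by omega))
        exact (whiskerLeft_comp _ _ _).symm.trans (h.trans (whiskerLeft_comp _ _ _))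

lemma crossAt_rev_rel (n : ℕ) : CoxeterRel n fun i => crossAt k n (n - 2 - i) where
  quad i hi := (crossAt_rel k n).quad _ (by omega)
  braid i hi := by
    have h := (crossAt_rel k n).braid (n - 2 - (i + 1)) (by omega)
    have e : n - 2 - (i + 1) + 1 = n - 2 - i := by omega
    rw [e] at h
    exact h.symm
  comm i j hij hj := ((crossAt_rel k n).comm (n - 2 - j) (n - 2 - i) (by omega) (by omega)).symm

/-- The homomorphism from the group algebra of the symmetric group to the endomorphism algebra of
the tensor power, sending the `i`th simple transposition to the crossing of the `i`th and the
`(i+1)`th strand counted from right to left. -/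
def iota (n : ℕ) : MonoidAlgebra k (Equiv.Perm (Fin n)) →ₐ[k] End (upPow k n) :=
  MonoidAlgebra.lift k _ _ (permHom (crossAt_rev_rel k n))

variable {k} in
/-- The image of an idempotent endomorphism in the additive Karoubi envelope. -/
def karObj {X : AH k} (e : End X) (he : e * e = e) : Kar (AH k) where
  X := (Mat_.embedding (AH k)).obj X
  p := (Mat_.embedding (AH k)).map e
  idem := by
    rw [← Functor.map_comp]
    exact congrArg _ he

variable [CharZero k]

/-- The object `H_n`. -/
def objH (n : ℕ) : Kar (AH k) :=
  karObj (iota k n (symIdem k n)) (by rw [← map_mul, symIdem_idem])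

/-- The object `E_n`. -/
def objE (n : ℕ) : Kar (AH k) :=
  karObj (iota k n (altIdem k n)) (by rw [← map_mul, altIdem_idem])

end Objects

section Delta

variable (k : Type u) [Field k]

/-- The isomorphism `blue ⊗ red ⟶ red ⊗ blue`. -/
def sigma : (⟨[.inl (), .inr ()]⟩ : AHBar k) ⟶ ⟨[.inr (), .inl ()]⟩ :=
  Presentation.homMk (P := ahBarPres k) (.gen (.old (.braid (P := ahPres k) (Q := ahPres k) [()] [()])))

/-- The inverse isomorphism `red ⊗ blue ⟶ blue ⊗ red`. -/
def sigmaInv : (⟨[.inr (), .inl ()]⟩ : AHBar k) ⟶ ⟨[.inl (), .inr ()]⟩ :=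
  Presentation.homMk (P := ahBarPres k) (.gen (.old (.braidInv (P := ahPres k) (Q := ahPres k) [()] [()])))

/-- The dumbbell on `blue ⊗ red`, i.e. the inverse of
(dot on the red strand) - (dot on the blue strand). -/
def dumbbell : (⟨[.inl (), .inr ()]⟩ : AHBar k) ⟶ ⟨[.inl (), .inr ()]⟩ :=
  Presentation.homMk (P := ahBarPres k) (.gen .inv)

/-- The dumbbell on `red ⊗ blue`. -/
def dumbbell' : (⟨[.inr (), .inl ()]⟩ : AHBar k) ⟶ ⟨[.inr (), .inl ()]⟩ :=
  sigmaInv k ≫ dumbbell k ≫ sigma k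

/-- The direct sum of the blue and the red generating object in the additive envelope. -/
def blueRed : Mat_ (AHBar k) := ⟨Unit ⊕ Unit, fun c => ⟨[c]⟩⟩

/-- The endomorphism (blue dot) + (red dot) of the direct sum. -/
def dotMat : blueRed k ⟶ blueRed k
  | .inl _, .inl _ => (blue k).map (dot k)
  | .inr _, .inr _ => (red k).map (dot k)
  | .inl _, .inr _ => 0
  | .inr _, .inl _ => 0

/-- The components of the image of the crossing under the comultiplication, from the tensor product
of the colours `a`, `b` to the tensor product of the colours `c`, `d`. -/
def crossEntry : (a b c d : Unit ⊕ Unit) → ((⟨[a, b]⟩ : AHBar k) ⟶ ⟨[c, d]⟩)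
  | .inl _, .inl _, .inl _, .inl _ => (blue k).map (cross k)
  | .inr _, .inr _, .inr _, .inr _ => (red k).map (cross k)
  | .inl _, .inr _, .inr _, .inl _ => sigma k - dumbbell k ≫ sigma k
  | .inr _, .inl _, .inl _, .inr _ => sigmaInv k + dumbbell' k ≫ sigmaInv k
  | .inl _, .inr _, .inl _, .inr _ => -dumbbell k
  | .inr _, .inl _, .inr _, .inl _ => dumbbell' k
  | _, _, _, _ => 0

/-- The image of the crossing under the comultiplication. -/
def crossMat : blueRed k ⊗ blueRed k ⟶ blueRed k ⊗ blueRed k :=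
  fun p q => crossEntry k p.1 p.2 q.1 q.2

/-- The categorical comultiplication: a `k`-linear monoidal functor from the degenerate affine
Hecke category to the additive envelope of the localized symmetric product of two copies of it,
with the prescribed values on the generating object and the generating morphisms. -/
structure Comultiplication where
  /-- the functor -/
  functor : AH k ⥤ Mat_ (AHBar k)
  additive : functor.Additive
  linear : functor.Linear k
  /-- the monoidal structure of the functor -/
  monoidal : functor.Monoidal
  /-- the identification of the image of the generating object -/
  genIso : functor.obj (up k) ≅ blueRed k
  map_dot : functor.map (dot k) = genIso.hom ≫ dotMat k ≫ genIso.inv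
  map_cross : functor.map (cross k) = (Functor.Monoidal.μIso functor (up k) (up k)).inv ≫
    (genIso.hom ⊗ₘ genIso.hom) ≫ crossMat k ≫ (genIso.inv ⊗ₘ genIso.inv) ≫
      (Functor.Monoidal.μIso functor (up k) (up k)).hom

attribute [instance] Comultiplication.additive

variable {k} in
/-- The extension of the comultiplication to additive Karoubi envelopes. -/
def Comultiplication.kar (Δ : Comultiplication k) : Kar (AH k) ⥤ Kar (AHBar k) :=
  karMap (Mat_.lift Δ.functor)

instance (Δ : Comultiplication k) : Δ.kar.Additive :=
  karMap_additive _

/-- The extension of the canonical functor from the blue copy. -/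
def blueKar : Kar (AH k) ⥤ Kar (AHBar k) := karMap (blue k).mapMat_

/-- The extension of the canonical functor from the red copy. -/
def redKar : Kar (AH k) ⥤ Kar (AHBar k) := karMap (red k).mapMat_

instance : (blueKar k).Additive := karMap_additive _

instance : (redKar k).Additive := karMap_additive _

/-- The canonical map on Grothendieck groups, `[X] ⊗ [Y] ↦ [blue X ⊗ red Y]`. -/
def epsilon : K0 (Kar (AH k)) ⊗[ℤ] K0 (Kar (AH k)) →ₗ[ℤ] K0 (Kar (AHBar k)) :=
  TensorProduct.lift ((LinearMap.mul ℤ (K0 (Kar (AHBar k)))).compl₁₂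
    (K0.map (blueKar k)).toIntLinearMap (K0.map (redKar k)).toIntLinearMap)

end Delta

section SymmetricFunctions

/-- The ring of symmetric functions over the integers, as the polynomial ring in the complete
symmetric functions `h 1, h 2, ...`; the variable with index `n` is `h (n + 1)`. -/
abbrev SymZ := MvPolynomial ℕ ℤ

/-- The complete symmetric functions. -/
def symH : ℕ → SymZ
  | 0 => 1
  | n + 1 => MvPolynomial.X n

/-- The elementary symmetric functions, determined by `∑ j ≤ n, (-1) ^ j * h j * e (n - j) = 0` for
`n > 0` and by `e 0 = 1`. -/
def symE : ℕ → SymZ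
  | 0 => 1
  | n + 1 => ∑ j : Fin (n + 1), (-1) ^ (j : ℕ) * symH (j + 1) * symE (n - j)

/-- The comultiplication of the ring of symmetric functions. -/
def symDelta : SymZ →ₐ[ℤ] SymZ ⊗[ℤ] SymZ :=
  MvPolynomial.aeval fun n => ∑ r : Fin (n + 2), symH (n + 1 - r) ⊗ₜ[ℤ] symH r

end SymmetricFunctions

end StrictLin

end

noncomputable section

namespace StrictLin

/-! ### Symmetrizers attached to solutions of the Coxeter relations -/

section Symmetrizer

open Equiv

/-! Existence of Δ is a computation in a presented category: a linear monoidal functor out of the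
affine Hecke category is a choice of dot and crossing satisfying the defining relations (`presLift`,
`ahLift`), so `dotMat` and `crossMat` have to be tested (`affineHeckeRel_crossMat`). On strands of
different colours the crossing is a 2×2 block built from the interchange t and the dumbbell d, the
inverse of a difference of dots, and the quadratic and dot relations become algebra in d and the
dots. In the braid relation the new case is that of two strands of one colour and one of the other.
If x₁, x₂ are the dots of the equal strands and x₃ is the third dot, it follows from commutation
rules between the crossing s and d = (x₃ - x₂)⁻¹, e = (x₃ - x₁)⁻¹, which are the dot relations of s
multiplied by these inverses (`braidBlock_entries`, `BraidBlock`).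

For the images of symmetric powers, Δ of the n-th tensor power is the direct sum of all two-coloured
words of length n. Up to the interchange, the block of a crossing is [[-d, 1-d], [1+d, d]]. A row
vector (y, z) is fixed by it exactly when (y - z)(1 + d) = 0 and (y - z)(1 - d) = 0, and adding
these gives 2(y - z) = 0: the dumbbell disappears. Hence a morphism into the sum of words is fixed
by all crossings iff its components are compatible with interchanges and fixed by the one-coloured
crossings (`invariant_of_fixed`, `fixed_of_invariant`). Such a family is determined by its
components at the sorted words, blue letters before red ones, where it is fixed by a product of two
symmetric groups (`StrandSystem.Invariant.eq_sum`). So the image of the symmetrizer splits as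
claimed (`symKar_iso_biproduct`). For the antisymmetrizer the dumbbell disappears from column
vectors instead, that is, from morphisms out of the sum of words; the same word combinatorics is
therefore run in the opposite category with signs (`signedSystem`, `altKar_iso_biproduct`).

On Grothendieck rings, the classes of the objects H_n commute, because a block rotation conjugates
the relevant idempotents (`cls_objH_commute`); this defines γ on the polynomial ring. Its value at
e_n is found from the split exact Koszul complex with terms H_j ⊗ E_{n-j}: consecutive terms share a
summand of hook shape, and the alternating sum of classes telescopes (`hookUp_add_hookDown`,
`cls_objE_succ`). Both sides of the comultiplication identity are ring homomorphisms, as the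
functors respect tensor products and blue classes commute with red ones (`cls_blue_red_commute`). It
is thus enough to compare them at h_n, where the identity is the decomposition of Δ(H_n)
(`Comultiplication.map_kar_eq_epsilon`). -/

lemma permHom_ext {M : Type*} [Monoid M] {n : ℕ} {f f' : Perm (Fin n) →* M}
    (h : ∀ i, i + 1 < n → f (adjSwap n i) = f' (adjSwap n i)) : f = f' := by
  refine MonoidHom.eq_of_eqOn_denseM (adjSwap_closure n) ?_
  rintro _ ⟨i, hi, rfl⟩
  exact h i hi

lemma CoxeterRel.congr {M : Type*} [Monoid M] {n : ℕ} {s s' : ℕ → M} (h : CoxeterRel n s)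
    (hs : ∀ i, i + 1 < n → s i = s' i) : CoxeterRel n s' where
  quad i hi := by rw [← hs i hi, h.quad i hi]
  braid i hi := by rw [← hs i (by omega), ← hs (i + 1) hi, h.braid i hi]
  comm i j hij hj := by rw [← hs i (by omega), ← hs j hj, h.comm i j hij hj]

lemma CoxeterRel.init {M : Type*} [Monoid M] {m n : ℕ} {s : ℕ → M} (h : CoxeterRel n s)
    (hmn : m ≤ n) : CoxeterRel m s where
  quad i hi := h.quad i (by omega)
  braid i hi := h.braid i (by omega)
  comm i j hij hj := h.comm i j hij (by omega)

/-- `iota` numbers strands from right to left and `crossAt` from left to right; reversal passes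
between the two. It also exchanges removal of the first letter with removal of the last one. -/
lemma CoxeterRel.rev {M : Type*} [Monoid M] {n : ℕ} {s : ℕ → M} (h : CoxeterRel n s) :
    CoxeterRel n fun i => s (n - 2 - i) where
  quad i hi := h.quad _ (by omega)
  braid i hi := by
    have h := h.braid (n - 2 - (i + 1)) (by omega)
    have e : n - 2 - (i + 1) + 1 = n - 2 - i := by omega
    rw [e] at h
    exact h.symm
  comm i j hij hj := (h.comm (n - 2 - j) (n - 2 - i) (by omega) (by omega)).symm

/-- With the signs changed, the symmetrizer becomes the antisymmetrizer (`lift_altIdem`), so facts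
about exterior powers are instances of facts about symmetrizers. -/
lemma CoxeterRel.neg {A : Type*} [Ring A] {n : ℕ} {s : ℕ → A} (h : CoxeterRel n s) :
    CoxeterRel n fun i => -s i where
  quad i hi := by rw [neg_mul_neg, h.quad i hi]
  braid i hi := by simpa using h.braid i hi
  comm i j hij hj := by simpa using h.comm i j hij hj

lemma CoxeterRel.map {M N F : Type*} [Monoid M] [Monoid N] [FunLike F M N] [MonoidHomClass F M N]
    {n : ℕ} {s : ℕ → M} (h : CoxeterRel n s) (f : F) : CoxeterRel n fun i => f (s i) where
  quad i hi := by rw [← map_mul, h.quad i hi, map_one]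
  braid i hi := by simp only [← map_mul, h.braid i hi]
  comm i j hij hj := by simp only [← map_mul, h.comm i j hij hj]

variable (k : Type u) [Field k] {A B : Type*} [Ring A] [Algebra k A] [Ring B] [Algebra k B]
  {n : ℕ} {s s' : ℕ → A}

/-- The image of the symmetrizing idempotent of the symmetric group under the homomorphism which
sends the simple transpositions to the elements `s i`. -/
def symmetrizer (h : CoxeterRel n s) : A := (n.factorial : k)⁻¹ • ∑ g, permHom h g

variable {k}

lemma symmetrizer_congr (h : CoxeterRel n s) (h' : CoxeterRel n s')
    (hs : ∀ i, i + 1 < n → s i = s' i) : symmetrizer k h = symmetrizer k h' := by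
  have : permHom h = permHom h' :=
    permHom_ext fun i hi => by rw [permHom_adjSwap h i hi, permHom_adjSwap h' i hi, hs i hi]
  rw [symmetrizer, symmetrizer, this]

lemma map_symmetrizer (f : A →ₐ[k] B) (h : CoxeterRel n s) (h' : CoxeterRel n fun i => f (s i)) :
    f (symmetrizer k h) = symmetrizer k h' := by
  have : (f : A →* B).comp (permHom h) = permHom h' :=
    permHom_ext fun i hi => by
      rw [permHom_adjSwap h' i hi, MonoidHom.comp_apply, permHom_adjSwap h i hi]; rfl
  rw [symmetrizer, symmetrizer, map_smul, map_sum, ← this]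
  rfl

lemma mul_symmetrizer (h : CoxeterRel n s) (i : ℕ) (hi : i + 1 < n) :
    s i * symmetrizer k h = symmetrizer k h := by
  rw [symmetrizer, mul_smul_comm, Finset.mul_sum, ← Equiv.sum_comp (Equiv.mulLeft (adjSwap n i))
    (permHom h)]
  simp [permHom_adjSwap h i hi]

lemma symmetrizer_mul (h : CoxeterRel n s) (i : ℕ) (hi : i + 1 < n) :
    symmetrizer k h * s i = symmetrizer k h := by
  rw [symmetrizer, smul_mul_assoc, Finset.sum_mul, ← Equiv.sum_comp (Equiv.mulRight (adjSwap n i))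
    (permHom h)]
  simp [permHom_adjSwap h i hi]

lemma closure_adjSwap_induction {p : Perm (Fin n) → Prop} (one : p 1)
    (mul : ∀ g g', p g → p g' → p (g * g')) (gen : ∀ i, i + 1 < n → p (adjSwap n i)) (g) : p g := by
  have hg : g ∈ Submonoid.closure {g | ∃ i, i + 1 < n ∧ adjSwap n i = g} := by
    rw [adjSwap_closure]; trivial
  induction hg using Submonoid.closure_induction with
  | mem g hg => obtain ⟨i, hi, rfl⟩ := hg; exact gen i hi
  | one => exact one
  | mul a b _ _ ha hb => exact mul a b ha hb

lemma symmetrizer_commute (h : CoxeterRel n s) (x : A) (hx : ∀ i, i + 1 < n → Commute x (s i)) :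
    Commute x (symmetrizer k h) := by
  have hg : ∀ g, Commute x (permHom h g) := fun g => by
    induction g using closure_adjSwap_induction with
    | one => simp
    | mul g g' hg hg' => rw [map_mul]; exact hg.mul_right hg'
    | gen i hi => rw [permHom_adjSwap h i hi]; exact hx i hi
  exact (Commute.sum_right _ _ _ fun g _ => hg g).smul_right _

section Eval

variable {N : Type*} [AddCommGroup N] [Module k N] [CharZero k]

/-- The symmetrizer is an average, so a linear map that is constant on the group elements takes the
same value there; characteristic zero makes the average possible. All absorption rules below are
obtained from suitable φ. -/
lemma eval_symmetrizer (h : CoxeterRel n s) (φ : A →ₗ[k] N) (hφ : ∀ g, φ (permHom h g) = φ 1) :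
    φ (symmetrizer k h) = φ 1 := by
  have h0 : (n.factorial : k) ≠ 0 := by exact_mod_cast n.factorial_ne_zero
  rw [symmetrizer, map_smul, map_sum, Finset.sum_congr rfl fun g _ => hφ g, Finset.sum_const,
    Finset.card_univ, Fintype.card_perm, Fintype.card_fin, ← Nat.cast_smul_eq_nsmul k, smul_smul,
    inv_mul_cancel₀ h0, one_smul]

lemma eval_symmetrizer_of_mul_right (h : CoxeterRel n s) (φ : A →ₗ[k] N)
    (hφ : ∀ i, i + 1 < n → ∀ a, φ (a * s i) = φ a) : φ (symmetrizer k h) = φ 1 := by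
  refine eval_symmetrizer h φ fun g => ?_
  suffices ∀ a, φ (a * permHom h g) = φ a by simpa using this 1
  induction g using closure_adjSwap_induction with
  | one => simp
  | mul g g' hg hg' => intro a; rw [map_mul (permHom h), ← mul_assoc, hg', hg]
  | gen i hi => intro a; rw [permHom_adjSwap h i hi, hφ i hi]

lemma eval_symmetrizer_of_mul_left (h : CoxeterRel n s) (φ : A →ₗ[k] N)
    (hφ : ∀ i, i + 1 < n → ∀ a, φ (s i * a) = φ a) : φ (symmetrizer k h) = φ 1 := by
  refine eval_symmetrizer h φ fun g => ?_
  suffices ∀ a, φ (permHom h g * a) = φ a by simpa using this 1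
  induction g using closure_adjSwap_induction with
  | one => simp
  | mul g g' hg hg' => intro a; rw [map_mul (permHom h), mul_assoc, hg, hg']
  | gen i hi => intro a; rw [permHom_adjSwap h i hi, hφ i hi]

lemma symmetrizer_mul_of_fixed (h : CoxeterRel n s) (x : A) (hx : ∀ i, i + 1 < n → s i * x = x) :
    symmetrizer k h * x = x := by
  have := eval_symmetrizer_of_mul_right h (LinearMap.mulRight k x) fun i hi a => by
    simp [mul_assoc, hx i hi]
  simpa using this

lemma mul_symmetrizer_of_fixed (h : CoxeterRel n s) (x : A) (hx : ∀ i, i + 1 < n → x * s i = x) :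
    x * symmetrizer k h = x := by
  have := eval_symmetrizer_of_mul_left h (LinearMap.mulLeft k x) fun i hi a => by
    simp [← mul_assoc, hx i hi]
  simpa using this

lemma symmetrizer_idem (h : CoxeterRel n s) :
    symmetrizer k h * symmetrizer k h = symmetrizer k h :=
  symmetrizer_mul_of_fixed h _ fun i hi => mul_symmetrizer h i hi

/-- The product of the symmetrizer with `e` equals `e` by `hl` and equals the symmetrizer by `hr`.
This recognises symmetrizers without any permutations. -/
lemma symmetrizer_unique (h : CoxeterRel n s) (e : A) (hl : ∀ i, i + 1 < n → s i * e = e)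
    (hr : ∀ x : A, (∀ i, i + 1 < n → x * s i = x) → x * e = x) : e = symmetrizer k h :=
  (symmetrizer_mul_of_fixed h e hl).symm.trans (hr _ fun i hi => symmetrizer_mul h i hi)

lemma symmetrizer_rev (h : CoxeterRel n s) : symmetrizer k h.rev = symmetrizer k h := by
  have e : ∀ i, i + 1 < n → n - 2 - (n - 2 - i) = i := by omega
  refine symmetrizer_unique h _ (fun i hi => ?_) fun x hx => ?_
  · have := mul_symmetrizer (k := k) h.rev (n - 2 - i) (by omega)
    simpa only [e i hi] using this
  · exact mul_symmetrizer_of_fixed h.rev x fun i hi => hx _ (by omega)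

end Eval

section Recursion

lemma permHom_coxProd (h : CoxeterRel n s) : ∀ p, p ≤ n - 1 → permHom h (coxProd (adjSwap n) p) =
    coxProd s p
  | 0, _ => map_one _
  | p + 1, hp => by
    rw [coxProd, coxProd, map_mul, permHom_adjSwap h p (by omega), permHom_coxProd h p (by omega)]

/-- By `perm_bijective` the products `coxProd` represent the left cosets of the subgroup fixing the
first letter. -/
lemma symmetrizer_succ_eq_sum (h : CoxeterRel (n + 1) s) : symmetrizer k h =
    ((n + 1 : ℕ) : k)⁻¹ • ∑ p : Fin (n + 1), coxProd s p * symmetrizer k h.shift := by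
  have h₁ : (permHom h).comp (permShift n) = permHom h.shift := permHom_ext fun i hi => by
    rw [permHom_adjSwap h.shift i hi, MonoidHom.comp_apply, permShift_adjSwap n i hi,
      permHom_adjSwap h _ (by omega)]
  rw [symmetrizer, ← Function.Bijective.sum_comp (perm_bijective n), Fintype.sum_prod_type,
    Nat.factorial_succ, Nat.cast_mul, mul_inv, mul_smul, Finset.smul_sum]
  congr 1
  refine Finset.sum_congr rfl fun p _ => ?_
  rw [symmetrizer, mul_smul_comm, Finset.mul_sum]
  congr 1
  refine Finset.sum_congr rfl fun g _ => ?_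
  rw [map_mul, permHom_coxProd h p (by omega), ← h₁]
  rfl

variable [CharZero k]

/-- The symmetrizer in terms of the symmetrizer of all but the first letter. -/
lemma symmetrizer_succ (h : CoxeterRel (n + 1) s) : ((n + 1 : ℕ) : k) • symmetrizer k h =
    symmetrizer k h.shift +
      (n : k) • (symmetrizer k h.shift * s 0 * symmetrizer k h.shift) := by
  have h0 : ((n + 1 : ℕ) : k) ≠ 0 := by exact_mod_cast n.succ_ne_zero
  have h₁ : symmetrizer k h.shift * symmetrizer k h = symmetrizer k h :=
    symmetrizer_mul_of_fixed h.shift _ fun i hi => mul_symmetrizer h (i + 1) (by omega)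
  -- The smaller symmetrizer on the left absorbs every factor of the coset representative except the
  -- last one, `s 0`. So all `n` nontrivial cosets contribute the same term.
  have h₂ : ∀ p < n, symmetrizer k h.shift * coxProd s (p + 1) = symmetrizer k h.shift * s 0 := by
    intro p
    induction p with
    | zero => simp [coxProd]
    | succ p ih =>
      intro hp
      rw [coxProd, ← mul_assoc, symmetrizer_mul h.shift p (by omega), ih (by omega)]
  rw [← h₁, symmetrizer_succ_eq_sum, mul_smul_comm, smul_smul, mul_inv_cancel₀ h0, one_smul,
    Finset.mul_sum, Fin.sum_univ_succ]
  congr 1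
  · simp [coxProd, symmetrizer_idem]
  · rw [Finset.sum_congr rfl fun p _ => by
      rw [← mul_assoc, Fin.val_succ, h₂ p p.2]]
    rw [Finset.sum_const, Finset.card_univ, Fintype.card_fin, ← Nat.cast_smul_eq_nsmul k]

/-- The symmetrizer in terms of the symmetrizer of all but the last letter. -/
lemma symmetrizer_succ' (h : CoxeterRel (n + 1) s) : ((n + 1 : ℕ) : k) • symmetrizer k h =
    symmetrizer k (h.init n.le_succ) +
      (n : k) • (symmetrizer k (h.init n.le_succ) * s (n - 1) *
        symmetrizer k (h.init n.le_succ)) := by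
  -- In the reversed sequence `s (n - 1)` comes first, so this is the previous recursion read
  -- backwards. For `n = 0` the truncated index does no harm, because its term has coefficient zero.
  have e : symmetrizer k h.rev.shift = symmetrizer k (h.init n.le_succ) := by
    rw [← symmetrizer_rev (h.init n.le_succ)]
    refine symmetrizer_congr _ _ fun i hi => ?_
    congr 1; omega
  have := symmetrizer_succ (k := k) h.rev
  rw [e, symmetrizer_rev] at this
  exact this

end Recursion

end Symmetrizer

open Idempotents

/-! ### Symmetrizers in endomorphism rings -/

section LinearCategories

universe v₁ u₁ v₂ u₂

variable {k : Type u} [Field k] {C : Type u₁} [Category.{v₁} C] [Preadditive C] [Linear k C]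
  {D : Type u₂} [Category.{v₂} D] [Preadditive D] [Linear k D]

section

variable [CharZero k] {X Z : C} {n : ℕ} {s : ℕ → End X}

/-- In `End X` the product `a * b` is `b ≫ a`, so morphisms into `X` call for the criterion about
right multiplication. -/
lemma comp_symmetrizer (h : CoxeterRel n s) (f : Z ⟶ X)
    (hf : ∀ i, i + 1 < n → f ≫ s i = f) : f ≫ (symmetrizer k h : End X) = f := by
  have := eval_symmetrizer_of_mul_right h (N := Z ⟶ X) (Linear.leftComp k X f : End X →ₗ[k] _)
    fun i hi a => by
      change f ≫ s i ≫ a = f ≫ a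
      rw [← Category.assoc, hf i hi]
  exact this.trans (Category.comp_id f)

lemma symmetrizer_comp (h : CoxeterRel n s) (f : X ⟶ Z)
    (hf : ∀ i, i + 1 < n → s i ≫ f = f) : (symmetrizer k h : End X) ≫ f = f := by
  have := eval_symmetrizer_of_mul_left h (N := X ⟶ Z) (Linear.rightComp k X f : End X →ₗ[k] _)
    fun i hi a => by
      change (a ≫ s i) ≫ f = a ≫ f
      rw [Category.assoc, hf i hi]
  exact this.trans (Category.id_comp f)

end

variable (k) in
/-- The action of a linear functor on an endomorphism algebra. -/
def endMap (F : C ⥤ D) [F.Additive] [F.Linear k] (X : C) : End X →ₐ[k] End (F.obj X) :=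
  AlgHom.ofLinearMap (F.mapLinearMap k : (X ⟶ X) →ₗ[k] _) (F.map_id X)
    fun f g => F.map_comp g f

variable (k) in
/-- Conjugation by an isomorphism on endomorphism algebras. -/
def endConj {X Y : C} (φ : X ≅ Y) : End X →ₐ[k] End Y :=
  AlgHom.ofLinearMap
    { toFun := fun f => φ.inv ≫ f ≫ φ.hom
      map_add' := fun f g => by
        rw [← Preadditive.comp_add, ← Preadditive.add_comp]
      map_smul' := fun a f => by
        rw [RingHom.id_apply, ← Linear.comp_smul, ← Linear.smul_comp] }
    (by
      change φ.inv ≫ 𝟙 X ≫ φ.hom = 𝟙 Y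
      simp)
    fun f g => by
      change φ.inv ≫ (g ≫ f) ≫ φ.hom = (φ.inv ≫ g ≫ φ.hom) ≫ φ.inv ≫ f ≫ φ.hom
      simp

lemma endMap_apply (F : C ⥤ D) [F.Additive] [F.Linear k] {X : C} (f : End X) :
    endMap k F X f = F.map f := rfl

lemma endConj_apply {X Y : C} (φ : X ≅ Y) (f : End X) :
    endConj k φ f = φ.inv ≫ f ≫ φ.hom := rfl

end LinearCategories

/-! ### Isomorphisms and direct sums in idempotent completions -/

section KaroubiObjects

universe v₁ u₁ v₂ u₂

variable {C : Type u₁} [Category.{v₁} C]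

/-- Two idempotents which factor through each other have isomorphic images. -/
def karIso {P Q : Karoubi C} (a : P.X ⟶ Q.X) (b : Q.X ⟶ P.X) (hab : a ≫ b = P.p)
    (hba : b ≫ a = Q.p) : P ≅ Q where
  hom := ⟨P.p ≫ a ≫ Q.p, by simp⟩
  inv := ⟨Q.p ≫ b ≫ P.p, by simp⟩
  hom_inv_id := by
    ext
    have : a ≫ Q.p = P.p ≫ a := by rw [← hab, ← hba, Category.assoc]
    have h : P.p ≫ a ≫ b = P.p := by rw [hab, P.idem]
    simp only [Karoubi.comp_f, Category.assoc, Karoubi.idem_assoc, Karoubi.id_f]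
    rw [reassoc_of% this, reassoc_of% hab]
    simp
  inv_hom_id := by
    ext
    have : b ≫ P.p = Q.p ≫ b := by rw [← hab, ← hba, Category.assoc]
    simp only [Karoubi.comp_f, Category.assoc, Karoubi.idem_assoc, Karoubi.id_f]
    rw [reassoc_of% this, reassoc_of% hba]
    simp

/-- An isomorphism which intertwines two idempotents induces an isomorphism of their images. -/
def karIsoOfIso {P Q : Karoubi C} (φ : P.X ≅ Q.X) (h : P.p ≫ φ.hom = φ.hom ≫ Q.p) : P ≅ Q :=
  karIso (P.p ≫ φ.hom) φ.inv (by simp) (by rw [h]; simp)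

/-- Two complementary families of morphisms exhibit an object as a direct sum. -/
def isoBiproduct [Preadditive C] {J : Type} [Fintype J] {P : C} {Q : J → C} [HasBiproduct Q]
    (a : ∀ j, P ⟶ Q j) (b : ∀ j, Q j ⟶ P) (h : ∑ j, a j ≫ b j = 𝟙 P)
    (hb : ∀ j, b j ≫ a j = 𝟙 (Q j)) (hne : ∀ i j, i ≠ j → b i ≫ a j = 0) : P ≅ ⨁ Q where
  hom := biproduct.lift a
  inv := biproduct.desc b
  hom_inv_id := by rw [biproduct.lift_desc, h]
  inv_hom_id := by
    ext i j
    by_cases hij : i = j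
    · subst hij; simp [hb]
    · simp [hne j i (Ne.symm hij), biproduct.ι_π_ne _ (Ne.symm hij)]

/-- Two complementary morphisms exhibit an object as a direct sum. -/
def isoBiprod [Preadditive C] {P Q R : C} [HasBinaryBiproduct Q R] (a : P ⟶ Q) (a' : Q ⟶ P)
    (b : P ⟶ R) (b' : R ⟶ P) (h : a ≫ a' + b ≫ b' = 𝟙 P) (ha : a' ≫ a = 𝟙 Q) (hb : b' ≫ b = 𝟙 R)
    (hab : a' ≫ b = 0) (hba : b' ≫ a = 0) : P ≅ Q ⊞ R where
  hom := biprod.lift a b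
  inv := biprod.desc a' b'
  hom_inv_id := by rw [biprod.lift_desc, h]
  inv_hom_id := by ext <;> simp [ha, hb, hab, hba]

/-- The image of a sum of orthogonal idempotents. -/
def karBiprod [Preadditive C] [HasFiniteBiproducts C] {X : C} {p q r : X ⟶ X} (hp : p ≫ p = p)
    (hq : q ≫ q = q) (hr : r ≫ r = r) (h : q + r = p) (hqr : q ≫ r = 0) (hrq : r ≫ q = 0) :
    (⟨X, p, hp⟩ : Karoubi C) ≅ (⟨X, q, hq⟩ : Karoubi C) ⊞ (⟨X, r, hr⟩ : Karoubi C) :=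
  have h₁ : p ≫ q = q := by simp [← h, hq, hrq]
  have h₂ : q ≫ p = q := by simp [← h, hq, hqr]
  have h₃ : p ≫ r = r := by simp [← h, hr, hqr]
  have h₄ : r ≫ p = r := by simp [← h, hr, hrq]
  isoBiprod ⟨q, by simp [h₁, hq]⟩ ⟨q, by simp [h₂, hq]⟩ ⟨r, by simp [h₃, hr]⟩ ⟨r, by simp [h₄, hr]⟩
    (by ext; simp [hq, hr, h]) (by ext; simp [hq]) (by ext; simp [hr]) (by ext; simp [hqr])
    (by ext; simp [hrq])

end KaroubiObjects

/-! ### Images of idempotents in the additive Karoubi envelope -/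

section Embedding

universe v₁ u₁

variable {C : Type u₁} [Category.{v₁} C] [Preadditive C]

/-- The image of an idempotent endomorphism in the additive Karoubi envelope. -/
def karOf (X : C) (e : X ⟶ X) (he : e ≫ e = e) : Kar C where
  X := (Mat_.embedding C).obj X
  p := (Mat_.embedding C).map e
  idem := by rw [← Functor.map_comp, he]

/-- Two idempotents which factor through each other have isomorphic images. -/
def karOfIso {X Y : C} {e : X ⟶ X} {f : Y ⟶ Y} {he : e ≫ e = e} {hf : f ≫ f = f} (a : X ⟶ Y)
    (b : Y ⟶ X) (hab : a ≫ b = e) (hba : b ≫ a = f) : karOf X e he ≅ karOf Y f hf :=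
  karIso ((Mat_.embedding C).map a) ((Mat_.embedding C).map b)
    (((Mat_.embedding C).map_comp a b).symm.trans (congrArg _ hab))
    (((Mat_.embedding C).map_comp b a).symm.trans (congrArg _ hba))

/-- The image of a sum of orthogonal idempotents. -/
def karOfBiprod {X : C} {p q r : X ⟶ X} (hp : p ≫ p = p)
    (hq : q ≫ q = q) (hr : r ≫ r = r) (h : q + r = p) (hqr : q ≫ r = 0) (hrq : r ≫ q = 0) :
    karOf X p hp ≅ karOf X q hq ⊞ karOf X r hr :=
  karBiprod _ _ _ (by rw [← Functor.map_add, h])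
    (by rw [← Functor.map_comp, hqr, Functor.map_zero])
    (by rw [← Functor.map_comp, hrq, Functor.map_zero])

section Tensor

variable [MonoidalCategory C]

/-- The embedding into the additive envelope is compatible with tensor products. -/
def embTensor (X Y : C) : (Mat_.embedding C).obj X ⊗ (Mat_.embedding C).obj Y ≅
    (Mat_.embedding C).obj (X ⊗ Y) :=
  matIso (M := (Mat_.embedding C).obj X ⊗ (Mat_.embedding C).obj Y)
    (N := (Mat_.embedding C).obj (X ⊗ Y)) (Equiv.punitProd PUnit) fun _ => Iso.refl _

lemma embTensor_naturality {X Y X' Y' : C} (f : X ⟶ X') (g : Y ⟶ Y') :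
    ((Mat_.embedding C).map f ⊗ₘ (Mat_.embedding C).map g) ≫ (embTensor X' Y').hom =
      (embTensor X Y).hom ≫ (Mat_.embedding C).map (f ⊗ₘ g) := by
  ext ⟨⟨⟩, ⟨⟩⟩ (j : PUnit)
  refine (comp_matOfMap_apply (M := (Mat_.embedding C).obj X' ⊗ (Mat_.embedding C).obj Y')
      (N := (Mat_.embedding C).obj (X' ⊗ Y')) (Equiv.punitProd PUnit) (Equiv.injective _) _ _ _
      (PUnit.unit, j)).trans
      (Eq.trans ?_ (matOfMap_comp_apply _ _ _ _ _).symm)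
  exact (Category.comp_id _).trans (Category.id_comp _).symm

variable [MonoidalPreadditive C]

/-- The tensor product of two images of idempotents. -/
def karOfTensor {X Y : C} {e : X ⟶ X} {f : Y ⟶ Y} (he : e ≫ e = e) (hf : f ≫ f = f) :
    karOf X e he ⊗ karOf Y f hf ≅
      karOf (X ⊗ Y) (e ⊗ₘ f) (by rw [tensorHom_comp_tensorHom, he, hf]) :=
  karIsoOfIso (embTensor X Y) (embTensor_naturality e f)

end Tensor

variable {D : Type u₁} [Category.{v₁} D] [Preadditive D]

/-- The extension of a functor to Karoubi envelopes on the image of an idempotent. -/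
def karMapOfIso (G : Mat_ C ⥤ Mat_ D) (F : C ⥤ Mat_ D) (α : Mat_.embedding C ⋙ G ≅ F) {X : C}
    {e : X ⟶ X} (he : e ≫ e = e) : (karMap G).obj (karOf X e he) ≅
      ⟨F.obj X, F.map e, by rw [← F.map_comp, he]⟩ :=
  karIsoOfIso (α.app X) (α.hom.naturality e)

end Embedding

/-! ### Classes in the split Grothendieck group -/

section GrothendieckGroup

universe v₁ u₁

variable {C : Type u₁} [Category.{v₁} C] [Preadditive C] [HasFiniteBiproducts C]

lemma cls_eq {X Y : C} (e : X ≅ Y) : K0.cls X = K0.cls Y :=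
  congrArg Algebra.GrothendieckAddGroup.of (isoClass_eq e)

lemma cls_biprod (X Y : C) : K0.cls (X ⊞ Y) = K0.cls X + K0.cls Y :=
  map_add Algebra.GrothendieckAddGroup.of (isoClass X) (isoClass Y)

open ZeroObject in
lemma cls_isZero {X : C} (h : IsZero X) : K0.cls X = 0 :=
  (cls_eq (h.iso (isZero_zero C))).trans (map_zero Algebra.GrothendieckAddGroup.of)

lemma cls_biproduct {n : ℕ} (f : Fin n → C) : K0.cls (⨁ f) = ∑ i, K0.cls (f i) := by
  induction n with
  | zero =>
    refine cls_isZero ((IsZero.iff_id_eq_zero _).2 ?_)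
    ext i
    exact i.elim0
  | succ n ih =>
    rw [Fin.sum_univ_succ, ← ih, ← cls_biprod]
    refine cls_eq (isoBiprod (biproduct.π f 0) (biproduct.ι f 0)
      (biproduct.lift fun i : Fin n => biproduct.π f i.succ)
      (biproduct.desc fun i : Fin n => biproduct.ι f i.succ) ?_ ?_ ?_ ?_ ?_)
    · rw [biproduct.lift_desc, ← Fin.sum_univ_succ fun i => biproduct.π f i ≫ biproduct.ι f i,
        biproduct.total]
    · simp
    · ext i j
      by_cases h : i = j
      · subst h; simp
      · simp [biproduct.ι_π_ne _ (Ne.symm h),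
          biproduct.ι_π_ne f (fun h' => Ne.symm h (Fin.succ_injective _ h'))]
    · ext i
      simp [biproduct.ι_π_ne f (Fin.succ_ne_zero i).symm]
    · ext i
      simp [biproduct.ι_π_ne f (Fin.succ_ne_zero i)]

variable [MonoidalCategory C] [MonoidalPreadditive C]

lemma cls_tensor (X Y : C) : K0.cls (X ⊗ Y) = K0.cls X * K0.cls Y :=
  (grothendieckMul_of (isoClass X) (isoClass Y)).symm

lemma cls_unit : K0.cls (𝟙_ C) = 1 := rfl

end GrothendieckGroup

/-! ### Products of symmetrizers and antisymmetrizers on complementary blocks -/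

section SymmetrizerPairs

open Equiv

/-- The rotation that moves the first `m` letters past the other `n` conjugates one block subgroup
into the other. This is the source of the commutativity of the classes of symmetric powers. -/
lemma exists_blockRotation (m n : ℕ) : ∃ g : Perm (Fin (n + m)),
    (∀ i, i + 1 < m → g * adjSwap (n + m) i = adjSwap (n + m) (n + i) * g) ∧
      ∀ i, i + 1 < n → g * adjSwap (n + m) (m + i) = adjSwap (n + m) i * g := by
  let g : Perm (Fin (n + m)) :=
    { toFun := fun x => ⟨if (x : ℕ) < m then x + n else x - m, by split_ifs <;> omega⟩
      invFun := fun y => ⟨if (y : ℕ) < n then y + m else y - n, by split_ifs <;> omega⟩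
      left_inv := fun x => by ext; dsimp only; split_ifs <;> omega
      right_inv := fun y => by ext; dsimp only; split_ifs <;> omega }
  have hg : ∀ x, (g x : ℕ) = if (x : ℕ) < m then (x : ℕ) + n else x - m := fun _ => rfl
  refine ⟨g, fun i hi => ?_, fun i hi => ?_⟩
  · ext x
    rw [Perm.mul_apply, Perm.mul_apply, hg, adjSwap_val _ _ (by omega), adjSwap_val _ _ (by omega), hg]
    split_ifs <;> omega
  · ext x
    rw [Perm.mul_apply, Perm.mul_apply, hg, adjSwap_val _ _ (by omega), adjSwap_val _ _ (by omega), hg]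
    split_ifs <;> omega

lemma CoxeterRel.drop {M : Type*} [Monoid M] {n : ℕ} {s : ℕ → M} (h : CoxeterRel n s) (j : ℕ) :
    CoxeterRel (n - j) fun i => s (j + i) where
  quad i hi := h.quad (j + i) (by omega)
  braid i hi := h.braid (j + i) (by omega)
  comm i l hij hl := h.comm (j + i) (j + l) (by omega) (by omega)

variable {k : Type u} [Field k] {A : Type*} [Ring A] [Algebra k A]
  {n : ℕ} {s : ℕ → A}

lemma permHom_neg (h : CoxeterRel n s) (g : Perm (Fin n)) :
    permHom h.neg g = ((Perm.sign g : ℤ) : k) • permHom h g := by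
  induction g using closure_adjSwap_induction with
  | one => simp
  | mul g g' hg hg' =>
    rw [map_mul, map_mul, hg, hg', map_mul, smul_mul_smul_comm, Units.val_mul, Int.cast_mul]
  | gen i hi =>
    rw [permHom_adjSwap h i hi, permHom_adjSwap h.neg i hi, adjSwap, dif_pos hi,
      Perm.sign_swap (by simp [Fin.ext_iff])]
    simp

lemma lift_symIdem (h : CoxeterRel n s) :
    MonoidAlgebra.lift k A (Perm (Fin n)) (permHom h) (symIdem k n) = symmetrizer k h := by
  rw [symIdem, symmetrizer, map_smul, map_sum]
  simp

lemma lift_altIdem (h : CoxeterRel n s) :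
    MonoidAlgebra.lift k A (Perm (Fin n)) (permHom h) (altIdem k n) = symmetrizer k h.neg := by
  rw [altIdem, symmetrizer, map_smul, map_sum]
  congr 1
  refine Finset.sum_congr rfl fun g _ => ?_
  rw [permHom_neg (k := k) h]
  simp

lemma eq_zero_of_eq_neg [CharZero k] {N : Type*} [AddCommGroup N] [Module k N] {x : N}
    (h : x = -x) : x = 0 := by
  have h₂ : (2 : k) • x = 0 := by
    rw [two_smul]
    nth_rewrite 1 [h]
    exact neg_add_cancel x
  exact (smul_eq_zero.1 h₂).resolve_left two_ne_zero

section Koszul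

variable (h : CoxeterRel n s)

variable (k) in
/-- The product of the symmetrizer of the first `j` letters and the antisymmetrizer of the
others. -/
def hookIdem {j : ℕ} (hj : j ≤ n) : A := symmetrizer k (h.init hj) * symmetrizer k (h.drop j).neg

/-- The two blocks of letters are disjoint, so every generator of one commutes with every generator
of the other. -/
lemma commute_init_drop {i j : ℕ} (hi : i ≤ j) (hj : j ≤ n) :
    Commute (symmetrizer k (h.init (hi.trans hj))) (symmetrizer k (h.drop j).neg) :=
  symmetrizer_commute _ _ fun b hb => (symmetrizer_commute _ _ fun a ha =>
    (Commute.neg_left (h.comm a (j + b) (by omega) (by omega)).symm)).symm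

variable [CharZero k]

lemma init_mul_init {i j : ℕ} (hi : i ≤ j) (hj : j ≤ n) :
    symmetrizer k (h.init (hi.trans hj)) * symmetrizer k (h.init hj) = symmetrizer k (h.init hj) :=
  symmetrizer_mul_of_fixed _ _ fun a ha => mul_symmetrizer (h.init hj) a (by omega)

lemma init_mul_init' {i j : ℕ} (hi : i ≤ j) (hj : j ≤ n) :
    symmetrizer k (h.init hj) * symmetrizer k (h.init (hi.trans hj)) = symmetrizer k (h.init hj) :=
  mul_symmetrizer_of_fixed _ _ fun a ha => symmetrizer_mul (h.init hj) a (by omega)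

lemma drop_mul_drop {i j : ℕ} (hi : i ≤ j) :
    symmetrizer k (h.drop j).neg * symmetrizer k (h.drop i).neg = symmetrizer k (h.drop i).neg :=
  symmetrizer_mul_of_fixed _ _ fun a ha => by
    have := mul_symmetrizer (k := k) (h.drop i).neg (j - i + a) (by omega)
    rwa [show i + (j - i + a) = j + a by omega] at this

lemma drop_mul_drop' {i j : ℕ} (hi : i ≤ j) :
    symmetrizer k (h.drop i).neg * symmetrizer k (h.drop j).neg = symmetrizer k (h.drop i).neg :=
  mul_symmetrizer_of_fixed _ _ fun a ha => by
    have := symmetrizer_mul (k := k) (h.drop i).neg (j - i + a) (by omega)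
    rwa [show i + (j - i + a) = j + a by omega] at this

/-- The blocks overlap in two letters. Their crossing `s j` is absorbed by the symmetrizer and
turned into a sign by the antisymmetrizer, so the product equals its own negative. This is the
reason why consecutive Koszul differentials compose to zero. -/
lemma init_mul_drop_eq_zero {j : ℕ} (hj : j + 2 ≤ n) :
    symmetrizer k (h.init hj) * symmetrizer k (h.drop j).neg = 0 := by
  have h₁ := symmetrizer_mul (k := k) (h.init hj) j (by omega)
  have h₂ := mul_symmetrizer (k := k) (h.drop j).neg 0 (by omega)
  refine eq_zero_of_eq_neg (k := k) ?_
  have h₃ : s j * symmetrizer k (h.drop j).neg = -symmetrizer k (h.drop j).neg := by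
    rw [← neg_eq_iff_eq_neg, ← neg_mul]
    exact h₂
  conv_lhs => rw [← h₁, mul_assoc, h₃, mul_neg]

lemma drop_mul_init_eq_zero {j : ℕ} (hj : j + 2 ≤ n) :
    symmetrizer k (h.drop j).neg * symmetrizer k (h.init hj) = 0 := by
  have h₁ := mul_symmetrizer (k := k) (h.init hj) j (by omega)
  have h₂ := symmetrizer_mul (k := k) (h.drop j).neg 0 (by omega)
  refine eq_zero_of_eq_neg (k := k) ?_
  have h₃ : symmetrizer k (h.drop j).neg * s j = -symmetrizer k (h.drop j).neg := by
    rw [← neg_eq_iff_eq_neg, ← mul_neg]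
    exact h₂
  conv_lhs => rw [← h₁, ← mul_assoc, h₃, neg_mul]

lemma hookIdem_idem {j : ℕ} (hj : j ≤ n) : hookIdem k h hj * hookIdem k h hj = hookIdem k h hj := by
  rw [hookIdem, mul_assoc, ← mul_assoc (symmetrizer k (h.drop j).neg),
    ← (commute_init_drop h le_rfl hj).eq, mul_assoc, symmetrizer_idem, ← mul_assoc,
    symmetrizer_idem]

/-- Of the four factors, the two smaller ones are absorbed by the larger (anti)symmetrizer of the
same kind. -/
lemma hookIdem_succ_mul {j : ℕ} (hj : j + 1 ≤ n) :
    hookIdem k h hj * hookIdem k h (Nat.le_of_succ_le hj) =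
      symmetrizer k (h.init hj) * symmetrizer k (h.drop j).neg := by
  rw [hookIdem, hookIdem, mul_assoc, ← mul_assoc (symmetrizer k (h.drop (j + 1)).neg),
    ← (commute_init_drop h j.le_succ hj).eq, mul_assoc, drop_mul_drop h j.le_succ, ← mul_assoc,
    init_mul_init' h j.le_succ hj]

lemma hookIdem_mul_succ {j : ℕ} (hj : j + 1 ≤ n) :
    hookIdem k h (Nat.le_of_succ_le hj) * hookIdem k h hj =
      symmetrizer k (h.drop j).neg * symmetrizer k (h.init hj) := by
  rw [hookIdem, (commute_init_drop h le_rfl (Nat.le_of_succ_le hj)).eq, hookIdem, mul_assoc,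
    ← mul_assoc (symmetrizer k (h.init (Nat.le_of_succ_le hj))), init_mul_init h j.le_succ hj,
    (commute_init_drop h le_rfl hj).eq, ← mul_assoc, drop_mul_drop' h j.le_succ]

lemma hookIdem_mul_hookIdem_succ_mul {j : ℕ} (hj : j + 1 ≤ n) :
    hookIdem k h (Nat.le_of_succ_le hj) * hookIdem k h hj * hookIdem k h (Nat.le_of_succ_le hj) =
      symmetrizer k (h.drop j).neg * symmetrizer k (h.init hj) *
        symmetrizer k (h.drop j).neg := by
  rw [hookIdem_mul_succ, hookIdem, ← mul_assoc, mul_assoc _ (symmetrizer k (h.init hj)),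
    init_mul_init' h j.le_succ hj]

lemma hookIdem_succ_mul_hookIdem_mul {j : ℕ} (hj : j + 1 ≤ n) :
    hookIdem k h hj * hookIdem k h (Nat.le_of_succ_le hj) * hookIdem k h hj =
      symmetrizer k (h.init hj) * symmetrizer k (h.drop j).neg * symmetrizer k (h.init hj) := by
  rw [hookIdem_succ_mul, hookIdem, (commute_init_drop h le_rfl hj).eq, ← mul_assoc,
    mul_assoc (symmetrizer k (h.init hj)), drop_mul_drop' h j.le_succ]

/-- After absorption only the symmetrizer of `j + 1` letters stands between two antisymmetrizers,
and `symmetrizer_succ'` expands it. For `j = 0` the meaningless crossing `s (0 - 1)` has coefficient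
zero. -/
lemma smul_hookIdem_mul_succ_mul {j : ℕ} (hj : j + 1 ≤ n) :
    ((j + 1 : ℕ) : k) • (hookIdem k h (Nat.le_of_succ_le hj) * hookIdem k h hj *
        hookIdem k h (Nat.le_of_succ_le hj)) = hookIdem k h (Nat.le_of_succ_le hj) +
      (j : k) • (hookIdem k h (Nat.le_of_succ_le hj) * s (j - 1) *
        hookIdem k h (Nat.le_of_succ_le hj)) := by
  have hc := (commute_init_drop (k := k) h le_rfl (Nat.le_of_succ_le hj)).eq
  have hi := symmetrizer_idem (k := k) (h.drop j).neg
  rw [hookIdem_mul_hookIdem_succ_mul, ← smul_mul_assoc, ← mul_smul_comm,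
    symmetrizer_succ' (h.init hj), mul_add, add_mul, ← hc, mul_assoc _ _ (symmetrizer k _), hi,
    mul_smul_comm, smul_mul_assoc]
  congr 2
  simp only [hookIdem, mul_assoc]
  rw [← mul_assoc, ← hc, mul_assoc]

/-- Here the antisymmetrizer of the letters from `j` on is in the middle, and `symmetrizer_succ`
expands it; the minus sign is that of `-s j`. The crossing `s j` also occurs in the preceding lemma
with `j + 1` for `j`, which allows the terms to cancel later. -/
lemma smul_hookIdem_succ_mul_mul {j : ℕ} (hj : j + 1 ≤ n) :
    ((n - j : ℕ) : k) • (hookIdem k h hj * hookIdem k h (Nat.le_of_succ_le hj) *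
        hookIdem k h hj) = hookIdem k h hj -
      ((n - (j + 1) : ℕ) : k) • (hookIdem k h hj * s j * hookIdem k h hj) := by
  have hc := (commute_init_drop (k := k) h le_rfl hj).eq
  have hi := symmetrizer_idem (k := k) (h.init hj)
  have key : ((n - j : ℕ) : k) • symmetrizer k (h.drop j).neg =
      symmetrizer k (h.drop (j + 1)).neg - ((n - (j + 1) : ℕ) : k) •
        (symmetrizer k (h.drop (j + 1)).neg * s j * symmetrizer k (h.drop (j + 1)).neg) := by
    -- The recursion is stated for a successor, so the truncated length `n - j` has to be exhibited
    -- as `m + 1`.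
    obtain ⟨m, rfl⟩ : ∃ m, n = m + (j + 1) := ⟨n - (j + 1), by omega⟩
    have e₁ : m + (j + 1) - (j + 1) = m := by omega
    have e₂ : m + (j + 1) - j = m + 1 := by omega
    have hd : CoxeterRel (m + 1) fun i => s (j + i) := by simpa only [e₂] using h.drop j
    have hd' : CoxeterRel m fun i => s (j + 1 + i) := by simpa only [e₁] using h.drop (j + 1)
    have h₁ : symmetrizer k (h.drop j).neg = symmetrizer k hd.neg := by congr 1
    have h₂ : symmetrizer k (h.drop (j + 1)).neg = symmetrizer k hd'.neg := by congr 1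
    have h₃ : symmetrizer k hd.neg.shift = symmetrizer k hd'.neg :=
      symmetrizer_congr _ _ fun i hi => by rw [show j + (i + 1) = j + 1 + i by omega]
    have := symmetrizer_succ (k := k) hd.neg
    rw [h₁, h₂, e₁, e₂, this, h₃]
    simp [sub_eq_add_neg]
  rw [hookIdem_succ_mul_hookIdem_mul, ← smul_mul_assoc, ← mul_smul_comm, key, mul_sub, sub_mul,
    hc, mul_assoc _ _ (symmetrizer k (h.init hj)), hi, ← hc, mul_smul_comm, smul_mul_assoc]
  congr 2
  simp only [hookIdem, mul_assoc]
  rw [hc]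

end Koszul

end SymmetrizerPairs

/-! ### Adding strands in a strict monoidal category of words -/

section StrictCalculus

variable {k : Type u} [Field k] {P : Presentation k}

/-- A strand added on the left. -/
def consHom (c : P.C) {x y : List P.C} (f : (⟨x⟩ : P.Cat) ⟶ ⟨y⟩) : (⟨c :: x⟩ : P.Cat) ⟶ ⟨c :: y⟩ :=
  (⟨[c]⟩ : P.Cat) ◁ f

/-- A morphism of two strands with further strands on the right. -/
def headHom {a b c d : P.C} (g : (⟨[a, b]⟩ : P.Cat) ⟶ ⟨[c, d]⟩) (v : List P.C) :
    (⟨a :: b :: v⟩ : P.Cat) ⟶ ⟨c :: d :: v⟩ :=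
  g ▷ (⟨v⟩ : P.Cat)

variable {a b c d a' b' : P.C} {x y z v w : List P.C}

@[simp]
lemma consHom_id (c : P.C) (x : List P.C) : consHom c (𝟙 (⟨x⟩ : P.Cat)) = 𝟙 _ :=
  whiskerLeft_id _ _

@[simp]
lemma consHom_comp (c : P.C) (f : (⟨x⟩ : P.Cat) ⟶ ⟨y⟩) (g : (⟨y⟩ : P.Cat) ⟶ ⟨z⟩) :
    consHom c (f ≫ g) = consHom c f ≫ consHom c g :=
  whiskerLeft_comp _ _ _

@[simp]
lemma consHom_zero (c : P.C) : consHom c (0 : (⟨x⟩ : P.Cat) ⟶ ⟨y⟩) = 0 :=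
  MonoidalPreadditive.whiskerLeft_zero

@[simp]
lemma consHom_add (c : P.C) (f g : (⟨x⟩ : P.Cat) ⟶ ⟨y⟩) :
    consHom c (f + g) = consHom c f + consHom c g :=
  MonoidalPreadditive.whiskerLeft_add _ _

@[simp]
lemma consHom_neg (c : P.C) (f : (⟨x⟩ : P.Cat) ⟶ ⟨y⟩) : consHom c (-f) = -consHom c f :=
  (tensorLeft (⟨[c]⟩ : P.Cat)).map_neg

@[simp]
lemma consHom_sub (c : P.C) (f g : (⟨x⟩ : P.Cat) ⟶ ⟨y⟩) :
    consHom c (f - g) = consHom c f - consHom c g :=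
  (tensorLeft (⟨[c]⟩ : P.Cat)).map_sub

@[simp]
lemma headHom_id (a b : P.C) (v : List P.C) : headHom (𝟙 (⟨[a, b]⟩ : P.Cat)) v = 𝟙 _ :=
  id_whiskerRight _ _

lemma headHom_comp (f : (⟨[a, b]⟩ : P.Cat) ⟶ ⟨[c, d]⟩) (g : (⟨[c, d]⟩ : P.Cat) ⟶ ⟨[a', b']⟩)
    (v : List P.C) : headHom (f ≫ g) v = headHom f v ≫ headHom g v :=
  comp_whiskerRight _ _ _

@[simp]
lemma headHom_add (f g : (⟨[a, b]⟩ : P.Cat) ⟶ ⟨[c, d]⟩) (v : List P.C) :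
    headHom (f + g) v = headHom f v + headHom g v :=
  MonoidalPreadditive.add_whiskerRight _ _

@[simp]
lemma headHom_neg (f : (⟨[a, b]⟩ : P.Cat) ⟶ ⟨[c, d]⟩) (v : List P.C) :
    headHom (-f) v = -headHom f v :=
  (tensorRight (⟨v⟩ : P.Cat)).map_neg

@[simp]
lemma headHom_sub (f g : (⟨[a, b]⟩ : P.Cat) ⟶ ⟨[c, d]⟩) (v : List P.C) :
    headHom (f - g) v = headHom f v - headHom g v :=
  (tensorRight (⟨v⟩ : P.Cat)).map_sub

lemma headHom_exchange (g : (⟨[a, b]⟩ : P.Cat) ⟶ ⟨[c, d]⟩) (f : (⟨v⟩ : P.Cat) ⟶ ⟨w⟩) :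
    headHom g v ≫ consHom c (consHom d f) = consHom a (consHom b f) ≫ headHom g w := by
  have e : ∀ a b : P.C, consHom a (consHom b f) = (⟨[a, b]⟩ : P.Cat) ◁ f := fun a b =>
    ((tensor_whiskerLeft (⟨[a]⟩ : P.Cat) (⟨[b]⟩ : P.Cat) f).trans
      ((Category.id_comp _).trans (Category.comp_id _))).symm
  rw [e, e]
  exact (whisker_exchange g f).symm

/-- When the first word is an explicit letter, both bracketings of a concatenation are equal by
definition. The associators are then identities, which `id_comp` and `comp_id` remove; this device
recurs throughout. -/
lemma consHom_whiskerRight (c : P.C) (f : (⟨x⟩ : P.Cat) ⟶ ⟨y⟩) (z : List P.C) :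
    consHom c f ▷ (⟨z⟩ : P.Cat) = consHom c (f ▷ (⟨z⟩ : P.Cat)) :=
  (whisker_assoc (⟨[c]⟩ : P.Cat) f (⟨z⟩ : P.Cat)).trans
    ((Category.id_comp _).trans (Category.comp_id _))

lemma headHom_whiskerRight (g : (⟨[a, b]⟩ : P.Cat) ⟶ ⟨[c, d]⟩) (v z : List P.C) :
    headHom g v ▷ (⟨z⟩ : P.Cat) = headHom g (v ++ z) :=
  ((whiskerRight_tensor g (⟨v⟩ : P.Cat) (⟨z⟩ : P.Cat)).trans
    ((Category.id_comp _).trans (Category.comp_id _))).symm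

lemma cons_whiskerLeft (c : P.C) (w : List P.C) (f : (⟨x⟩ : P.Cat) ⟶ ⟨y⟩) :
    (⟨c :: w⟩ : P.Cat) ◁ f = consHom c ((⟨w⟩ : P.Cat) ◁ f) :=
  (tensor_whiskerLeft (⟨[c]⟩ : P.Cat) (⟨w⟩ : P.Cat) f).trans
    ((Category.id_comp _).trans (Category.comp_id _))

lemma nil_whiskerLeft (f : (⟨x⟩ : P.Cat) ⟶ ⟨y⟩) : (⟨[]⟩ : P.Cat) ◁ f = f :=
  (id_whiskerLeft f).trans ((Category.id_comp _).trans (Category.comp_id _))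

/-- A strand added on the left of an isomorphism. -/
def consIso (c : P.C) (f : (⟨x⟩ : P.Cat) ≅ ⟨y⟩) : (⟨c :: x⟩ : P.Cat) ≅ ⟨c :: y⟩ where
  hom := consHom c f.hom
  inv := consHom c f.inv
  hom_inv_id := by rw [← consHom_comp, f.hom_inv_id, consHom_id]
  inv_hom_id := by rw [← consHom_comp, f.inv_hom_id, consHom_id]

end StrictCalculus

/-! ### Symmetrizers on tensor powers of the generating object -/

section SymmetricPowers

open Idempotents

variable {k : Type u} [Field k]

/-- A linear functor followed by an isomorphism transports symmetrizers. -/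
lemma map_symmetrizer_comp_iso {C D : Type*} [Category* C] [Category* D] [Preadditive C]
    [Preadditive D] [Linear k C] [Linear k D] (F : C ⥤ D) [F.Additive] [F.Linear k] {X : C} {Y : D}
    (φ : F.obj X ≅ Y) {n : ℕ} {s : ℕ → End X} {t : ℕ → End Y} (hs : CoxeterRel n s)
    (ht : CoxeterRel n t) (h : ∀ i, i + 1 < n → F.map (s i) ≫ φ.hom = φ.hom ≫ t i) :
    F.map (symmetrizer k hs : End X) ≫ φ.hom = φ.hom ≫ (symmetrizer k ht : End Y) := by
  have hc := (hs.map (endMap k F X)).map (endConj k φ)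
  have e : symmetrizer k hc = symmetrizer k ht := symmetrizer_congr _ _ fun i hi => by
    rw [endConj_apply, endMap_apply, h i hi, Iso.inv_hom_id_assoc]
  rw [← e, ← map_symmetrizer (endConj k φ) (hs.map (endMap k F X)) hc,
    ← map_symmetrizer (endMap k F X) hs (hs.map (endMap k F X)), endConj_apply, endMap_apply,
    Iso.hom_inv_id_assoc]

variable (k) in
/-- The tensor product of two tensor powers is a tensor power. -/
def upPowTensor (n : ℕ) : ∀ m : ℕ, upPow k m ⊗ upPow k n ≅ upPow k (n + m)
  -- The length of the product is written `n + m` to make the recursion on `m` definitional.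
  | 0 => Iso.refl _
  | m + 1 => consIso (P := ahPres k) () (upPowTensor n m)

lemma crossAt_whiskerRight_upPowTensor (n : ℕ) : ∀ m i : ℕ, i + 1 < m →
    (crossAt k m i ▷ upPow k n) ≫ (upPowTensor k n m).hom =
      (upPowTensor k n m).hom ≫ crossAt k (n + m) i
  | 0, _, h => by omega
  | 1, _, h => by omega
  | m + 2, 0, _ => by
    refine (congrArg (· ≫ _) (headHom_whiskerRight (P := ahPres k) (cross k) _ _)).trans ?_
    exact headHom_exchange (P := ahPres k) (cross k) (upPowTensor k n m).hom
  | m + 2, i + 1, h => by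
    have ih := crossAt_whiskerRight_upPowTensor n (m + 1) i (by omega)
    refine (congrArg (· ≫ _) (consHom_whiskerRight (P := ahPres k) () (crossAt k (m + 1) i) _)).trans
      ?_
    exact (consHom_comp _ _ _).symm.trans ((congrArg (consHom _) ih).trans (consHom_comp _ _ _))

lemma upPow_whiskerLeft_crossAt_upPowTensor (n i : ℕ) (hi : i + 1 < n) : ∀ m : ℕ,
    (upPow k m ◁ crossAt k n i) ≫ (upPowTensor k n m).hom =
      (upPowTensor k n m).hom ≫ crossAt k (n + m) (m + i)
  | 0 => by
    rw [Nat.zero_add]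
    exact (Category.comp_id _).trans ((nil_whiskerLeft _).trans (Category.id_comp _).symm)
  | m + 1 => by
    have ih := upPow_whiskerLeft_crossAt_upPowTensor n i hi m
    have e : crossAt k (n + (m + 1)) (m + 1 + i) =
        consHom (P := ahPres k) () (crossAt k (n + m) (m + i)) := by
      rw [show m + 1 + i = m + i + 1 by omega]
      exact crossAt_succ k (n + m) (m + i) (by omega)
    refine (congrArg (· ≫ _) (cons_whiskerLeft (P := ahPres k) () _ (crossAt k n i))).trans ?_
    refine Eq.trans ?_ (congrArg (_ ≫ ·) e.symm)
    exact (consHom_comp _ _ _).symm.trans ((congrArg (consHom _) ih).trans (consHom_comp _ _ _))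

/-- A form of `CoxeterRel.drop` that avoids subtraction of lengths. -/
lemma CoxeterRel.drop' {M : Type*} [Monoid M] {m n : ℕ} {s : ℕ → M} (h : CoxeterRel (n + m) s) :
    CoxeterRel n fun i => s (m + i) where
  quad i hi := h.quad (m + i) (by omega)
  braid i hi := h.braid (m + i) (by omega)
  comm i l hij hl := h.comm (m + i) (m + l) (by omega) (by omega)

variable [CharZero k]

/-- The numbering of the strands from right to left has no effect, since the symmetrizer is
invariant under reversal. -/
lemma iota_symIdem (n : ℕ) : iota k n (symIdem k n) = symmetrizer k (crossAt_rel k n) := by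
  rw [iota, lift_symIdem]
  exact symmetrizer_rev (crossAt_rel k n)

lemma iota_altIdem (n : ℕ) : iota k n (altIdem k n) = symmetrizer k (crossAt_rel k n).neg := by
  rw [iota, lift_altIdem]
  exact symmetrizer_rev (crossAt_rel k n).neg

lemma symmetrizer_comp_self {X : AH k} {n : ℕ} {s : ℕ → End X} (h : CoxeterRel n s) :
    (symmetrizer k h : End X) ≫ (symmetrizer k h : End X) = (symmetrizer k h : End X) :=
  symmetrizer_idem h

lemma objH_eq (n : ℕ) : objH k n = karOf (upPow k n) (symmetrizer k (crossAt_rel k n) : End _)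
    (symmetrizer_comp_self _) := by
  simp only [objH, iota_symIdem]
  rfl

lemma objE_eq (n : ℕ) : objE k n = karOf (upPow k n) (symmetrizer k (crossAt_rel k n).neg : End _)
    (symmetrizer_comp_self _) := by
  simp only [objE, iota_altIdem]
  rfl

/-- The generators on both factors are left arbitrary, so that each of them may carry signs; this
covers H ⊗ H and H ⊗ E together. -/
lemma symmetrizer_tensor_upPowTensor (m n : ℕ) {s : ℕ → End (upPow k m)} {t : ℕ → End (upPow k n)}
    {s' t' : ℕ → End (upPow k (n + m))} (hs : CoxeterRel m s) (ht : CoxeterRel n t)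
    (hs' : CoxeterRel m s') (ht' : CoxeterRel n t')
    (h : ∀ i, i + 1 < m → (s i ▷ upPow k n) ≫ (upPowTensor k n m).hom =
      (upPowTensor k n m).hom ≫ s' i)
    (h' : ∀ i, i + 1 < n → (upPow k m ◁ t i) ≫ (upPowTensor k n m).hom =
      (upPowTensor k n m).hom ≫ t' i) :
    ((symmetrizer k hs : End _) ⊗ₘ (symmetrizer k ht : End _)) ≫ (upPowTensor k n m).hom =
      (upPowTensor k n m).hom ≫ (symmetrizer k ht' * symmetrizer k hs' : End _) := by
  have h₁ := map_symmetrizer_comp_iso (k := k) (tensorRight (upPow k n)) (upPowTensor k n m) hs hs' h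
  have h₂ := map_symmetrizer_comp_iso (k := k) (tensorLeft (upPow k m)) (upPowTensor k n m) ht ht' h'
  rw [MonoidalCategory.tensorHom_def, Category.assoc, End.mul_def]
  refine (congrArg _ h₂).trans ?_
  rw [← Category.assoc, ← Category.assoc]
  exact congrArg (· ≫ _) h₁

end SymmetricPowers

/-! ### Splitting of the Koszul complex -/

section Koszul

variable {k : Type u} [Field k] [CharZero k] {A : Type*} [Ring A] [Algebra k A]
  {n : ℕ} {s : ℕ → A} (h : CoxeterRel n s)

/-- The scalar which turns the composite of two consecutive Koszul differentials in opposite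
directions into an idempotent. -/
def koszulScalar (k : Type u) [Field k] (n j : ℕ) : k := ((n - j : ℕ) : k) * ((j + 1 : ℕ) : k) / (n : k)

variable (k) in
/-- The direct summand of the `j`th term of the Koszul complex which maps isomorphically to a
summand of the next term. -/
def hookUp {j : ℕ} (hj : j + 1 ≤ n) : A :=
  koszulScalar k n j • (hookIdem k h (Nat.le_of_succ_le hj) * hookIdem k h hj *
    hookIdem k h (Nat.le_of_succ_le hj))

variable (k) in
/-- The direct summand of the `j + 1`st term of the Koszul complex which is the image of the
preceding term. -/
def hookDown {j : ℕ} (hj : j + 1 ≤ n) : A :=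
  koszulScalar k n j • (hookIdem k h hj * hookIdem k h (Nat.le_of_succ_le hj) * hookIdem k h hj)

/-- At the start of the complex there is no preceding term, and the scalar is `n * 1 / n = 1`;
likewise `1 * n / n = 1` at the end. -/
lemma hookUp_zero (hn : 0 + 1 ≤ n) : hookUp k h hn = hookIdem k h (Nat.zero_le n) := by
  have hn' : (n : k) ≠ 0 := by exact_mod_cast (by omega : n ≠ 0)
  have := smul_hookIdem_mul_succ_mul (k := k) h hn
  simp only [Nat.cast_zero, zero_smul, add_zero, Nat.zero_add, Nat.cast_one, one_smul] at this
  rw [hookUp, koszulScalar, this]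
  simp [hn']

lemma hookDown_last {j : ℕ} (hj : j + 1 = n) : hookDown k h hj.le = hookIdem k h hj.le := by
  subst hj
  have hn' : ((j + 1 : ℕ) : k) ≠ 0 := by exact_mod_cast (by omega : j + 1 ≠ 0)
  have := smul_hookIdem_succ_mul_mul (k := k) h le_rfl
  simp only [Nat.sub_self, Nat.cast_zero, zero_smul, sub_zero, Nat.add_sub_cancel_left,
    Nat.cast_one, one_smul] at this
  rw [hookDown, koszulScalar, this, Nat.add_sub_cancel_left, Nat.cast_one, one_mul, div_self hn',
    one_smul]

/-- This is the contracting homotopy. In the two expansions the hook idempotent has the coefficients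
`(n - j - 1) / n` and `(j + 1) / n`, whose sum is 1, and the terms containing the crossing `s j`
have opposite coefficients. The value of `koszulScalar` is chosen to achieve both. -/
lemma hookUp_add_hookDown {j : ℕ} (hj : j + 2 ≤ n) :
    hookUp k h hj + hookDown k h (Nat.le_of_succ_le hj) = hookIdem k h (Nat.le_of_succ_le hj) := by
  have hn' : (n : k) ≠ 0 := by exact_mod_cast (by omega : n ≠ 0)
  have h₁ := smul_hookIdem_mul_succ_mul (k := k) h hj
  have h₂ := smul_hookIdem_succ_mul_mul (k := k) h (Nat.le_of_succ_le hj)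
  rw [hookUp, hookDown, koszulScalar, koszulScalar, mul_div_right_comm, mul_smul, h₁,
    mul_comm ((n - j : ℕ) : k), mul_div_right_comm, mul_smul, h₂]
  simp only [smul_add, smul_sub, smul_smul]
  have e₁ : ((n - (j + 1) : ℕ) : k) / n + ((j + 1 : ℕ) : k) / n = 1 := by
    rw [← add_div, ← Nat.cast_add, Nat.sub_add_cancel (by omega), div_self hn']
  have e₂ : ((n - (j + 1) : ℕ) : k) / n * ((j + 1 : ℕ) : k) -
      ((j + 1 : ℕ) : k) / n * ((n - (j + 1) : ℕ) : k) = 0 := by ring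
  rw [Nat.add_sub_cancel]
  linear_combination (norm := module) e₁ • hookIdem k h (Nat.le_of_succ_le hj) +
    e₂ • (hookIdem k h (Nat.le_of_succ_le hj) * s j * hookIdem k h (Nat.le_of_succ_le hj))

lemma hookIdem_mul_mul_eq_zero {j : ℕ} (hj : j + 2 ≤ n) :
    hookIdem k h hj * hookIdem k h (Nat.le_of_succ_le hj) *
      hookIdem k h (Nat.le_of_succ_le (Nat.le_of_succ_le hj)) = 0 := by
  rw [hookIdem_succ_mul, hookIdem,
    (commute_init_drop h le_rfl (Nat.le_of_succ_le (Nat.le_of_succ_le hj))).eq, mul_assoc,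
    ← mul_assoc (symmetrizer k (h.drop (j + 1)).neg),
    drop_mul_drop h j.le_succ, ← mul_assoc, init_mul_drop_eq_zero h hj, zero_mul]

lemma hookIdem_mul_mul_eq_zero' {j : ℕ} (hj : j + 2 ≤ n) :
    hookIdem k h (Nat.le_of_succ_le (Nat.le_of_succ_le hj)) * hookIdem k h (Nat.le_of_succ_le hj) *
      hookIdem k h hj = 0 := by
  rw [mul_assoc, hookIdem_mul_succ, hookIdem, mul_assoc,
    ← mul_assoc (symmetrizer k (h.drop j).neg), drop_mul_drop' h j.le_succ,
    drop_mul_init_eq_zero h hj, mul_zero]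

/-- Orthogonality is the vanishing of the composite of two consecutive differentials, which appears
in the middle of the product. -/
lemma hookUp_mul_hookDown {j : ℕ} (hj : j + 2 ≤ n) :
    hookUp k h hj * hookDown k h (Nat.le_of_succ_le hj) = 0 := by
  have h₀ := hookIdem_idem (k := k) h (Nat.le_of_succ_le hj)
  have h₁ := hookIdem_mul_mul_eq_zero (k := k) h hj
  rw [hookUp, hookDown, smul_mul_smul_comm]
  simp only [mul_assoc] at h₁ ⊢
  rw [← mul_assoc (hookIdem k h (Nat.le_of_succ_le hj)) (hookIdem k h (Nat.le_of_succ_le hj)), h₀]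
  rw [← mul_assoc (hookIdem k h (Nat.le_of_succ_le hj)) (hookIdem k h _) (hookIdem k h _),
    ← mul_assoc (hookIdem k h hj), h₁, zero_mul, mul_zero, smul_zero]

lemma hookDown_mul_hookUp {j : ℕ} (hj : j + 2 ≤ n) :
    hookDown k h (Nat.le_of_succ_le hj) * hookUp k h hj = 0 := by
  have h₀ := hookIdem_idem (k := k) h (Nat.le_of_succ_le hj)
  have h₁ := hookIdem_mul_mul_eq_zero' (k := k) h hj
  rw [hookUp, hookDown, smul_mul_smul_comm]
  simp only [mul_assoc] at h₁ ⊢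
  rw [← mul_assoc (hookIdem k h (Nat.le_of_succ_le hj)) (hookIdem k h (Nat.le_of_succ_le hj)), h₀]
  rw [← mul_assoc (hookIdem k h (Nat.le_of_succ_le hj)) (hookIdem k h _) (hookIdem k h _),
    ← mul_assoc (hookIdem k h (Nat.le_of_succ_le (Nat.le_of_succ_le hj))), h₁, zero_mul, mul_zero,
    smul_zero]

/-- Two orthogonal elements whose sum acts on them as an identity are idempotent, so no further
computation is needed. At `j = 0` the other summand is absent. -/
lemma hookUp_idem {j : ℕ} (hj : j + 1 ≤ n) : hookUp k h hj * hookUp k h hj = hookUp k h hj := by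
  rcases j with _ | j
  · rw [hookUp_zero, hookIdem_idem]
  · have h₁ := hookUp_mul_hookDown (k := k) h hj
    have h₂ : hookUp k h hj * hookIdem k h (Nat.le_of_succ_le hj) = hookUp k h hj := by
      rw [hookUp, smul_mul_assoc, mul_assoc, hookIdem_idem]
    rwa [← hookUp_add_hookDown, mul_add, h₁, add_zero] at h₂

lemma hookDown_idem {j : ℕ} (hj : j + 1 ≤ n) :
    hookDown k h hj * hookDown k h hj = hookDown k h hj := by
  rcases Nat.lt_or_ge (j + 1) n with hj' | hj'
  · have h₁ := hookDown_mul_hookUp (k := k) h hj'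
    have h₂ : hookDown k h hj * hookIdem k h hj = hookDown k h hj := by
      rw [hookDown, smul_mul_assoc, mul_assoc, hookIdem_idem]
    rwa [← hookUp_add_hookDown h hj', mul_add, h₁, zero_add] at h₂
  · rw [hookDown_last h (le_antisymm hj hj'), hookIdem_idem]

end Koszul

/-! ### Relations between the classes of symmetric and exterior powers -/

section SymmetricPowerClasses

variable {k : Type u} [Field k] [CharZero k]

lemma cls_symmetrizer_mul {m n : ℕ} {s : ℕ → End (upPow k m)} {t : ℕ → End (upPow k n)}
    {s' t' : ℕ → End (upPow k (n + m))} (hs : CoxeterRel m s) (ht : CoxeterRel n t)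
    (hs' : CoxeterRel m s') (ht' : CoxeterRel n t')
    (h : ∀ i, i + 1 < m → (s i ▷ upPow k n) ≫ (upPowTensor k n m).hom =
      (upPowTensor k n m).hom ≫ s' i)
    (h' : ∀ i, i + 1 < n → (upPow k m ◁ t i) ≫ (upPowTensor k n m).hom =
      (upPowTensor k n m).hom ≫ t' i)
    {e : upPow k (n + m) ⟶ upPow k (n + m)} (he : e ≫ e = e)
    (hee : e = (symmetrizer k ht' * symmetrizer k hs' : End _)) :
    K0.cls (karOf (upPow k m) (symmetrizer k hs : End _) (symmetrizer_comp_self hs)) *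
      K0.cls (karOf (upPow k n) (symmetrizer k ht : End _) (symmetrizer_comp_self ht)) =
        K0.cls (karOf (upPow k (n + m)) e he) := by
  have key := symmetrizer_tensor_upPowTensor m n hs ht hs' ht' h h'
  rw [← hee] at key
  rw [← cls_tensor, cls_eq (karOfTensor _ _)]
  refine cls_eq (karOfIso (((symmetrizer k hs : End _) ⊗ₘ (symmetrizer k ht : End _)) ≫
    (upPowTensor k n m).hom) (upPowTensor k n m).inv (by simp) ?_)
  rw [key, Iso.inv_hom_id_assoc]

lemma cls_objH_mul_objE {m n N : ℕ} (hm : m ≤ N) (hN : N - m = n) :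
    K0.cls (objH k m) * K0.cls (objE k n) = K0.cls (karOf (upPow k N)
      (hookIdem k (crossAt_rel k N) hm : End _) (hookIdem_idem (crossAt_rel k N) hm)) := by
  obtain rfl : N = n + m := by omega
  have hd : CoxeterRel n fun i => crossAt k (n + m) (m + i) := (crossAt_rel k (n + m)).drop'
  rw [objH_eq, objE_eq]
  refine cls_symmetrizer_mul (crossAt_rel k m) (crossAt_rel k n).neg
    ((crossAt_rel k (n + m)).init hm) hd.neg
    (crossAt_whiskerRight_upPowTensor n m) (fun i hi => ?_) _ ?_
  · have := upPow_whiskerLeft_crossAt_upPowTensor (k := k) n i hi m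
    refine (congrArg (· ≫ _) ((tensorLeft (upPow k m)).map_neg (f := crossAt k n i))).trans ?_
    refine (Preadditive.neg_comp _ _).trans ((congrArg Neg.neg this).trans
      (Preadditive.comp_neg _ _).symm)
  · rw [hookIdem, (commute_init_drop (crossAt_rel k (n + m)) le_rfl hm).eq]
    congr 1
    congr 1

/-- The length `N` is a variable with an equation, which makes the products in both orders
comparable inside one endomorphism ring. -/
lemma cls_objH_mul_objH_eq {m n N : ℕ} (hN : N = n + m) (hs : CoxeterRel m (crossAt k N))
    (ht : CoxeterRel n fun i => crossAt k N (m + i))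
    (he : (symmetrizer k ht * symmetrizer k hs : End (upPow k N)) * (symmetrizer k ht *
      symmetrizer k hs) = symmetrizer k ht * symmetrizer k hs) :
    K0.cls (objH k m) * K0.cls (objH k n) = K0.cls (karOf (upPow k N)
      (symmetrizer k ht * symmetrizer k hs : End _) he) := by
  subst hN
  rw [objH_eq, objH_eq]
  exact cls_symmetrizer_mul (crossAt_rel k m) (crossAt_rel k n) hs ht
    (crossAt_whiskerRight_upPowTensor n m)
    (fun i hi => upPow_whiskerLeft_crossAt_upPowTensor n i hi m) _ rfl

/-- The Grothendieck ring is not known to be commutative. The block rotation, acting as an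
automorphism of the tensor power, carries the idempotent of one product to that of the other. -/
lemma cls_objH_commute (m n : ℕ) : K0.cls (objH k m) * K0.cls (objH k n) =
    K0.cls (objH k n) * K0.cls (objH k m) := by
  have h := crossAt_rel k (n + m)
  have h' : CoxeterRel (m + n) (crossAt k (n + m)) := by rw [Nat.add_comm m n]; exact h
  have hs₁ : CoxeterRel m (crossAt k (n + m)) := h.init (by omega)
  have ht₁ : CoxeterRel n fun i => crossAt k (n + m) (m + i) := h.drop'
  have hs₂ : CoxeterRel n (crossAt k (n + m)) := h.init (by omega)
  have ht₂ : CoxeterRel m fun i => crossAt k (n + m) (n + i) := h'.drop'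
  obtain ⟨g, hg₁, hg₂⟩ := exists_blockRotation m n
  let r : End (upPow k (n + m)) := permHom h g
  let r' : End (upPow k (n + m)) := permHom h g⁻¹
  have hr : r' * r = 1 := by rw [← map_mul, inv_mul_cancel, map_one]
  have hr' : r * r' = 1 := by rw [← map_mul, mul_inv_cancel, map_one]
  have c₁ : ∀ i, i + 1 < m → r * crossAt k (n + m) i = crossAt k (n + m) (n + i) * r :=
    fun i hi => by
      have := congrArg (permHom h) (hg₁ i hi)
      rwa [map_mul, map_mul, permHom_adjSwap h i (by omega),
        permHom_adjSwap h (n + i) (by omega)] at this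
  have c₂ : ∀ i, i + 1 < n → r * crossAt k (n + m) (m + i) = crossAt k (n + m) i * r :=
    fun i hi => by
      have := congrArg (permHom h) (hg₂ i hi)
      rwa [map_mul, map_mul, permHom_adjSwap h i (by omega),
        permHom_adjSwap h (m + i) (by omega)] at this
  let φ : upPow k (n + m) ≅ upPow k (n + m) := ⟨r, r', hr, hr'⟩
  -- For the identity functor the transport lemma is conjugation by the automorphism φ.
  have d₁ : r * symmetrizer k hs₁ = symmetrizer k ht₂ * r :=
    map_symmetrizer_comp_iso (k := k) (𝟭 _) φ hs₁ ht₂ c₁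
  have d₂ : r * symmetrizer k ht₁ = symmetrizer k hs₂ * r :=
    map_symmetrizer_comp_iso (k := k) (𝟭 _) φ ht₁ hs₂ c₂
  have hc : ∀ {a b : ℕ} (h : CoxeterRel (a + b) (crossAt k (n + m))) (h₁ : CoxeterRel b (crossAt k (n + m)))
      (h₂ : CoxeterRel a fun i => crossAt k (n + m) (b + i)),
      Commute (symmetrizer k h₂) (symmetrizer k h₁) := fun h h₁ h₂ =>
    symmetrizer_commute _ _ fun i hi => (symmetrizer_commute _ _ fun j hj =>
      h.comm i _ (by omega) (by omega)).symm
  have hi : ∀ {a b : End (upPow k (n + m))}, Commute a b → a * a = a → b * b = b →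
      (a * b) * (a * b) = a * b := fun {a b} h ha hb => by
    rw [h.symm.mul_mul_mul_comm, ha, hb]
  have he₁ := hi (hc h hs₁ ht₁) (symmetrizer_idem ht₁) (symmetrizer_idem hs₁)
  have he₂ := hi (hc h' hs₂ ht₂) (symmetrizer_idem ht₂) (symmetrizer_idem hs₂)
  rw [cls_objH_mul_objH_eq rfl hs₁ ht₁ he₁, cls_objH_mul_objH_eq (Nat.add_comm n m) hs₂ ht₂ he₂]
  have d : r * (symmetrizer k ht₁ * symmetrizer k hs₁) =
      symmetrizer k ht₂ * symmetrizer k hs₂ * r := by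
    rw [← mul_assoc, d₂, mul_assoc, d₁, ← mul_assoc, (hc h' hs₂ ht₂).eq]
  refine cls_eq (karOfIso (r * (symmetrizer k ht₁ * symmetrizer k hs₁) : End _) r' ?_ ?_)
  · change r' * (r * (symmetrizer k ht₁ * symmetrizer k hs₁)) = _
    rw [← mul_assoc, hr, one_mul]
  · change r * (symmetrizer k ht₁ * symmetrizer k hs₁) * r' = _
    rw [d, mul_assoc, hr', mul_one]

lemma objH_zero_iso : Nonempty (objH k 0 ≅ 𝟙_ (Kar (AH k))) := by
  have e : (symmetrizer k (crossAt_rel k 0) : End (upPow k 0)) = 𝟙 _ :=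
    (symmetrizer_unique (k := k) (crossAt_rel k 0) (1 : End (upPow k 0)) (fun i hi => by omega)
      fun x _ => mul_one x).symm
  rw [objH_eq]
  refine ⟨karIsoOfIso (Iso.refl _) ((Category.comp_id _).trans (Eq.trans ?_ (Category.id_comp _).symm))⟩
  exact (congrArg (Mat_.embedding (AH k)).map e).trans ((Mat_.embedding (AH k)).map_id _)

lemma cls_objH_zero : K0.cls (objH k 0) = 1 := (cls_eq objH_zero_iso.some).trans cls_unit

lemma objE_zero_eq : objE k 0 = objH k 0 := by
  have e : (symmetrizer k (crossAt_rel k 0).neg : End (upPow k 0)) =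
      symmetrizer k (crossAt_rel k 0) := symmetrizer_congr _ _ fun i hi => by omega
  rw [objH_eq, objE_eq]
  simp only [e]

/-- Exactness of the Koszul complex of symmetric and exterior powers. -/
lemma exists_cls_objH_mul_objE (N : ℕ) (hN : 0 < N) : ∃ a : ℕ → K0 (Kar (AH k)),
    K0.cls (objE k N) = a 0 ∧ a N = 0 ∧
      ∀ j, j < N → K0.cls (objH k (j + 1)) * K0.cls (objE k (N - (j + 1))) = a (j + 1) + a j := by
  have h := crossAt_rel k N
  -- `a j` is the class of the summand shared by the terms `j` and `j + 1`, and is zero beyond the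
  -- last pair of terms.
  let a : ℕ → K0 (Kar (AH k)) := fun j =>
    if hj : j + 1 ≤ N then K0.cls (karOf (upPow k N) (hookUp k h hj : End _) (hookUp_idem h hj))
    else 0
  -- The products of two consecutive hook idempotents in the two orders, one of them rescaled,
  -- factor `hookUp` and `hookDown` through each other.
  have ha : ∀ j (hj : j + 1 ≤ N), a j = K0.cls (karOf (upPow k N) (hookDown k h hj : End _)
      (hookDown_idem h hj)) := fun j hj => by
    simp only [a, dif_pos hj]
    refine cls_eq (karOfIso (koszulScalar k N j • (hookIdem k h hj *
      hookIdem k h (Nat.le_of_succ_le hj)) : End (upPow k N))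
      (hookIdem k h (Nat.le_of_succ_le hj) * hookIdem k h hj : End (upPow k N)) ?_ ?_)
    · change (hookIdem k h (Nat.le_of_succ_le hj) * hookIdem k h hj : End (upPow k N)) *
        koszulScalar k N j • (hookIdem k h hj * hookIdem k h (Nat.le_of_succ_le hj)) = hookUp k h hj
      rw [mul_smul_comm, hookUp, mul_assoc, ← mul_assoc (hookIdem k h hj), hookIdem_idem, mul_assoc]
    · change koszulScalar k N j • (hookIdem k h hj * hookIdem k h (Nat.le_of_succ_le hj)) *
        (hookIdem k h (Nat.le_of_succ_le hj) * hookIdem k h hj : End (upPow k N)) = hookDown k h hj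
      rw [smul_mul_assoc, hookDown, mul_assoc,
        ← mul_assoc (hookIdem k h (Nat.le_of_succ_le hj)), hookIdem_idem, mul_assoc]
  refine ⟨a, ?_, dif_neg (by omega), fun j hj => ?_⟩
  · have := cls_objH_mul_objE (k := k) (Nat.zero_le N) (Nat.sub_zero N)
    rw [cls_objH_zero, one_mul] at this
    rw [this]
    simp only [a, dif_pos (show 0 + 1 ≤ N from hN), hookUp_zero]
  · rw [ha j hj, cls_objH_mul_objE hj rfl]
    rcases Nat.lt_or_ge (j + 1) N with hj' | hj'
    · simp only [a, dif_pos (show j + 1 + 1 ≤ N from hj')]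
      rw [← cls_biprod]
      exact cls_eq (karOfBiprod _ _ _ (hookUp_add_hookDown h hj') (hookDown_mul_hookUp h hj')
        (hookUp_mul_hookDown h hj'))
    · simp only [a, dif_neg (show ¬ j + 1 + 1 ≤ N by omega), zero_add]
      have e := hookDown_last (k := k) h (le_antisymm hj hj')
      congr 2
      exact e.symm

/-- Each product is a sum of two consecutive `a j`, so the alternating sum telescopes. The result is
the recursion that defines `symE`. -/
lemma cls_objE_succ (n : ℕ) : K0.cls (objE k (n + 1)) = ∑ j : Fin (n + 1), (-1) ^ (j : ℕ) *
    K0.cls (objH k (j + 1)) * K0.cls (objE k (n - j)) := by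
  obtain ⟨a, h₀, hN, ha⟩ := exists_cls_objH_mul_objE (k := k) (n + 1) n.succ_pos
  -- The telescoping step has to hold in a noncommutative ring.
  have aux : ∀ (R : Type (max 1 u)) [Ring R] (p x y z : R),
      z - p * y + p * (x + y) = z - p * -1 * x := by
    intros; noncomm_ring
  have key : ∀ m ≤ n + 1, ∑ j ∈ Finset.range m, (-1) ^ j *
      K0.cls (objH k (j + 1)) * K0.cls (objE k (n - j)) = a 0 - (-1) ^ m * a m := by
    intro m
    induction m with
    | zero => simp
    | succ m ih =>
      intro hm
      have := ha m (by omega)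
      rw [Nat.add_sub_add_right] at this
      rw [Finset.sum_range_succ, ih (by omega), mul_assoc, this, pow_succ]
      exact aux (K0 (Kar (AH k))) _ _ _ _
  rw [Fin.sum_univ_eq_sum_range (fun j => (-1) ^ j * K0.cls (objH k (j + 1)) *
    K0.cls (objE k (n - j))) (n + 1), key _ le_rfl, hN, h₀]
  simp

end SymmetricPowerClasses

/-! ### Functors out of a presented monoidal category -/

section UniversalProperty

universe v w

variable {k : Type u} [Field k] {D : Type w} [Category.{v} D] [MonoidalCategory D]

section Words

variable {C : Type} (o : C → D)

/-- The tensor product of the images of the letters of a word. -/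
def wordObj : List C → D
  | [] => 𝟙_ D
  | c :: X => o c ⊗ wordObj X

/-- The image of a concatenation is the tensor product of the images. -/
def wordMu : ∀ X Y : List C, wordObj o (X ++ Y) ≅ wordObj o X ⊗ wordObj o Y
  | [], Y => (λ_ (wordObj o Y)).symm
  | c :: X, Y => whiskerLeftIso (o c) (wordMu X Y) ≪≫ (α_ (o c) (wordObj o X) (wordObj o Y)).symm

lemma wordObj_eqToHom_cons (c : C) {X Y : List C} (h : X = Y) :
    eqToHom (congrArg (fun X => wordObj o (c :: X)) h) =
      o c ◁ eqToHom (congrArg (wordObj o) h) := by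
  subst h
  exact (whiskerLeft_id (o c) _).symm

/-- The target category is not strict, so concatenation becomes a tensor product only up to
`wordMu`. This is its compatibility with associators, proved by induction on the first word with the
pentagon. -/
lemma wordMu_assoc (X Y Z : List C) :
    (wordMu o (X ++ Y) Z).hom ≫ ((wordMu o X Y).hom ▷ wordObj o Z) ≫ (α_ _ _ _).hom =
      eqToHom (congrArg (wordObj o) (List.append_assoc X Y Z)) ≫ (wordMu o X (Y ++ Z)).hom ≫
        wordObj o X ◁ (wordMu o Y Z).hom := by
  induction X with
  | nil =>
    change (wordMu o Y Z).hom ≫ ((λ_ (wordObj o Y)).inv ▷ wordObj o Z) ≫ (α_ _ _ _).hom =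
      𝟙 _ ≫ (λ_ (wordObj o (Y ++ Z))).inv ≫ 𝟙_ D ◁ (wordMu o Y Z).hom
    simp
  | cons c X ih =>
    have e := wordObj_eqToHom_cons o c (List.append_assoc X Y Z)
    refine Eq.trans ?_ (congrArg (· ≫ _) e.symm)
    change (o c ◁ (wordMu o (X ++ Y) Z).hom ≫ (α_ _ _ _).inv) ≫
      ((o c ◁ (wordMu o X Y).hom ≫ (α_ _ _ _).inv) ▷ wordObj o Z) ≫ (α_ _ _ _).hom = _ ≫
        (o c ◁ (wordMu o X (Y ++ Z)).hom ≫ (α_ _ _ _).inv) ≫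
          (o c ⊗ wordObj o X) ◁ (wordMu o Y Z).hom
    have ih' := congrArg (fun f => o c ◁ f) ih
    simp only [whiskerLeft_comp] at ih'
    simp only [Category.assoc, comp_whiskerRight, whisker_assoc, Iso.inv_hom_id_assoc]
    rw [pentagon_inv_inv_hom_hom_inv, reassoc_of% ih', associator_inv_naturality_right]

lemma wordMu_inv_assoc (X Y Z : List C) :
    ((wordMu o X Y).inv ▷ wordObj o Z) ≫ (wordMu o (X ++ Y) Z).inv ≫
        eqToHom (congrArg (wordObj o) (List.append_assoc X Y Z)) =
      (α_ _ _ _).hom ≫ (wordObj o X ◁ (wordMu o Y Z).inv) ≫ (wordMu o X (Y ++ Z)).inv := by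
  have h := wordMu_assoc o X Y Z
  have h' : eqToHom (congrArg (wordObj o) (List.append_assoc X Y Z)) =
      (wordMu o (X ++ Y) Z).hom ≫ ((wordMu o X Y).hom ▷ wordObj o Z) ≫ (α_ _ _ _).hom ≫
        (wordObj o X ◁ (wordMu o Y Z).inv) ≫ (wordMu o X (Y ++ Z)).inv := by
    rw [reassoc_of% h]
    simp
  rw [h', Iso.inv_hom_id_assoc, inv_hom_whiskerRight_assoc]

lemma wordMu_nil (X : List C) : (wordMu o X []).hom ≫ (ρ_ (wordObj o X)).hom =
    eqToHom (congrArg (wordObj o) (List.append_nil X)) := by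
  induction X with
  | nil =>
    change (λ_ (𝟙_ D)).inv ≫ (ρ_ (𝟙_ D)).hom = 𝟙 _
    rw [← unitors_equal, Iso.inv_hom_id]
  | cons c X ih =>
    refine Eq.trans ?_ (wordObj_eqToHom_cons o c (List.append_nil X)).symm
    rw [← ih]
    change (o c ◁ (wordMu o X []).hom ≫ (α_ _ _ _).inv) ≫ (ρ_ (o c ⊗ wordObj o X)).hom = _
    simp [wordObj]

variable [Preadditive D] [Linear k D] {G : List C → List C → Type}
  (g : ∀ {X Y : List C}, G X Y → (wordObj o X ⟶ wordObj o Y))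

/-- The value of a formal expression for given values of the generators. -/
def evalMor : ∀ {X Y : List C}, MorExpr k G X Y → (wordObj o X ⟶ wordObj o Y)
  | _, _, .ident h => eqToHom (congrArg (wordObj o) h)
  | _, _, .gen f => g f
  | _, _, .comp f f' => evalMor f ≫ evalMor f'
  | _, _, .tensor f f' => (wordMu o _ _).hom ≫ (evalMor f ⊗ₘ evalMor f') ≫ (wordMu o _ _).inv
  | _, _, .zero => 0
  | _, _, .add f f' => evalMor f + evalMor f'
  | _, _, .smul a f => a • evalMor f

end Words

variable [Preadditive D] [MonoidalPreadditive D] [Linear k D] [MonoidalLinear k D]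
  {P : Presentation k} (o : P.C → D)
  (g : ∀ {X Y : List P.C}, P.Gen X Y → (wordObj o X ⟶ wordObj o Y))

lemma smul_tensorHom {X Y X' Y' : D} (a : k) (f : X ⟶ Y) (f' : X' ⟶ Y') :
    ((a • f) ⊗ₘ f') = a • (f ⊗ₘ f') := by
  rw [MonoidalCategory.tensorHom_def, MonoidalLinear.smul_whiskerRight, Linear.smul_comp,
    ← MonoidalCategory.tensorHom_def]

lemma tensorHom_smul {X Y X' Y' : D} (a : k) (f : X ⟶ Y) (f' : X' ⟶ Y') :
    (f ⊗ₘ (a • f')) = a • (f ⊗ₘ f') := by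
  rw [MonoidalCategory.tensorHom_def, MonoidalLinear.whiskerLeft_smul, Linear.comp_smul,
    ← MonoidalCategory.tensorHom_def]

/-- Everything except the defining relations holds in any linear monoidal category. Coherence of
`wordMu` is needed where words are rebracketed or an empty word is removed on the right, that is,
for `tensor_assoc` and `tensor_unit`. -/
lemma evalMor_sound
    (hg : ∀ {X Y : List P.C} {f f' : MorExpr k P.Gen X Y}, P.Rel f f' →
      evalMor o g f = evalMor o g f')
    {X Y : List P.C} {f f' : MorExpr k P.Gen X Y} (h : P.Eqv f f') :
    evalMor o g f = evalMor o g f' := by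
  induction h with
  | rel h => exact hg h
  | refl f => rfl
  | symm _ ih => exact ih.symm
  | trans _ _ ih₁ ih₂ => exact ih₁.trans ih₂
  | comp_congr _ _ ih₁ ih₂ => simp only [evalMor, ih₁, ih₂]
  | tensor_congr _ _ ih₁ ih₂ => simp only [evalMor, ih₁, ih₂]
  | add_congr _ _ ih₁ ih₂ => simp only [evalMor, ih₁, ih₂]
  | smul_congr a _ ih => simp only [evalMor, ih]
  | id_comp f => simp [evalMor]
  | comp_id f => simp [evalMor]
  | assoc f f' f'' => exact Category.assoc _ _ _
  | tensor_id X Y =>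
    change (wordMu o X Y).hom ≫ (𝟙 _ ⊗ₘ 𝟙 _) ≫ (wordMu o X Y).inv = 𝟙 _
    rw [id_tensorHom_id, Category.id_comp, Iso.hom_inv_id]
  | interchange f f₁ f' f₁' =>
    simp only [evalMor, ← tensorHom_comp_tensorHom, Category.assoc, Iso.inv_hom_id_assoc]
  | @tensor_assoc X Y X' Y' X'' Y'' f f' f'' =>
    have h₁ := wordMu_assoc o X X' X''
    have h₂ := wordMu_assoc o Y Y' Y''
    have h₃ := associator_naturality (evalMor o g f) (evalMor o g f') (evalMor o g f'')
    have h₂' : (wordMu o (Y ++ Y') Y'').inv ≫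
        eqToHom (congrArg (wordObj o) (List.append_assoc Y Y' Y'')) =
        ((wordMu o Y Y').hom ▷ wordObj o Y'') ≫ (α_ _ _ _).hom ≫
          (wordObj o Y ◁ (wordMu o Y' Y'').inv) ≫ (wordMu o Y (Y' ++ Y'')).inv := by
      rw [Iso.inv_comp_eq, reassoc_of% h₂]
      simp
    have h₁' : ∀ {Z : D} (t : _ ⟶ Z), (wordMu o (X ++ X') X'').hom ≫
        ((wordMu o X X').hom ▷ wordObj o X'') ≫ (α_ _ _ _).hom ≫ t =
      eqToHom (congrArg (wordObj o) (List.append_assoc X X' X'')) ≫ (wordMu o X (X' ++ X'')).hom ≫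
        wordObj o X ◁ (wordMu o X' X'').hom ≫ t := fun t => by
      rw [← Category.assoc _ (α_ _ _ _).hom, ← Category.assoc, h₁]; simp
    simp only [evalMor, Category.assoc, h₂']
    have e₁ : (((wordMu o X X').hom ≫ (evalMor o g f ⊗ₘ evalMor o g f') ≫ (wordMu o Y Y').inv) ⊗ₘ
        evalMor o g f'') = ((wordMu o X X').hom ▷ wordObj o X'') ≫
          ((evalMor o g f ⊗ₘ evalMor o g f') ⊗ₘ evalMor o g f'') ≫
            ((wordMu o Y Y').inv ▷ wordObj o Y'') := by
      simp only [← tensorHom_id, tensorHom_comp_tensorHom, Category.id_comp, Category.comp_id]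
    have e₂ : (evalMor o g f ⊗ₘ ((wordMu o X' X'').hom ≫ (evalMor o g f' ⊗ₘ evalMor o g f'') ≫
        (wordMu o Y' Y'').inv)) = (wordObj o X ◁ (wordMu o X' X'').hom) ≫
          (evalMor o g f ⊗ₘ (evalMor o g f' ⊗ₘ evalMor o g f'')) ≫
            (wordObj o Y ◁ (wordMu o Y' Y'').inv) := by
      simp only [← id_tensorHom, tensorHom_comp_tensorHom, Category.id_comp, Category.comp_id]
    rw [e₁, e₂]
    simp only [Category.assoc]
    rw [inv_hom_whiskerRight_assoc, reassoc_of% h₃, h₁']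
  | unit_tensor f =>
    change (λ_ _).inv ≫ (𝟙 (𝟙_ D) ⊗ₘ evalMor o g f) ≫ (λ_ _).hom = _
    simp
  | @tensor_unit X Y f =>
    have h₁ := wordMu_nil o X
    have h₂ := wordMu_nil o Y
    have h₂' : (wordMu o Y []).inv ≫ eqToHom (congrArg (wordObj o) (List.append_nil Y)) =
        (ρ_ (wordObj o Y)).hom := by
      exact (Iso.inv_comp_eq _).2 h₂.symm
    have h₃ : (evalMor o g f ⊗ₘ 𝟙 (𝟙_ D)) ≫ (ρ_ (wordObj o Y)).hom =
        (ρ_ (wordObj o X)).hom ≫ evalMor o g f := by simp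
    refine (Category.assoc _ _ _).trans ((congrArg _ ((Category.assoc _ _ _).trans
      (congrArg _ h₂'))).trans ?_)
    exact (congrArg _ h₃).trans ((Category.assoc _ _ _).symm.trans (congrArg (· ≫ _) h₁))
  | add_assoc f g h => simp only [evalMor, add_assoc]
  | add_comm f f' => exact _root_.add_comm (evalMor o g f) (evalMor o g f')
  | zero_add f => simp only [evalMor, zero_add]
  | one_smul f => simp only [evalMor, one_smul]
  | mul_smul a b f => simp only [evalMor, mul_smul]
  | zero_smul f => simp only [evalMor, zero_smul]
  | smul_add a f g => simp only [evalMor, smul_add]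
  | add_smul a b f => simp only [evalMor, add_smul]
  | add_comp f g h => simp only [evalMor, Preadditive.add_comp]
  | comp_add f g h => simp only [evalMor, Preadditive.comp_add]
  | smul_comp a f g => simp only [evalMor, Linear.smul_comp]
  | comp_smul a f g => simp only [evalMor, Linear.comp_smul]
  | add_tensor f g h =>
    simp only [evalMor, MonoidalPreadditive.add_tensor, Preadditive.add_comp, Preadditive.comp_add]
  | tensor_add f g h =>
    simp only [evalMor, MonoidalPreadditive.tensor_add, Preadditive.add_comp, Preadditive.comp_add]
  | smul_tensor a f g =>
    simp only [evalMor, smul_tensorHom, Linear.smul_comp, Linear.comp_smul]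
  | tensor_smul a f g =>
    simp only [evalMor, tensorHom_smul, Linear.smul_comp, Linear.comp_smul]

variable (hg : ∀ {X Y : List P.C} {f f' : MorExpr k P.Gen X Y}, P.Rel f f' →
      evalMor o g f = evalMor o g f')

/-- The functor out of a presented category with given values on the generators. -/
def presLift : P.Cat ⥤ D where
  obj X := wordObj o X.word
  map {X Y} := Quotient.lift (fun f => evalMor o g f) fun _ _ h => evalMor_sound o g hg h
  map_id _ := rfl
  map_comp := by rintro _ _ _ ⟨f⟩ ⟨f'⟩; rfl

instance presLift_additive : (presLift o g hg).Additive where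
  map_add := by rintro _ _ ⟨f⟩ ⟨f'⟩; rfl

instance presLift_linear : (presLift o g hg).Linear k where
  map_smul := by rintro _ _ ⟨f⟩ a; rfl

lemma presLift_map_tens {X Y X' Y' : P.Cat} (f : X ⟶ Y) (f' : X' ⟶ Y') :
    (presLift o g hg).map (f ⊗ₘ f') = (wordMu o X.word X'.word).hom ≫
      ((presLift o g hg).map f ⊗ₘ (presLift o g hg).map f') ≫ (wordMu o Y.word Y'.word).inv := by
  obtain ⟨f⟩ := f
  obtain ⟨f'⟩ := f'
  rfl

lemma presLift_map_eqToHom {X Y : List P.C} (h : X = Y) :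
    (presLift o g hg).map (eqToHom (congrArg Presentation.Cat.mk h)) =
      eqToHom (congrArg (wordObj o) h) := by
  subst h
  exact (presLift o g hg).map_id _

/-- The monoidal structure of the functor out of a presented category. -/
@[reducible]
def presLiftMonoidal : (presLift o g hg).Monoidal :=
  Functor.CoreMonoidal.toMonoidal
    { εIso := Iso.refl _
      μIso := fun X Y => (wordMu o X.word Y.word).symm
      μIso_hom_natural_left := fun {X Y} f X' => by
        change _ ≫ (wordMu o Y.word X'.word).inv = (wordMu o X.word X'.word).inv ≫ _
        rw [← tensorHom_id f X', presLift_map_tens, (presLift o g hg).map_id, Iso.inv_hom_id_assoc]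
        exact congrArg (· ≫ _) (tensorHom_id _ _).symm
      μIso_hom_natural_right := fun {X Y} X' f => by
        change _ ≫ (wordMu o X'.word Y.word).inv = (wordMu o X'.word X.word).inv ≫ _
        rw [← id_tensorHom X' f, presLift_map_tens, (presLift o g hg).map_id, Iso.inv_hom_id_assoc]
        exact congrArg (· ≫ _) (id_tensorHom _ _).symm
      associativity := fun X Y Z => by
        have h := wordMu_assoc o X.word Y.word Z.word
        have e := presLift_map_eqToHom o g hg (List.append_assoc X.word Y.word Z.word)
        change ((wordMu o X.word Y.word).inv ▷ wordObj o Z.word) ≫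
          (wordMu o (X.word ++ Y.word) Z.word).inv ≫ (presLift o g hg).map
            (eqToHom (congrArg Presentation.Cat.mk (List.append_assoc X.word Y.word Z.word))) =
            (α_ _ _ _).hom ≫ (wordObj o X.word ◁ (wordMu o Y.word Z.word).inv) ≫
              (wordMu o X.word (Y.word ++ Z.word)).inv
        exact (congrArg (fun t => _ ≫ _ ≫ t) e).trans (wordMu_inv_assoc o X.word Y.word Z.word)
      left_unitality := fun X => by
        change (λ_ (wordObj o X.word)).hom = (𝟙 (𝟙_ D) ▷ wordObj o X.word) ≫
          (λ_ (wordObj o X.word)).hom ≫ (presLift o g hg).map (𝟙 _)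
        rw [(presLift o g hg).map_id, id_whiskerRight]
        exact (Category.id_comp _).symm.trans (congrArg _ (Category.comp_id _).symm)
      right_unitality := fun X => by
        have e := presLift_map_eqToHom o g hg (List.append_nil X.word)
        change (ρ_ (wordObj o X.word)).hom = (wordObj o X.word ◁ 𝟙 (𝟙_ D)) ≫
          (wordMu o X.word []).inv ≫ (presLift o g hg).map
            (eqToHom (congrArg Presentation.Cat.mk (List.append_nil X.word)))
        rw [e, ← wordMu_nil o X.word, whiskerLeft_id]
        exact (((Category.id_comp _)).trans (Iso.inv_hom_id_assoc _ _)).symm }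

end UniversalProperty

/-! ### Functors out of the degenerate affine Hecke category -/

section AffineHeckeLift

universe v w

variable {k : Type u} [Field k] {D : Type w} [Category.{v} D] [MonoidalCategory D]
  [Preadditive D] [MonoidalPreadditive D] [Linear k D] [MonoidalLinear k D]

/-- The images of the generating morphisms for given values of the dot and the crossing. -/
def ahValue {V : D} (x : V ⟶ V) (s : V ⊗ V ⟶ V ⊗ V) :
    ∀ {X Y : List Unit}, AHGen X Y → (wordObj (fun _ : Unit => V) X ⟶ wordObj (fun _ => V) Y)
  | _, _, .dot => (x ▷ 𝟙_ D : V ⊗ 𝟙_ D ⟶ V ⊗ 𝟙_ D)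
  | _, _, .cross => ((α_ V V (𝟙_ D)).inv ≫ (s ▷ 𝟙_ D) ≫ (α_ V V (𝟙_ D)).hom :
      V ⊗ V ⊗ 𝟙_ D ⟶ V ⊗ V ⊗ 𝟙_ D)

/-- The relations of the degenerate affine Hecke category. -/
structure AffineHeckeRel {V : D} (x : V ⟶ V) (s : V ⊗ V ⟶ V ⊗ V) : Prop where
  quad : s ≫ s = 𝟙 _
  braid : (s ▷ V) ≫ (α_ V V V).hom ≫ (V ◁ s) ≫ (α_ V V V).inv ≫ (s ▷ V) ≫ (α_ V V V).hom =
    (α_ V V V).hom ≫ (V ◁ s) ≫ (α_ V V V).inv ≫ (s ▷ V) ≫ (α_ V V V).hom ≫ (V ◁ s)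
  dot_cross : (x ▷ V) ≫ s = s ≫ (V ◁ x) + 𝟙 _
  cross_dot : s ≫ (x ▷ V) = (V ◁ x) ≫ s + 𝟙 _

section

variable {V : D} {x : V ⟶ V} {s : V ⊗ V ⟶ V ⊗ V}

/-- Conjugation of an endomorphism of a tensor square by the right unitor. -/
def twoBar (f : V ⊗ V ⟶ V ⊗ V) : V ⊗ V ⊗ 𝟙_ D ⟶ V ⊗ V ⊗ 𝟙_ D :=
  (V ◁ (ρ_ V).hom) ≫ f ≫ (V ◁ (ρ_ V).inv)

/-- Conjugation of an endomorphism of a tensor cube by the right unitor. -/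
def threeBar (f : V ⊗ V ⊗ V ⟶ V ⊗ V ⊗ V) : V ⊗ V ⊗ V ⊗ 𝟙_ D ⟶ V ⊗ V ⊗ V ⊗ 𝟙_ D :=
  (V ◁ V ◁ (ρ_ V).hom) ≫ f ≫ (V ◁ V ◁ (ρ_ V).inv)

lemma twoBar_comp (f g : V ⊗ V ⟶ V ⊗ V) : twoBar f ≫ twoBar g = twoBar (f ≫ g) := by
  simp [twoBar]

lemma threeBar_comp (f g : V ⊗ V ⊗ V ⟶ V ⊗ V ⊗ V) :
    threeBar f ≫ threeBar g = threeBar (f ≫ g) := by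
  simp [threeBar]

lemma twoBar_id : twoBar (𝟙 (V ⊗ V)) = 𝟙 _ := by
  simp [twoBar]

lemma twoBar_add (f g : V ⊗ V ⟶ V ⊗ V) : twoBar (f + g) = twoBar f + twoBar g := by
  simp [twoBar]

variable (x s)

/-- Words evaluate to products ending in a unit object. Conjugation by the trailing unitor, `twoBar`
or `threeBar`, is multiplicative, so once all diagrams are in this form the relations can be checked
without the unit. -/
lemma evalMor_crossE : evalMor (fun _ => V) (ahValue x s) (crossE k) = twoBar s := by
  change (α_ V V (𝟙_ D)).inv ≫ (s ▷ 𝟙_ D) ≫ (α_ V V (𝟙_ D)).hom = _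
  rw [twoBar]
  monoidal

lemma evalMor_dotE : evalMor (fun _ => V) (ahValue x s) (dotE k) = (ρ_ V).hom ≫ x ≫ (ρ_ V).inv := by
  change x ▷ 𝟙_ D = _
  simp

lemma evalMor_dotLeftE : evalMor (fun _ => V) (ahValue x s) (dotLeftE k) = twoBar (x ▷ V) := by
  change (V ◁ (λ_ (V ⊗ 𝟙_ D)).inv ≫ (α_ V (𝟙_ D) (V ⊗ 𝟙_ D)).inv) ≫
    ((x ▷ 𝟙_ D) ⊗ₘ (𝟙 (V ⊗ 𝟙_ D))) ≫ ((α_ V (𝟙_ D) (V ⊗ 𝟙_ D)).hom ≫ V ◁ (λ_ (V ⊗ 𝟙_ D)).hom) = _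
  rw [twoBar]
  monoidal

lemma evalMor_dotRightE : evalMor (fun _ => V) (ahValue x s) (dotRightE k) = twoBar (V ◁ x) := by
  change (V ◁ (λ_ (V ⊗ 𝟙_ D)).inv ≫ (α_ V (𝟙_ D) (V ⊗ 𝟙_ D)).inv) ≫
    ((𝟙 (V ⊗ 𝟙_ D)) ⊗ₘ (x ▷ 𝟙_ D)) ≫ ((α_ V (𝟙_ D) (V ⊗ 𝟙_ D)).hom ≫ V ◁ (λ_ (V ⊗ 𝟙_ D)).hom) = _
  rw [twoBar]
  monoidal

lemma evalMor_crossLeftE : evalMor (fun _ => V) (ahValue x s) (crossLeftE k) =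
    threeBar ((α_ V V V).inv ≫ (s ▷ V) ≫ (α_ V V V).hom) := by
  change (V ◁ (V ◁ (λ_ (V ⊗ 𝟙_ D)).inv ≫ (α_ V (𝟙_ D) (V ⊗ 𝟙_ D)).inv) ≫
      (α_ V (V ⊗ 𝟙_ D) (V ⊗ 𝟙_ D)).inv) ≫
    (((α_ V V (𝟙_ D)).inv ≫ (s ▷ 𝟙_ D) ≫ (α_ V V (𝟙_ D)).hom) ⊗ₘ (𝟙 (V ⊗ 𝟙_ D))) ≫
      ((α_ V (V ⊗ 𝟙_ D) (V ⊗ 𝟙_ D)).hom ≫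
        V ◁ ((α_ V (𝟙_ D) (V ⊗ 𝟙_ D)).hom ≫ V ◁ (λ_ (V ⊗ 𝟙_ D)).hom)) = _
  rw [threeBar]
  monoidal

lemma evalMor_crossRightE : evalMor (fun _ => V) (ahValue x s) (crossRightE k) =
    threeBar (V ◁ s) := by
  change (V ◁ (λ_ (V ⊗ V ⊗ 𝟙_ D)).inv ≫ (α_ V (𝟙_ D) (V ⊗ V ⊗ 𝟙_ D)).inv) ≫
    ((𝟙 (V ⊗ 𝟙_ D)) ⊗ₘ ((α_ V V (𝟙_ D)).inv ≫ (s ▷ 𝟙_ D) ≫ (α_ V V (𝟙_ D)).hom)) ≫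
      ((α_ V (𝟙_ D) (V ⊗ V ⊗ 𝟙_ D)).hom ≫ V ◁ (λ_ (V ⊗ V ⊗ 𝟙_ D)).hom) = _
  rw [threeBar]
  monoidal

end

section

variable {V : D} {x : V ⟶ V} {s : V ⊗ V ⟶ V ⊗ V} (h : AffineHeckeRel x s)
include h

lemma ahValue_rel {X Y : List Unit} {f f' : MorExpr k AHGen X Y} (r : AHRel f f') :
    evalMor (fun _ => V) (ahValue x s) f = evalMor (fun _ => V) (ahValue x s) f' := by
  cases r with
  | quadratic =>
    refine (congrArg₂ (· ≫ ·) (evalMor_crossE x s) (evalMor_crossE x s)).trans ?_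
    exact (twoBar_comp s s).trans ((congrArg twoBar h.quad).trans twoBar_id)
  | braid =>
    refine (congrArg₂ (· ≫ ·) (evalMor_crossLeftE x s)
      (congrArg₂ (· ≫ ·) (evalMor_crossRightE x s) (evalMor_crossLeftE x s))).trans (Eq.trans ?_
      (congrArg₂ (· ≫ ·) (evalMor_crossRightE x s)
      (congrArg₂ (· ≫ ·) (evalMor_crossLeftE x s) (evalMor_crossRightE x s))).symm)
    refine (congrArg (_ ≫ ·) (threeBar_comp _ _)).trans ((threeBar_comp _ _).trans (Eq.trans ?_
      ((congrArg (_ ≫ ·) (threeBar_comp _ _)).trans (threeBar_comp _ _)).symm))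
    refine congrArg threeBar ?_
    have := h.braid
    simp only [Category.assoc]
    rw [this, Iso.inv_hom_id_assoc]
  | dot_cross =>
    refine (congrArg₂ (· ≫ ·) (evalMor_dotLeftE x s) (evalMor_crossE x s)).trans (Eq.trans ?_
      (congrArg (· + 𝟙 (V ⊗ V ⊗ 𝟙_ D)) (congrArg₂ (· ≫ ·) (evalMor_crossE x s)
        (evalMor_dotRightE x s))).symm)
    refine (twoBar_comp _ _).trans ((congrArg twoBar h.dot_cross).trans ((twoBar_add _ _).trans ?_))
    exact congrArg₂ (· + ·) (twoBar_comp _ _).symm twoBar_id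
  | cross_dot =>
    refine (congrArg₂ (· ≫ ·) (evalMor_crossE x s) (evalMor_dotLeftE x s)).trans (Eq.trans ?_
      (congrArg (· + 𝟙 (V ⊗ V ⊗ 𝟙_ D)) (congrArg₂ (· ≫ ·) (evalMor_dotRightE x s)
        (evalMor_crossE x s))).symm)
    refine (twoBar_comp _ _).trans ((congrArg twoBar h.cross_dot).trans ((twoBar_add _ _).trans ?_))
    exact congrArg₂ (· + ·) (twoBar_comp _ _).symm twoBar_id

variable (k) in
/-- The functor out of the degenerate affine Hecke category given by a solution of its relations. -/
def ahLift : AH k ⥤ D :=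
  presLift (P := ahPres k) (fun _ => V) (ahValue x s) (ahValue_rel h)

instance : (ahLift k h).Additive :=
  presLift_additive (P := ahPres k) (fun _ => V) (ahValue x s) (ahValue_rel h)

instance : (ahLift k h).Linear k :=
  presLift_linear (P := ahPres k) (fun _ => V) (ahValue x s) (ahValue_rel h)

instance : (ahLift k h).Monoidal :=
  presLiftMonoidal (P := ahPres k) (fun _ => V) (ahValue x s) (ahValue_rel h)

variable (k) in
/-- The image of the generating object. -/
def ahLiftUp : (ahLift k h).obj (up k) ≅ V := ρ_ V

lemma ahLift_map_dot : (ahLift k h).map (dot k) = (ahLiftUp k h).hom ≫ x ≫ (ahLiftUp k h).inv :=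
  evalMor_dotE x s

lemma ahLift_map_cross : (ahLift k h).map (cross k) =
    (Functor.Monoidal.μIso (ahLift k h) (up k) (up k)).inv ≫
      ((ahLiftUp k h).hom ⊗ₘ (ahLiftUp k h).hom) ≫ s ≫
        ((ahLiftUp k h).inv ⊗ₘ (ahLiftUp k h).inv) ≫
          (Functor.Monoidal.μIso (ahLift k h) (up k) (up k)).hom := by
  refine (evalMor_crossE x s).trans ?_
  change _ = (V ◁ (λ_ (V ⊗ 𝟙_ D)).inv ≫ (α_ V (𝟙_ D) (V ⊗ 𝟙_ D)).inv) ≫ ((ρ_ V).hom ⊗ₘ (ρ_ V).hom) ≫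
    s ≫ ((ρ_ V).inv ⊗ₘ (ρ_ V).inv) ≫ ((α_ V (𝟙_ D) (V ⊗ 𝟙_ D)).hom ≫ V ◁ (λ_ (V ⊗ 𝟙_ D)).hom)
  rw [twoBar]
  monoidal

end

end AffineHeckeLift

/-! ### Coloured dots, crossings, interchanges and dumbbells -/

section Colours

variable (k : Type u) [Field k]

/-- The object given by a word of colours. -/
def wordC (w : List (Unit ⊕ Unit)) : AHBar k := ⟨w⟩

variable {k} {a b c d : Unit ⊕ Unit} {v w x y : List (Unit ⊕ Unit)}

/-- A coloured strand added on the left. -/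
def consC (c : Unit ⊕ Unit) (f : wordC k v ⟶ wordC k w) : wordC k (c :: v) ⟶ wordC k (c :: w) :=
  consHom (P := ahBarPres k) c f

/-- A morphism of two coloured strands with further strands on the right. -/
def headC (g : wordC k [a, b] ⟶ wordC k [c, d]) (v : List (Unit ⊕ Unit)) :
    wordC k (a :: b :: v) ⟶ wordC k (c :: d :: v) :=
  headHom (P := ahBarPres k) g v

@[simp]
lemma consC_id (c : Unit ⊕ Unit) (v : List (Unit ⊕ Unit)) : consC c (𝟙 (wordC k v)) = 𝟙 _ :=
  consHom_id (P := ahBarPres k) _ _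

@[simp]
lemma consC_comp (c : Unit ⊕ Unit) (f : wordC k v ⟶ wordC k w) (g : wordC k w ⟶ wordC k x) :
    consC c (f ≫ g) = consC c f ≫ consC c g :=
  consHom_comp (P := ahBarPres k) _ _ _

@[simp]
lemma consC_zero (c : Unit ⊕ Unit) : consC c (0 : wordC k v ⟶ wordC k w) = 0 :=
  consHom_zero (P := ahBarPres k) _

@[simp]
lemma consC_add (c : Unit ⊕ Unit) (f g : wordC k v ⟶ wordC k w) :
    consC c (f + g) = consC c f + consC c g :=
  consHom_add (P := ahBarPres k) _ _ _

@[simp]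
lemma consC_neg (c : Unit ⊕ Unit) (f : wordC k v ⟶ wordC k w) : consC c (-f) = -consC c f :=
  consHom_neg (P := ahBarPres k) _ _

@[simp]
lemma consC_sub (c : Unit ⊕ Unit) (f g : wordC k v ⟶ wordC k w) :
    consC c (f - g) = consC c f - consC c g :=
  consHom_sub (P := ahBarPres k) _ _ _

@[simp]
lemma headC_id (a b : Unit ⊕ Unit) (v : List (Unit ⊕ Unit)) :
    headC (𝟙 (wordC k [a, b])) v = 𝟙 _ :=
  headHom_id (P := ahBarPres k) _ _ _

@[simp]
lemma headC_comp {p q : Unit ⊕ Unit} (f : wordC k [a, b] ⟶ wordC k [c, d])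
    (g : wordC k [c, d] ⟶ wordC k [p, q]) (v : List (Unit ⊕ Unit)) :
    headC (f ≫ g) v = headC f v ≫ headC g v :=
  headHom_comp (P := ahBarPres k) _ _ _

@[simp]
lemma headC_neg (f : wordC k [a, b] ⟶ wordC k [c, d]) (v : List (Unit ⊕ Unit)) :
    headC (-f) v = -headC f v :=
  headHom_neg (P := ahBarPres k) _ _

@[simp]
lemma headC_add (f g : wordC k [a, b] ⟶ wordC k [c, d]) (v : List (Unit ⊕ Unit)) :
    headC (f + g) v = headC f v + headC g v :=
  headHom_add (P := ahBarPres k) _ _ _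

@[simp]
lemma headC_sub (f g : wordC k [a, b] ⟶ wordC k [c, d]) (v : List (Unit ⊕ Unit)) :
    headC (f - g) v = headC f v - headC g v :=
  headHom_sub (P := ahBarPres k) _ _ _

lemma headC_exchange (g : wordC k [a, b] ⟶ wordC k [c, d]) (f : wordC k v ⟶ wordC k w) :
    headC g v ≫ consC c (consC d f) = consC a (consC b f) ≫ headC g w :=
  headHom_exchange (P := ahBarPres k) _ _

variable (k)

/-- The dot of a given colour. -/
def dotC : (a : Unit ⊕ Unit) → (wordC k [a] ⟶ wordC k [a])
  | .inl _ => (blue k).map (dot k)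
  | .inr _ => (red k).map (dot k)

/-- The crossing of two strands of a given colour. -/
def crossC : (a : Unit ⊕ Unit) → (wordC k [a, a] ⟶ wordC k [a, a])
  | .inl _ => (blue k).map (cross k)
  | .inr _ => (red k).map (cross k)

/-- The interchange of two strands of different colours. -/
def swapC : (a b : Unit ⊕ Unit) → (wordC k [a, b] ⟶ wordC k [b, a])
  | .inl _, .inl _ => 𝟙 _
  | .inr _, .inr _ => 𝟙 _
  | .inl _, .inr _ => sigma k
  | .inr _, .inl _ => sigmaInv k

/-- The dumbbell on two strands of different colours, i.e. the inverse of
(dot on the right strand) - (dot on the left strand). -/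
def dumbC : (a b : Unit ⊕ Unit) → (wordC k [a, b] ⟶ wordC k [a, b])
  | .inl _, .inl _ => 0
  | .inr _, .inr _ => 0
  | .inl _, .inr _ => dumbbell k
  | .inr _, .inl _ => -dumbbell' k

/-- A dot on the left one of two strands. -/
def dotL (a b : Unit ⊕ Unit) : wordC k [a, b] ⟶ wordC k [a, b] :=
  dotC k a ▷ wordC k [b]

/-- A dot on the right one of two strands. -/
def dotR (a b : Unit ⊕ Unit) : wordC k [a, b] ⟶ wordC k [a, b] :=
  consC a (dotC k b)

/-- The components of the image of the crossing under the comultiplication. -/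
def crossW (a b c d : Unit ⊕ Unit) : wordC k [a, b] ⟶ wordC k [c, d] :=
  crossEntry k a b c d

lemma sigma_sigmaInv : sigma k ≫ sigmaInv k = 𝟙 _ :=
  Presentation.homMk_eq (P := ahBarPres k) (.rel (LocalizeRel.old
    (P := symProd (ahPres k) (ahPres k))
    (SymProdRel.braid_braidInv (P := ahPres k) (Q := ahPres k) [()] [()])))

lemma sigmaInv_sigma : sigmaInv k ≫ sigma k = 𝟙 _ :=
  Presentation.homMk_eq (P := ahBarPres k) (.rel (LocalizeRel.old
    (P := symProd (ahPres k) (ahPres k))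
    (SymProdRel.braidInv_braid (P := ahPres k) (Q := ahPres k) [()] [()])))

lemma dotL_sigma : dotL k (.inl ()) (.inr ()) ≫ swapC k (.inl ()) (.inr ()) =
    swapC k (.inl ()) (.inr ()) ≫ dotR k (.inr ()) (.inl ()) :=
  Presentation.homMk_eq (P := ahBarPres k) (.rel (LocalizeRel.old
    (P := symProd (ahPres k) (ahPres k)) (SymProdRel.braid_natural_left
      (P := ahPres k) (Q := ahPres k) (dotE k) [()])))

lemma dotR_sigma : dotR k (.inl ()) (.inr ()) ≫ swapC k (.inl ()) (.inr ()) =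
    swapC k (.inl ()) (.inr ()) ≫ dotL k (.inr ()) (.inl ()) :=
  Presentation.homMk_eq (P := ahBarPres k) (.rel (LocalizeRel.old
    (P := symProd (ahPres k) (ahPres k)) (SymProdRel.braid_natural_right
      (P := ahPres k) (Q := ahPres k) [()] (dotE k))))

/-- The braiding of two blue strands with a red strand. -/
def sigmaBBR : wordC k [.inl (), .inl (), .inr ()] ⟶ wordC k [.inr (), .inl (), .inl ()] :=
  Presentation.homMk (P := ahBarPres k)
    (.gen (.old (.braid (P := ahPres k) (Q := ahPres k) [(), ()] [()])))

/-- The braiding of a blue strand with two red strands. -/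
def sigmaBRR : wordC k [.inl (), .inr (), .inr ()] ⟶ wordC k [.inr (), .inr (), .inl ()] :=
  Presentation.homMk (P := ahBarPres k)
    (.gen (.old (.braid (P := ahPres k) (Q := ahPres k) [()] [(), ()])))

/-- The hexagon relation of the symmetric product. The identities in `h` are its identifications of
words, which are trivial for explicit words. -/
lemma sigmaBBR_eq : sigmaBBR k = consC (.inl ()) (swapC k (.inl ()) (.inr ())) ≫
    headC (swapC k (.inl ()) (.inr ())) [.inl ()] := by
  have h : sigmaBBR k = 𝟙 (wordC k _) ≫ consC (.inl ()) (swapC k (.inl ()) (.inr ())) ≫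
      𝟙 (wordC k _) ≫ headC (swapC k (.inl ()) (.inr ())) [.inl ()] ≫ 𝟙 (wordC k _) :=
    Presentation.homMk_eq (P := ahBarPres k) (.rel (LocalizeRel.old
      (P := symProd (ahPres k) (ahPres k)) (SymProdRel.braid_tensor_left
        (P := ahPres k) (Q := ahPres k) [()] [()] [()])))
  rw [h, Category.id_comp, Category.id_comp, Category.comp_id]

lemma sigmaBRR_eq : sigmaBRR k = headC (swapC k (.inl ()) (.inr ())) [.inr ()] ≫
    consC (.inr ()) (swapC k (.inl ()) (.inr ())) := by
  have h : sigmaBRR k = 𝟙 (wordC k _) ≫ headC (swapC k (.inl ()) (.inr ())) [.inr ()] ≫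
      𝟙 (wordC k _) ≫ consC (.inr ()) (swapC k (.inl ()) (.inr ())) ≫ 𝟙 (wordC k _) :=
    Presentation.homMk_eq (P := ahBarPres k) (.rel (LocalizeRel.old
      (P := symProd (ahPres k) (ahPres k)) (SymProdRel.braid_tensor_right
        (P := ahPres k) (Q := ahPres k) [()] [()] [()])))
  rw [h, Category.id_comp, Category.id_comp, Category.comp_id]

lemma blue_cross_sigma : headC (crossC k (.inl ())) [.inr ()] ≫ sigmaBBR k =
    sigmaBBR k ≫ consC (.inr ()) (crossC k (.inl ())) :=
  Presentation.homMk_eq (P := ahBarPres k) (.rel (LocalizeRel.old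
    (P := symProd (ahPres k) (ahPres k)) (SymProdRel.braid_natural_left
      (P := ahPres k) (Q := ahPres k) (crossE k) [()])))

lemma red_cross_sigma : consC (.inl ()) (crossC k (.inr ())) ≫ sigmaBRR k =
    sigmaBRR k ≫ headC (crossC k (.inr ())) [.inl ()] :=
  Presentation.homMk_eq (P := ahBarPres k) (.rel (LocalizeRel.old
    (P := symProd (ahPres k) (ahPres k)) (SymProdRel.braid_natural_right
      (P := ahPres k) (Q := ahPres k) [()] (crossE k))))

/-- Negation of morphisms is multiplication by -1 by definition, so after `sub_eq_add_neg` the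
difference of dots is the localized morphism `dotted` itself. -/
lemma dotted_dumbbell : (dotR k (.inl ()) (.inr ()) - dotL k (.inl ()) (.inr ())) ≫
    dumbC k (.inl ()) (.inr ()) = 𝟙 _ := by
  have h := Presentation.homMk_eq (P := ahBarPres k) (.rel (LocalizeRel.comp_inv
    (P := symProd (ahPres k) (ahPres k)) (f := dotted)))
  rw [sub_eq_add_neg]
  exact h

lemma dumbbell_dotted : dumbC k (.inl ()) (.inr ()) ≫
    (dotR k (.inl ()) (.inr ()) - dotL k (.inl ()) (.inr ())) = 𝟙 _ := by
  have h := Presentation.homMk_eq (P := ahBarPres k) (.rel (LocalizeRel.inv_comp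
    (P := symProd (ahPres k) (ahPres k)) (f := dotted)))
  rw [sub_eq_add_neg]
  exact h

lemma swapC_swapC (a b : Unit ⊕ Unit) : swapC k a b ≫ swapC k b a = 𝟙 _ := by
  rcases a with a | a <;> rcases b with b | b
  · exact Category.comp_id _
  · exact sigma_sigmaInv k
  · exact sigmaInv_sigma k
  · exact Category.comp_id _

lemma swapC_swapC_assoc (a b : Unit ⊕ Unit) {Z : AHBar k} (f : wordC k [a, b] ⟶ Z) :
    swapC k a b ≫ swapC k b a ≫ f = f := by
  rw [← Category.assoc, swapC_swapC, Category.id_comp]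

/-- An interchange turns "right dot minus left dot" into its negative, hence the sign in its
inverse. With this convention the formulas no longer distinguish the two colours, and one case
replaces two below. -/
lemma dumbC_swap (h : a ≠ b) : dumbC k b a = -(swapC k b a ≫ dumbC k a b ≫ swapC k a b) := by
  have e : dumbC k (.inr ()) (.inl ()) = -(swapC k (.inr ()) (.inl ()) ≫
    dumbC k (.inl ()) (.inr ()) ≫ swapC k (.inl ()) (.inr ())) := rfl
  rcases a with ⟨⟩ | ⟨⟩ <;> rcases b with ⟨⟩ | ⟨⟩
  · exact absurd rfl h
  · exact e
  · rw [e]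
    simp only [Preadditive.neg_comp, Preadditive.comp_neg, neg_neg, Category.assoc,
      swapC_swapC, Category.comp_id, swapC_swapC_assoc]
  · exact absurd rfl h

lemma dotL_swapC (h : a ≠ b) : dotL k a b ≫ swapC k a b = swapC k a b ≫ dotR k b a := by
  rcases a with ⟨⟩ | ⟨⟩ <;> rcases b with ⟨⟩ | ⟨⟩
  · exact absurd rfl h
  · exact dotL_sigma k
  · calc dotL k (.inr ()) (.inl ()) ≫ swapC k (.inr ()) (.inl ()) =
        swapC k (.inr ()) (.inl ()) ≫ (swapC k (.inl ()) (.inr ()) ≫ dotL k (.inr ()) (.inl ())) ≫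
          swapC k (.inr ()) (.inl ()) := by simp only [Category.assoc, swapC_swapC_assoc]
      _ = _ := by rw [← dotR_sigma, Category.assoc, swapC_swapC, Category.comp_id]
  · exact absurd rfl h

lemma dotR_swapC (h : a ≠ b) : dotR k a b ≫ swapC k a b = swapC k a b ≫ dotL k b a := by
  have h' := dotL_swapC k h.symm
  calc dotR k a b ≫ swapC k a b =
        swapC k a b ≫ (swapC k b a ≫ dotR k a b) ≫ swapC k a b := by
          simp only [Category.assoc, swapC_swapC_assoc]
      _ = _ := by rw [← h', Category.assoc, swapC_swapC, Category.comp_id]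

lemma dotted_dumbC (h : a ≠ b) : (dotR k a b - dotL k a b) ≫ dumbC k a b = 𝟙 _ := by
  rcases a with ⟨⟩ | ⟨⟩ <;> rcases b with ⟨⟩ | ⟨⟩
  · exact absurd rfl h
  · exact dotted_dumbbell k
  · rw [dumbC_swap k h.symm, Preadditive.comp_neg, ← Preadditive.neg_comp, neg_sub, ← Category.assoc,
      Preadditive.sub_comp, dotL_swapC k h, dotR_swapC k h, ← Preadditive.comp_sub, Category.assoc,
      ← Category.assoc (_ - _), dotted_dumbbell k, Category.id_comp, swapC_swapC]
  · exact absurd rfl h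

lemma dumbC_dotted (h : a ≠ b) : dumbC k a b ≫ (dotR k a b - dotL k a b) = 𝟙 _ := by
  rcases a with ⟨⟩ | ⟨⟩ <;> rcases b with ⟨⟩ | ⟨⟩
  · exact absurd rfl h
  · exact dumbbell_dotted k
  · rw [dumbC_swap k h.symm, Preadditive.neg_comp, ← Preadditive.comp_neg, neg_sub, Category.assoc,
      Category.assoc, Preadditive.comp_sub, ← dotR_swapC k h.symm, ← dotL_swapC k h.symm,
      ← Preadditive.sub_comp, ← Category.assoc (dumbC k _ _), dumbbell_dotted k, Category.id_comp,
      swapC_swapC]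
  · exact absurd rfl h

lemma headC_swapC_swapC (a b : Unit ⊕ Unit) (v : List (Unit ⊕ Unit)) :
    headC (swapC k a b) v ≫ headC (swapC k b a) v = 𝟙 _ := by
  rw [← headC_comp, swapC_swapC, headC_id]

lemma consC_swapC_swapC (a b c : Unit ⊕ Unit) :
    consC c (swapC k a b) ≫ consC c (swapC k b a) = 𝟙 _ := by
  rw [← consC_comp, swapC_swapC, consC_id]

/-- For two blue strands this is naturality of the braiding with a red strand. For two red strands
it is the naturality statement with the interchanges moved to the other side by their inverses. -/
lemma crossC_swapC (h : a ≠ b) : headC (crossC k a) [b] ≫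
      consC a (swapC k a b) ≫ headC (swapC k a b) [a] =
    consC a (swapC k a b) ≫ headC (swapC k a b) [a] ≫ consC b (crossC k a) := by
  rcases a with ⟨⟩ | ⟨⟩ <;> rcases b with ⟨⟩ | ⟨⟩
  · exact absurd rfl h
  · have := blue_cross_sigma k
    rwa [sigmaBBR_eq, Category.assoc] at this
  · have := red_cross_sigma k
    rw [sigmaBRR_eq, Category.assoc] at this
    have e₁ := headC_swapC_swapC k (.inr ()) (.inl ()) [.inr ()]
    have e₂ := consC_swapC_swapC k (.inr ()) (.inl ()) (.inr ())
    have e₁' := headC_swapC_swapC k (.inl ()) (.inr ()) [.inr ()]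
    have e₂' := consC_swapC_swapC k (.inl ()) (.inr ()) (.inr ())
    have := congrArg (fun t => (consC (.inr ()) (swapC k (.inr ()) (.inl ())) ≫
      headC (swapC k (.inr ()) (.inl ())) [.inr ()]) ≫ t ≫
        consC (.inr ()) (swapC k (.inr ()) (.inl ())) ≫
          headC (swapC k (.inr ()) (.inl ())) [.inr ()]) this
    simp only [Category.assoc] at this
    rw [reassoc_of% e₁, reassoc_of% e₂, reassoc_of% e₂', e₁', Category.comp_id] at this
    exact this.symm
  · exact absurd rfl h

lemma crossC_quad (a : Unit ⊕ Unit) : crossC k a ≫ crossC k a = 𝟙 _ := by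
  rcases a with a | a
  · exact ((blue k).map_comp _ _).symm.trans ((congrArg _ (cross_cross k)).trans ((blue k).map_id _))
  · exact ((red k).map_comp _ _).symm.trans ((congrArg _ (cross_cross k)).trans ((red k).map_id _))

lemma blue_dotLeftE : (blue k).map (Presentation.homMk (P := ahPres k) (dotLeftE k)) =
    dotL k (Sum.inl ()) (Sum.inl ()) := by
  change 𝟙 (wordC k _) ≫ dotL k (Sum.inl ()) (Sum.inl ()) ≫ 𝟙 (wordC k _) = _
  rw [Category.id_comp, Category.comp_id]

lemma blue_dotRightE : (blue k).map (Presentation.homMk (P := ahPres k) (dotRightE k)) =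
    dotR k (Sum.inl ()) (Sum.inl ()) := by
  change 𝟙 (wordC k _) ≫ dotR k (Sum.inl ()) (Sum.inl ()) ≫ 𝟙 (wordC k _) = _
  rw [Category.id_comp, Category.comp_id]

lemma blue_crossLeftE : (blue k).map (Presentation.homMk (P := ahPres k) (crossLeftE k)) =
    headC (crossC k (Sum.inl ())) [Sum.inl ()] := by
  change 𝟙 (wordC k _) ≫ headC (crossC k (Sum.inl ())) [Sum.inl ()] ≫ 𝟙 (wordC k _) = _
  rw [Category.id_comp, Category.comp_id]

lemma blue_crossRightE : (blue k).map (Presentation.homMk (P := ahPres k) (crossRightE k)) =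
    consC (Sum.inl ()) (crossC k (Sum.inl ())) := by
  change 𝟙 (wordC k _) ≫ consC (Sum.inl ()) (crossC k (Sum.inl ())) ≫ 𝟙 (wordC k _) = _
  rw [Category.id_comp, Category.comp_id]

lemma red_dotLeftE : (red k).map (Presentation.homMk (P := ahPres k) (dotLeftE k)) =
    dotL k (Sum.inr ()) (Sum.inr ()) := by
  change 𝟙 (wordC k _) ≫ dotL k (Sum.inr ()) (Sum.inr ()) ≫ 𝟙 (wordC k _) = _
  rw [Category.id_comp, Category.comp_id]

lemma red_dotRightE : (red k).map (Presentation.homMk (P := ahPres k) (dotRightE k)) =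
    dotR k (Sum.inr ()) (Sum.inr ()) := by
  change 𝟙 (wordC k _) ≫ dotR k (Sum.inr ()) (Sum.inr ()) ≫ 𝟙 (wordC k _) = _
  rw [Category.id_comp, Category.comp_id]

lemma red_crossLeftE : (red k).map (Presentation.homMk (P := ahPres k) (crossLeftE k)) =
    headC (crossC k (Sum.inr ())) [Sum.inr ()] := by
  change 𝟙 (wordC k _) ≫ headC (crossC k (Sum.inr ())) [Sum.inr ()] ≫ 𝟙 (wordC k _) = _
  rw [Category.id_comp, Category.comp_id]

lemma red_crossRightE : (red k).map (Presentation.homMk (P := ahPres k) (crossRightE k)) =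
    consC (Sum.inr ()) (crossC k (Sum.inr ())) := by
  change 𝟙 (wordC k _) ≫ consC (Sum.inr ()) (crossC k (Sum.inr ())) ≫ 𝟙 (wordC k _) = _
  rw [Category.id_comp, Category.comp_id]

lemma crossC_dot (a : Unit ⊕ Unit) : dotL k a a ≫ crossC k a = crossC k a ≫ dotR k a a + 𝟙 _ := by
  have h := Presentation.homMk_eq (P := ahPres k) (.rel AHRel.dot_cross)
  rcases a with ⟨⟩ | ⟨⟩
  · rw [← blue_dotLeftE, ← blue_dotRightE]
    exact congrArg (blue k).map h
  · rw [← red_dotLeftE, ← red_dotRightE]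
    exact congrArg (red k).map h

lemma dot_crossC (a : Unit ⊕ Unit) : crossC k a ≫ dotL k a a = dotR k a a ≫ crossC k a + 𝟙 _ := by
  have h := Presentation.homMk_eq (P := ahPres k) (.rel AHRel.cross_dot)
  rcases a with ⟨⟩ | ⟨⟩
  · rw [← blue_dotLeftE, ← blue_dotRightE]
    exact congrArg (blue k).map h
  · rw [← red_dotLeftE, ← red_dotRightE]
    exact congrArg (red k).map h

lemma crossC_braid (a : Unit ⊕ Unit) : headC (crossC k a) [a] ≫
    consC a (crossC k a) ≫ headC (crossC k a) [a] =
      consC a (crossC k a) ≫ headC (crossC k a) [a] ≫ consC a (crossC k a) := by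
  have h := Presentation.homMk_eq (P := ahPres k) (.rel AHRel.braid)
  rcases a with ⟨⟩ | ⟨⟩
  · rw [← blue_crossLeftE, ← blue_crossRightE]
    exact congrArg (blue k).map h
  · rw [← red_crossLeftE, ← red_crossRightE]
    exact congrArg (red k).map h

lemma crossW_same (a : Unit ⊕ Unit) : crossW k a a a a = crossC k a := by
  rcases a with a | a <;> rfl

lemma crossW_self (h : a ≠ b) : crossW k a b a b = -dumbC k a b := by
  rcases a with a | a <;> rcases b with b | b
  · exact absurd rfl h
  · rfl
  · exact (neg_neg _).symm
  · exact absurd rfl h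

/-- The opposite signs in the two mixed components of `crossEntry` are absorbed by the sign in
`dumbC`. -/
lemma crossW_swap (h : a ≠ b) :
    crossW k a b b a = swapC k a b - dumbC k a b ≫ swapC k a b := by
  rcases a with a | a <;> rcases b with b | b
  · exact absurd rfl h
  · rfl
  · change sigmaInv k + dumbbell' k ≫ sigmaInv k = sigmaInv k - (-dumbbell' k) ≫ sigmaInv k
    rw [Preadditive.neg_comp, sub_neg_eq_add]
  · exact absurd rfl h

lemma crossW_eq_zero (h : ¬ (c = a ∧ d = b)) (h' : ¬ (c = b ∧ d = a)) :
    crossW k a b c d = 0 := by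
  rcases a with ⟨⟩ | ⟨⟩ <;> rcases b with ⟨⟩ | ⟨⟩ <;> rcases c with ⟨⟩ | ⟨⟩ <;> rcases d with ⟨⟩ | ⟨⟩ <;>
    first | rfl | exact absurd ⟨rfl, rfl⟩ h | exact absurd ⟨rfl, rfl⟩ h'

end Colours

/-! ### The braid relation for two strands of one colour and one of the other -/

section BraidBlock

universe v w

variable {D : Type w} [Category.{v} D] [Preadditive D] {X Y Z T : D}
  {p : X ⟶ Y} {p' : Y ⟶ X} {q : Y ⟶ Z} {q' : Z ⟶ Y} {s d e : X ⟶ X}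
  {dY dY' : Y ⟶ Y} {dZ t : Z ⟶ Z}

/-- The relations between the components of the comultiplication of a crossing on three strands,
two of which have the same colour. -/
structure BraidBlock (p : X ⟶ Y) (p' : Y ⟶ X) (q : Y ⟶ Z) (q' : Z ⟶ Y) (s d e : X ⟶ X)
    (dY dY' : Y ⟶ Y) (dZ t : Z ⟶ Z) : Prop where
  hp : p ≫ p' = 𝟙 X
  hp' : p' ≫ p = 𝟙 Y
  hq : q ≫ q' = 𝟙 Y
  hq' : q' ≫ q = 𝟙 Z
  quad : s ≫ s = 𝟙 X
  sd : s ≫ d = e ≫ s - e ≫ d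
  se : s ≫ e = d ≫ s + d ≫ e
  de : d ≫ e = e ≫ d
  hdY : dY = p' ≫ e ≫ p
  hdY' : dY' = -(p' ≫ d ≫ p)
  hdZ : dZ = -(q' ≫ p' ≫ e ≫ p ≫ q)
  ht : t = q' ≫ p' ≫ s ≫ p ≫ q

variable (H : BraidBlock p p' q q' s d e dY dY' dZ t) (gX : X ⟶ T) (gY : Y ⟶ T) (gZ : Z ⟶ T)
include H

/-- The row of the braid relation that starts at `X`, with `gX`, `gY`, `gZ` standing for the
components of any morphism applied afterwards. Transport along `p` and `q` expresses every entry by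
`s`, `d`, `e`; the rules for these move the crossing to the right and order the dumbbells, after
which both sides agree term by term. -/
lemma BraidBlock.rowX :
    s ≫ (-d ≫ s ≫ gX + (p - d ≫ p) ≫ (-dY ≫ gY + (q - dY ≫ q) ≫ gZ)) =
      -d ≫ s ≫ (-d ≫ gX + (p - d ≫ p) ≫ gY) +
        (p - d ≫ p) ≫ (-dY ≫ (-dY' ≫ gY + (p' - dY' ≫ p') ≫ gX) + (q - dY ≫ q) ≫ t ≫ gZ) := by
  obtain ⟨hp, hp', hq, hq', quad, sd, se, de, rfl, rfl, rfl, rfl⟩ := H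
  simp only [Preadditive.comp_add, Preadditive.add_comp, Preadditive.comp_sub, Preadditive.sub_comp,
    Preadditive.comp_neg, Preadditive.neg_comp, Category.assoc, reassoc_of% hp, reassoc_of% hq,
    reassoc_of% quad, reassoc_of% sd, reassoc_of% se, reassoc_of% de]
  abel

lemma BraidBlock.rowY :
    -dY ≫ (-dY' ≫ (-dY ≫ gY + (q - dY ≫ q) ≫ gZ) + (p' - dY' ≫ p') ≫ s ≫ gX) +
        (q - dY ≫ q) ≫ t ≫ (-dZ ≫ gZ + (q' - dZ ≫ q') ≫ gY) =
      -dY' ≫ (-dY ≫ (-dY' ≫ gY + (p' - dY' ≫ p') ≫ gX) + (q - dY ≫ q) ≫ t ≫ gZ) +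
        (p' - dY' ≫ p') ≫ s ≫ (-d ≫ gX + (p - d ≫ p) ≫ gY) := by
  obtain ⟨hp, hp', hq, hq', quad, sd, se, de, rfl, rfl, rfl, rfl⟩ := H
  simp only [Preadditive.comp_add, Preadditive.add_comp, Preadditive.comp_sub, Preadditive.sub_comp,
    Preadditive.comp_neg, Preadditive.neg_comp, Category.assoc, reassoc_of% hp, reassoc_of% hq,
    reassoc_of% sd, reassoc_of% se, reassoc_of% de]
  abel

lemma BraidBlock.rowZ :
    -dZ ≫ t ≫ (-dZ ≫ gZ + (q' - dZ ≫ q') ≫ gY) + (q' - dZ ≫ q') ≫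
        (-dY' ≫ (-dY ≫ gY + (q - dY ≫ q) ≫ gZ) + (p' - dY' ≫ p') ≫ s ≫ gX) =
      t ≫ (-dZ ≫ t ≫ gZ + (q' - dZ ≫ q') ≫ (-dY' ≫ gY + (p' - dY' ≫ p') ≫ gX)) := by
  obtain ⟨hp, hp', hq, hq', quad, sd, se, de, rfl, rfl, rfl, rfl⟩ := H
  simp only [Preadditive.comp_add, Preadditive.add_comp, Preadditive.comp_sub, Preadditive.sub_comp,
    Preadditive.comp_neg, Preadditive.neg_comp, Category.assoc, reassoc_of% hp, reassoc_of% hq,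
    reassoc_of% quad, reassoc_of% sd, reassoc_of% se, reassoc_of% de]
  abel

end BraidBlock

/-! ### Commutation of dumbbells with crossings -/

section CrossingComponents

variable (k : Type u) [Field k] {a b c d : Unit ⊕ Unit} {v w x y : List (Unit ⊕ Unit)}

/-- A dot on the leftmost strand. -/
def dotH (a : Unit ⊕ Unit) (v : List (Unit ⊕ Unit)) : wordC k (a :: v) ⟶ wordC k (a :: v) :=
  dotC k a ▷ wordC k v

lemma dotH_consC (a : Unit ⊕ Unit) (f : wordC k v ⟶ wordC k w) :
    dotH k a v ≫ consC a f = consC a f ≫ dotH k a w :=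
  (whisker_exchange (dotC k a) f).symm

lemma headC_dotL (a b : Unit ⊕ Unit) (v : List (Unit ⊕ Unit)) :
    headC (dotL k a b) v = dotH k a (b :: v) :=
  ((whiskerRight_tensor (dotC k a) (wordC k [b]) (wordC k v)).trans
    ((Category.id_comp _).trans (Category.comp_id _))).symm

lemma headC_dotR (a b : Unit ⊕ Unit) (v : List (Unit ⊕ Unit)) :
    headC (dotR k a b) v = consC a (dotH k b v) :=
  (whisker_assoc (wordC k [a]) (dotC k b) (wordC k v)).trans
    ((Category.id_comp _).trans (Category.comp_id _))

/-- The three objects are the words aab, aba and baa. On aab with dots x₁, x₂, x₃, the morphism `d`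
is inverse to x₃ - x₂ and `e` to x₃ - x₁. The dot relations give (x₃ - x₁)s = s(x₃ - x₂) - 1 and
s(x₃ - x₁) = (x₃ - x₂)s - 1, with composition from left to right; composing with the inverses on
both sides yields the rules for `s ≫ d` and `s ≫ e`. -/
lemma braidBlock_entries (h : a ≠ b) : BraidBlock (consC a (swapC k a b)) (consC a (swapC k b a))
    (headC (swapC k a b) [a]) (headC (swapC k b a) [a]) (headC (crossC k a) [b])
    (consC a (dumbC k a b))
    (consC a (swapC k a b) ≫ headC (dumbC k a b) [a] ≫ consC a (swapC k b a))
    (headC (dumbC k a b) [a]) (consC a (dumbC k b a)) (headC (dumbC k b a) [a])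
    (consC b (crossC k a)) := by
  have hp := consC_swapC_swapC k a b a
  have hp' := consC_swapC_swapC k b a a
  have hq := headC_swapC_swapC k a b [a]
  have hq' := headC_swapC_swapC k b a [a]
  have hsy : headC (crossC k a) [b] ≫ consC a (dotR k a b) =
    consC a (dotR k a b) ≫ headC (crossC k a) [b] := headC_exchange _ _
  -- The interchange carries the difference of the first two dots on aba to x₃ - x₁ on aab. This
  -- identifies `e`, a conjugated dumbbell, as the inverse of the latter.
  have hF : consC a (swapC k a b) ≫ headC (dotR k a b - dotL k a b) [a] =
      (consC a (dotR k a b) - dotH k a [a, b]) ≫ consC a (swapC k a b) := by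
    rw [headC_sub, headC_dotR, headC_dotL, Preadditive.comp_sub, Preadditive.sub_comp, dotH_consC,
      ← consC_comp, ← consC_comp, dotR_swapC k h]
    rfl
  have hx2 : headC (dotR k a a) [b] = consC a (dotL k a b) := headC_dotR k a a [b]
  have hxs : dotH k a [a, b] ≫ headC (crossC k a) [b] =
      headC (crossC k a) [b] ≫ consC a (dotL k a b) + 𝟙 _ := by
    rw [← headC_dotL, ← headC_comp, crossC_dot, headC_add, headC_comp, headC_id, hx2]
  have hsx : headC (crossC k a) [b] ≫ dotH k a [a, b] =
      consC a (dotL k a b) ≫ headC (crossC k a) [b] + 𝟙 _ := by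
    rw [← headC_dotL, ← headC_comp, dot_crossC, headC_add, headC_comp, headC_id, hx2]
  generalize he : consC a (swapC k a b) ≫ headC (dumbC k a b) [a] ≫ consC a (swapC k b a) = e
  generalize hd : consC a (dumbC k a b) = d
  generalize hs : headC (crossC k a) [b] = s at *
  have hFe : (consC a (dotR k a b) - dotH k a [a, b]) ≫ e = 𝟙 _ := by
    rw [← he, ← Category.assoc, ← hF, Category.assoc, ← Category.assoc (headC _ _),
      ← headC_comp, dotted_dumbC k h, headC_id, Category.id_comp, hp]
  have heF : e ≫ (consC a (dotR k a b) - dotH k a [a, b]) = 𝟙 _ := by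
    rw [← Category.comp_id (e ≫ _), ← hp, Category.assoc, ← Category.assoc (_ - _), ← hF, ← he]
    simp only [Category.assoc]
    rw [reassoc_of% hp', ← Category.assoc (headC _ _), ← headC_comp, dumbC_dotted k h, headC_id,
      Category.id_comp]
  have hEd : (consC a (dotR k a b) - consC a (dotL k a b)) ≫ d = 𝟙 _ := by
    rw [← hd, ← consC_sub, ← consC_comp, dotted_dumbC k h, consC_id]
  have hdE : d ≫ (consC a (dotR k a b) - consC a (dotL k a b)) = 𝟙 _ := by
    rw [← hd, ← consC_sub, ← consC_comp, dumbC_dotted k h, consC_id]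
  have hxd : dotH k a [a, b] ≫ d = d ≫ dotH k a [a, b] := by
    rw [← hd, dotH_consC]
  -- The dot x₃ commutes with x₃ - x₂ and therefore with its inverse.
  have hyd : consC a (dotR k a b) ≫ d = d ≫ consC a (dotR k a b) := by
    have hxy : dotL k a b ≫ dotR k a b = dotR k a b ≫ dotL k a b := dotH_consC k a (dotC k b)
    have h₁ := dumbC_dotted k h
    have h₂ := dotted_dumbC k h
    have h₃ : (dotR k a b - dotL k a b) ≫ dotR k a b = dotR k a b ≫ (dotR k a b - dotL k a b) := by
      rw [Preadditive.comp_sub, Preadditive.sub_comp, hxy]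
    rw [← hd, ← consC_comp, ← consC_comp]
    congr 1
    calc dotR k a b ≫ dumbC k a b =
        dumbC k a b ≫ ((dotR k a b - dotL k a b) ≫ dotR k a b) ≫ dumbC k a b := by
          simp only [Category.assoc]
          rw [reassoc_of% h₁]
      _ = _ := by
          rw [h₃]
          simp only [Category.assoc]
          rw [h₂, Category.comp_id]
  have hFd : (consC a (dotR k a b) - dotH k a [a, b]) ≫ d =
      d ≫ (consC a (dotR k a b) - dotH k a [a, b]) := by
    rw [Preadditive.comp_sub, Preadditive.sub_comp, hyd, hxd]
  have hFs : (consC a (dotR k a b) - dotH k a [a, b]) ≫ s =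
      s ≫ (consC a (dotR k a b) - consC a (dotL k a b)) - 𝟙 _ := by
    rw [Preadditive.comp_sub, Preadditive.sub_comp, hsy, hxs, sub_sub]
  have hsF : s ≫ (consC a (dotR k a b) - dotH k a [a, b]) =
      (consC a (dotR k a b) - consC a (dotL k a b)) ≫ s - 𝟙 _ := by
    rw [Preadditive.comp_sub, Preadditive.sub_comp, hsy, hsx, sub_sub]
  refine ⟨hp, hp', hq, hq', ?_, ?_, ?_, ?_, ?_, ?_, ?_, ?_⟩
  · rw [← hs, ← headC_comp, crossC_quad, headC_id]
  · calc s ≫ d = e ≫ ((consC a (dotR k a b) - dotH k a [a, b]) ≫ s) ≫ d := by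
          rw [Category.assoc, reassoc_of% heF]
      _ = _ := by
          rw [hFs, Preadditive.sub_comp, Category.assoc, hEd, Category.comp_id, Category.id_comp,
            Preadditive.comp_sub]
  · have : d ≫ (s ≫ (consC a (dotR k a b) - dotH k a [a, b])) ≫ e = d ≫ s := by
      rw [Category.assoc, hFe, Category.comp_id]
    rw [← this, hsF, Preadditive.sub_comp, Preadditive.comp_sub, Category.assoc, reassoc_of% hdE,
      Category.id_comp, sub_add_cancel]
  · calc d ≫ e = e ≫ ((consC a (dotR k a b) - dotH k a [a, b]) ≫ d) ≫ e := by
          rw [Category.assoc, reassoc_of% heF]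
      _ = _ := by rw [hFd, Category.assoc, hFe, Category.comp_id]
  · rw [← he]
    simp only [Category.assoc]
    rw [hp', reassoc_of% hp', Category.comp_id]
  · rw [dumbC_swap k h, consC_neg, consC_comp, consC_comp, hd]
  · rw [dumbC_swap k h, headC_neg, headC_comp, headC_comp, ← he]
    simp only [Category.assoc]
    rw [reassoc_of% hp', reassoc_of% hp']
  · have := crossC_swapC k h
    rw [hs] at this
    rw [this, reassoc_of% hp', reassoc_of% hq']

end CrossingComponents

/-! ### Products of matrices with few nonzero entries -/

section MatrixRows

universe v₁ u₁

variable {C : Type u₁} [Category.{v₁} C] [Preadditive C]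

/-- A crossing preserves the set of colours of its two strands, so a row of its matrix is supported
in one position (equal colours) or two positions (different colours). This lemma and the next one
cover these cases. -/
lemma mat_comp_single {M N K : Mat_ C} (f : M ⟶ N) (g : N ⟶ K) (i : M.ι) (j : N.ι) (l : K.ι)
    (h : ∀ j', j' ≠ j → f i j' = 0) : (f ≫ g) i l = f i j ≫ g j l := by
  classical
  rw [Mat_.comp_apply, Finset.sum_eq_single j]
  · intro j' _ hj
    rw [h j' hj, zero_comp]
  · simp

lemma mat_comp_pair {M N K : Mat_ C} (f : M ⟶ N) (g : N ⟶ K) (i : M.ι) (j₁ j₂ : N.ι) (l : K.ι)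
    (hne : j₁ ≠ j₂) (h : ∀ j', j' ≠ j₁ → j' ≠ j₂ → f i j' = 0) :
    (f ≫ g) i l = f i j₁ ≫ g j₁ l + f i j₂ ≫ g j₂ l := by
  classical
  rw [Mat_.comp_apply, ← Finset.sum_subset (Finset.subset_univ {j₁, j₂}), Finset.sum_pair hne]
  intro j' _ hj
  simp only [Finset.mem_insert, Finset.mem_singleton, not_or] at hj
  rw [h j' hj.1 hj.2, zero_comp]

instance matMonoidalLinear {R : Type*} [Field R] [Linear R C] [MonoidalCategory C]
    [MonoidalPreadditive C] [MonoidalLinear R C] : MonoidalLinear R (Mat_ C) where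
  whiskerLeft_smul M _ _ r f := by
    ext p q
    exact tensorHom_smul r ((𝟙 M : M ⟶ M) p.1 q.1) (f p.2 q.2)
  smul_whiskerRight r _ _ f M := by
    ext p q
    exact smul_tensorHom r (f p.1 q.1) ((𝟙 M : M ⟶ M) p.2 q.2)

end MatrixRows

/-! ### Existence of the comultiplication functor -/

section Comultiplication

variable (k : Type u) [Field k] {a b c d : Unit ⊕ Unit} {M : Mat_ (AHBar k)}

variable {k} in
/-- The components of a morphism out of the tensor square of blue plus red. -/
def entTwo (g : blueRed k ⊗ blueRed k ⟶ M) (a b : Unit ⊕ Unit) (j : M.ι) : wordC k [a, b] ⟶ M.X j :=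
  g (a, b) j

variable {k} in
/-- The components of a morphism out of the tensor cube of blue plus red. -/
def entThree (g : blueRed k ⊗ blueRed k ⊗ blueRed k ⟶ M) (a b c : Unit ⊕ Unit) (j : M.ι) :
    wordC k [a, b, c] ⟶ M.X j :=
  g (a, b, c) j

variable {k} in
lemma entTwo_ext {f g : blueRed k ⊗ blueRed k ⟶ M}
    (h : ∀ (a b : Unit ⊕ Unit) (j : M.ι), entTwo f a b j = entTwo g a b j) : f = g := by
  ext ⟨a, b⟩ j
  exact h a b j

variable {k} in
lemma entThree_ext {f g : blueRed k ⊗ blueRed k ⊗ blueRed k ⟶ M}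
    (h : ∀ (a b c : Unit ⊕ Unit) (j : M.ι), entThree f a b c j = entThree g a b c j) : f = g := by
  ext ⟨a, b, c⟩ j
  exact h a b c j

/-- The crossing of the first two factors of the tensor cube. -/
def crossLeftMat : blueRed k ⊗ blueRed k ⊗ blueRed k ⟶ blueRed k ⊗ blueRed k ⊗ blueRed k :=
  fun w w' => (crossMat k ▷ blueRed k) ((w.1, w.2.1), w.2.2) ((w'.1, w'.2.1), w'.2.2)

/-- The crossing of the last two factors of the tensor cube. -/
def crossRightMat : blueRed k ⊗ blueRed k ⊗ blueRed k ⟶ blueRed k ⊗ blueRed k ⊗ blueRed k :=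
  blueRed k ◁ crossMat k

/-- Reindexing by triples of colours frees the braid relation from associators. -/
lemma crossMat_associator : (crossMat k ▷ blueRed k) ≫ (α_ _ _ _).hom =
    (α_ _ _ _).hom ≫ crossLeftMat k := by
  ext ⟨⟨a, b⟩, c⟩ ⟨a', b', c'⟩
  refine (comp_matOfMap_apply (M := (blueRed k ⊗ blueRed k) ⊗ blueRed k)
    (N := blueRed k ⊗ blueRed k ⊗ blueRed k) (Equiv.prodAssoc _ _ _) (Equiv.injective _) _
    (crossMat k ▷ blueRed k) ((a, b), c) ((a', b'), c')).trans (Eq.trans ?_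
    (matOfMap_comp_apply (M := (blueRed k ⊗ blueRed k) ⊗ blueRed k)
    (N := blueRed k ⊗ blueRed k ⊗ blueRed k) (Equiv.prodAssoc _ _ _) _ (crossLeftMat k)
      ((a, b), c) (a', b', c')).symm)
  exact (Category.comp_id _).trans (Category.id_comp _).symm

lemma crossLeftMat_apply (a b c a' b' : Unit ⊕ Unit) :
    crossLeftMat k (a, b, c) (a', b', c) = headC (crossW k a b a' b') [c] :=
  congrArg (crossEntry k a b a' b' ⊗ₘ ·) (Mat_.id_apply_self (blueRed k) c)

lemma crossRightMat_apply (a b c b' c' : Unit ⊕ Unit) :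
    crossRightMat k (a, b, c) (a, b', c') = consC a (crossW k b c b' c') :=
  congrArg (· ⊗ₘ crossEntry k b c b' c') (Mat_.id_apply_self (blueRed k) a)

lemma crossLeftMat_eq_zero {a b c a' b' c' : Unit ⊕ Unit} (h : c ≠ c' ∨ crossW k a b a' b' = 0) :
    crossLeftMat k (a, b, c) (a', b', c') = 0 := by
  rcases h with h | h
  · exact (congrArg (crossEntry k a b a' b' ⊗ₘ ·) (Mat_.id_apply_of_ne (blueRed k) c c' h)).trans
      (MonoidalPreadditive.tensor_zero _)
  · exact (congrArg (· ⊗ₘ (𝟙 (blueRed k) : blueRed k ⟶ blueRed k) c c') h).trans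
      (MonoidalPreadditive.zero_tensor _)

lemma crossRightMat_eq_zero {a b c a' b' c' : Unit ⊕ Unit} (h : a ≠ a' ∨ crossW k b c b' c' = 0) :
    crossRightMat k (a, b, c) (a', b', c') = 0 := by
  rcases h with h | h
  · exact (congrArg (· ⊗ₘ crossEntry k b c b' c') (Mat_.id_apply_of_ne (blueRed k) a a' h)).trans
      (MonoidalPreadditive.zero_tensor _)
  · exact (congrArg ((𝟙 (blueRed k) : blueRed k ⟶ blueRed k) a a' ⊗ₘ ·) h).trans
      (MonoidalPreadditive.tensor_zero _)

lemma entTwo_cross_same (g : blueRed k ⊗ blueRed k ⟶ M) (a : Unit ⊕ Unit) (j : M.ι) :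
    entTwo (crossMat k ≫ g) a a j = crossC k a ≫ entTwo g a a j := by
  rw [← crossW_same]
  refine mat_comp_single (crossMat k) g (a, a) (a, a) j ?_
  rintro ⟨a', b'⟩ hne
  refine crossW_eq_zero k (c := a') (d := b') ?_ ?_ <;> (rintro ⟨rfl, rfl⟩; exact hne rfl)

lemma entTwo_cross_ne (g : blueRed k ⊗ blueRed k ⟶ M) (h : a ≠ b) (j : M.ι) :
    entTwo (crossMat k ≫ g) a b j = -dumbC k a b ≫ entTwo g a b j +
      (swapC k a b - dumbC k a b ≫ swapC k a b) ≫ entTwo g b a j := by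
  rw [← Preadditive.neg_comp, ← crossW_swap k h, ← crossW_self k h]
  refine mat_comp_pair (crossMat k) g (a, b) (a, b) (b, a) j (fun e => h (congrArg Prod.fst e)) ?_
  rintro ⟨a', b'⟩ hne hne'
  refine crossW_eq_zero k (c := a') (d := b') ?_ ?_
  · rintro ⟨rfl, rfl⟩; exact hne rfl
  · rintro ⟨rfl, rfl⟩; exact hne' rfl

lemma entTwo_dotLeft (g : blueRed k ⊗ blueRed k ⟶ M) (a b : Unit ⊕ Unit) (j : M.ι) :
    entTwo ((dotMat k ▷ blueRed k) ≫ g) a b j = dotL k a b ≫ entTwo g a b j := by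
  refine (mat_comp_single (dotMat k ▷ blueRed k) g (a, b) (a, b) j ?_).trans ?_
  · rintro ⟨a', b'⟩ hne
    by_cases hb : b = b'
    · subst hb
      have : dotMat k a a' = 0 := by
        rcases a with ⟨⟩ | ⟨⟩ <;> rcases a' with ⟨⟩ | ⟨⟩ <;> first | rfl | exact absurd rfl hne
      exact (congrArg (· ⊗ₘ (𝟙 (blueRed k) : blueRed k ⟶ blueRed k) b b) this).trans
        (MonoidalPreadditive.zero_tensor _)
    · exact (congrArg (dotMat k a a' ⊗ₘ ·) (Mat_.id_apply_of_ne (blueRed k) b b' hb)).trans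
        (MonoidalPreadditive.tensor_zero _)
  · refine congrArg (· ≫ entTwo g a b j) ?_
    refine (congrArg (dotMat k a a ⊗ₘ ·) (Mat_.id_apply_self (blueRed k) b)).trans ?_
    rcases a with ⟨⟩ | ⟨⟩ <;> rfl

lemma entTwo_dotRight (g : blueRed k ⊗ blueRed k ⟶ M) (a b : Unit ⊕ Unit) (j : M.ι) :
    entTwo ((blueRed k ◁ dotMat k) ≫ g) a b j = dotR k a b ≫ entTwo g a b j := by
  refine (mat_comp_single (blueRed k ◁ dotMat k) g (a, b) (a, b) j ?_).trans ?_
  · rintro ⟨a', b'⟩ hne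
    by_cases hb : a = a'
    · subst hb
      have : dotMat k b b' = 0 := by
        rcases b with ⟨⟩ | ⟨⟩ <;> rcases b' with ⟨⟩ | ⟨⟩ <;> first | rfl | exact absurd rfl hne
      exact (congrArg ((𝟙 (blueRed k) : blueRed k ⟶ blueRed k) a a ⊗ₘ ·) this).trans
        (MonoidalPreadditive.tensor_zero _)
    · exact (congrArg (· ⊗ₘ dotMat k b b') (Mat_.id_apply_of_ne (blueRed k) a a' hb)).trans
        (MonoidalPreadditive.zero_tensor _)
  · refine congrArg (· ≫ entTwo g a b j) ?_
    refine (congrArg (· ⊗ₘ dotMat k b b) (Mat_.id_apply_self (blueRed k) a)).trans ?_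
    rcases b with ⟨⟩ | ⟨⟩ <;> rfl

lemma entThree_left_same (g : blueRed k ⊗ blueRed k ⊗ blueRed k ⟶ M) (a c : Unit ⊕ Unit) (j : M.ι) :
    entThree (crossLeftMat k ≫ g) a a c j = headC (crossC k a) [c] ≫ entThree g a a c j := by
  rw [← crossW_same, ← crossLeftMat_apply]
  refine mat_comp_single (crossLeftMat k) g (a, a, c) (a, a, c) j ?_
  rintro ⟨a', b', c'⟩ hne
  refine crossLeftMat_eq_zero k ?_
  by_cases hc : c = c'
  · subst hc
    right
    refine crossW_eq_zero k (c := a') (d := b') ?_ ?_ <;> (rintro ⟨rfl, rfl⟩; exact hne rfl)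
  · exact Or.inl hc

lemma entThree_right_same (g : blueRed k ⊗ blueRed k ⊗ blueRed k ⟶ M) (a c : Unit ⊕ Unit) (j : M.ι) :
    entThree (crossRightMat k ≫ g) c a a j = consC c (crossC k a) ≫ entThree g c a a j := by
  rw [← crossW_same, ← crossRightMat_apply]
  refine mat_comp_single (crossRightMat k) g (c, a, a) (c, a, a) j ?_
  rintro ⟨c', a', b'⟩ hne
  refine crossRightMat_eq_zero k ?_
  by_cases hc : c = c'
  · subst hc
    right
    refine crossW_eq_zero k (c := a') (d := b') ?_ ?_ <;> (rintro ⟨rfl, rfl⟩; exact hne rfl)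
  · exact Or.inl hc

lemma entThree_left_ne (g : blueRed k ⊗ blueRed k ⊗ blueRed k ⟶ M) (h : a ≠ b) (c : Unit ⊕ Unit)
    (j : M.ι) : entThree (crossLeftMat k ≫ g) a b c j =
      -headC (dumbC k a b) [c] ≫ entThree g a b c j +
        (headC (swapC k a b) [c] - headC (dumbC k a b) [c] ≫ headC (swapC k a b) [c]) ≫
          entThree g b a c j := by
  rw [← Preadditive.neg_comp, ← headC_comp, ← headC_sub, ← headC_neg, ← crossW_swap k h, ← crossW_self k h,
    ← crossLeftMat_apply, ← crossLeftMat_apply]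
  refine mat_comp_pair (crossLeftMat k) g (a, b, c) (a, b, c) (b, a, c) j
    (fun e => h (congrArg Prod.fst e)) ?_
  rintro ⟨a', b', c'⟩ hne hne'
  refine crossLeftMat_eq_zero k ?_
  by_cases hc : c = c'
  · subst hc
    right
    refine crossW_eq_zero k (c := a') (d := b') ?_ ?_
    · rintro ⟨rfl, rfl⟩; exact hne rfl
    · rintro ⟨rfl, rfl⟩; exact hne' rfl
  · exact Or.inl hc

lemma entThree_right_ne (g : blueRed k ⊗ blueRed k ⊗ blueRed k ⟶ M) (h : a ≠ b) (c : Unit ⊕ Unit)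
    (j : M.ι) : entThree (crossRightMat k ≫ g) c a b j =
      -consC c (dumbC k a b) ≫ entThree g c a b j +
        (consC c (swapC k a b) - consC c (dumbC k a b) ≫ consC c (swapC k a b)) ≫
          entThree g c b a j := by
  rw [← Preadditive.neg_comp, ← consC_comp, ← consC_sub, ← consC_neg, ← crossW_swap k h, ← crossW_self k h,
    ← crossRightMat_apply, ← crossRightMat_apply]
  refine mat_comp_pair (crossRightMat k) g (c, a, b) (c, a, b) (c, b, a) j
    (fun e => h (congrArg (fun t => t.2.1) e)) ?_
  rintro ⟨c', a', b'⟩ hne hne'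
  refine crossRightMat_eq_zero k ?_
  by_cases hc : c = c'
  · subst hc
    right
    refine crossW_eq_zero k (c := a') (d := b') ?_ ?_
    · rintro ⟨rfl, rfl⟩; exact hne rfl
    · rintro ⟨rfl, rfl⟩; exact hne' rfl
  · exact Or.inl hc

/-- Row by row: three equal colours give the braid relation of one copy. Otherwise one strand is of
a different colour, and its position, last, middle or first, selects the row of `BraidBlock`. The
arbitrary `g` keeps every composite nested to the right, so the row formulas can be applied
repeatedly. -/
lemma crossMat_braid_comp (g : blueRed k ⊗ blueRed k ⊗ blueRed k ⟶ M) :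
    crossLeftMat k ≫ crossRightMat k ≫ crossLeftMat k ≫ g =
      crossRightMat k ≫ crossLeftMat k ≫ crossRightMat k ≫ g := by
  refine entThree_ext fun a b c j => ?_
  by_cases hab : a = b
  · subst hab
    by_cases hac : a = c
    · subst hac
      simp only [entThree_left_same, entThree_right_same]
      have := crossC_braid k a
      rw [reassoc_of% this]
    · simp only [entThree_left_same, entThree_right_same, entThree_left_ne k _ hac,
        entThree_right_ne k _ hac, entThree_right_ne k _ (Ne.symm hac)]
      exact (braidBlock_entries k hac).rowX _ _ _
  · by_cases hac : a = c
    · subst hac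
      simp only [entThree_left_same, entThree_right_same, entThree_left_ne k _ hab,
        entThree_right_ne k _ hab, entThree_left_ne k _ (Ne.symm hab),
        entThree_right_ne k _ (Ne.symm hab)]
      exact (braidBlock_entries k hab).rowY _ _ _
    -- There are only two colours.
    · obtain rfl : b = c := by
        rcases a with ⟨⟩ | ⟨⟩ <;> rcases b with ⟨⟩ | ⟨⟩ <;> rcases c with ⟨⟩ | ⟨⟩ <;>
          first | rfl | exact absurd rfl hab | exact absurd rfl hac
      simp only [entThree_left_same, entThree_right_same, entThree_left_ne k _ hab,
        entThree_right_ne k _ hab, entThree_left_ne k _ (Ne.symm hab)]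
      exact (braidBlock_entries k (Ne.symm hab)).rowZ _ _ _

/-- For different colours the square of the block cancels to the identity as in d² + (1 - d)(1 + d)
= 1. -/
lemma crossMat_quad_comp (g : blueRed k ⊗ blueRed k ⟶ M) : crossMat k ≫ crossMat k ≫ g = g := by
  refine entTwo_ext fun a b j => ?_
  by_cases hab : a = b
  · subst hab
    have := crossC_quad k a
    simp only [entTwo_cross_same]
    rw [reassoc_of% this]
  · have hp := swapC_swapC k a b
    simp only [entTwo_cross_ne k _ hab, entTwo_cross_ne k _ (Ne.symm hab), dumbC_swap k hab,
      Preadditive.comp_add, Preadditive.comp_sub, Preadditive.sub_comp,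
      Preadditive.comp_neg, Preadditive.neg_comp, Category.assoc, reassoc_of% hp]
    abel

/-- The defining property of the dumbbell as a rewriting rule: it trades a right dot for a left dot
and produces an identity. This identity is the additional term in the dot relations between strands
of different colours. -/
lemma dotR_dumbC (h : a ≠ b) : dotR k a b ≫ dumbC k a b = 𝟙 _ + dotL k a b ≫ dumbC k a b := by
  rw [← dotted_dumbC k h, Preadditive.sub_comp]
  abel

lemma dumbC_dotR (h : a ≠ b) : dumbC k a b ≫ dotR k a b = 𝟙 _ + dumbC k a b ≫ dotL k a b := by
  rw [← dumbC_dotted k h, Preadditive.comp_sub]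
  abel

lemma dumbC_dotL (h : a ≠ b) : dumbC k a b ≫ dotL k a b = dotL k a b ≫ dumbC k a b := by
  have hxy : dotL k a b ≫ dotR k a b = dotR k a b ≫ dotL k a b := dotH_consC k a (dotC k b)
  have h₁ := dumbC_dotted k h
  have h₂ := dotted_dumbC k h
  have h₃ : (dotR k a b - dotL k a b) ≫ dotL k a b = dotL k a b ≫ (dotR k a b - dotL k a b) := by
    rw [Preadditive.comp_sub, Preadditive.sub_comp, hxy]
  calc dumbC k a b ≫ dotL k a b =
      dumbC k a b ≫ (dotL k a b ≫ (dotR k a b - dotL k a b)) ≫ dumbC k a b := by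
        rw [Category.assoc, h₂, Category.comp_id]
    _ = _ := by
        rw [← h₃]
        simp only [Category.assoc]
        rw [reassoc_of% h₁]

lemma dot_crossMat_comp (g : blueRed k ⊗ blueRed k ⟶ M) :
    (dotMat k ▷ blueRed k) ≫ crossMat k ≫ g = crossMat k ≫ (blueRed k ◁ dotMat k) ≫ g + g := by
  refine entTwo_ext fun a b j => ?_
  change entTwo _ a b j = entTwo (crossMat k ≫ (blueRed k ◁ dotMat k) ≫ g) a b j + entTwo g a b j
  by_cases hab : a = b
  · subst hab
    have := crossC_dot k a
    simp only [entTwo_cross_same, entTwo_dotLeft, entTwo_dotRight]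
    rw [reassoc_of% this, Preadditive.add_comp, Category.assoc, Category.id_comp]
  · have h₁ := dotL_swapC k hab
    have h₂ := dotR_dumbC k hab
    have h₃ := (dumbC_dotR k hab).trans (congrArg (𝟙 _ + ·) (dumbC_dotL k hab))
    have h₄ := dumbC_dotL k hab
    simp only [entTwo_cross_ne k _ hab, entTwo_dotLeft, entTwo_dotRight, ← reassoc_of% h₁,
      reassoc_of% h₃, reassoc_of% h₄,
      Preadditive.comp_add, Preadditive.add_comp, Preadditive.comp_sub, Preadditive.sub_comp,
      Preadditive.comp_neg, Category.assoc, Category.id_comp]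
    abel

lemma cross_dotMat_comp (g : blueRed k ⊗ blueRed k ⟶ M) :
    crossMat k ≫ (dotMat k ▷ blueRed k) ≫ g = (blueRed k ◁ dotMat k) ≫ crossMat k ≫ g + g := by
  refine entTwo_ext fun a b j => ?_
  change entTwo _ a b j = entTwo ((blueRed k ◁ dotMat k) ≫ crossMat k ≫ g) a b j + entTwo g a b j
  by_cases hab : a = b
  · subst hab
    have := dot_crossC k a
    simp only [entTwo_cross_same, entTwo_dotLeft, entTwo_dotRight]
    rw [reassoc_of% this, Preadditive.add_comp, Category.assoc, Category.id_comp]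
  · have h₁ := dotR_swapC k hab
    have h₂ := dotR_dumbC k hab
    have h₃ := (dumbC_dotR k hab).trans (congrArg (𝟙 _ + ·) (dumbC_dotL k hab))
    have h₄ := dumbC_dotL k hab
    simp only [entTwo_cross_ne k _ hab, entTwo_dotLeft, entTwo_dotRight, ← reassoc_of% h₁,
      reassoc_of% h₂, reassoc_of% h₃, reassoc_of% h₄,
      Preadditive.comp_add, Preadditive.add_comp, Preadditive.comp_sub, Preadditive.sub_comp,
      Preadditive.comp_neg, Category.assoc, Category.id_comp]
    abel

lemma affineHeckeRel_crossMat : AffineHeckeRel (dotMat k) (crossMat k) where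
  quad := by simpa using crossMat_quad_comp k (𝟙 _)
  dot_cross := by simpa using dot_crossMat_comp k (𝟙 _)
  cross_dot := by simpa using cross_dotMat_comp k (𝟙 _)
  braid := by
    have e : (α_ _ _ _).inv ≫ (crossMat k ▷ blueRed k) ≫ (α_ _ _ _).hom = crossLeftMat k := by
      rw [crossMat_associator, Iso.inv_hom_id_assoc]
    have h := crossMat_braid_comp k (𝟙 _)
    rw [← e, crossRightMat, Category.comp_id, Category.comp_id] at h
    have := congrArg ((α_ _ _ _).hom ≫ ·) h
    simpa using this

/-- The comultiplication. -/
def comultiplication : Comultiplication k where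
  functor := ahLift k (affineHeckeRel_crossMat k)
  additive := inferInstance
  linear := inferInstance
  monoidal := inferInstance
  genIso := ahLiftUp k (affineHeckeRel_crossMat k)
  map_dot := ahLift_map_dot _
  map_cross := ahLift_map_cross _

end Comultiplication

/-! ### Rearrangement of two-coloured words -/

section StrandSystems

universe v w

/-- The part of the structure of a monoidal category generated by strands of two colours that governs
the rearrangement of words: strands can be added on the left, neighbouring strands of different
colours can be interchanged, and there is a crossing of neighbouring strands of the same colour. -/
structure StrandSystem (D : Type w) [Category.{v} D] [Preadditive D] where
  /-- the object of a word -/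
  obj : List (Unit ⊕ Unit) → D
  /-- a strand added on the left -/
  cons (c : Unit ⊕ Unit) {v w : List (Unit ⊕ Unit)} : (obj v ⟶ obj w) → (obj (c :: v) ⟶ obj (c :: w))
  /-- the interchange of the two leftmost strands -/
  swap (a b : Unit ⊕ Unit) (v : List (Unit ⊕ Unit)) : obj (a :: b :: v) ⟶ obj (b :: a :: v)
  /-- the crossing of the two leftmost strands -/
  cross (a : Unit ⊕ Unit) (v : List (Unit ⊕ Unit)) : obj (a :: a :: v) ⟶ obj (a :: a :: v)
  cons_id (c v) : cons c (𝟙 (obj v)) = 𝟙 _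
  cons_comp (c) {v w x} (f : obj v ⟶ obj w) (g : obj w ⟶ obj x) : cons c (f ≫ g) = cons c f ≫ cons c g
  cons_zero (c v w) : cons c (0 : obj v ⟶ obj w) = 0
  swap_swap (a b v) (h : a ≠ b) : swap a b v ≫ swap b a v = 𝟙 _
  swap_natural (a b) {v w} (f : obj v ⟶ obj w) : swap a b v ≫ cons b (cons a f) =
    cons a (cons b f) ≫ swap a b w
  cross_natural (a) {v w} (f : obj v ⟶ obj w) : cross a v ≫ cons a (cons a f) =
    cons a (cons a f) ≫ cross a w
  cross_swap (a b v) (h : a ≠ b) : cross a (b :: v) ≫ cons a (swap a b v) ≫ swap a b (a :: v) =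
    cons a (swap a b v) ≫ swap a b (a :: v) ≫ cons b (cross a v)

/-- The word of `p` blue letters followed by `q` red letters. -/
def stdWord (p q : ℕ) : List (Unit ⊕ Unit) :=
  (List.replicate p ()).map Sum.inl ++ (List.replicate q ()).map Sum.inr

lemma stdWord_length (p q : ℕ) : (stdWord p q).length = p + q := by
  simp [stdWord]

namespace StrandSystem

variable {D : Type w} [Category.{v} D] [Preadditive D] (A : StrandSystem D)

/-- The interchanges of neighbouring strands of different colours. -/
inductive Swap : ℕ → ∀ w w' : List (Unit ⊕ Unit), (A.obj w ⟶ A.obj w') → Prop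
  | head (a b v) (h : a ≠ b) : Swap 0 (a :: b :: v) (b :: a :: v) (A.swap a b v)
  | cons (c) {i w w' t} (h : Swap i w w' t) : Swap (i + 1) (c :: w) (c :: w') (A.cons c t)

/-- The crossings of neighbouring strands of the same colour. -/
inductive Cross : ℕ → ∀ w : List (Unit ⊕ Unit), (A.obj w ⟶ A.obj w) → Prop
  | head (a v) : Cross 0 (a :: a :: v) (A.cross a v)
  | cons (c) {i w t} (h : Cross i w t) : Cross (i + 1) (c :: w) (A.cons c t)

/-- The composites of interchanges. -/
inductive Path : ∀ w w' : List (Unit ⊕ Unit), (A.obj w ⟶ A.obj w') → Prop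
  | refl (w) : Path w w (𝟙 _)
  | step {w w' w'' i m t} (h : Path w w' m) (h' : A.Swap i w' w'' t) : Path w w'' (m ≫ t)

/-- The crossings in a word of blue letters followed by red letters. -/
inductive StdCross : ∀ p q : ℕ, (A.obj (stdWord p q) ⟶ A.obj (stdWord p q)) → Prop
  | headLeft (p q) : StdCross (p + 2) q (A.cross (.inl ()) (stdWord p q))
  | headRight (q) : StdCross 0 (q + 2) (A.cross (.inr ()) (stdWord 0 q))
  | consLeft {p q c} (h : StdCross p q c) : StdCross (p + 1) q (A.cons (.inl ()) c)
  | consRight {q c} (h : StdCross 0 q c) : StdCross 0 (q + 1) (A.cons (.inr ()) c)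

/-- The rightmost blue letters followed by a red letter are moved past this letter. -/
def insertRed : ∀ p q : ℕ, A.obj (stdWord p (q + 1)) ⟶ A.obj (.inr () :: stdWord p q)
  | 0, _ => 𝟙 _
  | p + 1, q => (A.cons (.inl ()) (insertRed p q) ≫ A.swap (.inl ()) (.inr ()) (stdWord p q) :
      A.obj (.inl () :: stdWord p (q + 1)) ⟶ A.obj (.inr () :: .inl () :: stdWord p q))

/-- The rearrangement of a sorted word to a given word with the same numbers of letters of both
colours, and zero for the other words. -/
def arrange (p q : ℕ) : ∀ w : List (Unit ⊕ Unit), A.obj (stdWord p q) ⟶ A.obj w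
  | [] => match p, q with
    | 0, 0 => 𝟙 _
    | _, _ => 0
  | .inl _ :: w => match p with
    | 0 => 0
    | p + 1 => (A.cons (.inl ()) (arrange p q w) :
        A.obj (.inl () :: stdWord p q) ⟶ A.obj (.inl () :: w))
  | .inr _ :: w => match q with
    | 0 => 0
    | q + 1 => A.insertRed p q ≫ A.cons (.inr ()) (arrange p q w)

lemma arrange_inl (p q : ℕ) (w : List (Unit ⊕ Unit)) :
    A.arrange (p + 1) q (.inl () :: w) = A.cons (.inl ()) (A.arrange p q w) := rfl

lemma arrange_inl_zero (q : ℕ) (w : List (Unit ⊕ Unit)) :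
    A.arrange 0 q (.inl () :: w) = 0 := rfl

lemma arrange_inr (p q : ℕ) (w : List (Unit ⊕ Unit)) :
    A.arrange p (q + 1) (.inr () :: w) = A.insertRed p q ≫ A.cons (.inr ()) (A.arrange p q w) := rfl

lemma arrange_inr_zero (p : ℕ) (w : List (Unit ⊕ Unit)) :
    A.arrange p 0 (.inr () :: w) = 0 := rfl

lemma arrange_std (p q : ℕ) : A.arrange p q (stdWord p q) = 𝟙 _ := by
  induction p with
  | zero =>
    induction q with
    | zero => rfl
    | succ q ih =>
      refine (A.arrange_inr 0 q (stdWord 0 q)).trans ?_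
      rw [ih, A.cons_id]
      exact Category.comp_id _
  | succ p ih =>
    refine (A.arrange_inl p q (stdWord p q)).trans ?_
    rw [ih, A.cons_id]
    rfl

/-- The default value zero of `arrange` for words with other letter counts is what later makes the
summands orthogonal. -/
lemma arrange_std_of_ne {p q p' q' : ℕ} (h : p ≠ p' ∨ q ≠ q') :
    A.arrange p q (stdWord p' q') = 0 := by
  induction p' generalizing p q with
  | zero =>
    induction q' generalizing p q with
    | zero =>
      rcases p with _ | p
      · rcases q with _ | q
        · simp at h
        · rfl
      · rfl
    | succ q' ih =>
      rcases q with _ | q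
      · exact A.arrange_inr_zero p (stdWord 0 q')
      · refine (A.arrange_inr p q (stdWord 0 q')).trans ?_
        rw [ih (by omega), A.cons_zero]
        exact comp_zero
  | succ p' ih =>
    rcases p with _ | p
    · exact A.arrange_inl_zero q (stdWord p' q')
    · refine (A.arrange_inl p q (stdWord p' q')).trans ?_
      rw [ih (by omega), A.cons_zero]
      rfl

lemma arrange_swap_head (p q : ℕ) (v : List (Unit ⊕ Unit)) :
    A.arrange p q (.inl () :: .inr () :: v) ≫ A.swap (.inl ()) (.inr ()) v =
      A.arrange p q (.inr () :: .inl () :: v) := by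
  rcases p with _ | p
  · rcases q with _ | q
    · rw [arrange_inl_zero, arrange_inr_zero, zero_comp]
    · rw [arrange_inl_zero, arrange_inr, arrange_inl_zero, zero_comp, A.cons_zero, comp_zero]
  · rcases q with _ | q
    · rw [arrange_inl, arrange_inr_zero, arrange_inr_zero, A.cons_zero]
      exact zero_comp
    · rw [arrange_inl, arrange_inr, arrange_inr, arrange_inl, A.cons_comp]
      refine (Category.assoc _ _ _).trans (Eq.trans ?_ (Category.assoc _ _ _).symm)
      exact congrArg (A.cons (.inl ()) (A.insertRed p q) ≫ ·) (A.swap_natural _ _ _).symm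

variable {A}

/-- A rearrangement never crosses strands of the same colour, so it depends only on the target word.
By naturality the check is reduced to the interchange of the two leftmost letters. -/
lemma Swap.arrange {i w w' t} (h : A.Swap i w w' t) (p q : ℕ) :
    A.arrange p q w ≫ t = A.arrange p q w' := by
  induction h generalizing p q with
  | head a b v h =>
    rcases a with ⟨⟨⟩⟩ | ⟨⟨⟩⟩ <;> rcases b with ⟨⟨⟩⟩ | ⟨⟨⟩⟩
    · exact absurd rfl h
    · exact A.arrange_swap_head p q v
    · rw [← arrange_swap_head, Category.assoc, A.swap_swap _ _ _ h.symm, Category.comp_id]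
    · exact absurd rfl h
  | @cons c i w w' t h ih =>
    rcases c with ⟨⟨⟩⟩ | ⟨⟨⟩⟩
    · rcases p with _ | p
      · rw [arrange_inl_zero, arrange_inl_zero, zero_comp]
      · rw [arrange_inl, arrange_inl, ← ih, A.cons_comp]
        rfl
    · rcases q with _ | q
      · rw [arrange_inr_zero, arrange_inr_zero, zero_comp]
      · rw [arrange_inr, arrange_inr, ← ih, A.cons_comp, Category.assoc]

/-- The red letter that moves to the left end slides past any crossing of the remaining strands,
which is then a crossing of the longer sorted word. -/
lemma StdCross.insertRed {p q c} (h : A.StdCross p q c) : ∃ c', A.StdCross p (q + 1) c' ∧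
    A.insertRed p q ≫ A.cons (.inr ()) c = c' ≫ A.insertRed p q := by
  induction h with
  | headLeft p q =>
    refine ⟨_, .headLeft p (q + 1), ?_⟩
    change (A.cons (.inl ()) (A.cons (.inl ()) (A.insertRed p q) ≫ A.swap (.inl ()) (.inr ()) _) ≫
      A.swap (.inl ()) (.inr ()) (.inl () :: stdWord p q)) ≫ A.cons (.inr ()) (A.cross _ _) =
        A.cross (.inl ()) (stdWord p (q + 1)) ≫
      (A.cons (.inl ()) (A.cons (.inl ()) (A.insertRed p q) ≫ A.swap (.inl ()) (.inr ()) _) ≫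
        A.swap (.inl ()) (.inr ()) (.inl () :: stdWord p q))
    have h₁ := A.cross_swap (.inl ()) (.inr ()) (stdWord p q) (by simp)
    have h₂ := A.cross_natural (.inl ()) (A.insertRed p q)
    simp only [A.cons_comp, Category.assoc]
    rw [reassoc_of% h₂, h₁]
  | headRight q =>
    refine ⟨_, .consRight (.headRight q), ?_⟩
    exact (Category.id_comp _).trans (Category.comp_id _).symm
  | @consLeft p q c h ih =>
    obtain ⟨c', hc, e⟩ := ih
    refine ⟨_, .consLeft hc, ?_⟩
    change (A.cons (.inl ()) (A.insertRed p q) ≫ A.swap (.inl ()) (.inr ()) (stdWord p q)) ≫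
      A.cons (.inr ()) (A.cons (.inl ()) c) = A.cons (.inl ()) c' ≫
        A.cons (.inl ()) (A.insertRed p q) ≫ A.swap (.inl ()) (.inr ()) (stdWord p q)
    rw [Category.assoc, A.swap_natural, ← Category.assoc, ← A.cons_comp, e, A.cons_comp,
      Category.assoc]
  | consRight h ih =>
    refine ⟨_, .consRight (.consRight h), ?_⟩
    exact (Category.id_comp _).trans (Category.comp_id _).symm

/-- The mirror image of `cross_swap`, obtained from it by composing with the inverse interchanges on
both sides. -/
lemma swap_cons_swap_cross (v : List (Unit ⊕ Unit)) {a b : Unit ⊕ Unit} (h : a ≠ b) :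
    A.swap a b (b :: v) ≫ A.cons b (A.swap a b v) ≫ A.cross b (a :: v) =
      A.cons a (A.cross b v) ≫ A.swap a b (b :: v) ≫ A.cons b (A.swap a b v) := by
  have e := A.cross_swap b a v h.symm
  have h₁ := A.swap_swap a b (b :: v) h
  have h₁' := A.swap_swap b a (b :: v) h.symm
  have h₂ : A.cons b (A.swap a b v) ≫ A.cons b (A.swap b a v) = 𝟙 _ := by
    rw [← A.cons_comp, A.swap_swap a b v h, A.cons_id]
  have h₂' : A.cons b (A.swap b a v) ≫ A.cons b (A.swap a b v) = 𝟙 _ := by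
    rw [← A.cons_comp, A.swap_swap b a v h.symm, A.cons_id]
  have := congrArg (fun t => (A.swap a b (b :: v) ≫ A.cons b (A.swap a b v)) ≫ t ≫
    A.swap a b (b :: v) ≫ A.cons b (A.swap a b v)) e
  simp only [Category.assoc] at this
  rw [reassoc_of% h₁', h₂', reassoc_of% h₂, reassoc_of% h₁, Category.comp_id] at this
  exact this

variable (A) in
lemma insertRed_insertRed_cross (p q : ℕ) : ∃ c, A.StdCross p (q + 2) c ∧
    A.insertRed p (q + 1) ≫ A.cons (.inr ()) (A.insertRed p q) ≫ A.cross (.inr ()) (stdWord p q) =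
      c ≫ A.insertRed p (q + 1) ≫ A.cons (.inr ()) (A.insertRed p q) := by
  induction p with
  | zero =>
    refine ⟨_, .headRight q, ?_⟩
    have e : A.insertRed 0 (q + 1) ≫ A.cons (.inr ()) (A.insertRed 0 q) = 𝟙 _ :=
      (Category.id_comp _).trans (A.cons_id _ _)
    rw [← Category.assoc, e]
    exact (Category.id_comp _).trans (Category.comp_id _).symm
  | succ p ih =>
    obtain ⟨c, hc, e⟩ := ih
    refine ⟨_, .consLeft hc, ?_⟩
    change (A.cons (.inl ()) (A.insertRed p (q + 1)) ≫
      A.swap (.inl ()) (.inr ()) (stdWord p (q + 1))) ≫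
        A.cons (.inr ()) (A.cons (.inl ()) (A.insertRed p q) ≫
          A.swap (.inl ()) (.inr ()) (stdWord p q)) ≫
            A.cross (.inr ()) (.inl () :: stdWord p q) = A.cons (.inl ()) c ≫
      (A.cons (.inl ()) (A.insertRed p (q + 1)) ≫
      A.swap (.inl ()) (.inr ()) (stdWord p (q + 1))) ≫
        A.cons (.inr ()) (A.cons (.inl ()) (A.insertRed p q) ≫
          A.swap (.inl ()) (.inr ()) (stdWord p q))
    have h₁ := A.swap_natural (.inl ()) (.inr ()) (A.insertRed p q)
    have h₂ := swap_cons_swap_cross (A := A) (stdWord p q)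
      (a := Sum.inl ()) (b := Sum.inr ()) (by simp)
    have h₃ := congrArg (fun t => A.cons (.inl ()) t) e
    simp only [A.cons_comp] at h₃
    simp only [A.cons_comp, Category.assoc]
    rw [reassoc_of% h₁, h₂, reassoc_of% h₃, reassoc_of% h₁]

/-- Neighbouring letters of one colour are still neighbours after sorting, because the order within
each colour is kept. A crossing can thus be pulled back to the sorted word. -/
lemma Cross.arrange {i w c} (h : A.Cross i w c) (p q : ℕ) : A.arrange p q w = 0 ∨
    ∃ c', A.StdCross p q c' ∧ A.arrange p q w ≫ c = c' ≫ A.arrange p q w := by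
  induction h generalizing p q with
  | head a v =>
    rcases a with ⟨⟨⟩⟩ | ⟨⟨⟩⟩
    · rcases p with _ | _ | p
      · exact Or.inl (A.arrange_inl_zero _ _)
      · left
        rw [arrange_inl, arrange_inl_zero, A.cons_zero]
        rfl
      · refine Or.inr ⟨_, .headLeft p q, ?_⟩
        rw [arrange_inl, arrange_inl]
        exact (A.cross_natural _ _).symm
    · rcases q with _ | _ | q
      · exact Or.inl (A.arrange_inr_zero _ _)
      · left
        rw [arrange_inr, arrange_inr_zero, A.cons_zero, comp_zero]
      · obtain ⟨c, hc, e⟩ := A.insertRed_insertRed_cross p q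
        refine Or.inr ⟨_, hc, ?_⟩
        rw [arrange_inr, arrange_inr, A.cons_comp]
        simp only [Category.assoc]
        rw [← A.cross_natural, reassoc_of% e]
  | @cons a i w t h ih =>
    rcases a with ⟨⟨⟩⟩ | ⟨⟨⟩⟩
    · rcases p with _ | p
      · exact Or.inl (A.arrange_inl_zero _ _)
      · rcases ih p q with h₀ | ⟨c', hc, e⟩
        · left
          rw [arrange_inl, h₀, A.cons_zero]
          rfl
        · refine Or.inr ⟨_, .consLeft hc, ?_⟩
          exact (A.cons_comp _ _ _).symm.trans
            ((congrArg (A.cons (.inl ())) e).trans (A.cons_comp _ _ _))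
    · rcases q with _ | q
      · exact Or.inl (A.arrange_inr_zero _ _)
      · rcases ih p q with h₀ | ⟨c', hc, e⟩
        · left
          rw [arrange_inr, h₀, A.cons_zero, comp_zero]
        · obtain ⟨c'', hc', e'⟩ := hc.insertRed
          refine Or.inr ⟨_, hc', ?_⟩
          rw [arrange_inr, Category.assoc, ← A.cons_comp, e, A.cons_comp, reassoc_of% e']

lemma StdCross.cross {p q c} (h : A.StdCross p q c) : ∃ i, A.Cross i (stdWord p q) c := by
  induction h with
  | headLeft p q => exact ⟨_, .head _ _⟩
  | headRight q => exact ⟨_, .head _ _⟩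
  | consLeft h ih => exact ⟨_, .cons _ ih.choose_spec⟩
  | consRight h ih => exact ⟨_, .cons _ ih.choose_spec⟩

lemma Swap.length {i w w' t} (h : A.Swap i w w' t) : w'.length = w.length := by
  induction h with
  | head a b v h => rfl
  | cons c h ih => exact congrArg Nat.succ ih

lemma Path.length {w w' t} (h : A.Path w w' t) : w'.length = w.length := by
  induction h with
  | refl => rfl
  | step h h' ih => exact h'.length.trans ih

lemma Path.cons (c : Unit ⊕ Unit) {w w' m} (h : A.Path w w' m) :
    A.Path (c :: w) (c :: w') (A.cons c m) := by
  induction h with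
  | refl =>
    rw [A.cons_id]
    exact .refl _
  | step h h' ih =>
    rw [A.cons_comp]
    exact .step ih (.cons c h')

lemma Path.trans {w w' w'' m m'} (h : A.Path w w' m) (h' : A.Path w' w'' m') :
    A.Path w w'' (m ≫ m') := by
  induction h' with
  | refl =>
    rw [Category.comp_id]
    exact h
  | step h₁ h₂ ih =>
    rw [← Category.assoc]
    exact .step ih h₂

variable (A) in
lemma path_insertRed (p q : ℕ) : A.Path (stdWord p (q + 1)) (.inr () :: stdWord p q)
    (A.insertRed p q) := by
  induction p with
  | zero => exact .refl _
  | succ p ih => exact .step (ih.cons (.inl ())) (.head _ _ _ (by simp))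

variable (A) in
-- Only the sorted word with the same letter counts as `w` matters; from it `arrange` is a genuine
-- composite of interchanges.
lemma exists_path_arrange (w : List (Unit ⊕ Unit)) : ∃ p q, p + q = w.length ∧
    A.Path (stdWord p q) w (A.arrange p q w) ∧
      ∀ p' q', (p' ≠ p ∨ q' ≠ q) → A.arrange p' q' w = 0 := by
  induction w with
  | nil =>
    refine ⟨0, 0, rfl, .refl _, fun p q h => ?_⟩
    exact A.arrange_std_of_ne (p' := 0) (q' := 0) h
  | cons c w ih =>
    obtain ⟨p, q, hl, hP, h₀⟩ := ih
    rcases c with ⟨⟨⟩⟩ | ⟨⟨⟩⟩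
    · refine ⟨p + 1, q, by simp; omega, ?_, fun p' q' h => ?_⟩
      · rw [arrange_inl]
        exact hP.cons _
      · rcases p' with _ | p'
        · exact A.arrange_inl_zero _ _
        · rw [arrange_inl, h₀ p' q' (by omega), A.cons_zero]
          rfl
    · refine ⟨p, q + 1, by simp; omega, ?_, fun p' q' h => ?_⟩
      · rw [arrange_inr]
        exact (A.path_insertRed p q).trans (hP.cons _)
      · rcases q' with _ | q'
        · exact A.arrange_inr_zero _ _
        · rw [arrange_inr, h₀ p' q' (by omega), A.cons_zero, comp_zero]

variable (A) in
/-- Families of morphisms to the words of length `n` which are invariant under rearrangements. -/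
structure Invariant {n : ℕ} {Z : D} (f : ∀ w : {w : List (Unit ⊕ Unit) // w.length = n}, Z ⟶ A.obj w.1) :
    Prop where
  swap {i w w' t} (h : A.Swap i w.1 w'.1 t) : f w ≫ t = f w'
  cross {i w c} (h : A.Cross i w.1 c) : f w ≫ c = f w

lemma Invariant.comp_path {n : ℕ} {Z : D}
    {f : ∀ w : {w : List (Unit ⊕ Unit) // w.length = n}, Z ⟶ A.obj w.1} (hf : A.Invariant f)
    {w w' m} (h : A.Path w w' m) (hw : w.length = n) :
    f ⟨w, hw⟩ ≫ m = f ⟨w', h.length.trans hw⟩ := by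
  induction h with
  | refl => exact Category.comp_id _
  | step h h' ih =>
    rw [← Category.assoc, ih]
    exact hf.swap (w := ⟨_, _⟩) (w' := ⟨_, _⟩) h'

/-- An invariant family is determined by its values at the sorted words. Each word is reached by
interchanges from one of them, and the other terms of the sum vanish. -/
lemma Invariant.eq_sum {n : ℕ} {Z : D}
    {f : ∀ w : {w : List (Unit ⊕ Unit) // w.length = n}, Z ⟶ A.obj w.1} (hf : A.Invariant f)
    (w : {w : List (Unit ⊕ Unit) // w.length = n}) :
    f w = ∑ r : Fin (n + 1), f ⟨stdWord (n - r) r, by rw [stdWord_length]; omega⟩ ≫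
      A.arrange (n - r) r w.1 := by
  obtain ⟨w, hw⟩ := w
  obtain ⟨p, q, hl, hP, h₀⟩ := A.exists_path_arrange w
  obtain rfl : p = n - q := by omega
  rw [Finset.sum_eq_single (⟨q, by omega⟩ : Fin (n + 1))]
  · exact (hf.comp_path hP _).symm
  · intro r _ hr
    rw [h₀ _ _ (Or.inr fun e => hr (Fin.ext e)), comp_zero]
  · simp

/-- The converse construction: a morphism to a sorted word that absorbs the crossings there extends
to an invariant family. -/
lemma invariant_arrange {p q : ℕ} (n : ℕ) {Z : D} (e : Z ⟶ A.obj (stdWord p q))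
    (he : ∀ c, A.StdCross p q c → e ≫ c = e) :
    A.Invariant fun w : {w : List (Unit ⊕ Unit) // w.length = n} => e ≫ A.arrange p q w.1 where
  swap h := by rw [Category.assoc, h.arrange]
  cross h := by
    rcases h.arrange p q with h₀ | ⟨c, hc, h'⟩
    · rw [h₀, comp_zero, zero_comp]
    · rw [Category.assoc, h', ← Category.assoc, he c hc]

end StrandSystem

end StrandSystems

/-! ### The strand systems of symmetric and antisymmetric morphisms -/

section ColouredStrands

variable (k : Type u) [Field k] {a b c d : Unit ⊕ Unit} {v w x y : List (Unit ⊕ Unit)}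

variable {k} in
lemma headC_whiskerRight (g : wordC k [a, b] ⟶ wordC k [c, d]) (x v : List (Unit ⊕ Unit)) :
    headC g x ▷ wordC k v = headC g (x ++ v) :=
  headHom_whiskerRight (P := ahBarPres k) g x v

variable {k} in
lemma consC_whiskerRight (c : Unit ⊕ Unit) (f : wordC k x ⟶ wordC k y) (v : List (Unit ⊕ Unit)) :
    consC c f ▷ wordC k v = consC c (f ▷ wordC k v : wordC k (x ++ v) ⟶ wordC k (y ++ v)) :=
  consHom_whiskerRight (P := ahBarPres k) c f v

lemma crossC_swapC_head (h : a ≠ b) (v : List (Unit ⊕ Unit)) : headC (crossC k a) (b :: v) ≫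
      consC a (headC (swapC k a b) v) ≫ headC (swapC k a b) (a :: v) =
    consC a (headC (swapC k a b) v) ≫ headC (swapC k a b) (a :: v) ≫
      consC b (headC (crossC k a) v) := by
  have tri : ∀ {X Y Z T : AHBar k} (f : X ⟶ Y) (g : Y ⟶ Z) (l : Z ⟶ T),
      (f ≫ g ≫ l) ▷ wordC k v = f ▷ wordC k v ≫ g ▷ wordC k v ≫ l ▷ wordC k v := by simp
  have e := congrArg (fun f => f ▷ wordC k v) (crossC_swapC k h)
  have e₁ := tri (headC (crossC k a) [b]) (consC a (swapC k a b)) (headC (swapC k a b) [a])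
  have e₂ := tri (consC a (swapC k a b)) (headC (swapC k a b) [a]) (consC b (crossC k a))
  have e₃ := (e₁.symm.trans e).trans e₂
  rw [headC_whiskerRight, headC_whiskerRight, consC_whiskerRight, consC_whiskerRight] at e₃
  exact e₃

/-- Words of blue and red strands. -/
def colourSystem : StrandSystem (AHBar k) where
  obj w := wordC k w
  cons c _ _ f := consC c f
  swap a b v := headC (swapC k a b) v
  cross a v := headC (crossC k a) v
  cons_id _ _ := consC_id _ _
  cons_comp _ _ _ _ _ _ := consC_comp _ _ _
  cons_zero _ _ _ := consC_zero _
  swap_swap a b v _ := headC_swapC_swapC k a b v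
  swap_natural _ _ _ _ f := headC_exchange _ f
  cross_natural _ _ _ f := headC_exchange _ f
  cross_swap _ _ v h := crossC_swapC_head k h v

open Opposite in
/-- Words of blue and red strands in the opposite category, with the signs that turn antisymmetric
morphisms into symmetric ones. -/
def signedSystem : StrandSystem (AHBar k)ᵒᵖ where
  obj w := op (wordC k w)
  cons c _ _ f := (consC c f.unop).op
  swap a b v := (-headC (swapC k b a) v).op
  cross a v := (-headC (crossC k a) v).op
  cons_id _ _ := congrArg Quiver.Hom.op (consC_id _ _)
  cons_comp _ _ _ _ _ _ := congrArg Quiver.Hom.op (consC_comp _ _ _)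
  cons_zero _ _ _ := congrArg Quiver.Hom.op (consC_zero _)
  swap_swap a b v _ := by
    refine congrArg Quiver.Hom.op (?_ : (-headC (swapC k a b) v) ≫ (-headC (swapC k b a) v) = 𝟙 _)
    rw [Preadditive.neg_comp, Preadditive.comp_neg, neg_neg, headC_swapC_swapC]
  swap_natural a b _ _ f := by
    refine congrArg Quiver.Hom.op (?_ : consC b (consC a f.unop) ≫ (-headC (swapC k b a) _) =
      (-headC (swapC k b a) _) ≫ consC a (consC b f.unop))
    rw [Preadditive.neg_comp, Preadditive.comp_neg, headC_exchange]
  cross_natural a _ _ f := by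
    refine congrArg Quiver.Hom.op (?_ : consC a (consC a f.unop) ≫ (-headC (crossC k a) _) =
      (-headC (crossC k a) _) ≫ consC a (consC a f.unop))
    rw [Preadditive.neg_comp, Preadditive.comp_neg, headC_exchange]
  cross_swap a b v h := by
    refine congrArg Quiver.Hom.op (?_ : ((-headC (swapC k b a) (a :: v)) ≫
      consC a (-headC (swapC k b a) v)) ≫ (-headC (crossC k a) (b :: v)) =
        (consC b (-headC (crossC k a) v) ≫ (-headC (swapC k b a) (a :: v))) ≫
          consC a (-headC (swapC k b a) v))
    -- Reversal of arrows turns the required relation into the mirrored one, and each side carries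
    -- three signs.
    have := StrandSystem.swap_cons_swap_cross (A := colourSystem k) v h.symm
    simp only [consC_neg, Preadditive.neg_comp, Preadditive.comp_neg, neg_neg, Category.assoc]
    exact congrArg (-·) this

end ColouredStrands

/-! ### Blocks of the matrix of a crossing on words -/

section CrossingMatrices

variable (k : Type u) [Field k] {a b c d : Unit ⊕ Unit} {v w x y v' w' : List (Unit ⊕ Unit)}

open scoped Classical in
/-- The matrix units of the identity on all words. -/
def wordDelta (v w : List (Unit ⊕ Unit)) : wordC k v ⟶ wordC k w :=
  if h : v = w then eqToHom (congrArg (wordC k) h) else 0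

lemma wordDelta_self (v : List (Unit ⊕ Unit)) : wordDelta k v v = 𝟙 _ := by
  simp [wordDelta]

lemma wordDelta_of_ne (h : v ≠ w) : wordDelta k v w = 0 := by
  simp [wordDelta, h]

/-- The components of the image of a crossing of neighbouring strands. -/
def crossComp : ℕ → ∀ w w' : List (Unit ⊕ Unit), wordC k w ⟶ wordC k w'
  | 0, a :: b :: v, c :: d :: v' => crossW k a b c d ⊗ₘ wordDelta k v v'
  | i + 1, c :: w, c' :: w' => (𝟙 (blueRed k) : blueRed k ⟶ blueRed k) c c' ⊗ₘ crossComp i w w'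
  | _, _, _ => 0

lemma crossComp_zero_apply (a b c d : Unit ⊕ Unit) (v : List (Unit ⊕ Unit)) :
    crossComp k 0 (a :: b :: v) (c :: d :: v) = headC (crossW k a b c d) v :=
  congrArg (crossW k a b c d ⊗ₘ ·) (wordDelta_self k v)

lemma crossComp_zero_eq_zero (h : v ≠ v' ∨ crossW k a b c d = 0) :
    crossComp k 0 (a :: b :: v) (c :: d :: v') = 0 := by
  rcases h with h | h
  · exact (congrArg (crossW k a b c d ⊗ₘ ·) (wordDelta_of_ne k h)).trans
      (MonoidalPreadditive.tensor_zero _)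
  · exact (congrArg (· ⊗ₘ wordDelta k v v') h).trans (MonoidalPreadditive.zero_tensor _)

lemma crossComp_succ_apply (i : ℕ) (c : Unit ⊕ Unit) (w w' : List (Unit ⊕ Unit)) :
    crossComp k (i + 1) (c :: w) (c :: w') = consC c (crossComp k i w w') :=
  congrArg (· ⊗ₘ crossComp k i w w') (Mat_.id_apply_self (blueRed k) c)

lemma crossComp_succ_eq_zero (i : ℕ) (h : c ≠ d) (w w' : List (Unit ⊕ Unit)) :
    crossComp k (i + 1) (c :: w) (d :: w') = 0 :=
  (congrArg (· ⊗ₘ crossComp k i w w') (Mat_.id_apply_of_ne (blueRed k) c d h)).trans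
    (MonoidalPreadditive.zero_tensor _)

variable {k}

lemma crossComp_zero_eq_zero_of_ne (h₁ : ∀ {c d v'}, x = c :: d :: v' → v = v' → crossW k a b c d = 0) :
    crossComp k 0 (a :: b :: v) x = 0 := by
  rcases x with _ | ⟨c, _ | ⟨d, x⟩⟩
  · rfl
  · rfl
  · refine crossComp_zero_eq_zero k ?_
    by_cases h : v = x
    · exact Or.inr (h₁ rfl h)
    · exact Or.inl h

lemma crossComp_zero_eq_zero_of_ne' (h₁ : ∀ {c d v'}, x = c :: d :: v' → v' = v → crossW k c d a b = 0) :
    crossComp k 0 x (a :: b :: v) = 0 := by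
  rcases x with _ | ⟨c, _ | ⟨d, x⟩⟩
  · rfl
  · rfl
  · refine crossComp_zero_eq_zero k ?_
    by_cases h : x = v
    · exact Or.inr (h₁ rfl h)
    · exact Or.inl h

lemma crossComp_succ_eq_zero_of_ne {i : ℕ} (h : ∀ {w'}, x = c :: w' → crossComp k i w w' = 0) :
    crossComp k (i + 1) (c :: w) x = 0 := by
  rcases x with _ | ⟨d, x⟩
  · rfl
  · by_cases hc : c = d
    · subst hc
      rw [crossComp_succ_apply, h rfl, consC_zero]
    · exact crossComp_succ_eq_zero k i hc _ _

lemma crossComp_succ_eq_zero_of_ne' {i : ℕ} (h : ∀ {w'}, x = c :: w' → crossComp k i w' w = 0) :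
    crossComp k (i + 1) x (c :: w) = 0 := by
  rcases x with _ | ⟨d, x⟩
  · rfl
  · by_cases hc : d = c
    · subst hc
      rw [crossComp_succ_apply, h rfl, consC_zero]
    · exact crossComp_succ_eq_zero k i hc _ _

/-- Where the two strands have equal colours, the word is a 1×1 block: its row and its column have
no other nonzero entry. -/
lemma cross_block {i : ℕ} {t : (colourSystem k).obj w ⟶ (colourSystem k).obj w} (h : (colourSystem k).Cross i w t) :
    i + 1 < w.length ∧ crossComp k i w w = t ∧
      ∀ x, x ≠ w → crossComp k i w x = 0 ∧ crossComp k i x w = 0 := by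
  induction h with
  | head a v =>
    refine ⟨by simp, ?_, fun x hx => ⟨?_, ?_⟩⟩
    · rw [crossComp_zero_apply, crossW_same]
      rfl
    · refine crossComp_zero_eq_zero_of_ne ?_
      rintro c d v' rfl rfl
      refine crossW_eq_zero k ?_ ?_ <;> (rintro ⟨rfl, rfl⟩; exact hx rfl)
    · refine crossComp_zero_eq_zero_of_ne' ?_
      rintro c d v' rfl rfl
      refine crossW_eq_zero k ?_ ?_ <;> (rintro ⟨rfl, rfl⟩; exact hx rfl)
  | cons c h ih =>
    obtain ⟨hl, h₁, h₂⟩ := ih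
    refine ⟨by simpa using hl, ?_, fun x hx => ⟨?_, ?_⟩⟩
    · rw [crossComp_succ_apply, h₁]
      rfl
    · refine crossComp_succ_eq_zero_of_ne ?_
      rintro w' rfl
      exact (h₂ w' fun e => hx (by rw [e])).1
    · refine crossComp_succ_eq_zero_of_ne' ?_
      rintro w' rfl
      exact (h₂ w' fun e => hx (by rw [e])).2

/-- The components of the image of a crossing on two words that differ by an interchange. -/
structure SwapBlock (i : ℕ) (w w' : List (Unit ⊕ Unit)) (t : wordC k w ⟶ wordC k w')
    (t' : wordC k w' ⟶ wordC k w) (d : wordC k w ⟶ wordC k w) : Prop where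
  length : i + 1 < w.length
  ne : w ≠ w'
  swap : (colourSystem k).Swap i w' w t'
  hom_inv : t ≫ t' = 𝟙 _
  inv_hom : t' ≫ t = 𝟙 _
  self : crossComp k i w w = -d
  right : crossComp k i w w' = t - d ≫ t
  left : crossComp k i w' w = t' + t' ≫ d
  self' : crossComp k i w' w' = t' ≫ d ≫ t
  row : ∀ x, x ≠ w → x ≠ w' → crossComp k i w x = 0
  row' : ∀ x, x ≠ w → x ≠ w' → crossComp k i w' x = 0
  col : ∀ x, x ≠ w → x ≠ w' → crossComp k i x w = 0
  col' : ∀ x, x ≠ w → x ≠ w' → crossComp k i x w' = 0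

lemma SwapBlock.cons {i : ℕ} {t : wordC k w ⟶ wordC k w'} {t' : wordC k w' ⟶ wordC k w}
    {d : wordC k w ⟶ wordC k w} (H : SwapBlock i w w' t t' d) (c : Unit ⊕ Unit) :
    SwapBlock (i + 1) (c :: w) (c :: w') (consC c t) (consC c t') (consC c d) := by
  refine ⟨by simpa using H.length, fun e => H.ne (List.cons_eq_cons.1 e).2, .cons _ H.swap, ?_, ?_, ?_,
    ?_, ?_, ?_, fun x hx hx' => ?_, fun x hx hx' => ?_, fun x hx hx' => ?_, fun x hx hx' => ?_⟩
  · rw [← consC_comp, H.hom_inv, consC_id]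
  · rw [← consC_comp, H.inv_hom, consC_id]
  · rw [crossComp_succ_apply, H.self, consC_neg]
  · rw [crossComp_succ_apply, H.right, consC_sub, consC_comp]
  · rw [crossComp_succ_apply, H.left, consC_add, consC_comp]
  · rw [crossComp_succ_apply, H.self', consC_comp, consC_comp]
  · refine crossComp_succ_eq_zero_of_ne ?_
    rintro w' rfl
    exact H.row _ (fun e => hx (by rw [e])) (fun e => hx' (by rw [e]))
  · refine crossComp_succ_eq_zero_of_ne ?_
    rintro w' rfl
    exact H.row' _ (fun e => hx (by rw [e])) (fun e => hx' (by rw [e]))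
  · refine crossComp_succ_eq_zero_of_ne' ?_
    rintro w' rfl
    exact H.col _ (fun e => hx (by rw [e])) (fun e => hx' (by rw [e]))
  · refine crossComp_succ_eq_zero_of_ne' ?_
    rintro w' rfl
    exact H.col' _ (fun e => hx (by rw [e])) (fun e => hx' (by rw [e]))

/-- Here `d` is the dumbbell on the two strands in `w`. The dumbbell on `w'` is rewritten as a
conjugate of `-d` by `dumbC_swap`, so the whole 2×2 block is expressed by `t`, `t'` and one `d`. -/
lemma swap_block {i : ℕ} {t : (colourSystem k).obj w ⟶ (colourSystem k).obj w'} (h : (colourSystem k).Swap i w w' t) :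
    ∃ t' d, SwapBlock i w w' t t' d := by
  induction h with
  | head a b v h =>
    refine ⟨headC (swapC k b a) v, headC (dumbC k a b) v, ?_⟩
    have e := headC_swapC_swapC k a b v
    have e' := headC_swapC_swapC k b a v
    refine ⟨by simp, fun hab => h (List.cons_eq_cons.1 hab).1, .head _ _ _ h.symm, e, e', ?_, ?_, ?_,
      ?_, fun x hx hx' => ?_, fun x hx hx' => ?_, fun x hx hx' => ?_, fun x hx hx' => ?_⟩
    · rw [crossComp_zero_apply, crossW_self k h, headC_neg]
    · rw [crossComp_zero_apply, crossW_swap k h, headC_sub, headC_comp]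
      rfl
    · rw [crossComp_zero_apply, crossW_swap k h.symm, headC_sub, headC_comp, dumbC_swap k h, headC_neg,
        headC_comp, headC_comp, Preadditive.neg_comp, sub_neg_eq_add, Category.assoc, Category.assoc, e,
        Category.comp_id]
    · rw [crossComp_zero_apply, crossW_self k h.symm, dumbC_swap k h, neg_neg, headC_comp, headC_comp]
      rfl
    all_goals
      first | refine crossComp_zero_eq_zero_of_ne ?_ | refine crossComp_zero_eq_zero_of_ne' ?_
      rintro c d v' rfl rfl
      refine crossW_eq_zero k ?_ ?_ <;> rintro ⟨rfl, rfl⟩ <;> first | exact hx rfl | exact hx' rfl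
  | cons c h ih =>
    obtain ⟨t', d, H⟩ := ih
    exact ⟨_, _, H.cons c⟩

variable (k) in
lemma exists_cross_or_swap {i : ℕ} (h : i + 1 < w.length) :
    (∃ t, (colourSystem k).Cross i w t) ∨ ∃ w' t, (colourSystem k).Swap i w w' t := by
  induction i generalizing w with
  | zero =>
    obtain _ | ⟨a, _ | ⟨b, v⟩⟩ := w
    · simp at h
    · simp at h
    · by_cases hab : a = b
      · subst hab
        exact Or.inl ⟨_, .head _ _⟩
      · exact Or.inr ⟨_, _, .head _ _ _ hab⟩
  | succ i ih =>
    obtain _ | ⟨a, w⟩ := w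
    · simp at h
    · rcases ih (w := w) (by simpa using h) with ⟨t, ht⟩ | ⟨w', t, ht⟩
      · exact Or.inl ⟨_, .cons _ ht⟩
      · exact Or.inr ⟨_, _, .cons _ ht⟩

end CrossingMatrices

/-! ### Morphisms fixed or negated by all crossings -/

section WordMatrices

universe v₁ u₁

lemma mat_comp_single_col {C : Type u₁} [Category.{v₁} C] [Preadditive C] {M N K : Mat_ C}
    (f : M ⟶ N) (g : N ⟶ K) (i : M.ι) (j : N.ι) (l : K.ι)
    (h : ∀ j', j' ≠ j → g j' l = 0) : (f ≫ g) i l = f i j ≫ g j l := by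
  classical
  rw [Mat_.comp_apply, Finset.sum_eq_single j]
  · intro j' _ hj
    rw [h j' hj, comp_zero]
  · simp

lemma mat_comp_pair_col {C : Type u₁} [Category.{v₁} C] [Preadditive C] {M N K : Mat_ C}
    (f : M ⟶ N) (g : N ⟶ K) (i : M.ι) (j₁ j₂ : N.ι) (l : K.ι)
    (hne : j₁ ≠ j₂) (h : ∀ j', j' ≠ j₁ → j' ≠ j₂ → g j' l = 0) :
    (f ≫ g) i l = f i j₁ ≫ g j₁ l + f i j₂ ≫ g j₂ l := by
  classical
  rw [Mat_.comp_apply, ← Finset.sum_subset (Finset.subset_univ {j₁, j₂}), Finset.sum_pair hne]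
  intro j' _ hj
  simp only [Finset.mem_insert, Finset.mem_singleton, not_or] at hj
  rw [h j' hj.1 hj.2, comp_zero]

instance wordFintype (n : ℕ) : Fintype {w : List (Unit ⊕ Unit) // w.length = n} :=
  inferInstanceAs (Fintype (List.Vector (Unit ⊕ Unit) n))

variable (k : Type u) [Field k]

/-- The direct sum of all words of length `n`. -/
def wordMat (n : ℕ) : Mat_ (AHBar k) :=
  ⟨{w : List (Unit ⊕ Unit) // w.length = n}, fun w => wordC k w.1⟩

/-- The image of the crossing of neighbouring strands on the direct sum of all words. -/
def crossMatAt (n i : ℕ) : wordMat k n ⟶ wordMat k n :=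
  fun w w' => crossComp k i w.1 w'.1

variable {k} {n : ℕ} {M : Mat_ (AHBar k)}

/-- The components of a morphism to the direct sum of all words. -/
def wordCol (f : M ⟶ wordMat k n) (j : M.ι) (w : {w : List (Unit ⊕ Unit) // w.length = n}) :
    M.X j ⟶ wordC k w.1 :=
  f j w

/-- The components of a morphism out of the direct sum of all words. -/
def wordRow (g : wordMat k n ⟶ M) (j : M.ι) (w : {w : List (Unit ⊕ Unit) // w.length = n}) :
    wordC k w.1 ⟶ M.X j :=
  g w j

lemma wordCol_comp_single (f : M ⟶ wordMat k n) (j : M.ι) {i : ℕ}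
    {w : {w : List (Unit ⊕ Unit) // w.length = n}} {t : wordC k w.1 ⟶ wordC k w.1}
    (h : (colourSystem k).Cross i w.1 t) :
    wordCol (f ≫ crossMatAt k n i) j w = wordCol f j w ≫ t := by
  obtain ⟨-, h₁, h₂⟩ := cross_block h
  refine (mat_comp_single_col f (crossMatAt k n i) j w w
    fun x hx => (h₂ x.1 fun e => hx (Subtype.ext e)).2).trans ?_
  exact congrArg (wordCol f j w ≫ ·) h₁

lemma wordRow_comp_single (g : wordMat k n ⟶ M) (j : M.ι) {i : ℕ}
    {w : {w : List (Unit ⊕ Unit) // w.length = n}} {t : wordC k w.1 ⟶ wordC k w.1}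
    (h : (colourSystem k).Cross i w.1 t) :
    wordRow (crossMatAt k n i ≫ g) j w = t ≫ wordRow g j w := by
  obtain ⟨-, h₁, h₂⟩ := cross_block h
  refine (mat_comp_single (crossMatAt k n i) g w w j
    fun x hx => (h₂ x.1 fun e => hx (Subtype.ext e)).1).trans ?_
  exact congrArg (· ≫ wordRow g j w) h₁

section

variable {i : ℕ} {w w' : {w : List (Unit ⊕ Unit) // w.length = n}} {t : wordC k w.1 ⟶ wordC k w'.1}
  {t' : wordC k w'.1 ⟶ wordC k w.1} {d : wordC k w.1 ⟶ wordC k w.1}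

lemma wordCol_comp_left (f : M ⟶ wordMat k n) (j : M.ι) (H : SwapBlock i w.1 w'.1 t t' d) :
    wordCol (f ≫ crossMatAt k n i) j w =
      wordCol f j w ≫ (-d) + wordCol f j w' ≫ (t' + t' ≫ d) := by
  refine (mat_comp_pair_col f (crossMatAt k n i) j w w' w (fun e => H.ne (congrArg Subtype.val e))
    fun x hx hx' => H.col x.1 (fun e => hx (Subtype.ext e)) (fun e => hx' (Subtype.ext e))).trans ?_
  exact congrArg₂ (· + ·) (congrArg (wordCol f j w ≫ ·) H.self)
    (congrArg (wordCol f j w' ≫ ·) H.left)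

lemma wordCol_comp_right (f : M ⟶ wordMat k n) (j : M.ι) (H : SwapBlock i w.1 w'.1 t t' d) :
    wordCol (f ≫ crossMatAt k n i) j w' =
      wordCol f j w ≫ (t - d ≫ t) + wordCol f j w' ≫ t' ≫ d ≫ t := by
  refine (mat_comp_pair_col f (crossMatAt k n i) j w w' w' (fun e => H.ne (congrArg Subtype.val e))
    fun x hx hx' => H.col' x.1 (fun e => hx (Subtype.ext e)) (fun e => hx' (Subtype.ext e))).trans ?_
  exact congrArg₂ (· + ·) (congrArg (wordCol f j w ≫ ·) H.right)
    (congrArg (wordCol f j w' ≫ ·) H.self')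

lemma wordRow_comp_left (g : wordMat k n ⟶ M) (j : M.ι) (H : SwapBlock i w.1 w'.1 t t' d) :
    wordRow (crossMatAt k n i ≫ g) j w =
      (-d) ≫ wordRow g j w + (t - d ≫ t) ≫ wordRow g j w' := by
  refine (mat_comp_pair (crossMatAt k n i) g w w w' j (fun e => H.ne (congrArg Subtype.val e))
    fun x hx hx' => H.row x.1 (fun e => hx (Subtype.ext e)) (fun e => hx' (Subtype.ext e))).trans ?_
  exact congrArg₂ (· + ·) (congrArg (· ≫ wordRow g j w) H.self)
    (congrArg (· ≫ wordRow g j w') H.right)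

lemma wordRow_comp_right (g : wordMat k n ⟶ M) (j : M.ι) (H : SwapBlock i w.1 w'.1 t t' d) :
    wordRow (crossMatAt k n i ≫ g) j w' =
      (t' + t' ≫ d) ≫ wordRow g j w + (t' ≫ d ≫ t) ≫ wordRow g j w' := by
  refine (mat_comp_pair (crossMatAt k n i) g w' w w' j (fun e => H.ne (congrArg Subtype.val e))
    fun x hx hx' => H.row' x.1 (fun e => hx (Subtype.ext e)) (fun e => hx' (Subtype.ext e))).trans ?_
  exact congrArg₂ (· + ·) (congrArg (· ≫ wordRow g j w) H.left)
    (congrArg (· ≫ wordRow g j w') H.self')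

end

/-- On a 2×2 block with components `y`, `z`, the two equations amount to (y - zt')(1 + d) = 0 and (y
- zt')(1 - d) = 0. Their sum removes `d`, so no invertibility of 1 ± d is needed, only that of 2. -/
lemma invariant_of_fixed [CharZero k] (f : M ⟶ wordMat k n)
    (hf : ∀ i, i + 1 < n → f ≫ crossMatAt k n i = f) (j : M.ι) :
    (colourSystem k).Invariant (n := n) (wordCol f j) where
  swap {i w w' t} h := by
    obtain ⟨t', d, H⟩ := swap_block h
    have hi : i + 1 < n := w.2 ▸ H.length
    have e₁ := wordCol_comp_left f j H
    have e₂ := wordCol_comp_right f j H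
    rw [hf i hi] at e₁ e₂
    generalize wordCol f j w = y at *
    generalize wordCol f j w' = z at *
    change wordC k w.1 ⟶ wordC k w'.1 at t
    change y ≫ t = z
    have e₃ : z ≫ t' = y - y ≫ d + z ≫ t' ≫ d := by
      nth_rewrite 1 [e₂]
      have := H.hom_inv
      simp only [Preadditive.add_comp, Preadditive.comp_sub, Preadditive.sub_comp, Category.assoc]
      rw [this, Category.comp_id, Category.comp_id]
    -- With `e₁` inserted for `y` and `e₃` for `z ≫ t'`, the terms with `d` cancel and the
    -- difference becomes its own negative.
    have e₄ : y - z ≫ t' = 0 := by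
      refine eq_zero_of_eq_neg (k := k) ?_
      nth_rewrite 1 [e₁, e₃]
      simp only [Preadditive.comp_add, Preadditive.comp_neg]
      abel
    rw [sub_eq_zero.1 e₄, Category.assoc]
    exact (congrArg (z ≫ ·) H.inv_hom).trans (Category.comp_id _)
  cross {i w c} h := by
    have hi : i + 1 < n := w.2 ▸ (cross_block h).1
    have := wordCol_comp_single f j h
    rw [hf i hi] at this
    exact this.symm

lemma fixed_of_invariant (f : M ⟶ wordMat k n)
    (hf : ∀ j, (colourSystem k).Invariant (n := n) (wordCol f j)) (i : ℕ) (hi : i + 1 < n) :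
    f ≫ crossMatAt k n i = f := by
  suffices H : ∀ j (w : {w : List (Unit ⊕ Unit) // w.length = n}),
      wordCol (f ≫ crossMatAt k n i) j w = wordCol f j w by
    ext j w
    exact H j w
  intro j w
  rcases exists_cross_or_swap k (w := w.1) (i := i) (by rw [w.2]; exact hi) with ⟨t, h⟩ | ⟨w', t, h⟩
  · exact (wordCol_comp_single f j h).trans ((hf j).cross h)
  · obtain ⟨t', d, H⟩ := swap_block h
    -- Any word with different colours at this place can serve as the first word of its block, so a
    -- single column formula is enough.
    have e := wordCol_comp_left (w' := ⟨w', h.length.trans w.2⟩) f j H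
    have e' := (hf j).swap (w' := ⟨w', h.length.trans w.2⟩) h
    rw [e, ← e']
    change wordC k w.1 ⟶ wordC k w' at t
    have := H.hom_inv
    change wordCol f j w ≫ (-d) + (wordCol f j w ≫ t) ≫ (t' + t' ≫ d) = _
    simp only [Preadditive.comp_add, Preadditive.comp_neg, Category.assoc]
    rw [this, reassoc_of% this, Category.comp_id, neg_add_eq_sub]
    abel

/-- Passage to the opposite category reverses an interchange and gives it a sign. -/
lemma signed_swap {i : ℕ} {w w' : List (Unit ⊕ Unit)}
    {t : (signedSystem k).obj w ⟶ (signedSystem k).obj w'} (h : (signedSystem k).Swap i w w' t) :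
    ∃ t' : wordC k w' ⟶ wordC k w, (colourSystem k).Swap i w' w t' ∧ t = (-t').op := by
  induction h with
  | head a b v h => exact ⟨_, .head b a v h.symm, rfl⟩
  | cons c h ih =>
    obtain ⟨t', h', rfl⟩ := ih
    exact ⟨_, .cons c h', congrArg Quiver.Hom.op (consC_neg c t')⟩

lemma signed_cross {i : ℕ} {w : List (Unit ⊕ Unit)}
    {t : (signedSystem k).obj w ⟶ (signedSystem k).obj w} (h : (signedSystem k).Cross i w t) :
    ∃ t' : wordC k w ⟶ wordC k w, (colourSystem k).Cross i w t' ∧ t = (-t').op := by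
  induction h with
  | head a v => exact ⟨_, .head a v, rfl⟩
  | cons c h ih =>
    obtain ⟨t', h', rfl⟩ := ih
    exact ⟨_, .cons c h', congrArg Quiver.Hom.op (consC_neg c t')⟩

lemma swap_signed {i : ℕ} {w w' : List (Unit ⊕ Unit)}
    {t : (colourSystem k).obj w ⟶ (colourSystem k).obj w'} (h : (colourSystem k).Swap i w w' t) :
    (signedSystem k).Swap i w' w (-t).op := by
  induction h with
  | head a b v h => exact .head b a v h.symm
  | @cons c i w w' t h ih =>
    have e := StrandSystem.Swap.cons c ih
    have e' : (signedSystem k).cons c (-t : wordC k w ⟶ wordC k w').op = (-consC c t).op :=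
      congrArg Quiver.Hom.op (consC_neg c _)
    exact e' ▸ e

lemma cross_signed {i : ℕ} {w : List (Unit ⊕ Unit)}
    {t : (colourSystem k).obj w ⟶ (colourSystem k).obj w} (h : (colourSystem k).Cross i w t) :
    (signedSystem k).Cross i w (-t).op := by
  induction h with
  | head a v => exact .head a v
  | @cons c i w t h ih =>
    have e := StrandSystem.Cross.cons c ih
    have e' : (signedSystem k).cons c (-t : wordC k w ⟶ wordC k w).op = (-consC c t).op :=
      congrArg Quiver.Hom.op (consC_neg c _)
    exact e' ▸ e

/-- For morphisms out of the words, the two equations of a block have (1 - d) and (1 + d) as left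
factors of the same sum of components, and adding them removes `d`. For antisymmetric morphisms into
the words the relation between components would still involve `d`; this is why exterior powers are
treated through morphisms in the other direction. -/
lemma invariant_of_antifixed [CharZero k] (g : wordMat k n ⟶ M)
    (hg : ∀ i, i + 1 < n → crossMatAt k n i ≫ g = -g) (j : M.ι) :
    (signedSystem k).Invariant (n := n) (fun w => (wordRow g j w).op) where
  swap {i w w' t} h := by
    obtain ⟨t, h', rfl⟩ := signed_swap h
    obtain ⟨t', d, H⟩ := swap_block h'
    refine congrArg Quiver.Hom.op (?_ : (-t) ≫ wordRow g j w = wordRow g j w')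
    have hi : i + 1 < n := w'.2 ▸ H.length
    have e₁ := wordRow_comp_left g j H
    have e₂ := wordRow_comp_right g j H
    rw [hg i hi] at e₁ e₂
    have e₁' : wordRow (-g) j w' = -wordRow g j w' := rfl
    have e₂' : wordRow (-g) j w = -wordRow g j w := rfl
    rw [e₁'] at e₁
    rw [e₂'] at e₂
    generalize wordRow g j w = y at *
    generalize wordRow g j w' = z at *
    have e₃ : -(t ≫ y) = z + d ≫ z + d ≫ t ≫ y := by
      rw [← Preadditive.comp_neg, e₂]
      have := H.hom_inv
      simp only [Preadditive.comp_add, Preadditive.add_comp, Category.assoc]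
      rw [reassoc_of% this, reassoc_of% this, reassoc_of% this]
    have e₄ : -(t ≫ y) - z = 0 := by
      refine eq_zero_of_eq_neg (k := k) ?_
      have e₅ : d ≫ z = z + t ≫ y - d ≫ t ≫ y := by
        simp only [Preadditive.sub_comp, Preadditive.neg_comp, Category.assoc] at e₁
        rw [← sub_eq_zero, ← sub_eq_zero.2 e₁]
        abel
      rw [neg_sub]
      nth_rewrite 1 [e₃]
      rw [e₅]
      abel
    rw [Preadditive.neg_comp]
    exact sub_eq_zero.1 e₄
  cross {i w c} h := by
    obtain ⟨c, h', rfl⟩ := signed_cross h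
    refine congrArg Quiver.Hom.op (?_ : (-c) ≫ wordRow g j w = wordRow g j w)
    have hi : i + 1 < n := w.2 ▸ (cross_block h').1
    have := wordRow_comp_single g j h'
    rw [hg i hi] at this
    rw [Preadditive.neg_comp, ← this]
    exact neg_neg (wordRow g j w)

lemma antifixed_of_invariant (g : wordMat k n ⟶ M)
    (hg : ∀ j, (signedSystem k).Invariant (n := n) (fun w => (wordRow g j w).op)) (i : ℕ)
    (hi : i + 1 < n) : crossMatAt k n i ≫ g = -g := by
  suffices H : ∀ j (w : {w : List (Unit ⊕ Unit) // w.length = n}),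
      wordRow (crossMatAt k n i ≫ g) j w = -wordRow g j w by
    ext w j
    exact H j w
  intro j w
  rcases exists_cross_or_swap k (w := w.1) (i := i) (by rw [w.2]; exact hi) with ⟨t, h⟩ | ⟨w', t, h⟩
  · change wordC k w.1 ⟶ wordC k w.1 at t
    have e : (-t) ≫ wordRow g j w = wordRow g j w :=
      congrArg Quiver.Hom.unop ((hg j).cross (cross_signed h))
    have e' : -(t ≫ wordRow g j w) = wordRow g j w := by
      rw [← Preadditive.neg_comp]; exact e
    exact (wordRow_comp_single g j h).trans (neg_eq_iff_eq_neg.1 e')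
  · obtain ⟨t', d, H⟩ := swap_block h
    have e := wordRow_comp_left (w' := ⟨w', h.length.trans w.2⟩) g j H
    have e' : (-t) ≫ wordRow g j ⟨w', h.length.trans w.2⟩ = wordRow g j w :=
      congrArg Quiver.Hom.unop ((hg j).swap (w := ⟨w', h.length.trans w.2⟩) (swap_signed h))
    rw [e, ← e']
    change wordC k w.1 ⟶ wordC k w' at t
    generalize wordRow g j ⟨w', h.length.trans w.2⟩ = y
    change wordC k w' ⟶ M.X j at y
    change (-d) ≫ ((-t) ≫ y) + (t - d ≫ t) ≫ y = -((-t) ≫ y)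
    simp only [Preadditive.sub_comp, Preadditive.neg_comp, Category.assoc, Preadditive.comp_neg]
    abel

end WordMatrices

/-! ### Sums of words as iterated tensor products -/

section WordMatrixIsos

variable (k : Type u) [Field k]

/-- Adding a letter on the left of a word. -/
def wordConsEquiv (n : ℕ) : (Unit ⊕ Unit) × {w : List (Unit ⊕ Unit) // w.length = n} ≃
    {w : List (Unit ⊕ Unit) // w.length = n + 1} :=
  Equiv.ofBijective (fun p => ⟨p.1 :: p.2.1, by rw [List.length_cons, p.2.2]⟩) <| by
    constructor
    · rintro ⟨c, w, hw⟩ ⟨c', w', hw'⟩ h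
      simpa using h
    · rintro ⟨_ | ⟨c, w⟩, h⟩
      · simp at h
      · exact ⟨(c, ⟨w, by simpa using h⟩), rfl⟩

/-- The words of length `n + 1` are the words of length `n` with a further letter on the left. -/
def wordConsIso (n : ℕ) : blueRed k ⊗ wordMat k n ≅ wordMat k (n + 1) :=
  matIso (M := blueRed k ⊗ wordMat k n) (N := wordMat k (n + 1)) (wordConsEquiv n)
    fun p => Iso.refl (wordC k (p.1 :: p.2.1))

/-- The only word of length zero is the empty word. -/
def wordNilIso : 𝟙_ (Mat_ (AHBar k)) ≅ wordMat k 0 :=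
  matIso (M := 𝟙_ (Mat_ (AHBar k))) (N := wordMat k 0)
    (Equiv.ofBijective (fun _ => (⟨[], rfl⟩ : {w : List (Unit ⊕ Unit) // w.length = 0})) <| by
      constructor
      · rintro ⟨⟩ ⟨⟩ _
        rfl
      · rintro ⟨w, hw⟩
        exact ⟨PUnit.unit, Subtype.ext (List.length_eq_zero_iff.1 hw).symm⟩)
    fun _ => Iso.refl (wordC k [])

lemma wordConsIso_crossMatAt (n i : ℕ) : (blueRed k ◁ crossMatAt k n i) ≫ (wordConsIso k n).hom =
    (wordConsIso k n).hom ≫ crossMatAt k (n + 1) (i + 1) := by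
  ext ⟨c, w⟩ q
  obtain ⟨⟨c', w'⟩, rfl⟩ := (wordConsEquiv n).surjective q
  refine (comp_matOfMap_apply (M := blueRed k ⊗ wordMat k n) (N := wordMat k (n + 1))
    (wordConsEquiv n) (Equiv.injective _) _ (blueRed k ◁ crossMatAt k n i) (c, w) (c', w')).trans
    (Eq.trans ?_ (matOfMap_comp_apply (M := blueRed k ⊗ wordMat k n) (N := wordMat k (n + 1))
    (wordConsEquiv n) _ (crossMatAt k (n + 1) (i + 1)) (c, w) (wordConsEquiv n (c', w'))).symm)
  exact (Category.comp_id _).trans (Category.id_comp _).symm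

/-- The words of length `n + 2` are the words of length `n` with two further letters on the left. -/
def wordConsConsIso (n : ℕ) : (blueRed k ⊗ blueRed k) ⊗ wordMat k n ≅ wordMat k (n + 2) :=
  α_ _ _ _ ≪≫ whiskerLeftIso (blueRed k) (wordConsIso k n) ≪≫ wordConsIso k (n + 1)

lemma wordConsConsIso_hom (n : ℕ) : (wordConsConsIso k n).hom =
    matOfMap (M := (blueRed k ⊗ blueRed k) ⊗ wordMat k n) (N := wordMat k (n + 2))
      (fun p => wordConsEquiv (n + 1) (p.1.1, wordConsEquiv n (p.1.2, p.2)))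
      (fun p => 𝟙 (wordC k (p.1.1 :: p.1.2 :: p.2.1))) := by
  have h₁ : (blueRed k ◁ (wordConsIso k n).hom) = matOfMap (M := blueRed k ⊗ blueRed k ⊗ wordMat k n)
      (N := blueRed k ⊗ wordMat k (n + 1)) (fun p => (p.1, wordConsEquiv n p.2))
      (fun p => consC p.1 (𝟙 (wordC k (p.2.1 :: p.2.2.1)))) := by
    rw [← id_tensorHom, ← matOfMap_id]
    exact mat_tensorHom_matOfMap _ _ _ _
  have h₂ : (α_ (blueRed k) (blueRed k) (wordMat k n)).hom ≫ (blueRed k ◁ (wordConsIso k n).hom) =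
      matOfMap (M := (blueRed k ⊗ blueRed k) ⊗ wordMat k n) (N := blueRed k ⊗ wordMat k (n + 1))
        (fun p => (p.1.1, wordConsEquiv n (p.1.2, p.2)))
        (fun p => 𝟙 (wordC k (p.1.1 :: p.1.2 :: p.2.1)) ≫
          consC p.1.1 (𝟙 (wordC k (p.1.2 :: p.2.1)))) := by
    rw [h₁]
    exact matOfMap_comp _ _ _ _
  have h₃ : (wordConsConsIso k n).hom = ((α_ (blueRed k) (blueRed k) (wordMat k n)).hom ≫
      (blueRed k ◁ (wordConsIso k n).hom)) ≫ (wordConsIso k (n + 1)).hom :=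
    (Category.assoc _ _ _).symm
  rw [h₃, h₂]
  refine (matOfMap_comp _ _ _ _).trans ?_
  refine congrArg (matOfMap (M := (blueRed k ⊗ blueRed k) ⊗ wordMat k n) (N := wordMat k (n + 2))
      (fun p => wordConsEquiv (n + 1) (p.1.1, wordConsEquiv n (p.1.2, p.2)))) ?_
  funext p
  have h₄ : ∀ (a b : Unit ⊕ Unit) (w : List (Unit ⊕ Unit)), (𝟙 (wordC k (a :: b :: w)) ≫
      consC a (𝟙 (wordC k (b :: w)))) ≫ 𝟙 (wordC k (a :: b :: w)) = 𝟙 _ := fun a b w => by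
    rw [consC_id, Category.id_comp, Category.id_comp]
  exact h₄ p.1.1 p.1.2 p.2.1

lemma wordConsConsIso_crossMatAt (n : ℕ) :
    (crossMat k ▷ wordMat k n) ≫ (wordConsConsIso k n).hom =
      (wordConsConsIso k n).hom ≫ crossMatAt k (n + 2) 0 := by
  rw [wordConsConsIso_hom]
  ext ⟨⟨a, b⟩, w⟩ q
  obtain ⟨⟨c, q⟩, rfl⟩ := (wordConsEquiv (n + 1)).surjective q
  obtain ⟨⟨d, w'⟩, rfl⟩ := (wordConsEquiv n).surjective q
  have hinj : Function.Injective fun p : ((Unit ⊕ Unit) × (Unit ⊕ Unit)) ×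
      {w : List (Unit ⊕ Unit) // w.length = n} =>
      wordConsEquiv (n + 1) (p.1.1, wordConsEquiv n (p.1.2, p.2)) := by
    rintro ⟨⟨a, b⟩, w⟩ ⟨⟨c, d⟩, w'⟩ h
    have h₁ := (wordConsEquiv (n + 1)).injective h
    have h₂ := (wordConsEquiv n).injective (Prod.ext_iff.1 h₁).2
    simp_all
  refine (comp_matOfMap_apply (M := (blueRed k ⊗ blueRed k) ⊗ wordMat k n) (N := wordMat k (n + 2))
    (fun p => wordConsEquiv (n + 1) (p.1.1, wordConsEquiv n (p.1.2, p.2))) hinj _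
    (crossMat k ▷ wordMat k n) ((a, b), w) ((c, d), w')).trans
    (Eq.trans ?_ (matOfMap_comp_apply (M := (blueRed k ⊗ blueRed k) ⊗ wordMat k n)
      (N := wordMat k (n + 2))
      (fun p => wordConsEquiv (n + 1) (p.1.1, wordConsEquiv n (p.1.2, p.2))) _
      (crossMatAt k (n + 2) 0) ((a, b), w)
      (wordConsEquiv (n + 1) (c, wordConsEquiv n (d, w')))).symm)
  refine (Category.comp_id _).trans (Eq.trans ?_ (Category.id_comp _).symm)
  refine congrArg (crossW k a b c d ⊗ₘ ·) (?_ :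
    (𝟙 (wordMat k n) : wordMat k n ⟶ wordMat k n) w w' = wordDelta k w.1 w'.1)
  by_cases h : w = w'
  · subst h
    rw [wordDelta_self]
    exact Mat_.id_apply_self (wordMat k n) w
  · rw [wordDelta_of_ne k fun e => h (Subtype.ext e)]
    exact Mat_.id_apply_of_ne (wordMat k n) w w' h

end WordMatrixIsos

/-! ### Oplax monoidal functors and morphisms acting on some of the strands -/

section MonoidalFunctors

universe v₁ u₁ v₂ u₂

variable {C : Type u₁} [Category.{v₁} C] [MonoidalCategory C] {D : Type u₂} [Category.{v₂} D]
  [MonoidalCategory D] (F : C ⥤ D) [F.OplaxMonoidal]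

open Functor.OplaxMonoidal

/-- The case of `map_crossAt_powIso` in which the crossing avoids the first strand and is covered by
induction. -/
lemma map_whiskerLeft_comp_delta {X Z : C} {V W K : D} (c : Z ⟶ Z) (g : F.obj X ⟶ V)
    (φ : F.obj Z ⟶ W) (m : W ⟶ W) (h : F.map c ≫ φ = φ ≫ m) (κ : V ⊗ W ⟶ K) (s : K ⟶ K)
    (hs : (V ◁ m) ≫ κ = κ ≫ s) :
    F.map (X ◁ c) ≫ δ F X Z ≫ (g ⊗ₘ φ) ≫ κ = (δ F X Z ≫ (g ⊗ₘ φ) ≫ κ) ≫ s := by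
  rw [← δ_natural_right_assoc, Category.assoc, Category.assoc, ← hs, ← id_tensorHom,
    ← id_tensorHom, tensorHom_comp_tensorHom_assoc, tensorHom_comp_tensorHom_assoc,
    Category.id_comp, Category.comp_id, h]

/-- The case of a crossing of the first two strands. `powIso` splits off one strand at a time, so
coassociativity of `δ` is needed to bring these two together. -/
lemma map_whiskerRight_comp_delta {X Y Z : C} {V U W K L : D} (c : X ⊗ Y ⟶ X ⊗ Y)
    (g : F.obj X ⟶ V) (g' : F.obj Y ⟶ U) (φ : F.obj Z ⟶ W) (m : V ⊗ U ⟶ V ⊗ U)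
    (h : F.map c ≫ δ F X Y ≫ (g ⊗ₘ g') = δ F X Y ≫ (g ⊗ₘ g') ≫ m) (κ : U ⊗ W ⟶ K)
    (κ' : V ⊗ K ⟶ L) (s : L ⟶ L)
    (hs : (m ▷ W) ≫ (α_ V U W).hom ≫ (V ◁ κ) ≫ κ' = (α_ V U W).hom ≫ (V ◁ κ) ≫ κ' ≫ s) :
    F.map ((α_ X Y Z).inv ≫ (c ▷ Z) ≫ (α_ X Y Z).hom) ≫
        δ F X (Y ⊗ Z) ≫ (g ⊗ₘ (δ F Y Z ≫ (g' ⊗ₘ φ) ≫ κ)) ≫ κ' =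
      (δ F X (Y ⊗ Z) ≫ (g ⊗ₘ (δ F Y Z ≫ (g' ⊗ₘ φ) ≫ κ)) ≫ κ') ≫ s := by
  have e : F.map (α_ X Y Z).hom ≫ δ F X (Y ⊗ Z) ≫ (g ⊗ₘ (δ F Y Z ≫ (g' ⊗ₘ φ) ≫ κ)) =
      δ F (X ⊗ Y) Z ≫ ((δ F X Y ≫ (g ⊗ₘ g')) ⊗ₘ φ) ≫ (α_ V U W).hom ≫ (V ◁ κ) := by
    have e₁ : (g ⊗ₘ (δ F Y Z ≫ (g' ⊗ₘ φ) ≫ κ)) =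
        (F.obj X ◁ δ F Y Z) ≫ (g ⊗ₘ (g' ⊗ₘ φ)) ≫ (V ◁ κ) := by
      rw [← id_tensorHom, ← id_tensorHom, tensorHom_comp_tensorHom, tensorHom_comp_tensorHom,
        Category.id_comp, Category.comp_id]
    have e₂ : ((δ F X Y ≫ (g ⊗ₘ g')) ⊗ₘ φ) = (δ F X Y ▷ F.obj Z) ≫ ((g ⊗ₘ g') ⊗ₘ φ) := by
      rw [← tensorHom_id, tensorHom_comp_tensorHom, Category.id_comp]
    rw [e₁, e₂, ← Functor.OplaxMonoidal.associativity_assoc, Category.assoc,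
      associator_naturality_assoc]
  have e' : δ F X (Y ⊗ Z) ≫ (g ⊗ₘ (δ F Y Z ≫ (g' ⊗ₘ φ) ≫ κ)) = F.map (α_ X Y Z).inv ≫
      δ F (X ⊗ Y) Z ≫ ((δ F X Y ≫ (g ⊗ₘ g')) ⊗ₘ φ) ≫ (α_ V U W).hom ≫ (V ◁ κ) := by
    rw [← e, ← F.map_comp_assoc, Iso.inv_hom_id, F.map_id, Category.id_comp]
  have e₃ : F.map (c ▷ Z) ≫ δ F (X ⊗ Y) Z ≫ ((δ F X Y ≫ (g ⊗ₘ g')) ⊗ₘ φ) =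
      δ F (X ⊗ Y) Z ≫ ((δ F X Y ≫ (g ⊗ₘ g')) ⊗ₘ φ) ≫ (m ▷ W) := by
    rw [← δ_natural_left_assoc, ← tensorHom_id, ← tensorHom_id, tensorHom_comp_tensorHom,
      tensorHom_comp_tensorHom, Category.id_comp, Category.comp_id, h, Category.assoc]
  rw [F.map_comp, F.map_comp, Category.assoc, Category.assoc, reassoc_of% e, reassoc_of% e₃, hs,
    reassoc_of% e']
  simp only [Category.assoc]

end MonoidalFunctors

/-! ### Images of symmetrizers under the comultiplication -/

section ComultiplicationPowers

/-- The image of a symmetrizer. -/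
def symKar (k : Type u) [Field k] [CharZero k] {D : Type*} [Category* D] [Preadditive D] [Linear k D]
    {Y : D} {n : ℕ} {t : ℕ → End Y} (ht : CoxeterRel n t) : Idempotents.Karoubi D :=
  ⟨Y, (symmetrizer k ht : End Y), symmetrizer_idem ht⟩

variable {k : Type u} [Field k] (Δ : Comultiplication k)

attribute [local instance] Comultiplication.monoidal

/-- The image of a tensor power of the generating object under the comultiplication. -/
def Comultiplication.powIso : ∀ n : ℕ, Δ.functor.obj (upPow k n) ≅ wordMat k n
  | 0 => (Functor.Monoidal.εIso Δ.functor).symm ≪≫ wordNilIso k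
  | n + 1 => (Functor.Monoidal.μIso Δ.functor (up k) (upPow k n)).symm ≪≫
      (Δ.genIso ⊗ᵢ powIso n) ≪≫ wordConsIso k n

lemma Comultiplication.map_crossAt_powIso (n i : ℕ) (hi : i + 1 < n) :
    Δ.functor.map (crossAt k n i : upPow k n ⟶ upPow k n) ≫ (Δ.powIso n).hom =
      (Δ.powIso n).hom ≫ crossMatAt k n i := by
  induction n generalizing i with
  | zero => omega
  | succ n ih =>
    rcases i with _ | i
    · obtain ⟨m, rfl⟩ : ∃ m, n = m + 1 := ⟨n - 1, by omega⟩
      have h : Δ.functor.map (cross k) ≫ Functor.OplaxMonoidal.δ Δ.functor (up k) (up k) ≫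
          (Δ.genIso.hom ⊗ₘ Δ.genIso.hom) = Functor.OplaxMonoidal.δ Δ.functor (up k) (up k) ≫
          (Δ.genIso.hom ⊗ₘ Δ.genIso.hom) ≫ crossMat k := by
        rw [Δ.map_cross]
        simp
      have h' : (crossMat k ▷ wordMat k m) ≫ (α_ _ _ _).hom ≫
          (blueRed k ◁ (wordConsIso k m).hom) ≫ (wordConsIso k (m + 1)).hom =
          (α_ _ _ _).hom ≫ (blueRed k ◁ (wordConsIso k m).hom) ≫ (wordConsIso k (m + 1)).hom ≫
            crossMatAt k (m + 2) 0 :=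
        (wordConsConsIso_crossMatAt k m).trans (by simp [wordConsConsIso])
      have := map_whiskerRight_comp_delta Δ.functor (cross k) Δ.genIso.hom Δ.genIso.hom
        (Δ.powIso m).hom (crossMat k) h (wordConsIso k m).hom (wordConsIso k (m + 1)).hom
        (crossMatAt k (m + 2) 0) h'
      have e : crossAt k (m + 2) 0 = (α_ (up k) (up k) (upPow k m)).inv ≫ (cross k ▷ upPow k m) ≫
          (α_ (up k) (up k) (upPow k m)).hom :=
        ((Category.id_comp _).trans (Category.comp_id _)).symm
      rw [e]
      exact this
    · rw [crossAt_succ k n i (by omega)]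
      exact map_whiskerLeft_comp_delta Δ.functor (crossAt k n i : upPow k n ⟶ upPow k n)
        Δ.genIso.hom (Δ.powIso n).hom (crossMatAt k n i) (ih i (by omega)) (wordConsIso k n).hom
        (crossMatAt k (n + 1) (i + 1)) (wordConsIso_crossMatAt k n i)

/-- The matrices do not depend on Δ, yet their Coxeter relations are transported along Δ from the
affine Hecke category, which avoids checking them on words. -/
lemma Comultiplication.crossMatAt_rel (Δ : Comultiplication k) (n : ℕ) : CoxeterRel n (M := End (wordMat k n))
    (crossMatAt k n) := by
  have := Δ.linear
  refine (((crossAt_rel k n).map (endMap k Δ.functor (upPow k n))).map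
    (endConj k (Δ.powIso n))).congr fun i hi => ?_
  rw [endConj_apply, endMap_apply, Δ.map_crossAt_powIso n i hi, Iso.inv_hom_id_assoc]

/-- The image under the comultiplication of the image of a symmetrizer. -/
def Comultiplication.karIso {n : ℕ} {s : ℕ → End (upPow k n)} {t : ℕ → End (wordMat k n)} [CharZero k]
    (hs : CoxeterRel n s) (ht : CoxeterRel n t)
    (h : ∀ i, i + 1 < n → Δ.functor.map (s i) ≫ (Δ.powIso n).hom = (Δ.powIso n).hom ≫ t i) :
    Δ.kar.obj (karOf (upPow k n) (symmetrizer k hs : End _) (symmetrizer_comp_self _)) ≅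
      symKar k ht :=
  have := Δ.linear
  karMapOfIso.{u, 1} (Mat_.lift Δ.functor) Δ.functor (Mat_.embeddingLiftIso Δ.functor)
      (symmetrizer_comp_self _) ≪≫
    karIsoOfIso (Δ.powIso n) (map_symmetrizer_comp_iso Δ.functor (Δ.powIso n) hs ht h)

variable [CharZero k]

lemma Comultiplication.kar_objH_iso (n : ℕ) : Nonempty (Δ.kar.obj (objH k n) ≅
    symKar k (Δ.crossMatAt_rel n)) := by
  rw [objH_eq]
  exact ⟨Δ.karIso _ _ (Δ.map_crossAt_powIso n)⟩

lemma Comultiplication.kar_objE_iso (n : ℕ) : Nonempty (Δ.kar.obj (objE k n) ≅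
    symKar k (Δ.crossMatAt_rel n).neg) := by
  rw [objE_eq]
  refine ⟨Δ.karIso _ _ fun i hi => ?_⟩
  change Δ.functor.map (-(crossAt k n i : upPow k n ⟶ upPow k n)) ≫ (Δ.powIso n).hom =
    (Δ.powIso n).hom ≫ (-crossMatAt k n i)
  rw [Functor.map_neg, Preadditive.neg_comp, Preadditive.comp_neg, Δ.map_crossAt_powIso n i hi]

end ComultiplicationPowers

/-! ### Tensor products of symmetrizers -/

section TensorSymmetrizers

universe v₁ u₁ v₂ u₂

variable {k : Type u} [Field k] {C : Type u₁} [Category.{v₁} C] [Preadditive C] [Linear k C]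
  {D : Type u₂} [Category.{v₂} D] [MonoidalCategory D] (F G : C ⥤ D) {X Y : C} {Z : D} {m n : ℕ} {s : ℕ → End X} {t : ℕ → End Y}
  (hs : CoxeterRel m s) (ht : CoxeterRel n t)

/-- The tensor product of the images of two symmetrizers. -/
def tensorSymmetrizer : F.obj X ⊗ G.obj Y ⟶ F.obj X ⊗ G.obj Y :=
  F.map (symmetrizer k hs : End X) ⊗ₘ G.map (symmetrizer k ht : End Y)

lemma tensorSymmetrizer_left (i : ℕ) (hi : i + 1 < m) :
    tensorSymmetrizer (k := k) F G hs ht ≫ (F.map (s i) ▷ G.obj Y) =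
      tensorSymmetrizer (k := k) F G hs ht := by
  have := mul_symmetrizer (k := k) hs i hi
  rw [End.mul_def] at this
  rw [tensorSymmetrizer, ← tensorHom_id, tensorHom_comp_tensorHom, ← F.map_comp, this,
    Category.comp_id]

lemma tensorSymmetrizer_right (i : ℕ) (hi : i + 1 < n) :
    tensorSymmetrizer (k := k) F G hs ht ≫ (F.obj X ◁ G.map (t i)) =
      tensorSymmetrizer (k := k) F G hs ht := by
  have := mul_symmetrizer (k := k) ht i hi
  rw [End.mul_def] at this
  rw [tensorSymmetrizer, ← id_tensorHom, tensorHom_comp_tensorHom, ← G.map_comp, this,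
    Category.comp_id]

lemma left_tensorSymmetrizer (i : ℕ) (hi : i + 1 < m) :
    (F.map (s i) ▷ G.obj Y) ≫ tensorSymmetrizer (k := k) F G hs ht =
      tensorSymmetrizer (k := k) F G hs ht := by
  have := symmetrizer_mul (k := k) hs i hi
  rw [End.mul_def] at this
  rw [tensorSymmetrizer, ← tensorHom_id, tensorHom_comp_tensorHom, ← F.map_comp, this,
    Category.id_comp]

lemma right_tensorSymmetrizer (i : ℕ) (hi : i + 1 < n) :
    (F.obj X ◁ G.map (t i)) ≫ tensorSymmetrizer (k := k) F G hs ht =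
      tensorSymmetrizer (k := k) F G hs ht := by
  have := symmetrizer_mul (k := k) ht i hi
  rw [End.mul_def] at this
  rw [tensorSymmetrizer, ← id_tensorHom, tensorHom_comp_tensorHom, ← G.map_comp, this,
    Category.id_comp]

variable [Preadditive D] [Linear k D] [MonoidalPreadditive D] [MonoidalLinear k D]
  [F.Additive] [F.Linear k] [G.Additive] [G.Linear k]

lemma map_symmetrizer_whiskerRight (W : D) (hs' : CoxeterRel (M := End (F.obj X ⊗ W)) m
    fun i => F.map (s i) ▷ W) :
    F.map (symmetrizer k hs : End X) ▷ W = (symmetrizer k hs' : End (F.obj X ⊗ W)) :=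
  map_symmetrizer (endMap k (F ⋙ tensorRight W) X) hs hs'

lemma whiskerLeft_map_symmetrizer (W : D) (ht' : CoxeterRel (M := End (W ⊗ G.obj Y)) n
    fun i => W ◁ G.map (t i)) :
    W ◁ G.map (symmetrizer k ht : End Y) = (symmetrizer k ht' : End (W ⊗ G.obj Y)) :=
  map_symmetrizer (endMap k (G ⋙ tensorLeft W) Y) ht ht'

variable [CharZero k]

/-- Each whiskered symmetrizer is the symmetrizer of the whiskered crossings, and the tensor product
is the composite of the two. -/
lemma comp_tensorSymmetrizer (f : Z ⟶ F.obj X ⊗ G.obj Y)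
    (hf : ∀ i, i + 1 < m → f ≫ (F.map (s i) ▷ G.obj Y) = f)
    (hf' : ∀ i, i + 1 < n → f ≫ (F.obj X ◁ G.map (t i)) = f) :
    f ≫ tensorSymmetrizer (k := k) F G hs ht = f := by
  have h₁ : CoxeterRel (M := End (F.obj X ⊗ G.obj Y)) m fun i => F.map (s i) ▷ G.obj Y :=
    hs.map (endMap k (F ⋙ tensorRight (G.obj Y)) X)
  have h₂ : CoxeterRel (M := End (F.obj X ⊗ G.obj Y)) n fun i => F.obj X ◁ G.map (t i) :=
    ht.map (endMap k (G ⋙ tensorLeft (F.obj X)) Y)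
  rw [tensorSymmetrizer, MonoidalCategory.tensorHom_def, map_symmetrizer_whiskerRight F hs _ h₁,
    whiskerLeft_map_symmetrizer G ht _ h₂, ← Category.assoc, comp_symmetrizer _ f hf, comp_symmetrizer _ f hf']

lemma tensorSymmetrizer_comp (f : F.obj X ⊗ G.obj Y ⟶ Z)
    (hf : ∀ i, i + 1 < m → (F.map (s i) ▷ G.obj Y) ≫ f = f)
    (hf' : ∀ i, i + 1 < n → (F.obj X ◁ G.map (t i)) ≫ f = f) :
    tensorSymmetrizer (k := k) F G hs ht ≫ f = f := by
  have h₁ : CoxeterRel (M := End (F.obj X ⊗ G.obj Y)) m fun i => F.map (s i) ▷ G.obj Y :=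
    hs.map (endMap k (F ⋙ tensorRight (G.obj Y)) X)
  have h₂ : CoxeterRel (M := End (F.obj X ⊗ G.obj Y)) n fun i => F.obj X ◁ G.map (t i) :=
    ht.map (endMap k (G ⋙ tensorLeft (F.obj X)) Y)
  rw [tensorSymmetrizer, MonoidalCategory.tensorHom_def, map_symmetrizer_whiskerRight F hs _ h₁,
    whiskerLeft_map_symmetrizer G ht _ h₂, Category.assoc, symmetrizer_comp _ f hf', symmetrizer_comp _ f hf]

end TensorSymmetrizers

/-! ### One-coloured crossings in sorted words -/

section ColouredSymmetrizers

variable {k : Type u} [Field k]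

instance : (blue k).Linear k where
  map_smul := by rintro _ _ ⟨f⟩ r; rfl

instance : (red k).Linear k where
  map_smul := by rintro _ _ ⟨f⟩ r; rfl

variable (k) in
/-- The crossings of blue strands in a word of blue letters followed by red letters. -/
def blueCross (p q i : ℕ) : wordC k (stdWord p q) ⟶ wordC k (stdWord p q) :=
  (blue k).map (crossAt k p i : upPow k p ⟶ upPow k p) ▷ (red k).obj (upPow k q)

variable (k) in
/-- The crossings of red strands in a word of blue letters followed by red letters. -/
def redCross (p q i : ℕ) : wordC k (stdWord p q) ⟶ wordC k (stdWord p q) :=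
  (blue k).obj (upPow k p) ◁ (red k).map (crossAt k q i : upPow k q ⟶ upPow k q)

lemma blue_whiskerLeft {n : ℕ} (f : upPow k n ⟶ upPow k n) :
    (blue k).map (up k ◁ f : upPow k (n + 1) ⟶ upPow k (n + 1)) =
      consHom (P := ahBarPres k) (.inl ()) ((blue k).map f) := by
  obtain ⟨f⟩ := f
  exact (Category.id_comp (consHom (P := ahBarPres k) (.inl ()) ((blue k).map (Presentation.homMk f)) ≫
    𝟙 _)).trans (Category.comp_id _)

lemma red_whiskerLeft {n : ℕ} (f : upPow k n ⟶ upPow k n) :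
    (red k).map (up k ◁ f : upPow k (n + 1) ⟶ upPow k (n + 1)) =
      consHom (P := ahBarPres k) (.inr ()) ((red k).map f) := by
  obtain ⟨f⟩ := f
  exact (Category.id_comp (consHom (P := ahBarPres k) (.inr ()) ((red k).map (Presentation.homMk f)) ≫
    𝟙 _)).trans (Category.comp_id _)

lemma blueCross_zero (p q : ℕ) :
    blueCross k (p + 2) q 0 = headC (crossC k (.inl ())) (stdWord p q) := by
  have e : (blue k).map (crossAt k (p + 2) 0 : upPow k (p + 2) ⟶ upPow k (p + 2)) =
      headHom (P := ahBarPres k) ((blue k).map (cross k)) ((List.replicate p ()).map Sum.inl) :=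
    (Category.id_comp (headHom (P := ahBarPres k) ((blue k).map (cross k))
      ((List.replicate p ()).map Sum.inl) ≫ 𝟙 _)).trans (Category.comp_id _)
  refine (congrArg (· ▷ (red k).obj (upPow k q)) e).trans ?_
  exact headHom_whiskerRight (P := ahBarPres k) ((blue k).map (cross k)) _ _

lemma blueCross_succ (p q i : ℕ) (hi : i + 1 < p) :
    blueCross k (p + 1) q (i + 1) = consC (.inl ()) (blueCross k p q i) := by
  have e : (blue k).map (crossAt k (p + 1) (i + 1) : upPow k (p + 1) ⟶ upPow k (p + 1)) =
      consHom (P := ahBarPres k) (.inl ()) ((blue k).map (crossAt k p i)) :=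
    (congrArg (blue k).map (crossAt_succ k p i hi)).trans (blue_whiskerLeft _)
  refine (congrArg (· ▷ (red k).obj (upPow k q)) e).trans ?_
  exact consHom_whiskerRight (P := ahBarPres k) _ _ _

lemma redCross_cons (p q i : ℕ) : redCross k (p + 1) q i = consC (.inl ()) (redCross k p q i) :=
  cons_whiskerLeft (P := ahBarPres k) (.inl ()) _ ((red k).map (crossAt k q i))

lemma redCross_zero (q : ℕ) :
    redCross k 0 (q + 2) 0 = headC (crossC k (.inr ())) (stdWord 0 q) := by
  refine (nil_whiskerLeft (P := ahBarPres k) ((red k).map (crossAt k (q + 2) 0))).trans ?_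
  exact (Category.id_comp (headHom (P := ahBarPres k) ((red k).map (cross k))
    ((List.replicate q ()).map Sum.inr) ≫ 𝟙 _)).trans (Category.comp_id _)

lemma redCross_succ (q i : ℕ) (hi : i + 1 < q) :
    redCross k 0 (q + 1) (i + 1) = consC (.inr ()) (redCross k 0 q i) := by
  refine (nil_whiskerLeft (P := ahBarPres k) ((red k).map (crossAt k (q + 1) (i + 1)))).trans ?_
  refine ((congrArg (red k).map (crossAt_succ k q i hi)).trans (red_whiskerLeft _)).trans ?_
  exact (congrArg (consHom (P := ahBarPres k) (.inr ()))
    (nil_whiskerLeft (P := ahBarPres k) ((red k).map (crossAt k q i)))).symm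

/-- Together with the two lemmas that follow, this matches the inductively described crossings of a
sorted word with the generators of the two symmetric groups. -/
lemma stdCross_cases {p q : ℕ} {c : (colourSystem k).obj (stdWord p q) ⟶ (colourSystem k).obj (stdWord p q)}
    (h : (colourSystem k).StdCross p q c) :
    (∃ i, i + 1 < p ∧ c = blueCross k p q i) ∨ ∃ i, i + 1 < q ∧ c = redCross k p q i := by
  induction h with
  | headLeft p q => exact Or.inl ⟨0, by omega, (blueCross_zero p q).symm⟩
  | headRight q => exact Or.inr ⟨0, by omega, (redCross_zero q).symm⟩
  | @consLeft p q c h ih =>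
    rcases ih with ⟨i, hi, rfl⟩ | ⟨i, hi, rfl⟩
    · exact Or.inl ⟨i + 1, by omega, (blueCross_succ p q i hi).symm⟩
    · exact Or.inr ⟨i, hi, (redCross_cons p q i).symm⟩
  | @consRight q c h ih =>
    rcases ih with ⟨i, hi, rfl⟩ | ⟨i, hi, rfl⟩
    · omega
    · exact Or.inr ⟨i + 1, by omega, (redCross_succ q i hi).symm⟩

lemma stdCross_blueCross (p q i : ℕ) (hi : i + 1 < p) :
    (colourSystem k).StdCross p q (blueCross k p q i) := by
  induction p generalizing i with
  | zero => omega
  | succ p ih =>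
    rcases i with _ | i
    · obtain ⟨m, rfl⟩ : ∃ m, p = m + 1 := ⟨p - 1, by omega⟩
      rw [blueCross_zero]
      exact .headLeft m q
    · rw [blueCross_succ p q i (by omega)]
      exact .consLeft (ih i (by omega))

lemma stdCross_redCross (p q i : ℕ) (hi : i + 1 < q) :
    (colourSystem k).StdCross p q (redCross k p q i) := by
  induction p with
  | zero =>
    induction q generalizing i with
    | zero => omega
    | succ q ih =>
      rcases i with _ | i
      · obtain ⟨m, rfl⟩ : ∃ m, q = m + 1 := ⟨q - 1, by omega⟩
        rw [redCross_zero]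
        exact .headRight m
      · rw [redCross_succ q i (by omega)]
        exact .consRight (ih i (by omega))
  | succ p ih =>
    rw [redCross_cons]
    exact .consLeft ih

lemma signed_stdCross {p q : ℕ}
    {c : (signedSystem k).obj (stdWord p q) ⟶ (signedSystem k).obj (stdWord p q)}
    (h : (signedSystem k).StdCross p q c) :
    ∃ c' : wordC k (stdWord p q) ⟶ wordC k (stdWord p q),
      (colourSystem k).StdCross p q c' ∧ c = (-c').op := by
  induction h with
  | headLeft p q => exact ⟨_, .headLeft p q, rfl⟩
  | headRight q => exact ⟨_, .headRight q, rfl⟩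
  | consLeft h ih =>
    obtain ⟨t', h', rfl⟩ := ih
    exact ⟨_, .consLeft h', congrArg Quiver.Hom.op (consC_neg _ t')⟩
  | consRight h ih =>
    obtain ⟨t', h', rfl⟩ := ih
    exact ⟨_, .consRight h', congrArg Quiver.Hom.op (consC_neg _ t')⟩

end ColouredSymmetrizers

/-! ### The idempotents of the summands -/

section StandardIdempotents

variable (k : Type u) [Field k] (p q : ℕ)

/-- The product of the symmetrizers of the blue and of the red strands. -/
def stdSym : wordC k (stdWord p q) ⟶ wordC k (stdWord p q) :=
  tensorSymmetrizer (k := k) (blue k) (red k) (crossAt_rel k p) (crossAt_rel k q)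

/-- The product of the antisymmetrizers of the blue and of the red strands. -/
def stdAlt : wordC k (stdWord p q) ⟶ wordC k (stdWord p q) :=
  tensorSymmetrizer (k := k) (blue k) (red k) (crossAt_rel k p).neg (crossAt_rel k q).neg

variable {k p q}

lemma stdSym_comp_stdCross {c : wordC k (stdWord p q) ⟶ wordC k (stdWord p q)}
    (h : (colourSystem k).StdCross p q c) : stdSym k p q ≫ c = stdSym k p q := by
  rcases stdCross_cases h with ⟨i, hi, rfl⟩ | ⟨i, hi, rfl⟩
  · exact tensorSymmetrizer_left (k := k) (blue k) (red k) (crossAt_rel k p) (crossAt_rel k q) i hi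
  · exact tensorSymmetrizer_right (k := k) (blue k) (red k) (crossAt_rel k p) (crossAt_rel k q) i hi

lemma blueCross_neg (i : ℕ) : (blue k).map (-crossAt k p i : upPow k p ⟶ upPow k p) ▷
    (red k).obj (upPow k q) = -blueCross k p q i := by
  rw [Functor.map_neg]
  exact (tensorRight ((red k).obj (upPow k q))).map_neg

lemma redCross_neg (i : ℕ) : (blue k).obj (upPow k p) ◁
    (red k).map (-crossAt k q i : upPow k q ⟶ upPow k q) = -redCross k p q i := by
  rw [Functor.map_neg]
  exact (tensorLeft ((blue k).obj (upPow k p))).map_neg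

lemma stdCross_comp_stdAlt {c : wordC k (stdWord p q) ⟶ wordC k (stdWord p q)}
    (h : (colourSystem k).StdCross p q c) : (-c) ≫ stdAlt k p q = stdAlt k p q := by
  rcases stdCross_cases h with ⟨i, hi, rfl⟩ | ⟨i, hi, rfl⟩
  · rw [← blueCross_neg]
    exact left_tensorSymmetrizer (k := k) (blue k) (red k) (crossAt_rel k p).neg
      (crossAt_rel k q).neg i hi
  · rw [← redCross_neg]
    exact right_tensorSymmetrizer (k := k) (blue k) (red k) (crossAt_rel k p).neg
      (crossAt_rel k q).neg i hi

variable [CharZero k]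

lemma comp_stdSym {Z : AHBar k} (f : Z ⟶ wordC k (stdWord p q))
    (hf : ∀ c : wordC k (stdWord p q) ⟶ wordC k (stdWord p q),
      (colourSystem k).StdCross p q c → f ≫ c = f) : f ≫ stdSym k p q = f :=
  comp_tensorSymmetrizer (k := k) (blue k) (red k) (crossAt_rel k p) (crossAt_rel k q) f
    (fun i hi => hf _ (stdCross_blueCross p q i hi)) (fun i hi => hf _ (stdCross_redCross p q i hi))

lemma stdSym_idem : stdSym k p q ≫ stdSym k p q = stdSym k p q :=
  comp_stdSym _ fun _ => stdSym_comp_stdCross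

lemma stdAlt_comp {Z : AHBar k} (f : wordC k (stdWord p q) ⟶ Z)
    (hf : ∀ c : wordC k (stdWord p q) ⟶ wordC k (stdWord p q),
      (colourSystem k).StdCross p q c → (-c) ≫ f = f) : stdAlt k p q ≫ f = f :=
  tensorSymmetrizer_comp (k := k) (blue k) (red k) (crossAt_rel k p).neg (crossAt_rel k q).neg f
    (fun i hi => (congrArg (· ≫ f) (blueCross_neg i)).trans (hf _ (stdCross_blueCross p q i hi)))
    (fun i hi => (congrArg (· ≫ f) (redCross_neg i)).trans (hf _ (stdCross_redCross p q i hi)))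

lemma stdAlt_idem : stdAlt k p q ≫ stdAlt k p q = stdAlt k p q :=
  stdAlt_comp _ fun _ => stdCross_comp_stdAlt

end StandardIdempotents

/-! ### Decomposition of the symmetrizer and the antisymmetrizer on all words -/

section Decomposition

open Idempotents

variable {k : Type u} [Field k] {n : ℕ}

/-- The standard words of length `n`. -/
def stdIndex (n : ℕ) (r : Fin (n + 1)) : {w : List (Unit ⊕ Unit) // w.length = n} :=
  ⟨stdWord (n - r) r, by rw [stdWord_length]; omega⟩

/-- The morphism from a word with the given components. -/
def wordColMk {w : List (Unit ⊕ Unit)}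
    (g : ∀ v : {w : List (Unit ⊕ Unit) // w.length = n}, wordC k w ⟶ wordC k v.1) :
    (Mat_.embedding (AHBar k)).obj (wordC k w) ⟶ wordMat k n :=
  fun _ v => g v

/-- The morphism to a word with the given components. -/
def wordRowMk {w : List (Unit ⊕ Unit)}
    (g : ∀ v : {w : List (Unit ⊕ Unit) // w.length = n}, wordC k v.1 ⟶ wordC k w) :
    wordMat k n ⟶ (Mat_.embedding (AHBar k)).obj (wordC k w) :=
  fun v _ => g v

lemma embedding_map_comp_wordColMk {w w' : List (Unit ⊕ Unit)} (e : wordC k w' ⟶ wordC k w)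
    (g : ∀ v : {w : List (Unit ⊕ Unit) // w.length = n}, wordC k w ⟶ wordC k v.1) :
    (Mat_.embedding (AHBar k)).map e ≫ wordColMk g = wordColMk fun v => e ≫ g v := by
  ext i v
  exact mat_comp_single _ _ i PUnit.unit v fun j hj => (hj rfl).elim

lemma wordRowMk_comp_embedding_map {w w' : List (Unit ⊕ Unit)} (e : wordC k w ⟶ wordC k w')
    (g : ∀ v : {w : List (Unit ⊕ Unit) // w.length = n}, wordC k v.1 ⟶ wordC k w) :
    wordRowMk g ≫ (Mat_.embedding (AHBar k)).map e = wordRowMk fun v => g v ≫ e := by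
  ext v i
  exact mat_comp_single _ _ v PUnit.unit i fun j hj => (hj rfl).elim

lemma wordRowMk_comp_wordColMk {w : List (Unit ⊕ Unit)}
    (f : ∀ v : {w : List (Unit ⊕ Unit) // w.length = n}, wordC k v.1 ⟶ wordC k w)
    (g : ∀ v : {w : List (Unit ⊕ Unit) // w.length = n}, wordC k w ⟶ wordC k v.1)
    (v v' : {w : List (Unit ⊕ Unit) // w.length = n}) :
    wordCol (wordRowMk f ≫ wordColMk g) v v' = f v ≫ g v' :=
  mat_comp_single (wordRowMk f) (wordColMk g) v PUnit.unit v' fun _ hj => (hj rfl).elim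

lemma wordCol_sum {M : Mat_ (AHBar k)} {J : Type} [Fintype J] (f : J → (M ⟶ wordMat k n)) (j : M.ι)
    (v : {w : List (Unit ⊕ Unit) // w.length = n}) :
    wordCol (∑ r, f r) j v = ∑ r, wordCol (f r) j v :=
  map_sum (AddMonoidHom.mk' (fun f : M ⟶ wordMat k n => wordCol f j v) fun _ _ => rfl) f _

lemma karoubi_iso_biproduct {D : Type*} [Category* D] [Preadditive D] [HasFiniteBiproducts (Karoubi D)]
    {J : Type} [Fintype J] (P : Karoubi D) (Q : J → Karoubi D) (a : ∀ j, P.X ⟶ (Q j).X)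
    (b : ∀ j, (Q j).X ⟶ P.X) (ha : ∀ j, P.p ≫ a j = a j) (ha' : ∀ j, a j ≫ (Q j).p = a j)
    (hb : ∀ j, (Q j).p ≫ b j = b j) (hb' : ∀ j, b j ≫ P.p = b j) (h : ∑ j, a j ≫ b j = P.p)
    (hba : ∀ j, b j ≫ a j = (Q j).p) (hne : ∀ i j, i ≠ j → b i ≫ a j = 0) :
    Nonempty (P ≅ ⨁ Q) := by
  refine ⟨isoBiproduct (fun j => ⟨a j, by rw [ha', ha]⟩) (fun j => ⟨b j, by rw [hb', hb]⟩) ?_ ?_ ?_⟩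
  · ext
    rw [Karoubi.sum_hom]
    exact h
  · intro j
    ext
    exact hba j
  · intro i j hij
    ext
    exact hne i j hij

variable [CharZero k]

/-- The projection `a r` is the column of the symmetrizer `e` at the `r`th sorted word, and the
inclusion `b r` spreads the idempotent `E r` over all words by rearrangement. Columns of `e` are
invariant, so `eq_sum` gives `e` as the sum of all `a r ≫ b r`. Since `b r` absorbs `e`, its
composite with `a r'` is just its component at a sorted word, which is `E r` or zero. -/
lemma symKar_iso_biproduct (hX : CoxeterRel (M := End (wordMat k n)) n (crossMatAt k n)) :
    Nonempty (symKar k hX ≅ ⨁ fun r : Fin (n + 1) =>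
      karOf (wordC k (stdWord (n - r) r)) (stdSym k (n - r) r) stdSym_idem) := by
  let E (r : Fin (n + 1)) := stdSym k (n - r) r
  set e : wordMat k n ⟶ wordMat k n := (symmetrizer k hX : End (wordMat k n)) with he
  have hee : e ≫ e = e := symmetrizer_idem hX
  have hinv := invariant_of_fixed e fun i hi => by
    have := mul_symmetrizer (k := k) hX i hi
    rwa [End.mul_def] at this
  let a (r : Fin (n + 1)) := wordRowMk fun v => wordCol e v (stdIndex n r)
  let b (r : Fin (n + 1)) := wordColMk (n := n) fun v =>
    E r ≫ (colourSystem k).arrange (n - r) r v.1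
  have haE : ∀ r v, wordCol e v (stdIndex n r) ≫ E r = wordCol e v (stdIndex n r) := fun r v =>
    comp_stdSym _ fun c hc => by
      obtain ⟨i, hi⟩ := hc.cross
      exact (hinv v).cross (w := stdIndex n r) hi
  have hbe : ∀ r, b r ≫ e = b r := fun r => comp_symmetrizer hX (b r) <|
    fixed_of_invariant (b r) fun _ => StrandSystem.invariant_arrange n (stdSym k (n - r) r)
      fun c hc => stdSym_comp_stdCross hc
  -- This is the equation `b r ≫ e = b r` read in the column of the `r'`th sorted word.
  have hba : ∀ r r', b r ≫ a r' = (Mat_.embedding (AHBar k)).map (E r ≫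
      (colourSystem k).arrange (n - r) r (stdWord (n - r') r')) := fun r r' => by
    ext x y
    exact congrFun (congrFun (hbe r) x) (stdIndex n r')
  refine karoubi_iso_biproduct _ _ a b (fun r => ?_) (fun r => ?_) (fun r => ?_) hbe ?_ (fun r => ?_)
    fun r r' hr => ?_
  · ext v i
    exact congrFun (congrFun hee v) (stdIndex n r)
  · exact (wordRowMk_comp_embedding_map _ _).trans (congrArg wordRowMk (funext (haE r)))
  · refine (embedding_map_comp_wordColMk _ _).trans (congrArg wordColMk (funext fun v => ?_))
    exact (Category.assoc _ _ _).symm.trans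
      (congrArg (· ≫ (colourSystem k).arrange (n - r) r v.1) stdSym_idem)
  · suffices H : ∀ v v' : {w : List (Unit ⊕ Unit) // w.length = n},
        wordCol (∑ r, a r ≫ b r) v v' = wordCol e v v' by
      ext v v'
      exact H v v'
    intro v v'
    refine (wordCol_sum (fun r => a r ≫ b r) v v').trans (Eq.trans ?_ ((hinv v).eq_sum v').symm)
    refine Finset.sum_congr rfl fun r _ => (wordRowMk_comp_wordColMk _ _ v v').trans ?_
    exact (Category.assoc _ _ _).symm.trans (congrArg (· ≫ _) (haE r v))
  · refine (hba r r).trans (congrArg (Mat_.embedding (AHBar k)).map ?_)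
    exact (congrArg (E r ≫ ·) ((colourSystem k).arrange_std _ _)).trans (Category.comp_id _)
  · have h : n - (r : ℕ) ≠ n - r' ∨ (r : ℕ) ≠ r' := Or.inr fun h => hr (Fin.ext h)
    refine (hba r r').trans ((congrArg (Mat_.embedding (AHBar k)).map ?_).trans ((Mat_.embedding (AHBar k)).map_zero _ _))
    exact (congrArg (E r ≫ ·) ((colourSystem k).arrange_std_of_ne h)).trans comp_zero

/-- The dual argument: rows of the antisymmetrizer supply the inclusions `b r`, and the projections
`a r` are signed rearrangements, that is, `arrange` in the opposite category. -/
lemma altKar_iso_biproduct (hX : CoxeterRel (M := End (wordMat k n)) n (crossMatAt k n)) :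
    Nonempty (symKar k hX.neg ≅ ⨁ fun r : Fin (n + 1) =>
      karOf (wordC k (stdWord (n - r) r)) (stdAlt k (n - r) r) stdAlt_idem) := by
  let E (r : Fin (n + 1)) := stdAlt k (n - r) r
  set e : wordMat k n ⟶ wordMat k n := (symmetrizer k hX.neg : End (wordMat k n)) with he
  have hee : e ≫ e = e := symmetrizer_idem hX.neg
  have hinv := invariant_of_antifixed e fun i hi => by
    have h : (-crossMatAt k n i) ≫ e = e := by
      have := symmetrizer_mul (k := k) hX.neg i hi
      rwa [End.mul_def] at this
    rw [Preadditive.neg_comp] at h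
    exact neg_eq_iff_eq_neg.1 h
  let d (r : Fin (n + 1)) (v : {w : List (Unit ⊕ Unit) // w.length = n}) :
    wordC k v.1 ⟶ wordC k (stdWord (n - r) r) := ((signedSystem k).arrange (n - r) r v.1).unop
  let a (r : Fin (n + 1)) := wordRowMk (n := n) fun v => d r v ≫ E r
  let b (r : Fin (n + 1)) := wordColMk fun v => wordRow e v (stdIndex n r)
  have hEb : ∀ r v, E r ≫ wordRow e v (stdIndex n r) = wordRow e v (stdIndex n r) := fun r v =>
    stdAlt_comp _ fun c hc => by
      obtain ⟨i, hi⟩ := hc.cross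
      exact congrArg Quiver.Hom.unop ((hinv v).cross (w := stdIndex n r) (cross_signed hi))
  have hea : ∀ r, e ≫ a r = a r := fun r => symmetrizer_comp hX.neg (a r) fun i hi => by
    have : crossMatAt k n i ≫ a r = -a r := antifixed_of_invariant (a r)
      (fun _ => StrandSystem.invariant_arrange (A := signedSystem k) n (stdAlt k (n - r) r).op fun c hc => by
        obtain ⟨c', hc', rfl⟩ := signed_stdCross hc
        exact congrArg Quiver.Hom.op (stdCross_comp_stdAlt hc')) i hi
    exact (Preadditive.neg_comp _ _).trans ((congrArg (-·) this).trans (neg_neg (a r)))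
  have hba : ∀ r r', b r ≫ a r' = (Mat_.embedding (AHBar k)).map
      (d r' (stdIndex n r) ≫ E r') := fun r r' => by
    ext x y
    exact congrFun (congrFun (hea r') (stdIndex n r)) y
  refine karoubi_iso_biproduct _ _ a b hea (fun r => ?_) (fun r => ?_) (fun r => ?_) ?_ (fun r => ?_)
    fun r r' hr => ?_
  · refine (wordRowMk_comp_embedding_map _ _).trans (congrArg wordRowMk (funext fun v => ?_))
    exact (Category.assoc _ _ _).trans (congrArg (d r v ≫ ·) stdAlt_idem)
  · exact (embedding_map_comp_wordColMk _ _).trans (congrArg wordColMk (funext (hEb r)))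
  · ext i v
    exact congrFun (congrFun hee (stdIndex n r)) v
  · suffices H : ∀ v v' : {w : List (Unit ⊕ Unit) // w.length = n},
        wordCol (∑ r, a r ≫ b r) v v' = wordRow e v' v by
      ext v v'
      exact H v v'
    intro v v'
    -- The expansion of an invariant family in the opposite category, translated back.
    have h := congrArg Quiver.Hom.unop ((hinv v').eq_sum v)
    refine (wordCol_sum (fun r => a r ≫ b r) v v').trans (Eq.trans ?_ h.symm)
    refine Eq.trans ?_ (unop_sum _ _ _ _).symm
    refine Finset.sum_congr rfl fun r _ => (wordRowMk_comp_wordColMk _ _ v v').trans ?_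
    exact (Category.assoc _ _ _).trans (congrArg (d r v ≫ ·) (hEb r v'))
  · refine (hba r r).trans (congrArg (Mat_.embedding (AHBar k)).map ?_)
    exact (congrArg (·.unop ≫ E r) ((signedSystem k).arrange_std _ _)).trans (Category.id_comp _)
  · have h : n - (r' : ℕ) ≠ n - r ∨ (r' : ℕ) ≠ r := Or.inr fun h => hr (Fin.ext h.symm)
    refine (hba r r').trans ((congrArg (Mat_.embedding (AHBar k)).map ?_).trans ((Mat_.embedding (AHBar k)).map_zero _ _))
    exact (congrArg (·.unop ≫ E r') ((signedSystem k).arrange_std_of_ne h)).trans zero_comp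

end Decomposition

/-! ### Images of symmetric and exterior powers -/

section ImagesOfPowers

variable {k : Type u} [Field k] [CharZero k] (Δ : Comultiplication k)

lemma blueKar_objH_tensor_iso (p q : ℕ) : Nonempty ((blueKar k).obj (objH k p) ⊗
    (redKar k).obj (objH k q) ≅ karOf (wordC k (stdWord p q)) (stdSym k p q) stdSym_idem) := by
  rw [objH_eq, objH_eq]
  exact ⟨karOfTensor (C := AHBar k) (X := (blue k).obj (upPow k p)) (Y := (red k).obj (upPow k q))
    (e := (blue k).map (symmetrizer k (crossAt_rel k p) : End (upPow k p)))
    (f := (red k).map (symmetrizer k (crossAt_rel k q) : End (upPow k q)))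
    (by rw [← Functor.map_comp, symmetrizer_comp_self])
    (by rw [← Functor.map_comp, symmetrizer_comp_self])⟩

lemma blueKar_objE_tensor_iso (p q : ℕ) : Nonempty ((blueKar k).obj (objE k p) ⊗
    (redKar k).obj (objE k q) ≅ karOf (wordC k (stdWord p q)) (stdAlt k p q) stdAlt_idem) := by
  rw [objE_eq, objE_eq]
  exact ⟨karOfTensor (C := AHBar k) (X := (blue k).obj (upPow k p)) (Y := (red k).obj (upPow k q))
    (e := (blue k).map (symmetrizer k (crossAt_rel k p).neg : End (upPow k p)))
    (f := (red k).map (symmetrizer k (crossAt_rel k q).neg : End (upPow k q)))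
    (by rw [← Functor.map_comp, symmetrizer_comp_self])
    (by rw [← Functor.map_comp, symmetrizer_comp_self])⟩

theorem Comultiplication.kar_objH (n : ℕ) : Nonempty (Δ.kar.obj (objH k n) ≅
    ⨁ fun r : Fin (n + 1) => (blueKar k).obj (objH k (n - r)) ⊗ (redKar k).obj (objH k r)) :=
  ⟨(Δ.kar_objH_iso n).some ≪≫ (symKar_iso_biproduct (Δ.crossMatAt_rel n)).some ≪≫
    biproduct.mapIso fun r => (blueKar_objH_tensor_iso (n - r) r).some.symm⟩

theorem Comultiplication.kar_objE (n : ℕ) : Nonempty (Δ.kar.obj (objE k n) ≅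
    ⨁ fun r : Fin (n + 1) => (blueKar k).obj (objE k (n - r)) ⊗ (redKar k).obj (objE k r)) :=
  ⟨(Δ.kar_objE_iso n).some ≪≫ (altKar_iso_biproduct (Δ.crossMatAt_rel n)).some ≪≫
    biproduct.mapIso fun r => (blueKar_objE_tensor_iso (n - r) r).some.symm⟩

end ImagesOfPowers

/-! ### Commutation of blue and red classes -/

section BraidedColours

variable {k : Type u} [Field k]

/-- The interchange of blue and red strands. -/
def braidIso (X Y : AH k) : (blue k).obj X ⊗ (red k).obj Y ≅ (red k).obj Y ⊗ (blue k).obj X where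
  hom := Presentation.homMk (P := ahBarPres k)
    (.gen (.old (.braid (P := ahPres k) (Q := ahPres k) X.word Y.word)))
  inv := Presentation.homMk (P := ahBarPres k)
    (.gen (.old (.braidInv (P := ahPres k) (Q := ahPres k) X.word Y.word)))
  hom_inv_id := Presentation.homMk_eq (P := ahBarPres k) (.rel (LocalizeRel.old
    (P := symProd (ahPres k) (ahPres k))
    (SymProdRel.braid_braidInv (P := ahPres k) (Q := ahPres k) X.word Y.word)))
  inv_hom_id := Presentation.homMk_eq (P := ahBarPres k) (.rel (LocalizeRel.old
    (P := symProd (ahPres k) (ahPres k))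
    (SymProdRel.braidInv_braid (P := ahPres k) (Q := ahPres k) X.word Y.word)))

lemma braidIso_natural_left {X X' : AH k} (f : X ⟶ X') (Y : AH k) :
    ((blue k).map f ▷ (red k).obj Y) ≫ (braidIso X' Y).hom =
      (braidIso X Y).hom ≫ ((red k).obj Y ◁ (blue k).map f) := by
  obtain ⟨f⟩ := f
  -- The defining relation renames generators in two steps, first into the symmetric product and
  -- then into its localization; the functor `blue` does so in one.
  have e := mapGen_map (P := ahPres k) (Q := symProd (ahPres k) (ahPres k))
    (G := (ahBarPres k).Gen) Sum.inl SymProdGen.left LocalizeGen.old f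
  have h := Presentation.homMk_eq (P := ahBarPres k) (.rel (LocalizeRel.old
    (P := symProd (ahPres k) (ahPres k)) (SymProdRel.braid_natural_left
      (P := ahPres k) (Q := ahPres k) f Y.word)))
  refine Eq.trans ?_ (h.trans ?_)
  · exact congrArg (fun t => (Presentation.homMk (P := ahBarPres k) t ▷ (red k).obj Y) ≫
      (braidIso X' Y).hom) e.symm
  · exact congrArg (fun t => (braidIso X Y).hom ≫
      ((red k).obj Y ◁ Presentation.homMk (P := ahBarPres k) t)) e

lemma braidIso_natural_right (X : AH k) {Y Y' : AH k} (f : Y ⟶ Y') :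
    ((blue k).obj X ◁ (red k).map f) ≫ (braidIso X Y').hom =
      (braidIso X Y).hom ≫ ((red k).map f ▷ (blue k).obj X) := by
  obtain ⟨f⟩ := f
  have e := mapGen_map (P := ahPres k) (Q := symProd (ahPres k) (ahPres k))
    (G := (ahBarPres k).Gen) Sum.inr SymProdGen.right LocalizeGen.old f
  have h := Presentation.homMk_eq (P := ahBarPres k) (.rel (LocalizeRel.old
    (P := symProd (ahPres k) (ahPres k)) (SymProdRel.braid_natural_right
      (P := ahPres k) (Q := ahPres k) X.word f)))
  refine Eq.trans ?_ (h.trans ?_)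
  · exact congrArg (fun t => ((blue k).obj X ◁ Presentation.homMk (P := ahBarPres k) t) ≫
      (braidIso X Y').hom) e.symm
  · exact congrArg (fun t => (braidIso X Y).hom ≫
      (Presentation.homMk (P := ahBarPres k) t ▷ (blue k).obj X)) e

lemma braidIso_natural {X X' Y Y' : AH k} (f : X ⟶ X') (g : Y ⟶ Y') :
    ((blue k).map f ⊗ₘ (red k).map g) ≫ (braidIso X' Y').hom =
      (braidIso X Y).hom ≫ ((red k).map g ⊗ₘ (blue k).map f) := by
  rw [MonoidalCategory.tensorHom_def, Category.assoc, braidIso_natural_right,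
    reassoc_of% braidIso_natural_left f Y, ← tensorHom_def']

/-- The interchange is natural in both variables, so it intertwines the two orders of the tensor
product of idempotents. This is what makes the right-hand side of the comultiplication identity
multiplicative. -/
lemma cls_blue_red_commute {X Y : AH k} {e : X ⟶ X} {f : Y ⟶ Y} (he : e ≫ e = e) (hf : f ≫ f = f) :
    Commute (K0.cls ((blueKar k).obj (karOf X e he))) (K0.cls ((redKar k).obj (karOf Y f hf))) := by
  have he' : (blue k).map e ≫ (blue k).map e = (blue k).map e := by rw [← Functor.map_comp, he]
  have hf' : (red k).map f ≫ (red k).map f = (red k).map f := by rw [← Functor.map_comp, hf]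
  have h₁ : K0.cls ((blueKar k).obj (karOf X e he)) * K0.cls ((redKar k).obj (karOf Y f hf)) =
      K0.cls (karOf _ ((blue k).map e ⊗ₘ (red k).map f) _) :=
    (cls_tensor _ _).symm.trans (cls_eq (karOfTensor he' hf'))
  have h₂ : K0.cls ((redKar k).obj (karOf Y f hf)) * K0.cls ((blueKar k).obj (karOf X e he)) =
      K0.cls (karOf _ ((red k).map f ⊗ₘ (blue k).map e) _) :=
    (cls_tensor _ _).symm.trans (cls_eq (karOfTensor hf' he'))
  refine h₁.trans (Eq.trans (cls_eq ?_) h₂.symm)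
  refine karIsoOfIso ((Mat_.embedding (AHBar k)).mapIso (braidIso X Y)) ?_
  exact ((Mat_.embedding (AHBar k)).map_comp _ _).symm.trans
    ((congrArg (Mat_.embedding (AHBar k)).map (braidIso_natural e f)).trans
      ((Mat_.embedding (AHBar k)).map_comp _ _))

end BraidedColours

/-! ### Multiplicativity on Grothendieck rings -/

section MultiplicativeFunctors

universe v₁ u₁

variable {C : Type u₁} [Category.{v₁} C] [Preadditive C] [MonoidalCategory C] [MonoidalPreadditive C]
  {D : Type u₁} [Category.{v₁} D] [Preadditive D] [MonoidalCategory D] [MonoidalPreadditive D]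

/-- The unit object is the image of its identity. -/
lemma karOf_unit_iso : Nonempty (karOf (𝟙_ C) (𝟙 _) (Category.comp_id _) ≅ 𝟙_ (Kar C)) :=
  ⟨karIsoOfIso (Iso.refl _) ((Category.comp_id _).trans (Eq.trans
    ((Mat_.embedding C).map_id _) (Category.id_comp _).symm))⟩

variable (C) in
/-- The classes of the images of idempotent endomorphisms of objects. -/
def idempotentClasses : Submonoid (K0 (Kar C)) where
  carrier := {a | ∃ (X : C) (e : X ⟶ X) (he : e ≫ e = e), a = K0.cls (karOf X e he)}
  one_mem' := ⟨_, _, _, cls_unit.symm.trans (cls_eq karOf_unit_iso.some.symm)⟩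
  mul_mem' := by
    rintro _ _ ⟨X, e, he, rfl⟩ ⟨Y, f, hf, rfl⟩
    exact ⟨_, _, _, (cls_tensor _ _).symm.trans (cls_eq (karOfTensor he hf))⟩

/-- A functor which is compatible with tensor products of images of idempotents. -/
structure IsTensorFunctor (G : Kar C ⥤ Kar D) : Prop where
  unit : Nonempty (G.obj (karOf (𝟙_ C) (𝟙 _) (Category.comp_id _)) ≅ 𝟙_ (Kar D))
  tensor {X Y : C} {e : X ⟶ X} {f : Y ⟶ Y} (he : e ≫ e = e) (hf : f ≫ f = f) :
    Nonempty (G.obj (karOf (X ⊗ Y) (e ⊗ₘ f) (by rw [tensorHom_comp_tensorHom, he, hf])) ≅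
      G.obj (karOf X e he) ⊗ G.obj (karOf Y f hf))

variable {G : Kar C ⥤ Kar D} [G.Additive] (hG : IsTensorFunctor G)

include hG

lemma IsTensorFunctor.map_one : K0.map G 1 = 1 := by
  rw [← cls_unit, ← cls_eq karOf_unit_iso.some, K0.map_cls, cls_eq hG.unit.some, cls_unit]

/-- Multiplicativity is established only for images of idempotents of single objects. These classes
form a submonoid containing all [H_n], which suffices and avoids monoidal structures on the extended
functors. -/
lemma IsTensorFunctor.map_mul {a b : K0 (Kar C)} (ha : a ∈ idempotentClasses C)
    (hb : b ∈ idempotentClasses C) : K0.map G (a * b) = K0.map G a * K0.map G b := by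
  obtain ⟨X, e, he, rfl⟩ := ha
  obtain ⟨Y, f, hf, rfl⟩ := hb
  rw [← cls_tensor, cls_eq (karOfTensor he hf), K0.map_cls, K0.map_cls, K0.map_cls,
    cls_eq (hG.tensor he hf).some, cls_tensor]

end MultiplicativeFunctors

/-! ### Compatibility of the extended functors with tensor products -/

section TensorFunctors

variable (k : Type u) [Field k]

lemma eqToHom_conj_comp {C : Type*} [Category* C] {X Y : C} (h : X = Y) (f : Y ⟶ Y) :
    (eqToHom h ≫ f ≫ eqToHom h.symm) ≫ (eqToIso h).hom = (eqToIso h).hom ≫ f := by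
  subst h
  simp

lemma karMap_mapMat_isTensorFunctor {C D : Type 1} [Category.{u} C] [Category.{u} D]
    [Preadditive C] [Preadditive D] [MonoidalCategory C] [MonoidalCategory D] [MonoidalPreadditive C]
    [MonoidalPreadditive D] (F : C ⥤ D) [F.Additive] (ε : F.obj (𝟙_ C) ≅ 𝟙_ D)
    (μ : ∀ X Y, F.obj (X ⊗ Y) ≅ F.obj X ⊗ F.obj Y)
    (hμ : ∀ {X Y : C} (f : X ⟶ X) (g : Y ⟶ Y),
      F.map (f ⊗ₘ g) ≫ (μ X Y).hom = (μ X Y).hom ≫ (F.map f ⊗ₘ F.map g)) :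
    IsTensorFunctor (karMap F.mapMat_) where
  unit := by
    refine ⟨Iso.trans (Y := karOf (𝟙_ D) (𝟙 _) (Category.comp_id _))
      (karIsoOfIso ((Mat_.embedding D).mapIso ε) ?_) karOf_unit_iso.some⟩
    exact ((Mat_.embedding D).map_comp _ _).symm.trans ((congrArg (Mat_.embedding D).map
      ((congrArg (· ≫ ε.hom) (F.map_id _)).trans ((Category.id_comp _).trans
        (Category.comp_id _).symm))).trans ((Mat_.embedding D).map_comp _ _))
  tensor {X Y e f} he hf := by
    have he' := (F.map_comp e e).symm.trans (congrArg _ he)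
    have hf' := (F.map_comp f f).symm.trans (congrArg _ hf)
    refine ⟨Iso.trans (Y := karOf _ (F.map e ⊗ₘ F.map f) (by rw [tensorHom_comp_tensorHom, he', hf']))
      (karIsoOfIso ((Mat_.embedding D).mapIso (μ X Y)) ?_) (karOfTensor he' hf').symm⟩
    exact ((Mat_.embedding D).map_comp _ _).symm.trans
      ((congrArg (Mat_.embedding D).map (hμ e f)).trans ((Mat_.embedding D).map_comp _ _))

lemma blueKar_isTensorFunctor : IsTensorFunctor (blueKar k) := by
  refine karMap_mapMat_isTensorFunctor (blue k) (Iso.refl _)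
    (fun X Y => eqToIso (congrArg Presentation.Cat.mk List.map_append)) ?_
  rintro X Y ⟨f⟩ ⟨g⟩
  have h : (blue k).map (Presentation.homMk f ⊗ₘ Presentation.homMk g) =
      eqToHom (congrArg Presentation.Cat.mk List.map_append) ≫
        ((blue k).map (Presentation.homMk f) ⊗ₘ (blue k).map (Presentation.homMk g)) ≫
          eqToHom (congrArg Presentation.Cat.mk List.map_append.symm) :=
    Presentation.homMk_map_tensor (P := ahPres k) (Q := ahBarPres k) _ _ f g
  exact (congrArg (· ≫ _) h).trans (eqToHom_conj_comp _ _)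

lemma redKar_isTensorFunctor : IsTensorFunctor (redKar k) := by
  refine karMap_mapMat_isTensorFunctor (red k) (Iso.refl _)
    (fun X Y => eqToIso (congrArg Presentation.Cat.mk List.map_append)) ?_
  rintro X Y ⟨f⟩ ⟨g⟩
  have h : (red k).map (Presentation.homMk f ⊗ₘ Presentation.homMk g) =
      eqToHom (congrArg Presentation.Cat.mk List.map_append) ≫
        ((red k).map (Presentation.homMk f) ⊗ₘ (red k).map (Presentation.homMk g)) ≫
          eqToHom (congrArg Presentation.Cat.mk List.map_append.symm) :=
    Presentation.homMk_map_tensor (P := ahPres k) (Q := ahBarPres k) _ _ f g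
  exact (congrArg (· ≫ _) h).trans (eqToHom_conj_comp _ _)

variable {k}

attribute [local instance] Comultiplication.monoidal

lemma Comultiplication.kar_isTensorFunctor (Δ : Comultiplication k) : IsTensorFunctor Δ.kar where
  unit := by
    refine ⟨karMapOfIso.{u, 1} (Mat_.lift Δ.functor) Δ.functor (Mat_.embeddingLiftIso Δ.functor) _ ≪≫
      karIsoOfIso (Functor.Monoidal.εIso Δ.functor).symm ?_⟩
    exact (congrArg (· ≫ _) (Δ.functor.map_id _)).trans
      ((Category.id_comp _).trans (Category.comp_id _).symm)
  tensor {X Y e f} he hf := by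
    refine ⟨karMapOfIso.{u, 1} (Mat_.lift Δ.functor) Δ.functor (Mat_.embeddingLiftIso Δ.functor) _ ≪≫
      Iso.trans (Y := Idempotents.Karoubi.mk (Δ.functor.obj X) (Δ.functor.map e)
        (by rw [← Functor.map_comp, he]) ⊗ Idempotents.Karoubi.mk (Δ.functor.obj Y) (Δ.functor.map f)
          (by rw [← Functor.map_comp, hf]))
      (karIsoOfIso (Functor.Monoidal.μIso Δ.functor X Y).symm ?_)
      (karMapOfIso.{u, 1} (Mat_.lift Δ.functor) Δ.functor (Mat_.embeddingLiftIso Δ.functor) he ⊗ᵢ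
        karMapOfIso.{u, 1} (Mat_.lift Δ.functor) Δ.functor (Mat_.embeddingLiftIso Δ.functor) hf).symm⟩
    exact (Functor.OplaxMonoidal.δ_natural Δ.functor e f).symm

end TensorFunctors

/-! ### Ring homomorphisms out of the ring of symmetric functions -/

section SymmetricFunctions

/-- The target ring need not be commutative, but the subring generated by commuting elements is, and
the evaluation homomorphism lands there. -/
lemma exists_symZ_ringHom {R : Type*} [Ring R] (a : ℕ → R) (h : ∀ m n, a m * a n = a n * a m) :
    ∃ γ : SymZ →+* R, ∀ n, γ (MvPolynomial.X n) = a n := by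
  let _ : CommRing (Subring.closure (Set.range a)) :=
    { (Subring.closure (Set.range a)).toRing with
      mul_comm := (Subring.isMulCommutative_closure
        (by rintro _ ⟨m, rfl⟩ _ ⟨n, rfl⟩; exact h m n)).is_comm.comm }
  let g : SymZ →+* Subring.closure (Set.range a) :=
    MvPolynomial.eval₂Hom (Int.castRingHom _) fun n => ⟨a n, Subring.subset_closure ⟨n, rfl⟩⟩
  refine ⟨(Subring.closure (Set.range a)).subtype.comp g, fun n => ?_⟩
  exact congrArg Subtype.val (MvPolynomial.eval₂Hom_X' _ _ n)

variable {R S : Type*} [Ring R] [Ring S] {M : Submonoid R} {γ : SymZ →+* R}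

lemma symZ_ringHom_mem_closure (h : ∀ n, γ (MvPolynomial.X n) ∈ M) (f : SymZ) :
    γ f ∈ Subring.closure (M : Set R) := by
  induction f using MvPolynomial.induction_on with
  | C z =>
    rw [show γ (MvPolynomial.C z) = (z : R) from
      RingHom.congr_fun (RingHom.ext_int (γ.comp MvPolynomial.C) (Int.castRingHom R)) z]
    exact intCast_mem _ z
  | add f g hf hg => rw [map_add]; exact add_mem hf hg
  | mul_X f n hf => rw [map_mul]; exact mul_mem hf (Subring.subset_closure (h n))

/-- The subring generated by a submonoid is its additive span, so biadditivity extends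
multiplicativity from the submonoid. This makes the composite of such a φ with γ a ring
homomorphism. -/
lemma map_mul_of_mem_closure (φ : R →+ S) (hφ : ∀ a ∈ M, ∀ b ∈ M, φ (a * b) = φ a * φ b) {x y : R}
    (hx : x ∈ Subring.closure (M : Set R)) (hy : y ∈ Subring.closure (M : Set R)) :
    φ (x * y) = φ x * φ y := by
  rw [Subring.mem_closure_iff, Submonoid.closure_eq] at hx hy
  induction hx using AddSubgroup.closure_induction with
  | mem a ha =>
    induction hy using AddSubgroup.closure_induction with
    | mem b hb => exact hφ a ha b hb
    | zero => simp
    | add b c _ _ hb hc => rw [mul_add, map_add, map_add, mul_add, hb, hc]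
    | neg b _ hb => rw [mul_neg, map_neg, map_neg, mul_neg, hb]
  | zero => simp
  | add b c _ _ hb hc => rw [add_mul, map_add, map_add, add_mul, hb, hc]
  | neg b _ hb => rw [neg_mul, map_neg, map_neg, neg_mul, hb]

lemma exists_ringHom_eq_comp (h : ∀ n, γ (MvPolynomial.X n) ∈ M) (φ : R →+ S) (h1 : φ 1 = 1)
    (hφ : ∀ a ∈ M, ∀ b ∈ M, φ (a * b) = φ a * φ b) : ∃ Φ : SymZ →+* S, ∀ f, Φ f = φ (γ f) :=
  ⟨{ toFun := fun f => φ (γ f)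
     map_one' := by rw [map_one, h1]
     map_zero' := by rw [map_zero, map_zero]
     map_add' := fun f g => by rw [map_add, map_add]
     map_mul' := fun f g => by
      rw [map_mul, map_mul_of_mem_closure φ hφ (symZ_ringHom_mem_closure h f)
        (symZ_ringHom_mem_closure h g)] }, fun _ => rfl⟩

lemma commute_of_commute_X (Q : SymZ →+* S) {s : S}
    (h : ∀ n, Commute s (Q (MvPolynomial.X n))) (f : SymZ) : Commute s (Q f) := by
  induction f using MvPolynomial.induction_on with
  | C z =>
    rw [show Q (MvPolynomial.C z) = (z : S) from
      RingHom.congr_fun (RingHom.ext_int (Q.comp MvPolynomial.C) (Int.castRingHom S)) z]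
    exact Int.commute_cast _ z
  | add f g hf hg => rw [map_add]; exact hf.add_right hg
  | mul_X f n hf => rw [map_mul]; exact hf.mul_right (h n)

/-- Both sides are ring homomorphisms in `f`, so `hX` on the variables decides. On the right-hand
side this rests on `hc`: the images under β and ρ commute, so they combine to an algebra
homomorphism `Ψ` on the tensor product, which agrees with the additive map on pure tensors. -/
lemma map_eq_lift_map_symDelta (h : ∀ n, γ (MvPolynomial.X n) ∈ M) (δ β ρ : R →+ S)
    (hδ : δ 1 = 1) (hδ' : ∀ a ∈ M, ∀ b ∈ M, δ (a * b) = δ a * δ b)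
    (hβ : β 1 = 1) (hβ' : ∀ a ∈ M, ∀ b ∈ M, β (a * b) = β a * β b)
    (hρ : ρ 1 = 1) (hρ' : ∀ a ∈ M, ∀ b ∈ M, ρ (a * b) = ρ a * ρ b)
    (hc : ∀ m n, Commute (β (γ (MvPolynomial.X m))) (ρ (γ (MvPolynomial.X n))))
    (hX : ∀ n, δ (γ (MvPolynomial.X n)) =
      ∑ r : Fin (n + 2), β (γ (symH (n + 1 - r))) * ρ (γ (symH r))) (f : SymZ) :
    δ (γ f) = TensorProduct.lift ((LinearMap.mul ℤ S).compl₁₂ β.toIntLinearMap ρ.toIntLinearMap)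
      (TensorProduct.map γ.toAddMonoidHom.toIntLinearMap γ.toAddMonoidHom.toIntLinearMap
        (symDelta f)) := by
  obtain ⟨Δ, hΔ⟩ := exists_ringHom_eq_comp h δ hδ hδ'
  obtain ⟨B, hB⟩ := exists_ringHom_eq_comp h β hβ hβ'
  obtain ⟨P, hP⟩ := exists_ringHom_eq_comp h ρ hρ hρ'
  have hBP := fun f g : SymZ => (commute_of_commute_X B (s := P g) (fun m =>
    (commute_of_commute_X P (s := B (MvPolynomial.X m)) (fun n => by
      rw [hB, hP]; exact hc m n) g).symm) f).symm
  let Ψ : SymZ ⊗[ℤ] SymZ →ₐ[ℤ] S :=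
    Algebra.TensorProduct.lift B.toIntAlgHom P.toIntAlgHom hBP
  have hΨ (t : SymZ ⊗[ℤ] SymZ) : TensorProduct.lift
      ((LinearMap.mul ℤ S).compl₁₂ β.toIntLinearMap ρ.toIntLinearMap)
      (TensorProduct.map γ.toAddMonoidHom.toIntLinearMap γ.toAddMonoidHom.toIntLinearMap t) =
        Ψ t := by
    induction t with
    | zero => simp only [map_zero]
    | tmul f g =>
      refine Eq.trans ?_ (Algebra.TensorProduct.lift_tmul _ _ hBP f g).symm
      exact (congrArg₂ (· * ·) (hB f) (hP g)).symm
    | add t₁ t₂ h₁ h₂ => simp only [map_add, h₁, h₂]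
  rw [hΨ, ← hΔ]
  suffices Δ = (Ψ.comp symDelta : SymZ →+* S) from RingHom.congr_fun this f
  refine MvPolynomial.ringHom_ext' (RingHom.ext_int _ _) fun n => ?_
  rw [hΔ, hX]
  refine Eq.symm ((congrArg Ψ (MvPolynomial.aeval_X _ n)).trans ((map_sum Ψ _ _).trans ?_))
  refine Finset.sum_congr rfl fun r _ => (Algebra.TensorProduct.lift_tmul _ _ hBP _ _).trans ?_
  exact congrArg₂ (· * ·) (hB _) (hP _)

end SymmetricFunctions

/-! ### The homomorphism γ and the comultiplication identity -/

section

variable {k : Type u} [Field k] [CharZero k]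

lemma cls_objH_mem (n : ℕ) : K0.cls (objH k n) ∈ idempotentClasses (AH k) :=
  ⟨_, _, _, congrArg K0.cls (objH_eq n)⟩

/-- The values at the complete symmetric functions may be prescribed because the classes [H_n]
commute. Those at the elementary ones are then forced, as `symE` and the classes [E_n] satisfy the
same recursion. -/
lemma exists_symZ_categorification : ∃ γ : SymZ →+* K0 (Kar (AH k)),
    (∀ n, γ (symH n) = K0.cls (objH k n)) ∧ ∀ n, γ (symE n) = K0.cls (objE k n) := by
  obtain ⟨γ, hγ⟩ := exists_symZ_ringHom (fun n => K0.cls (objH k (n + 1)))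
    fun m n => cls_objH_commute (m + 1) (n + 1)
  have hH : ∀ n, γ (symH n) = K0.cls (objH k n)
    | 0 => (map_one γ).trans cls_objH_zero.symm
    | n + 1 => hγ n
  refine ⟨γ, hH, fun n => ?_⟩
  induction n using Nat.strong_induction_on with
  | _ n ih =>
    cases n with
    | zero => rw [symE]; exact (map_one γ).trans (cls_objH_zero.symm.trans (congrArg K0.cls objE_zero_eq.symm))
    | succ n =>
      rw [symE, map_sum, cls_objE_succ]
      refine Finset.sum_congr rfl fun j _ => ?_
      rw [map_mul, map_mul, map_pow, map_neg, map_one, hH, ih _ (by omega)]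

lemma Comultiplication.map_kar_eq_epsilon (Δ : Comultiplication k) (γ : SymZ →+* K0 (Kar (AH k)))
    (hγ : ∀ n, γ (symH n) = K0.cls (objH k n)) (f : SymZ) :
    K0.map Δ.kar (γ f) = epsilon k (TensorProduct.map γ.toAddMonoidHom.toIntLinearMap
      γ.toAddMonoidHom.toIntLinearMap (symDelta f)) := by
  have hX (n : ℕ) : γ (MvPolynomial.X n) = K0.cls (objH k (n + 1)) := hγ (n + 1)
  refine map_eq_lift_map_symDelta (M := idempotentClasses (AH k))
    (fun n => (hX n).symm ▸ cls_objH_mem _) (K0.map Δ.kar) (K0.map (blueKar k)) (K0.map (redKar k))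
    Δ.kar_isTensorFunctor.map_one (fun a ha b hb => Δ.kar_isTensorFunctor.map_mul ha hb)
    (blueKar_isTensorFunctor k).map_one (fun a ha b hb => (blueKar_isTensorFunctor k).map_mul ha hb)
    (redKar_isTensorFunctor k).map_one (fun a ha b hb => (redKar_isTensorFunctor k).map_mul ha hb)
    (fun m n => ?_) (fun n => ?_) f
  · rw [hX, hX, K0.map_cls, K0.map_cls, objH_eq, objH_eq]
    exact cls_blue_red_commute _ _
  · rw [hX, K0.map_cls, cls_eq (Δ.kar_objH (n + 1)).some, cls_biproduct]
    refine Finset.sum_congr rfl fun r _ => ?_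
    rw [cls_tensor, hγ, hγ, K0.map_cls, K0.map_cls]

end

end StrictLin

end

theorem theorem4 (k : Type u) [Field k] [CharZero k] :
    Nonempty (StrictLin.Comultiplication k) ∧ ∀ Δ : StrictLin.Comultiplication k,
      (∀ n : ℕ, Nonempty (Δ.kar.obj (StrictLin.objH k n) ≅
        ⨁ fun r : Fin (n + 1) => (StrictLin.blueKar k).obj (StrictLin.objH k (n - r)) ⊗
          (StrictLin.redKar k).obj (StrictLin.objH k r))) ∧
      (∀ n : ℕ, Nonempty (Δ.kar.obj (StrictLin.objE k n) ≅
        ⨁ fun r : Fin (n + 1) => (StrictLin.blueKar k).obj (StrictLin.objE k (n - r)) ⊗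
          (StrictLin.redKar k).obj (StrictLin.objE k r))) ∧
      ∃ γ : StrictLin.SymZ →+* StrictLin.K0 (StrictLin.Kar (StrictLin.AH k)),
        (∀ n : ℕ, γ (StrictLin.symH n) = StrictLin.K0.cls (StrictLin.objH k n)) ∧
        (∀ n : ℕ, γ (StrictLin.symE n) = StrictLin.K0.cls (StrictLin.objE k n)) ∧
        ∀ f : StrictLin.SymZ, StrictLin.K0.map Δ.kar (γ f) = StrictLin.epsilon k
          (TensorProduct.map γ.toAddMonoidHom.toIntLinearMap γ.toAddMonoidHom.toIntLinearMap
            (StrictLin.symDelta f)) := by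
  refine ⟨⟨StrictLin.comultiplication k⟩, fun Δ => ⟨Δ.kar_objH, Δ.kar_objE, ?_⟩⟩
  obtain ⟨γ, hH, hE⟩ := StrictLin.exists_symZ_categorification (k := k)
  exact ⟨γ, hH, hE, Δ.map_kar_eq_epsilon γ hH⟩
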